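/- Let $k$ be a field and let $H$ be a Hopf algebra over $k$ with bijective antipode. A (left-left) Yetter-Drinfel'd module over $H$ is a left $H$-module and left $H$-comodule $V$ with $\delta(hv)=h_{(1)}v_{(-1)}S(h_{(3)})\otimes h_{(2)}v_{(0)}$; the category ${}^H_H\mathcal{YD}$ of these is braided by $c(v\otimes w)=v_{(-1)}w\otimes v_{(0)}$. A Nichols algebra $\mathfrak B(V)$ of $V$ is a braided Hopf algebra $R$ in ${}^H_H\mathcal{YD}$ with a grading $R=\bigoplus_{n\ge 0}R(n)$ as an algebra and as a coalgebra such that $c(R(i)\otimes R(j))\subset R(j)\otimes R(i)$, $R(1)\cong V$ in ${}^H_H\mathcal{YD}$, $R$ is generated as an algebra by $R(1)$, and $R(1)$ is the space $P(R)$ of primitive elements. Let $V\in{}^H_H\mathcal{YD}$ and let $A:=\mathfrak B(V)\# H$ be the Radford biproduct, graded by $A(n):=\mathfrak B(V)(n)\# H$; regard $H$ as the Hopf subalgebra $1\# H=A(0)$. Let $M$ be a graded Yetter-Drinfel'd module over $A$, i.e. $M\in{}^A_A\mathcal{YD}$ with a vector space grading $M=\bigoplus_{n\ge 1}M(n)$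 for which action and coaction are graded maps. Put $M_H:=\{m\in M\mid \delta(m)\in H\otimes M\}$ (the space of highest weight vectors) and assume that $M$ is of highest weight: $M_H=M(1)$, and $M_H$ generates $M$ as an $A$-module. Then $M_H$ is a Yetter-Drinfel'd module over $H$ by restriction of the structure maps of $M$. Let $\mathfrak B(M)$ be a Nichols algebra of $M$ over $A$, with the grading $\mathfrak B(M)[n]$ spanned by the products $m_1\cdots m_r$ with $m_i\in M(n_i)$ and $n_1+\dots+n_r=n$. Let $\mathfrak B(M)\#\mathfrak B(V)$ be the braided biproduct: the vector space $\mathfrak B(M)\otimes\mathfrak B(V)$ with the structure of a braided Hopf algebra in ${}^H_H\mathcal{YD}$ that it inherits as the space $\mathfrak B(M)\#\mathfrak B(V)\# 1$ of right coinvariants of the Hopf algebra projection $\varepsilon\otimes\varepsilon\otimes\mathrm{id}_H:\mathfrak B(M)\#(\mathfrak B(V)\# H)\to H$. Give it the tensor product grading of the gradings $\mathfrak B(M)[\cdot]$ and $\mathfrak B(V)(\cdot)$. Then $\mathfrak B(M)\#\mathfrak B(V)$ is a graded braided Hopf algebra in ${}^H_H\mathcal{YD}$, it is a Nichols algebra of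 $M_H\oplus V$ via $(x,v)\mapsto x\#1+1\#v$, and for every Nichols algebra $\mathfrak B(M_H\oplus V)$ of $M_H\oplus V$ over $H$, $$\mathfrak B(M)\#\mathfrak B(V)\;\cong\;\mathfrak B(M_H\oplus V)$$ as graded braided Hopf algebras in ${}^H_H\mathcal{YD}$. -/

import Mathlib

open scoped TensorProduct

noncomputable section

namespace NicholsExt

/-! ## Operations of (braided) Hopf algebras and Yetter-Drinfel'd modules

Structure maps and their laws are kept apart: `HopfOps` and `YDOps` hold the structure maps, the
predicates `IsYD`, `IsBraidedHopf`, ... hold the laws. -/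

/-- The structure maps of a (braided) Hopf algebra on the vector space `A`. -/
structure HopfOps (k A : Type*) [Field k] [AddCommGroup A] [Module k A] where
  one : A
  mul : A ⊗[k] A →ₗ[k] A
  comul : A →ₗ[k] A ⊗[k] A
  counit : A →ₗ[k] k
  antipode : A →ₗ[k] A

/-- The structure maps of an ordinary Hopf algebra. -/
def HopfOps.of (k H : Type*) [Field k] [Ring H] [HopfAlgebra k H] : HopfOps k H where
  one := 1
  mul := LinearMap.mul' k H
  comul := Coalgebra.comul
  counit := Coalgebra.counit
  antipode := HopfAlgebra.antipode k

/-- An action of `H` on `M` and a coaction of `H` on `M`, both from the left. -/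
structure YDOps (k H M : Type*) [Field k] [AddCommGroup H] [Module k H]
    [AddCommGroup M] [Module k M] where
  act : H ⊗[k] M →ₗ[k] M
  coact : M →ₗ[k] H ⊗[k] M

section Basic

variable {k : Type*} [Field k]
variable {A B B' C C' D : Type*}
  [AddCommGroup A] [Module k A] [AddCommGroup B] [Module k B] [AddCommGroup B'] [Module k B']
  [AddCommGroup C] [Module k C] [AddCommGroup C'] [Module k C'] [AddCommGroup D] [Module k D]
variable {H M N R S E X : Type*}
  [AddCommGroup H] [Module k H] [AddCommGroup M] [Module k M] [AddCommGroup N] [Module k N]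
  [AddCommGroup R] [Module k R] [AddCommGroup S] [Module k S] [AddCommGroup E] [Module k E]
  [AddCommGroup X] [Module k X]

/-- `id ⊗ f ⊗ id`, i.e. `(a ⊗ b) ⊗ (c ⊗ d) ↦ (a ⊗ c') ⊗ (b' ⊗ d)` where `f (b ⊗ c) = c' ⊗ b'`. -/
def middle (f : B ⊗[k] C →ₗ[k] C' ⊗[k] B') :
    (A ⊗[k] B) ⊗[k] (C ⊗[k] D) →ₗ[k] (A ⊗[k] C') ⊗[k] (B' ⊗[k] D) :=
  (TensorProduct.assoc k A C' (B' ⊗[k] D)).symm.toLinearMap ∘ₗ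
    LinearMap.lTensor A ((TensorProduct.assoc k C' B' D).toLinearMap ∘ₗ
      LinearMap.rTensor D f ∘ₗ (TensorProduct.assoc k B C D).symm.toLinearMap) ∘ₗ
    (TensorProduct.assoc k A B (C ⊗[k] D)).toLinearMap

/-- The subspace `p ⊗ q` of `M ⊗ N`. -/
def tensorSub (p : Submodule k M) (q : Submodule k N) : Submodule k (M ⊗[k] N) :=
  Submodule.map₂ (TensorProduct.mk k M N) p q

/-- The tensor product grading `(M ⊗ N)(n) = ∑_{i + j = n} M(i) ⊗ N(j)`. -/
def tensorGrading (F : ℕ → Submodule k M) (G : ℕ → Submodule k N) (n : ℕ) :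
    Submodule k (M ⊗[k] N) :=
  ⨆ p ∈ Finset.HasAntidiagonal.antidiagonal n, tensorSub (F p.1) (G p.2)

/-! ## Yetter-Drinfel'd modules -/

/-- `(a ⊗ c) ⊗ b ↦ a b S(c)`. -/
def HopfOps.conj (𝓗 : HopfOps k H) : (H ⊗[k] H) ⊗[k] H →ₗ[k] H :=
  𝓗.mul ∘ₗ
    LinearMap.lTensor H (𝓗.mul ∘ₗ LinearMap.lTensor H 𝓗.antipode ∘ₗ
      (TensorProduct.comm k H H).toLinearMap) ∘ₗ
    (TensorProduct.assoc k H H H).toLinearMap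

/-- `h ⊗ m ↦ h₍₁₎ m₍₋₁₎ S(h₍₃₎) ⊗ h₍₂₎ m₍₀₎`. -/
def YDOps.ydMap (𝓗 : HopfOps k H) (Y : YDOps k H M) : H ⊗[k] M →ₗ[k] H ⊗[k] M :=
  TensorProduct.map 𝓗.conj Y.act ∘ₗ
    (TensorProduct.tensorTensorTensorComm k (H ⊗[k] H) H H M).toLinearMap ∘ₗ
    TensorProduct.map
      ((TensorProduct.assoc k H H H).symm.toLinearMap ∘ₗ
        LinearMap.lTensor H ((TensorProduct.comm k H H).toLinearMap ∘ₗ 𝓗.comul) ∘ₗ 𝓗.comul)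
      Y.coact

/-- Left-left Yetter-Drinfel'd modules. -/
structure IsYD (𝓗 : HopfOps k H) (Y : YDOps k H M) : Prop where
  one_act : ∀ m, Y.act (𝓗.one ⊗ₜ m) = m
  mul_act : ∀ g h m, Y.act (𝓗.mul (g ⊗ₜ h) ⊗ₜ m) = Y.act (g ⊗ₜ Y.act (h ⊗ₜ m))
  counit_coact : ∀ m, TensorProduct.lid k M (LinearMap.rTensor M 𝓗.counit (Y.coact m)) = m
  coassoc : ∀ m, TensorProduct.assoc k H H M (LinearMap.rTensor M 𝓗.comul (Y.coact m)) =
    LinearMap.lTensor H Y.coact (Y.coact m)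
  coact_act : Y.coact ∘ₗ Y.act = Y.ydMap 𝓗

/-- The maps `M → N` that are `H`-linear and `H`-colinear. -/
structure IsYDHom (Y : YDOps k H M) (Z : YDOps k H N) (f : M →ₗ[k] N) : Prop where
  map_act : f ∘ₗ Y.act = Z.act ∘ₗ LinearMap.lTensor H f
  map_coact : Z.coact ∘ₗ f = LinearMap.lTensor H f ∘ₗ Y.coact

/-- The braiding `c(m ⊗ n) = m₍₋₁₎ n ⊗ m₍₀₎`. -/
def braiding (Y : YDOps k H M) (Z : YDOps k H N) : M ⊗[k] N →ₗ[k] N ⊗[k] M :=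
  LinearMap.rTensor M Z.act ∘ₗ (TensorProduct.rightComm k H M N).toLinearMap ∘ₗ
    LinearMap.rTensor N Y.coact

/-- The trivial Yetter-Drinfel'd module `k`: `h · a = ε(h) a` and `δ(a) = 1 ⊗ a`. -/
def YDOps.trivial (𝓗 : HopfOps k H) : YDOps k H k where
  act := (TensorProduct.lid k k).toLinearMap ∘ₗ LinearMap.rTensor k 𝓗.counit
  coact := TensorProduct.mk k H k 𝓗.one

/-- The tensor product of Yetter-Drinfel'd modules: `h · (m ⊗ n) = h₍₁₎ m ⊗ h₍₂₎ n` and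
`δ(m ⊗ n) = m₍₋₁₎ n₍₋₁₎ ⊗ (m₍₀₎ ⊗ n₍₀₎)`. -/
def YDOps.tensor (𝓗 : HopfOps k H) (Y : YDOps k H M) (Z : YDOps k H N) :
    YDOps k H (M ⊗[k] N) where
  act := TensorProduct.map Y.act Z.act ∘ₗ
    (TensorProduct.tensorTensorTensorComm k H H M N).toLinearMap ∘ₗ
    LinearMap.rTensor (M ⊗[k] N) 𝓗.comul
  coact := LinearMap.rTensor (M ⊗[k] N) 𝓗.mul ∘ₗ
    (TensorProduct.tensorTensorTensorComm k H M H N).toLinearMap ∘ₗ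
    TensorProduct.map Y.coact Z.coact

/-- The direct sum of Yetter-Drinfel'd modules. -/
def YDOps.prod (Y : YDOps k H M) (Z : YDOps k H N) : YDOps k H (M × N) where
  act := LinearMap.prod (Y.act ∘ₗ LinearMap.lTensor H (LinearMap.fst k M N))
    (Z.act ∘ₗ LinearMap.lTensor H (LinearMap.snd k M N))
  coact := LinearMap.coprod (LinearMap.lTensor H (LinearMap.inl k M N) ∘ₗ Y.coact)
    (LinearMap.lTensor H (LinearMap.inr k M N) ∘ₗ Z.coact)

/-- Restriction of the action along `ι : H → A` and corestriction of the coaction along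
`π : A → H`. -/
def YDOps.pull (ι : H →ₗ[k] A) (π : A →ₗ[k] H) (Y : YDOps k A M) : YDOps k H M where
  act := Y.act ∘ₗ LinearMap.rTensor M ι
  coact := LinearMap.rTensor M π ∘ₗ Y.coact

/-- Restriction of the structure maps to a subspace that is stable under action and coaction. -/
def YDOps.restrict (Y : YDOps k H M) (P : Submodule k M)
    (hact : ∀ h, ∀ m ∈ P, Y.act (h ⊗ₜ m) ∈ P)
    (hcoact : ∀ m ∈ P, Y.coact m ∈ LinearMap.range (LinearMap.lTensor H P.subtype)) :
    YDOps k H P where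
  act := LinearMap.codRestrict P (Y.act ∘ₗ LinearMap.lTensor H P.subtype) (by
    intro t
    induction t with
    | zero => simp
    | tmul h m => simpa using hact h m m.2
    | add x y hx hy => rw [map_add]; exact P.add_mem hx hy)
  coact := (LinearEquiv.ofInjective (LinearMap.lTensor H P.subtype)
      (Module.Flat.lTensor_preserves_injective_linearMap _ P.injective_subtype)).symm.toLinearMap ∘ₗ
    LinearMap.codRestrict _ (Y.coact ∘ₗ P.subtype) (fun m => hcoact m m.2)

/-! ## Braided Hopf algebras -/

/-- Braided Hopf algebras in the category of Yetter-Drinfel'd modules over `H`. -/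
structure IsBraidedHopf (𝓗 : HopfOps k H) (𝓡 : HopfOps k R) (Y : YDOps k H R) : Prop where
  yd : IsYD 𝓗 Y
  -- algebra
  one_mul : ∀ x, 𝓡.mul (𝓡.one ⊗ₜ x) = x
  mul_one : ∀ x, 𝓡.mul (x ⊗ₜ 𝓡.one) = x
  mul_assoc : ∀ x y z, 𝓡.mul (𝓡.mul (x ⊗ₜ y) ⊗ₜ z) = 𝓡.mul (x ⊗ₜ 𝓡.mul (y ⊗ₜ z))
  -- coalgebra
  coassoc : ∀ x, TensorProduct.assoc k R R R (LinearMap.rTensor R 𝓡.comul (𝓡.comul x)) =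
    LinearMap.lTensor R 𝓡.comul (𝓡.comul x)
  counit_left : ∀ x, TensorProduct.lid k R (LinearMap.rTensor R 𝓡.counit (𝓡.comul x)) = x
  counit_right : ∀ x, TensorProduct.rid k R (LinearMap.lTensor R 𝓡.counit (𝓡.comul x)) = x
  -- the structure maps are linear and colinear over `H`
  one_hom : IsYDHom (YDOps.trivial 𝓗) Y (LinearMap.toSpanSingleton k R 𝓡.one)
  mul_hom : IsYDHom (Y.tensor 𝓗 Y) Y 𝓡.mul
  counit_hom : IsYDHom Y (YDOps.trivial 𝓗) 𝓡.counit
  comul_hom : IsYDHom Y (Y.tensor 𝓗 Y) 𝓡.comul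
  -- `ε` and `Δ` are algebra maps, `R ⊗ R` having the multiplication `(m ⊗ m)(id ⊗ c ⊗ id)`
  counit_one : 𝓡.counit 𝓡.one = 1
  counit_mul : ∀ x y, 𝓡.counit (𝓡.mul (x ⊗ₜ y)) = 𝓡.counit x * 𝓡.counit y
  comul_one : 𝓡.comul 𝓡.one = 𝓡.one ⊗ₜ 𝓡.one
  comul_mul : 𝓡.comul ∘ₗ 𝓡.mul =
    TensorProduct.map 𝓡.mul 𝓡.mul ∘ₗ middle (braiding Y Y) ∘ₗ
      TensorProduct.map 𝓡.comul 𝓡.comul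
  -- the antipode is the convolution inverse of the identity
  antipode_left : ∀ x, 𝓡.mul (LinearMap.rTensor R 𝓡.antipode (𝓡.comul x)) =
    𝓡.counit x • 𝓡.one
  antipode_right : ∀ x, 𝓡.mul (LinearMap.lTensor R 𝓡.antipode (𝓡.comul x)) =
    𝓡.counit x • 𝓡.one

/-- `R = ⨁ₙ G n` is graded as an algebra and as a coalgebra. -/
structure IsGraded (𝓡 : HopfOps k R) (G : ℕ → Submodule k R) : Prop where
  isInternal : DirectSum.IsInternal G
  one_mem : 𝓡.one ∈ G 0
  mul_mem : ∀ i j, ∀ x ∈ G i, ∀ y ∈ G j, 𝓡.mul (x ⊗ₜ y) ∈ G (i + j)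
  comul_mem : ∀ n, ∀ x ∈ G n, 𝓡.comul x ∈ tensorGrading G G n
  counit_eq_zero : ∀ n, n ≠ 0 → ∀ x ∈ G n, 𝓡.counit x = 0

/-- Graded braided Hopf algebras in the category of Yetter-Drinfel'd modules over `H`. -/
structure IsGradedBraidedHopf (𝓗 : HopfOps k H) (𝓡 : HopfOps k R) (Y : YDOps k H R)
    (G : ℕ → Submodule k R) : Prop where
  hopf : IsBraidedHopf 𝓗 𝓡 Y
  graded : IsGraded 𝓡 G
  act_mem : ∀ n h, ∀ x ∈ G n, Y.act (h ⊗ₜ x) ∈ G n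
  coact_mem : ∀ n, ∀ x ∈ G n, Y.coact x ∈ tensorSub ⊤ (G n)

/-- Isomorphisms of graded braided Hopf algebras in the category of Yetter-Drinfel'd modules. -/
structure IsGradedBraidedHopfIso (𝓡 : HopfOps k R) (Y : YDOps k H R) (G : ℕ → Submodule k R)
    (𝓢 : HopfOps k S) (Z : YDOps k H S) (F : ℕ → Submodule k S) (e : R ≃ₗ[k] S) : Prop where
  map_one : e 𝓡.one = 𝓢.one
  map_mul : ∀ x y, e (𝓡.mul (x ⊗ₜ y)) = 𝓢.mul (e x ⊗ₜ e y)
  map_comul : ∀ x, 𝓢.comul (e x) = TensorProduct.map e.toLinearMap e.toLinearMap (𝓡.comul x)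
  map_counit : ∀ x, 𝓢.counit (e x) = 𝓡.counit x
  map_antipode : ∀ x, e (𝓡.antipode x) = 𝓢.antipode (e x)
  ydHom : IsYDHom Y Z e.toLinearMap
  map_grading : ∀ n, (G n).map e.toLinearMap = F n

/-- The subspace `P` generates the algebra `R`: the only subalgebra containing `P` is `R`. -/
def Generates (𝓡 : HopfOps k R) (P : Submodule k R) : Prop :=
  ∀ T : Submodule k R, 𝓡.one ∈ T → P ≤ T →
    (∀ x ∈ T, ∀ y ∈ T, 𝓡.mul (x ⊗ₜ y) ∈ T) → T = ⊤

/-- The braided Hopf algebra `R = ⨁ₙ G n` over `H`, together with `j : M → R`, is a Nichols algebra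
of the Yetter-Drinfel'd module `M`; `j` is the isomorphism of `M` with `R(1)`. -/
structure IsNichols (𝓗 : HopfOps k H) (Z : YDOps k H M) (𝓡 : HopfOps k R) (Y : YDOps k H R)
    (G : ℕ → Submodule k R) (j : M →ₗ[k] R) : Prop where
  hopf : IsBraidedHopf 𝓗 𝓡 Y
  graded : IsGraded 𝓡 G
  braiding_mem : ∀ m n, ∀ t ∈ tensorSub (G m) (G n), braiding Y Y t ∈ tensorSub (G n) (G m)
  injective : Function.Injective j
  range_eq : LinearMap.range j = G 1
  ydHom : IsYDHom Z Y j
  generates : Generates 𝓡 (G 1)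
  primitive_iff : ∀ x, x ∈ G 1 ↔ 𝓡.comul x = 𝓡.one ⊗ₜ x + x ⊗ₜ 𝓡.one

/-! ## The Radford biproduct -/

/-- `h ⊗ r ↦ h₍₁₎ r ⊗ h₍₂₎`. -/
def crossAct (𝓗 : HopfOps k H) (Y : YDOps k H R) : H ⊗[k] R →ₗ[k] R ⊗[k] H :=
  LinearMap.rTensor H Y.act ∘ₗ (TensorProduct.rightComm k H H R).toLinearMap ∘ₗ
    LinearMap.rTensor R 𝓗.comul

/-- `r ⊗ h ↦ r₍₋₁₎ h ⊗ r₍₀₎`. -/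
def crossCoact (𝓗 : HopfOps k H) (Y : YDOps k H R) : R ⊗[k] H →ₗ[k] H ⊗[k] R :=
  LinearMap.rTensor R 𝓗.mul ∘ₗ (TensorProduct.rightComm k H R H).toLinearMap ∘ₗ
    LinearMap.rTensor H Y.coact

/-- The Radford biproduct `R # H`:
`(r # h)(r' # h') = r (h₍₁₎ r') # h₍₂₎ h'`,
`Δ(r # h) = (r⁽¹⁾ # r⁽²⁾₍₋₁₎ h₍₁₎) ⊗ (r⁽²⁾₍₀₎ # h₍₂₎)`,
`S(r # h) = (1 # S(r₍₋₁₎ h)) (S(r₍₀₎) # 1)`. -/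
def radford (𝓗 : HopfOps k H) (𝓡 : HopfOps k R) (Y : YDOps k H R) : HopfOps k (R ⊗[k] H) where
  one := 𝓡.one ⊗ₜ 𝓗.one
  mul := TensorProduct.map 𝓡.mul 𝓗.mul ∘ₗ middle (crossAct 𝓗 Y)
  comul := middle (crossCoact 𝓗 Y) ∘ₗ TensorProduct.map 𝓡.comul 𝓗.comul
  counit := (TensorProduct.lid k k).toLinearMap ∘ₗ TensorProduct.map 𝓡.counit 𝓗.counit
  antipode := crossAct 𝓗 Y ∘ₗ TensorProduct.map 𝓗.antipode 𝓡.antipode ∘ₗ crossCoact 𝓗 Y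

/-- The inclusion `H → R # H`, `h ↦ 1 # h`. -/
def radfordIncl (𝓡 : HopfOps k R) : H →ₗ[k] R ⊗[k] H :=
  TensorProduct.mk k R H 𝓡.one

/-- The projection `R # H → H`, `r # h ↦ ε(r) h`. -/
def radfordProj (𝓡 : HopfOps k R) : R ⊗[k] H →ₗ[k] H :=
  (TensorProduct.lid k H).toLinearMap ∘ₗ LinearMap.rTensor H 𝓡.counit

/-- The grading `(R # H)(n) = R(n) # H`. -/
def radfordGrading (H : Type*) [AddCommGroup H] [Module k H] (G : ℕ → Submodule k R) (n : ℕ) :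
    Submodule k (R ⊗[k] H) :=
  tensorSub (G n) ⊤

/-! ## Hopf algebras with a projection

Let `π : E → H` and `ι : H → E` be morphisms of Hopf algebras with `π ι = id`. The structure of a
braided Hopf algebra over `H` on the right coinvariants of `π` is written down on a space `X` that
is identified with the coinvariants: `i : X → E` is injective with image the coinvariants, and
`p : E → X` satisfies `p i = id`. As all maps below take values in (tensor products of) the
coinvariants before `p` is applied, `p` only serves to identify the coinvariants with `X`. -/

/-- `θ(a) = a₍₁₎ ι S π(a₍₂₎)`. -/
def theta (𝓗 : HopfOps k H) (𝓔 : HopfOps k E) (ι : H →ₗ[k] E) (π : E →ₗ[k] H) : E →ₗ[k] E :=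
  𝓔.mul ∘ₗ LinearMap.lTensor E (ι ∘ₗ 𝓗.antipode ∘ₗ π) ∘ₗ 𝓔.comul

/-- The braided Hopf algebra of coinvariants: it is a subalgebra of `E`, its comultiplication is
`r ↦ r₍₁₎ ι S π(r₍₂₎) ⊗ r₍₃₎`, its antipode is `r ↦ ι π(r₍₁₎) S(r₍₂₎)`. -/
def coinvOps (𝓗 : HopfOps k H) (𝓔 : HopfOps k E) (ι : H →ₗ[k] E) (π : E →ₗ[k] H)
    (i : X →ₗ[k] E) (p : E →ₗ[k] X) : HopfOps k X where
  one := p 𝓔.one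
  mul := p ∘ₗ 𝓔.mul ∘ₗ TensorProduct.map i i
  comul := TensorProduct.map (p ∘ₗ theta 𝓗 𝓔 ι π) p ∘ₗ 𝓔.comul ∘ₗ i
  counit := 𝓔.counit ∘ₗ i
  antipode := p ∘ₗ 𝓔.mul ∘ₗ TensorProduct.map (ι ∘ₗ π) 𝓔.antipode ∘ₗ 𝓔.comul ∘ₗ i

/-- The Yetter-Drinfel'd module of coinvariants: the adjoint action
`h · r = ι(h₍₁₎) r ι(S(h₍₂₎))` and the coaction `(π ⊗ id) Δ`. -/
def coinvYD (𝓗 : HopfOps k H) (𝓔 : HopfOps k E) (ι : H →ₗ[k] E) (π : E →ₗ[k] H)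
    (i : X →ₗ[k] E) (p : E →ₗ[k] X) : YDOps k H X where
  act := p ∘ₗ 𝓔.mul ∘ₗ
    TensorProduct.map (𝓔.mul ∘ₗ TensorProduct.map ι i) (ι ∘ₗ 𝓗.antipode) ∘ₗ
    (TensorProduct.rightComm k H H X).toLinearMap ∘ₗ
    LinearMap.rTensor X 𝓗.comul
  coact := TensorProduct.map π p ∘ₗ 𝓔.comul ∘ₗ i

end Basic

/-! ## The braided biproduct -/

section Biproduct

variable {k : Type*} [Field k] {H R Q : Type*}
  [AddCommGroup H] [Module k H] [AddCommGroup R] [Module k R] [AddCommGroup Q] [Module k Q]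

/-- `H → Q # (R # H)`, `h ↦ 1 # 1 # h`. -/
def biIncl (𝓡 : HopfOps k R) (𝓠 : HopfOps k Q) : H →ₗ[k] Q ⊗[k] (R ⊗[k] H) :=
  radfordIncl 𝓠 ∘ₗ radfordIncl 𝓡

/-- `Q # (R # H) → H`, `x # r # h ↦ ε(x) ε(r) h`. -/
def biProj (𝓡 : HopfOps k R) (𝓠 : HopfOps k Q) : Q ⊗[k] (R ⊗[k] H) →ₗ[k] H :=
  radfordProj 𝓡 ∘ₗ radfordProj 𝓠

/-- The identification of `Q ⊗ R` with the coinvariants `Q # R # 1` of `Q # (R # H) → H`. -/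
def toCoinv (𝓗 : HopfOps k H) : Q ⊗[k] R →ₗ[k] Q ⊗[k] (R ⊗[k] H) :=
  LinearMap.lTensor Q ((TensorProduct.mk k R H).flip 𝓗.one)

/-- `x # r # h ↦ ε(h) x ⊗ r`; this inverts `toCoinv` on the coinvariants. -/
def ofCoinv (𝓗 : HopfOps k H) : Q ⊗[k] (R ⊗[k] H) →ₗ[k] Q ⊗[k] R :=
  LinearMap.lTensor Q ((TensorProduct.rid k R).toLinearMap ∘ₗ LinearMap.lTensor R 𝓗.counit)

/-- The braided biproduct `Q # R` of a braided Hopf algebra `R` over `H` and a braided Hopf algebra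
`Q` over `R # H`, as a braided Hopf algebra over `H`: the coinvariants of `Q # (R # H) → H`. -/
def biOps (𝓗 : HopfOps k H) (𝓡 : HopfOps k R) (Y : YDOps k H R)
    (𝓠 : HopfOps k Q) (Z : YDOps k (R ⊗[k] H) Q) : HopfOps k (Q ⊗[k] R) :=
  coinvOps 𝓗 (radford (radford 𝓗 𝓡 Y) 𝓠 Z) (biIncl 𝓡 𝓠) (biProj 𝓡 𝓠) (toCoinv 𝓗) (ofCoinv 𝓗)

/-- The Yetter-Drinfel'd structure over `H` of the braided biproduct `Q # R`. -/
def biYD (𝓗 : HopfOps k H) (𝓡 : HopfOps k R) (Y : YDOps k H R)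
    (𝓠 : HopfOps k Q) (Z : YDOps k (R ⊗[k] H) Q) : YDOps k H (Q ⊗[k] R) :=
  coinvYD 𝓗 (radford (radford 𝓗 𝓡 Y) 𝓠 Z) (biIncl 𝓡 𝓠) (biProj 𝓡 𝓠) (toCoinv 𝓗) (ofCoinv 𝓗)

end Biproduct

/-! ## Graded Yetter-Drinfel'd modules and highest weight vectors -/

section Graded

variable {k : Type*} [Field k] {H R M Q : Type*}
  [AddCommGroup H] [Module k H] [AddCommGroup R] [Module k R]
  [AddCommGroup M] [Module k M] [AddCommGroup Q] [Module k Q]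

/-- `M = ⨁_{n ≥ 1} D n` is a graded Yetter-Drinfel'd module over the Hopf algebra `A` with grading
`F`. -/
structure IsGradedYD {A : Type*} [AddCommGroup A] [Module k A] (𝓐 : HopfOps k A)
    (F : ℕ → Submodule k A) (Y : YDOps k A M) (D : ℕ → Submodule k M) : Prop where
  yd : IsYD 𝓐 Y
  isInternal : DirectSum.IsInternal D
  zero_eq : D 0 = ⊥
  act_mem : ∀ i j, ∀ a ∈ F i, ∀ m ∈ D j, Y.act (a ⊗ₜ m) ∈ D (i + j)
  coact_mem : ∀ n, ∀ m ∈ D n, Y.coact m ∈ tensorGrading F D n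

/-- The space `M_H = {m | δ(m) ∈ H ⊗ M}` of highest weight vectors of a Yetter-Drinfel'd module
over `R # H`, where `H` is the Hopf subalgebra `1 # H` of `R # H`. -/
def hwSpace (𝓡 : HopfOps k R) (Y : YDOps k (R ⊗[k] H) M) : Submodule k M :=
  (LinearMap.range (LinearMap.rTensor M (radfordIncl (H := H) 𝓡))).comap Y.coact

/-- `M = ⨁_{n ≥ 1} D n` is a graded Yetter-Drinfel'd module over `R # H` of highest weight, where
`R # H` is graded by `(R # H)(n) = R(n) # H`. -/
structure IsHighestWeight (𝓗 : HopfOps k H) (𝓡 : HopfOps k R) (YR : YDOps k H R)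
    (G : ℕ → Submodule k R) (Y : YDOps k (R ⊗[k] H) M) (D : ℕ → Submodule k M) : Prop where
  gradedYD : IsGradedYD (radford 𝓗 𝓡 YR) (radfordGrading H G) Y D
  hwSpace_eq : hwSpace 𝓡 Y = D 1
  generates : ∀ T : Submodule k M, hwSpace 𝓡 Y ≤ T →
    (∀ a, ∀ m ∈ T, Y.act (a ⊗ₜ m) ∈ T) → T = ⊤

theorem IsHighestWeight.act_mem {𝓗 : HopfOps k H} {𝓡 : HopfOps k R} {YR : YDOps k H R}
    {G : ℕ → Submodule k R} {Y : YDOps k (R ⊗[k] H) M} {D : ℕ → Submodule k M}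
    (hM : IsHighestWeight 𝓗 𝓡 YR G Y D) (h1 : 𝓡.one ∈ G 0) (h : H) (m : M)
    (hm : m ∈ hwSpace 𝓡 Y) :
    (Y.pull (radfordIncl 𝓡) (radfordProj 𝓡)).act (h ⊗ₜ m) ∈ hwSpace 𝓡 Y := by
  rw [hM.hwSpace_eq] at hm ⊢
  have := hM.gradedYD.act_mem 0 1 (𝓡.one ⊗ₜ h)
    (Submodule.apply_mem_map₂ _ h1 (Submodule.mem_top (x := h))) m hm
  simpa [YDOps.pull, radfordIncl] using this

theorem IsHighestWeight.coact_mem {𝓗 : HopfOps k H} {𝓡 : HopfOps k R} {YR : YDOps k H R}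
    {G : ℕ → Submodule k R} {Y : YDOps k (R ⊗[k] H) M} {D : ℕ → Submodule k M}
    (hM : IsHighestWeight 𝓗 𝓡 YR G Y D) (m : M) (hm : m ∈ hwSpace 𝓡 Y) :
    (Y.pull (radfordIncl 𝓡) (radfordProj 𝓡)).coact m ∈
      LinearMap.range (LinearMap.lTensor H (hwSpace 𝓡 Y).subtype) := by
  rw [hM.hwSpace_eq] at hm ⊢
  have h := hM.gradedYD.coact_mem 1 m hm
  suffices tensorGrading (radfordGrading H G) D 1 ≤
      (LinearMap.range (LinearMap.lTensor H (D 1).subtype)).comap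
        (LinearMap.rTensor M (radfordProj 𝓡)) from this h
  refine iSup₂_le fun p hp => Submodule.map₂_le.2 fun a _ x hx => ?_
  have hp' : p.1 + p.2 = 1 := Finset.HasAntidiagonal.mem_antidiagonal.1 hp
  rcases Nat.eq_zero_or_pos p.2 with h0 | h0
  · rw [h0, hM.gradedYD.zero_eq, Submodule.mem_bot] at hx
    simp [hx]
  · have h2 : p.2 = 1 := by omega
    rw [h2] at hx
    exact ⟨radfordProj 𝓡 a ⊗ₜ ⟨x, hx⟩, by simp⟩

/-- The Yetter-Drinfel'd module `M_H` over `H`, with action and coaction given by the restrictions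
of the structure maps on `M`: `h · m = (1 # h) m`, and `δ` on `M_H` takes values in
`H ⊗ M_H = (1 # H) ⊗ M_H`. -/
def hwYD {𝓗 : HopfOps k H} {𝓡 : HopfOps k R} {YR : YDOps k H R}
    {G : ℕ → Submodule k R} {Y : YDOps k (R ⊗[k] H) M} {D : ℕ → Submodule k M}
    (h1 : 𝓡.one ∈ G 0) (hM : IsHighestWeight 𝓗 𝓡 YR G Y D) : YDOps k H (hwSpace 𝓡 Y) :=
  (Y.pull (radfordIncl 𝓡) (radfordProj 𝓡)).restrict (hwSpace 𝓡 Y) (hM.act_mem h1) hM.coact_mem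

/-- `IsWord 𝓠 j D n x`: `x` is a product `j(m₁) ⋯ j(m_r)` with `m_i ∈ D nᵢ` and `∑ nᵢ = n`. -/
inductive IsWord (𝓠 : HopfOps k Q) (j : M →ₗ[k] Q) (D : ℕ → Submodule k M) : ℕ → Q → Prop
  | one : IsWord 𝓠 j D 0 𝓠.one
  | cons {i n : ℕ} {m : M} {x : Q} : m ∈ D i → IsWord 𝓠 j D n x →
      IsWord 𝓠 j D (i + n) (𝓠.mul (j m ⊗ₜ x))

/-- The grading of the Nichols algebra `j : M → Q` induced by the grading of the tensor algebra of
`M` in which the elements of `D n` have degree `n`. -/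
def weightGrading (𝓠 : HopfOps k Q) (j : M →ₗ[k] Q) (D : ℕ → Submodule k M) (n : ℕ) :
    Submodule k Q :=
  Submodule.span k {x | IsWord 𝓠 j D n x}

end Graded

end NicholsExt

end

open NicholsExt

open scoped TensorProduct

noncomputable section

namespace NicholsExt

open WithConv

/-! ## Hopf algebras given by their structure maps -/

section Hopf

variable {k : Type*} [Field k] {E : Type*} [AddCommGroup E] [Module k E]

/-! Write `A = R # H` and `E = Q # A`. Both are Hopf algebras (`isHopf_radford`, applied twice), and
`E → A → H` is a Hopf algebra projection that splits. By Radford's theorem its right coinvariants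
form a braided Hopf algebra over `H` (`CoinvModel.isBraidedHopf`), and they are identified with `Q ⊗
R` by `isCoinvModel_biproduct`.

For the grading one has to know that the weights of products of elements of `M` decompose `Q` as a
direct sum, i.e. that a linear relation between words holds weight by weight. In a Nichols algebra
an element of degree at least two is zero as soon as the inner components of its comultiplication
vanish, for then it is primitive and so of degree one (`IsNichols.eq_zero_of_proj_comul`). The inner
components of the comultiplication of a word are expressed by shorter words through the action and
coaction of `M` alone, so induction on the length applies. The induction is run for pairs of
corresponding words in two Nichols algebras of the same module (`IsNichols.exists_wordMap`). With
both algebras equal it gives the direct sum decomposition (`IsNichols.isInternal_weightGrading`);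
with all weights zero it gives the isomorphism of any two Nichols algebras of one module
(`IsNichols.exists_iso`).

It remains to see that `Q # R` is a Nichols algebra of `M_H ⊕ V`. Since `M` starts in degree one and
`M(1) = M_H`, the components of degree zero and one are `k` and `M_H ⊕ V`. For generation, `v x =
(v₋₁ · x) v₀ + v · x` in `Q # R` for `v` in `V` and `x` in `Q`. Hence a subalgebra containing `M_H`
and `V` contains the `A`-submodule generated by `M_H`, which is `M`, and therefore all of `Q` and
`R` (`biprod_generates`).

For primitive elements, projecting the right leg of the comultiplication to `R` shows that a
primitive element is `x # 1 + 1 # v` with `v` primitive in `R`, so `v` is in `V`. Then `x # 1` is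
primitive, which forces `x` to be primitive in `Q`, so `x` is in `M`, and forces the `R`-part of its
coaction to be trivial, so `x` is a highest weight vector (`biprod_primitive`). -/

/-- The structure maps `𝓔` make `E` an algebra. -/
structure IsAlg (𝓔 : HopfOps k E) : Prop where
  one_mul : ∀ x, 𝓔.mul (𝓔.one ⊗ₜ x) = x
  mul_one : ∀ x, 𝓔.mul (x ⊗ₜ 𝓔.one) = x
  mul_assoc : ∀ x y z, 𝓔.mul (𝓔.mul (x ⊗ₜ y) ⊗ₜ z) = 𝓔.mul (x ⊗ₜ 𝓔.mul (y ⊗ₜ z))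

/-- The ring with the multiplication of `𝓔`. -/
@[reducible] def IsAlg.ring {𝓔 : HopfOps k E} (h : IsAlg 𝓔) : Ring E where
  __ := (inferInstance : AddCommGroup E)
  one := 𝓔.one
  mul x y := 𝓔.mul (x ⊗ₜ y)
  one_mul := h.one_mul
  mul_one := h.mul_one
  mul_assoc := h.mul_assoc
  zero_mul x := by change 𝓔.mul (0 ⊗ₜ x) = 0; simp
  mul_zero x := by change 𝓔.mul (x ⊗ₜ 0) = 0; simp
  left_distrib x y z := by
    change 𝓔.mul (x ⊗ₜ (y + z)) = 𝓔.mul (x ⊗ₜ y) + 𝓔.mul (x ⊗ₜ z); simp [TensorProduct.tmul_add]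
  right_distrib x y z := by
    change 𝓔.mul ((x + y) ⊗ₜ z) = 𝓔.mul (x ⊗ₜ z) + 𝓔.mul (y ⊗ₜ z); simp [TensorProduct.add_tmul]

/-- The algebra with the multiplication of `𝓔`. -/
@[reducible] def IsAlg.algebra {𝓔 : HopfOps k E} (h : IsAlg 𝓔) :
    letI := h.ring; Algebra k E :=
  letI := h.ring
  Algebra.ofModule (R := k) (A := E)
    (fun c x y => by
      change 𝓔.mul ((c • x) ⊗ₜ y) = c • 𝓔.mul (x ⊗ₜ y)
      rw [← TensorProduct.smul_tmul', map_smul])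
    (fun c x y => by
      change 𝓔.mul (x ⊗ₜ (c • y)) = c • 𝓔.mul (x ⊗ₜ y)
      rw [TensorProduct.tmul_smul, map_smul])

/-- The structure maps `𝓔` make `E` a Hopf algebra. -/
structure IsHopf (𝓔 : HopfOps k E) : Prop extends IsAlg 𝓔 where
  coassoc : ∀ x, TensorProduct.assoc k E E E (LinearMap.rTensor E 𝓔.comul (𝓔.comul x)) =
    LinearMap.lTensor E 𝓔.comul (𝓔.comul x)
  counit_left : ∀ x, LinearMap.rTensor E 𝓔.counit (𝓔.comul x) = 1 ⊗ₜ x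
  counit_right : ∀ x, LinearMap.lTensor E 𝓔.counit (𝓔.comul x) = x ⊗ₜ 1
  counit_one : 𝓔.counit 𝓔.one = 1
  counit_mul : ∀ x y, 𝓔.counit (𝓔.mul (x ⊗ₜ y)) = 𝓔.counit x * 𝓔.counit y
  comul_one : 𝓔.comul 𝓔.one = 𝓔.one ⊗ₜ 𝓔.one
  comul_mul : letI := toIsAlg.ring; letI := toIsAlg.algebra;
    ∀ x y : E, 𝓔.comul (x * y) = 𝓔.comul x * 𝓔.comul y
  antipode_left : ∀ x, 𝓔.mul (LinearMap.rTensor E 𝓔.antipode (𝓔.comul x)) =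
    𝓔.counit x • 𝓔.one
  antipode_right : ∀ x, 𝓔.mul (LinearMap.lTensor E 𝓔.antipode (𝓔.comul x)) =
    𝓔.counit x • 𝓔.one

theorem IsAlg.mul'_eq {𝓔 : HopfOps k E} (h : IsAlg 𝓔) :
    letI := h.ring; letI := h.algebra; LinearMap.mul' k E = 𝓔.mul := by
  letI := h.ring; letI := h.algebra
  exact TensorProduct.ext' fun x y => rfl

/-- The Hopf algebra with the structure maps `𝓔`. -/
@[reducible] def IsHopf.hopfAlgebra {𝓔 : HopfOps k E} (h : IsHopf 𝓔) :
    letI := h.ring; HopfAlgebra k E :=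
  letI := h.ring; letI := h.algebra
  letI : Coalgebra k E :=
    { comul := 𝓔.comul
      counit := 𝓔.counit
      coassoc := LinearMap.ext h.coassoc
      rTensor_counit_comp_comul := LinearMap.ext h.counit_left
      lTensor_counit_comp_comul := LinearMap.ext h.counit_right }
  letI : Bialgebra k E := Bialgebra.mk' k E h.counit_one (fun {x y} => h.counit_mul x y)
    h.comul_one (fun {x y} => h.comul_mul x y)
  { antipode := 𝓔.antipode
    mul_antipode_rTensor_comul := by
      rw [h.mul'_eq]
      exact LinearMap.ext fun x => (h.antipode_left x).trans (Algebra.algebraMap_eq_smul_one _).symm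
    mul_antipode_lTensor_comul := by
      rw [h.mul'_eq]
      exact LinearMap.ext fun x =>
        (h.antipode_right x).trans (Algebra.algebraMap_eq_smul_one _).symm }

/-- The base changes from `H` to `R # H`, whose structure is known only as a `HopfOps`. Rewriting
along this equality carries results proved for a Hopf algebra instance over to such bases. -/
theorem IsHopf.of_eq {𝓔 : HopfOps k E} (h : IsHopf 𝓔) :
    letI := h.ring; letI := h.hopfAlgebra; HopfOps.of k E = 𝓔 := by
  letI := h.ring; letI := h.hopfAlgebra
  have : LinearMap.mul' k E = 𝓔.mul := h.mul'_eq
  cases 𝓔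
  simp only [HopfOps.of, HopfOps.mk.injEq]
  exact ⟨rfl, this, rfl, rfl, rfl⟩

end Hopf

/-! ## The Radford biproduct is a Hopf algebra -/

section RadfordAlg

variable {k : Type*} [Field k] {H : Type*} [Ring H] [HopfAlgebra k H]
variable {R : Type*} [AddCommGroup R] [Module k R]

/-- The action as a map `H → End M`. -/
def YDOps.actL {H M : Type*} [AddCommGroup H] [Module k H] [AddCommGroup M] [Module k M]
    (Y : YDOps k H M) : H →ₗ[k] M →ₗ[k] M := TensorProduct.curry Y.act

@[simp] theorem YDOps.actL_apply {H M : Type*} [AddCommGroup H] [Module k H] [AddCommGroup M]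
    [Module k M] (Y : YDOps k H M) (h : H) (m : M) : Y.actL h m = Y.act (h ⊗ₜ m) := rfl

/-- Left multiplication as a map `R → End R`. -/
def HopfOps.mulL (𝓡 : HopfOps k R) : R →ₗ[k] R →ₗ[k] R := TensorProduct.curry 𝓡.mul

@[simp] theorem HopfOps.mulL_apply (𝓡 : HopfOps k R) (x y : R) :
    𝓡.mulL x y = 𝓡.mul (x ⊗ₜ y) := rfl

/-- Left multiplication by `1 # h` on `R # H`. -/
def smashAct (Y : YDOps k H R) : H →ₗ[k] Module.End k (R ⊗[k] H) :=
  TensorProduct.map₂ Y.actL (LinearMap.mul k H) ∘ₗ Coalgebra.comul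

theorem middle_tmul {A B B' C C' D : Type*}
    [AddCommGroup A] [Module k A] [AddCommGroup B] [Module k B] [AddCommGroup B'] [Module k B']
    [AddCommGroup C] [Module k C] [AddCommGroup C'] [Module k C'] [AddCommGroup D] [Module k D]
    (f : B ⊗[k] C →ₗ[k] C' ⊗[k] B') (a : A) (b : B) (c : C) (d : D) :
    middle f ((a ⊗ₜ[k] b) ⊗ₜ[k] (c ⊗ₜ[k] d)) =
      TensorProduct.map (TensorProduct.mk k A C' a) ((TensorProduct.mk k B' D).flip d)
        (f (b ⊗ₜ c)) := by
  simp only [middle, LinearMap.comp_apply, LinearEquiv.coe_coe, TensorProduct.assoc_tmul,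
    LinearMap.lTensor_tmul, TensorProduct.assoc_symm_tmul, LinearMap.rTensor_tmul]
  induction f (b ⊗ₜ c) with
  | zero => simp
  | tmul x y => simp
  | add x y hx hy => simp only [TensorProduct.add_tmul, TensorProduct.tmul_add, map_add, hx, hy]

theorem crossAct_tmul (Y : YDOps k H R) (h : H) (r : R) :
    crossAct (HopfOps.of k H) Y (h ⊗ₜ r) =
      LinearMap.rTensor H (Y.actL.flip r) (Coalgebra.comul h) := by
  simp only [crossAct, LinearMap.comp_apply, LinearEquiv.coe_coe, LinearMap.rTensor_tmul,
    HopfOps.of]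
  induction (Coalgebra.comul h : H ⊗[k] H) with
  | zero => simp
  | tmul x y => simp
  | add x y hx hy => simp only [TensorProduct.add_tmul, map_add, hx, hy]

theorem crossCoact_tmul (Y : YDOps k H R) (r : R) (h : H) :
    crossCoact (HopfOps.of k H) Y (r ⊗ₜ h) =
      LinearMap.rTensor R (LinearMap.mulRight k h) (Y.coact r) := by
  simp only [crossCoact, LinearMap.comp_apply, LinearEquiv.coe_coe, LinearMap.rTensor_tmul,
    HopfOps.of]
  induction Y.coact r with
  | zero => simp
  | tmul x y => simp
  | add x y hx hy => simp only [TensorProduct.add_tmul, map_add, hx, hy]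

/-- Left multiplication by `r # h` factors into left multiplication by `r` after the diagonal action
of `h`. The algebra axioms thereby become identities between these two kinds of operators. -/
theorem radford_mul_tmul (𝓡 : HopfOps k R) (Y : YDOps k H R) (r : R) (h : H) (t : R ⊗[k] H) :
    (radford (HopfOps.of k H) 𝓡 Y).mul ((r ⊗ₜ h) ⊗ₜ t) =
      LinearMap.rTensor H (𝓡.mulL r) (smashAct Y h t) := by
  induction t with
  | zero => simp
  | add x y hx hy => simp only [TensorProduct.tmul_add, map_add, hx, hy]
  | tmul s g =>
    simp only [radford, LinearMap.comp_apply, middle_tmul, crossAct_tmul, smashAct]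
    induction (Coalgebra.comul h : H ⊗[k] H) with
    | zero => simp
    | tmul x y => simp [HopfOps.of]
    | add x y hx hy => simp only [map_add, hx, hy, LinearMap.add_apply]

theorem smashAct_one {Y : YDOps k H R} (hY : IsYD (HopfOps.of k H) Y) :
    smashAct Y 1 = 1 := by
  ext r h
  have := hY.one_act r
  simp only [HopfOps.of] at this
  simp [smashAct, Algebra.TensorProduct.one_def, this]

theorem smashAct_mul {Y : YDOps k H R} (hY : IsYD (HopfOps.of k H) Y) (g h : H) :
    smashAct Y (g * h) = smashAct Y g * smashAct Y h := by
  simp only [smashAct, LinearMap.comp_apply, Bialgebra.comul_mul]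
  induction (Coalgebra.comul g : H ⊗[k] H) with
  | zero => simp
  | add x y hx hy => simp only [add_mul, map_add, hx, hy]
  | tmul a b =>
    induction (Coalgebra.comul h : H ⊗[k] H) with
    | zero => simp
    | add x y hx hy => simp only [mul_add, map_add, hx, hy]
    | tmul c d =>
      ext r e
      have := hY.mul_act a c r
      simp only [HopfOps.of, LinearMap.mul'_apply] at this
      simp [this, mul_assoc]

theorem act_mul {𝓡 : HopfOps k R} {Y : YDOps k H R} (hR : IsBraidedHopf (HopfOps.of k H) 𝓡 Y)
    (h : H) (r s : R) : Y.act (h ⊗ₜ 𝓡.mul (r ⊗ₜ s)) =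
      𝓡.mul (TensorProduct.map (Y.actL.flip r) (Y.actL.flip s) (Coalgebra.comul h)) := by
  have := LinearMap.congr_fun hR.mul_hom.map_act (h ⊗ₜ (r ⊗ₜ s))
  simp only [LinearMap.comp_apply, LinearMap.lTensor_tmul, YDOps.tensor, HopfOps.of,
    LinearMap.rTensor_tmul, LinearEquiv.coe_coe] at this
  rw [← this]
  congr 1
  induction (Coalgebra.comul h : H ⊗[k] H) with
  | zero => simp
  | tmul x y => simp
  | add x y hx hy => simp only [TensorProduct.add_tmul, map_add, hx, hy]

/-- The exchange rule `h r = (h₁ · r) h₂` as an identity of operators on `R # H`. It combines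
`H`-linearity of the multiplication of `R` with coassociativity of `H`. -/
theorem smashAct_comp_mulL {𝓡 : HopfOps k R} {Y : YDOps k H R}
    (hR : IsBraidedHopf (HopfOps.of k H) 𝓡 Y) (h : H) (r : R) :
    smashAct Y h ∘ₗ LinearMap.rTensor H (𝓡.mulL r) =
      TensorProduct.lift ((LinearMap.mul k (Module.End k (R ⊗[k] H))).compl₁₂
        (LinearMap.rTensorHom H ∘ₗ 𝓡.mulL ∘ₗ Y.actL.flip r) (smashAct Y)) (Coalgebra.comul h) := by
  ext s g
  let Φ : (H ⊗[k] H) ⊗[k] H →ₗ[k] R ⊗[k] H :=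
    TensorProduct.map (𝓡.mul ∘ₗ TensorProduct.map (Y.actL.flip r) (Y.actL.flip s))
      (LinearMap.mulRight k g)
  have h1 : ∀ t : H ⊗[k] H, TensorProduct.map₂ Y.actL (LinearMap.mul k H) t
      (𝓡.mul (r ⊗ₜ s) ⊗ₜ g) = Φ (LinearMap.rTensor H Coalgebra.comul t) := by
    intro t
    induction t with
    | zero => simp
    | tmul x y => simp [Φ, act_mul hR]
    | add x y hx hy => simp only [map_add, LinearMap.add_apply, hx, hy]
  have h2 : ∀ t : H ⊗[k] H, TensorProduct.lift ((LinearMap.mul k (Module.End k (R ⊗[k] H))).compl₁₂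
        (LinearMap.rTensorHom H ∘ₗ 𝓡.mulL ∘ₗ Y.actL.flip r) (smashAct Y)) t (s ⊗ₜ g) =
      Φ ((TensorProduct.assoc k H H H).symm (LinearMap.lTensor H Coalgebra.comul t)) := by
    intro t
    induction t with
    | zero => simp
    | add x y hx hy => simp only [map_add, LinearMap.add_apply, hx, hy]
    | tmul x y =>
      simp only [TensorProduct.lift.tmul, LinearMap.compl₁₂_apply, smashAct, LinearMap.comp_apply,
        LinearMap.lTensor_tmul]
      induction (Coalgebra.comul y : H ⊗[k] H) with
      | zero => simp
      | tmul a b => simp [Φ]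
      | add x y hx hy => simp only [TensorProduct.tmul_add, map_add, hx, hy, LinearMap.add_apply]
  simp only [TensorProduct.AlgebraTensorModule.curry_apply, LinearMap.restrictScalars_self,
    TensorProduct.curry_apply, LinearMap.comp_apply, LinearMap.rTensor_tmul, smashAct,
    HopfOps.mulL_apply]
  rw [h1, ← Coalgebra.coassoc_symm_apply, ← h2]
  rfl

theorem isAlg_radford {𝓡 : HopfOps k R} {Y : YDOps k H R}
    (hR : IsBraidedHopf (HopfOps.of k H) 𝓡 Y) : IsAlg (radford (HopfOps.of k H) 𝓡 Y) where
  one_mul x := by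
    change (radford (HopfOps.of k H) 𝓡 Y).mul ((𝓡.one ⊗ₜ 1) ⊗ₜ x) = x
    rw [radford_mul_tmul, smashAct_one hR.yd]
    have : 𝓡.mulL 𝓡.one = LinearMap.id := LinearMap.ext hR.one_mul
    simp [this]
  mul_one x := by
    change (radford (HopfOps.of k H) 𝓡 Y).mul (x ⊗ₜ (𝓡.one ⊗ₜ 1)) = x
    induction x with
    | zero => simp
    | add x y hx hy => simp only [TensorProduct.add_tmul, map_add, hx, hy]
    | tmul r h =>
      rw [radford_mul_tmul]
      have h1 : ∀ h : H, Y.act (h ⊗ₜ 𝓡.one) = Coalgebra.counit (R := k) h • 𝓡.one := by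
        intro h
        have := LinearMap.congr_fun hR.one_hom.map_act (h ⊗ₜ 1)
        simpa [YDOps.trivial, HopfOps.of] using this.symm
      have h2 : ∀ t : H ⊗[k] H, LinearMap.rTensor H (𝓡.mulL r)
          (TensorProduct.map₂ Y.actL (LinearMap.mul k H) t (𝓡.one ⊗ₜ 1)) =
          r ⊗ₜ TensorProduct.lid k H (LinearMap.rTensor H Coalgebra.counit t) := by
        intro t
        induction t with
        | zero => simp
        | add x y hx hy => simp only [map_add, LinearMap.add_apply, hx, hy, TensorProduct.tmul_add]
        | tmul x y => simp [h1, hR.mul_one, TensorProduct.smul_tmul']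
      simp [smashAct, h2]
  mul_assoc x y z := by
    set μ := (radford (HopfOps.of k H) 𝓡 Y).mul with hμ
    -- Associativity says that left multiplications commute with right multiplication by `z`, so it
    -- suffices to treat the two factors `mulL r` and `smashAct h`. The second one needs the
    -- exchange rule.
    have hL : ∀ r t, μ (LinearMap.rTensor H (𝓡.mulL r) t ⊗ₜ z) =
        LinearMap.rTensor H (𝓡.mulL r) (μ (t ⊗ₜ z)) := by
      intro r t
      induction t with
      | zero => simp
      | add x y hx hy => simp only [map_add, TensorProduct.add_tmul, hx, hy]
      | tmul s g =>
        rw [LinearMap.rTensor_tmul, hμ, radford_mul_tmul, radford_mul_tmul,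
          ← LinearMap.rTensor_comp_apply]
        congr 2
        exact LinearMap.ext fun u => hR.mul_assoc r s u
    have hρ : ∀ h t, μ (smashAct Y h t ⊗ₜ z) = smashAct Y h (μ (t ⊗ₜ z)) := by
      intro h t
      induction t with
      | zero => simp
      | add x y hx hy => simp only [map_add, TensorProduct.add_tmul, hx, hy]
      | tmul s g =>
        rw [hμ, radford_mul_tmul, ← LinearMap.comp_apply (smashAct Y h),
          smashAct_comp_mulL hR h s]
        conv_lhs => rw [smashAct, LinearMap.comp_apply]
        induction (Coalgebra.comul h : H ⊗[k] H) with
        | zero => simp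
        | add x y hx hy => simp only [map_add, LinearMap.add_apply, TensorProduct.add_tmul, hx, hy]
        | tmul a b =>
          simp [radford_mul_tmul, smashAct_mul hR.yd]
    induction x with
    | zero => simp
    | add x y hx hy => simp only [map_add, TensorProduct.add_tmul, hx, hy]
    | tmul r h => rw [hμ, radford_mul_tmul, ← hμ, hL, hρ, hμ, radford_mul_tmul]

end RadfordAlg

/-! ### The convolution algebra of maps from a coalgebra to an algebra -/

section Conv

variable {k : Type*} [Field k] {C : Type*} [AddCommGroup C] [Module k C] [Coalgebra k C]
variable {B : Type*} [Ring B] [Algebra k B]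

/-- The element `c ↦ ε(c) b` of the convolution algebra. -/
def cst (k : Type*) [Field k] (C : Type*) [AddCommGroup C] [Module k C] [Coalgebra k C]
    {B : Type*} [Ring B] [Algebra k B] : B →ₗ[k] WithConv (C →ₗ[k] B) where
  toFun b := toConv ((Coalgebra.counit (R := k) (A := C)).smulRight b)
  map_add' x y := by ext; simp
  map_smul' c x := by ext; exact smul_comm _ _ _

@[simp] theorem cst_apply (b : B) (c : C) :
    (cst k C b) c = Coalgebra.counit (R := k) c • b := rfl

/-- The counit absorbs one leg of the comultiplication, so multiplying by a constant is pointwise.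
Sweedler computations with fixed elements can thus be done as monoid computations. -/
theorem conv_mul_cst_apply (f : WithConv (C →ₗ[k] B)) (b : B) (c : C) :
    (f * cst k C b) c = f c * b := by
  have : ∀ t : C ⊗[k] C, LinearMap.mul' k B (TensorProduct.map f.ofConv (cst k C b).ofConv t) =
      f (TensorProduct.rid k C (LinearMap.lTensor C Coalgebra.counit t)) * b := by
    intro t
    induction t with
    | zero => simp
    | tmul x y =>
      have : (cst k C b).ofConv y = Coalgebra.counit (R := k) y • b := rfl
      simp [this]
    | add x y hx hy => simp only [map_add, hx, hy, add_mul]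
  rw [LinearMap.convMul_apply, this]
  simp

theorem cst_mul_conv_apply (f : WithConv (C →ₗ[k] B)) (b : B) (c : C) :
    (cst k C b * f) c = b * f c := by
  have : ∀ t : C ⊗[k] C, LinearMap.mul' k B (TensorProduct.map (cst k C b).ofConv f.ofConv t) =
      b * f (TensorProduct.lid k C (LinearMap.rTensor C Coalgebra.counit t)) := by
    intro t
    induction t with
    | zero => simp
    | tmul x y =>
      have : (cst k C b).ofConv x = Coalgebra.counit (R := k) x • b := rfl
      simp [this]
    | add x y hx hy => simp only [map_add, hx, hy, mul_add]
  rw [LinearMap.convMul_apply, this]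
  simp

theorem cst_mul (a b : B) : cst k C (a * b) = cst k C a * cst k C b := by
  ext c; rw [conv_mul_cst_apply]; simp

theorem cst_one : cst k C (1 : B) = 1 := by
  ext c; simp [Algebra.algebraMap_eq_smul_one]

/-- `f ∘ S` is a convolution inverse of an algebra map `f` on a Hopf algebra. -/
theorem conv_algHom_mul_antipode {H : Type*} [Ring H] [HopfAlgebra k H] (f : H →ₐ[k] B) :
    toConv f.toLinearMap * toConv (f.toLinearMap ∘ₗ HopfAlgebra.antipode k) = 1 := by
  have := LinearMap.algHom_comp_convMul_distrib f (toConv (LinearMap.id : H →ₗ[k] H))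
    (toConv (HopfAlgebra.antipode k))
  rw [LinearMap.id_mul_antipode] at this
  ext c
  simpa using (LinearMap.congr_fun this c).symm

theorem conv_antipode_mul_algHom {H : Type*} [Ring H] [HopfAlgebra k H] (f : H →ₐ[k] B) :
    toConv (f.toLinearMap ∘ₗ HopfAlgebra.antipode k) * toConv f.toLinearMap = 1 := by
  have := LinearMap.algHom_comp_convMul_distrib f (toConv (HopfAlgebra.antipode k : H →ₗ[k] H))
    (toConv LinearMap.id)
  rw [LinearMap.antipode_mul_id] at this
  ext c
  simpa using (LinearMap.congr_fun this c).symm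

end Conv

/-! ### Smash pairs and the multiplicativity of the comultiplication on `R` -/

section SmashPair

variable {k : Type*} [Field k] {H : Type*} [Ring H] [HopfAlgebra k H]
variable {R : Type*} [AddCommGroup R] [Module k R] {E : Type*} [Ring E] [Algebra k E]

/-- Maps of `R` and `H` to an algebra `E` that define an algebra map `R # H → E`. -/
structure SmashPair (𝓡 : HopfOps k R) (Y : YDOps k H R) (iR : R →ₗ[k] E) (iH : H →ₐ[k] E) :
    Prop where
  map_one : iR 𝓡.one = 1
  map_mul : ∀ r s, iR (𝓡.mul (r ⊗ₜ s)) = iR r * iR s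
  exch : ∀ h r, iH h * iR r =
    LinearMap.mul' k E (TensorProduct.map (iR ∘ₗ Y.actL.flip r) iH.toLinearMap (Coalgebra.comul h))

/-- `b ↦ iH(b₍₋₁₎) ⊗ iR(b₍₀₎)`. -/
def coactMap (Y : YDOps k H R) (iR : R →ₗ[k] E) (iH : H →ₐ[k] E) : R →ₗ[k] E ⊗[k] E :=
  TensorProduct.map iH.toLinearMap iR ∘ₗ Y.coact

/-- `a ⊗ b ↦ iR(a) iH(b₍₋₁₎) ⊗ iR(b₍₀₎)`. -/
def coactMap₂ (Y : YDOps k H R) (iR : R →ₗ[k] E) (iH : H →ₐ[k] E) : R ⊗[k] R →ₗ[k] E ⊗[k] E :=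
  LinearMap.mul' k (E ⊗[k] E) ∘ₗ
    TensorProduct.map ((TensorProduct.mk k E E).flip 1 ∘ₗ iR) (coactMap Y iR iH)

@[simp] theorem coactMap₂_tmul (Y : YDOps k H R) (iR : R →ₗ[k] E) (iH : H →ₐ[k] E) (a b : R) :
    coactMap₂ Y iR iH (a ⊗ₜ b) = (iR a ⊗ₜ 1) * coactMap Y iR iH b := rfl

/-- `h ↦ iH(h₍₁₎) ⊗ iH(h₍₂₎)`. -/
def comulH (iH : H →ₐ[k] E) : H →ₐ[k] E ⊗[k] E :=
  (Algebra.TensorProduct.map iH iH).comp (Bialgebra.comulAlgHom k H)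

theorem comulH_apply (iH : H →ₐ[k] E) (h : H) :
    comulH iH h = TensorProduct.map iH.toLinearMap iH.toLinearMap (Coalgebra.comul h) := rfl

variable {𝓡 : HopfOps k R} {Y : YDOps k H R} {iR : R →ₗ[k] E} {iH : H →ₐ[k] E}

theorem coact_mul (hR : IsBraidedHopf (HopfOps.of k H) 𝓡 Y) (r s : R) :
    Y.coact (𝓡.mul (r ⊗ₜ s)) = TensorProduct.map (LinearMap.mul' k H) 𝓡.mul
      (TensorProduct.tensorTensorTensorComm k H R H R (Y.coact r ⊗ₜ Y.coact s)) := by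
  have := LinearMap.congr_fun hR.mul_hom.map_coact (r ⊗ₜ s)
  simp only [LinearMap.comp_apply, YDOps.tensor, HopfOps.of, TensorProduct.map_tmul,
    LinearEquiv.coe_coe] at this
  rw [this, ← LinearMap.comp_apply, LinearMap.lTensor_comp_rTensor]

theorem coact_one (hR : IsBraidedHopf (HopfOps.of k H) 𝓡 Y) : Y.coact 𝓡.one = 1 ⊗ₜ 𝓡.one := by
  have := LinearMap.congr_fun hR.one_hom.map_coact 1
  simpa [YDOps.trivial, HopfOps.of] using this

theorem act_one (hR : IsBraidedHopf (HopfOps.of k H) 𝓡 Y) (h : H) :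
    Y.act (h ⊗ₜ 𝓡.one) = Coalgebra.counit (R := k) h • 𝓡.one := by
  have := LinearMap.congr_fun hR.one_hom.map_act (h ⊗ₜ 1)
  simpa [YDOps.trivial, HopfOps.of] using this.symm

theorem coactMap_one (hR : IsBraidedHopf (HopfOps.of k H) 𝓡 Y) (hE : SmashPair 𝓡 Y iR iH) :
    coactMap Y iR iH 𝓡.one = 1 := by
  simp [coactMap, coact_one hR, hE.map_one, Algebra.TensorProduct.one_def]

theorem coactMap_mul (hR : IsBraidedHopf (HopfOps.of k H) 𝓡 Y) (hE : SmashPair 𝓡 Y iR iH)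
    (r s : R) : coactMap Y iR iH (𝓡.mul (r ⊗ₜ s)) = coactMap Y iR iH r * coactMap Y iR iH s := by
  simp only [coactMap, LinearMap.comp_apply, coact_mul hR]
  induction Y.coact r with
  | zero => simp
  | add x y hx hy => simp only [TensorProduct.add_tmul, map_add, hx, hy, add_mul]
  | tmul a b =>
    induction Y.coact s with
    | zero => simp
    | add x y hx hy => simp only [TensorProduct.tmul_add, map_add, hx, hy, mul_add]
    | tmul c d => simp [hE.map_mul]

/-- Moving `a` to the left past `b₋₁` by the exchange rule splits `b₋₁` in two. By coassociativity
of the coaction the left part acts on `a` as in the braiding, and the right part is the coaction of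
`b₀`. -/
theorem coactMap_mul_includeLeft (hR : IsBraidedHopf (HopfOps.of k H) 𝓡 Y)
    (hE : SmashPair 𝓡 Y iR iH) (b a : R) : coactMap Y iR iH b * (iR a ⊗ₜ 1) =
      coactMap₂ Y iR iH (braiding Y Y (b ⊗ₜ a)) := by
  let Ψ : (H ⊗[k] H) ⊗[k] R →ₗ[k] E ⊗[k] E :=
    TensorProduct.map (LinearMap.mul' k E ∘ₗ
      TensorProduct.map (iR ∘ₗ Y.actL.flip a) iH.toLinearMap) iR
  have h1 : ∀ t : H ⊗[k] R, TensorProduct.map iH.toLinearMap iR t * (iR a ⊗ₜ 1) =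
      Ψ (LinearMap.rTensor R Coalgebra.comul t) := by
    intro t
    induction t with
    | zero => simp
    | add x y hx hy => simp only [map_add, add_mul, hx, hy]
    | tmul g c => simp [Ψ, hE.exch]
  have h2 : ∀ t : H ⊗[k] R, coactMap₂ Y iR iH (LinearMap.rTensor R Y.act
        (TensorProduct.rightComm k H R R (t ⊗ₜ a))) =
      Ψ ((TensorProduct.assoc k H H R).symm (LinearMap.lTensor H Y.coact t)) := by
    intro t
    induction t with
    | zero => simp
    | add x y hx hy => simp only [map_add, hx, hy, TensorProduct.add_tmul]
    | tmul g c =>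
      simp only [TensorProduct.rightComm_tmul, LinearMap.rTensor_tmul, coactMap₂_tmul, coactMap,
        LinearMap.comp_apply, LinearMap.lTensor_tmul]
      induction Y.coact c with
      | zero => simp
      | add x y hx hy => simp only [map_add, hx, hy, TensorProduct.tmul_add, mul_add]
      | tmul x y => simp [Ψ]
  have h3 := hR.yd.coassoc b
  rw [← LinearEquiv.eq_symm_apply] at h3
  simp only [HopfOps.of] at h3
  simp only [braiding, LinearMap.comp_apply, LinearMap.rTensor_tmul, LinearEquiv.coe_coe]
  rw [h2, coactMap, LinearMap.comp_apply, h1, h3]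

/-- So `a ⊗ b ↦ a b₋₁ ⊗ b₀` turns the braided multiplication of `R ⊗ R` into the ordinary one of `E
⊗ E`. This is why the braided bialgebra axiom of `R` becomes the ordinary one for `R # H`. -/
theorem coactMap₂_mul (hR : IsBraidedHopf (HopfOps.of k H) 𝓡 Y)
    (hE : SmashPair 𝓡 Y iR iH) (s t : R ⊗[k] R) : coactMap₂ Y iR iH s * coactMap₂ Y iR iH t =
      coactMap₂ Y iR iH (TensorProduct.map 𝓡.mul 𝓡.mul (middle (braiding Y Y) (s ⊗ₜ t))) := by
  induction s with
  | zero => simp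
  | add x y hx hy => simp only [map_add, hx, hy, TensorProduct.add_tmul, add_mul]
  | tmul a b =>
    induction t with
    | zero => simp
    | add x y hx hy => simp only [map_add, hx, hy, TensorProduct.tmul_add, mul_add]
    | tmul a' b' =>
      rw [coactMap₂_tmul, coactMap₂_tmul, mul_assoc, ← mul_assoc (coactMap Y iR iH b),
        coactMap_mul_includeLeft hR hE, middle_tmul]
      induction braiding Y Y (b ⊗ₜ a') with
      | zero => simp
      | add x y hx hy => simp only [map_add, hx, hy, mul_add, add_mul]
      | tmul x y =>
        simp [coactMap_mul hR hE, hE.map_mul, ← mul_assoc]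

theorem coactMap₂_comul_mul (hR : IsBraidedHopf (HopfOps.of k H) 𝓡 Y)
    (hE : SmashPair 𝓡 Y iR iH) (r s : R) : coactMap₂ Y iR iH (𝓡.comul (𝓡.mul (r ⊗ₜ s))) =
      coactMap₂ Y iR iH (𝓡.comul r) * coactMap₂ Y iR iH (𝓡.comul s) := by
  rw [coactMap₂_mul hR hE]
  exact congrArg _ (LinearMap.congr_fun hR.comul_mul (r ⊗ₜ s))

theorem coactMap₂_comul_one (hR : IsBraidedHopf (HopfOps.of k H) 𝓡 Y)
    (hE : SmashPair 𝓡 Y iR iH) : coactMap₂ Y iR iH (𝓡.comul 𝓡.one) = 1 := by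
  rw [hR.comul_one, coactMap₂_tmul, coactMap_one hR hE, hE.map_one, mul_one,
    Algebra.TensorProduct.one_def]

theorem coact_act_eq (hY : IsYD (HopfOps.of k H) Y) (h : H) (m : R) :
    Y.coact (Y.act (h ⊗ₜ m)) = TensorProduct.map (HopfOps.of k H).conj Y.act
      (TensorProduct.tensorTensorTensorComm k (H ⊗[k] H) H H R
        ((TensorProduct.assoc k H H H).symm (LinearMap.lTensor H
          ((TensorProduct.comm k H H).toLinearMap ∘ₗ Coalgebra.comul) (Coalgebra.comul h)) ⊗ₜ
            Y.coact m)) :=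
  LinearMap.congr_fun hY.coact_act (h ⊗ₜ m)

/-- The expression `h₁ g S(h₃) ⊗ h₂ c` of the Yetter-Drinfel'd condition as a convolution product,
in which `φ ∘ S` can be cancelled against `φ`. The targets are general because the formula serves
the smash product as well as the coinvariants. -/
theorem conj_conv {M B B' : Type*} [AddCommGroup M] [Module k M] [Ring B] [Algebra k B]
    [Ring B'] [Algebra k B'] (Y : YDOps k H M) (φ : H →ₐ[k] B) (ψ : M →ₗ[k] B') (g : H) (c : M)
    (h : H) :
    TensorProduct.map φ.toLinearMap ψ (TensorProduct.map (HopfOps.of k H).conj Y.act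
        (TensorProduct.tensorTensorTensorComm k (H ⊗[k] H) H H M
        ((TensorProduct.assoc k H H H).symm (LinearMap.lTensor H
          ((TensorProduct.comm k H H).toLinearMap ∘ₗ Coalgebra.comul) (Coalgebra.comul h)) ⊗ₜ
            (g ⊗ₜ c)))) =
      ((toConv ((Algebra.TensorProduct.includeLeft : B →ₐ[k] B ⊗[k] B').comp φ).toLinearMap *
          cst k H (φ g ⊗ₜ[k] (1 : B'))) *
        (toConv ((TensorProduct.mk k B B' 1) ∘ₗ ψ ∘ₗ Y.actL.flip c) *
          toConv (((Algebra.TensorProduct.includeLeft : B →ₐ[k] B ⊗[k] B').comp φ).toLinearMap ∘ₗ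
            HopfAlgebra.antipode k))) h := by
  set l₁ : H →ₐ[k] B ⊗[k] B' := (Algebra.TensorProduct.includeLeft : B →ₐ[k] B ⊗[k] B').comp φ
  set m : WithConv (H →ₗ[k] B ⊗[k] B') := toConv ((TensorProduct.mk k B B' 1) ∘ₗ ψ ∘ₗ Y.actL.flip c)
  rw [LinearMap.convMul_apply]
  induction (Coalgebra.comul h : H ⊗[k] H) with
  | zero => simp
  | add x y hx hy => simp only [map_add, hx, hy, TensorProduct.add_tmul]
  | tmul x y =>
    have e1 : (toConv l₁.toLinearMap * cst k H (φ g ⊗ₜ[k] (1 : B'))).ofConv x =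
        φ (x * g) ⊗ₜ 1 := by
      refine (conv_mul_cst_apply _ _ _).trans ?_
      change (φ x ⊗ₜ[k] (1 : B')) * (φ g ⊗ₜ[k] (1 : B')) = _
      simp
    have e2 : (m * toConv (l₁.toLinearMap ∘ₗ HopfAlgebra.antipode k)).ofConv y =
      LinearMap.mul' k (B ⊗[k] B') (TensorProduct.map m.ofConv
        (l₁.toLinearMap ∘ₗ HopfAlgebra.antipode k) (Coalgebra.comul y)) := rfl
    simp only [TensorProduct.map_tmul, LinearMap.mul'_apply, e1, e2, LinearMap.lTensor_tmul,
      LinearMap.comp_apply]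
    induction (Coalgebra.comul y : H ⊗[k] H) with
    | zero => simp
    | add x y hx hy => simp only [map_add, hx, hy, TensorProduct.add_tmul, mul_add,
        TensorProduct.tmul_add]
    | tmul u v => simp [m, l₁, HopfOps.conj, HopfOps.of, mul_assoc]

/-- This is the Yetter-Drinfel'd condition `δ(h b) = h₁ b₋₁ S(h₃) ⊗ h₂ b₀` with the antipode moved
to the other side. -/
theorem comulH_mul_coactMap (hR : IsBraidedHopf (HopfOps.of k H) 𝓡 Y)
    (hE : SmashPair 𝓡 Y iR iH) (b : R) :
    toConv (comulH iH).toLinearMap * cst k H (coactMap Y iR iH b) =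
      toConv (coactMap Y iR iH ∘ₗ Y.actL.flip b) * toConv (comulH iH).toLinearMap := by
  let l₁ : H →ₐ[k] E ⊗[k] E := Algebra.TensorProduct.includeLeft.comp iH
  let l₂ : H →ₐ[k] E ⊗[k] E := Algebra.TensorProduct.includeRight.comp iH
  let m : R →ₗ[k] WithConv (H →ₗ[k] E ⊗[k] E) :=
    { toFun := fun c => toConv ((TensorProduct.mk k E E 1) ∘ₗ iR ∘ₗ Y.actL.flip c)
      map_add' := fun x y => by ext; simp [TensorProduct.tmul_add]
      map_smul' := fun x y => by ext; simp }
  have hΔ : toConv (comulH iH).toLinearMap = toConv l₁.toLinearMap * toConv l₂.toLinearMap := by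
    ext h
    change comulH iH h = LinearMap.mul' k (E ⊗[k] E)
      (TensorProduct.map l₁.toLinearMap l₂.toLinearMap (Coalgebra.comul h))
    rw [comulH_apply]
    induction (Coalgebra.comul h : H ⊗[k] H) with
    | zero => simp
    | add x y hx hy => simp only [map_add, hx, hy]
    | tmul x y => simp [l₁, l₂]
  have hm : ∀ c, m c * toConv l₂.toLinearMap = toConv l₂.toLinearMap * cst k H (1 ⊗ₜ iR c) := by
    intro c
    ext h
    rw [conv_mul_cst_apply]
    change LinearMap.mul' k (E ⊗[k] E) (TensorProduct.map (m c).ofConv l₂.toLinearMap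
      (Coalgebra.comul h)) = (1 ⊗ₜ[k] iH h) * (1 ⊗ₜ iR c)
    rw [Algebra.TensorProduct.tmul_mul_tmul, hE.exch]
    induction (Coalgebra.comul h : H ⊗[k] H) with
    | zero => simp
    | add x y hx hy => simp only [map_add, hx, hy, TensorProduct.tmul_add]
    | tmul x y => simp [l₂, m]
  have hcomm : ∀ g, cst k H (iH g ⊗ₜ[k] (1 : E)) * toConv l₂.toLinearMap =
      toConv l₂.toLinearMap * cst k H (iH g ⊗ₜ[k] (1 : E)) := by
    intro g
    ext h
    rw [conv_mul_cst_apply, cst_mul_conv_apply]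
    change (iH g ⊗ₜ[k] (1 : E)) * (1 ⊗ₜ[k] iH h) = (1 ⊗ₜ[k] iH h) * (iH g ⊗ₜ[k] (1 : E))
    simp
  -- The convolution factorisation exists only for pure tensors `g ⊗ c`. Asking for some `f` with
  -- the right values and the cancellation property gives a statement that passes to sums.
  have key : ∀ t : H ⊗[k] R, ∃ f : WithConv (H →ₗ[k] E ⊗[k] E),
      f * (toConv l₁.toLinearMap * toConv l₂.toLinearMap) =
        toConv l₁.toLinearMap * toConv l₂.toLinearMap *
          cst k H (TensorProduct.map iH.toLinearMap iR t) ∧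
      ∀ h, f h = TensorProduct.map iH.toLinearMap iR (TensorProduct.map (HopfOps.of k H).conj Y.act
        (TensorProduct.tensorTensorTensorComm k (H ⊗[k] H) H H R
        ((TensorProduct.assoc k H H H).symm (LinearMap.lTensor H
          ((TensorProduct.comm k H H).toLinearMap ∘ₗ Coalgebra.comul) (Coalgebra.comul h)) ⊗ₜ
            t))) := by
    intro t
    induction t with
    | zero => exact ⟨0, by simp, by intro h; simp⟩
    | add x y hx hy =>
      obtain ⟨f, hf, hf'⟩ := hx
      obtain ⟨g, hg, hg'⟩ := hy
      refine ⟨f + g, by simp only [add_mul, hf, hg, map_add, mul_add], fun h => ?_⟩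
      simp only [TensorProduct.tmul_add, map_add, ← hf', ← hg']
      rfl
    | tmul g c =>
      refine ⟨(toConv l₁.toLinearMap * cst k H (iH g ⊗ₜ[k] (1 : E))) *
        (m c * toConv (l₁.toLinearMap ∘ₗ HopfAlgebra.antipode k)), ?_, ?_⟩
      · have h1 := conv_antipode_mul_algHom l₁
        have : cst k H (TensorProduct.map iH.toLinearMap iR (g ⊗ₜ c)) =
            cst k H (iH g ⊗ₜ[k] (1 : E)) * cst k H (1 ⊗ₜ[k] iR c) := by
          rw [← cst_mul]; simp
        rw [this]
        -- The antipode cancels against `l₁`; then `hm` moves `c` past `l₂` by the exchange rule in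
        -- the right leg, and `g` commutes with `l₂` because it lives in the left leg.
        calc _ = toConv l₁.toLinearMap * cst k H (iH g ⊗ₜ[k] (1 : E)) * m c *
              (toConv (l₁.toLinearMap ∘ₗ HopfAlgebra.antipode k) * toConv l₁.toLinearMap) *
                toConv l₂.toLinearMap := by simp only [mul_assoc]
          _ = toConv l₁.toLinearMap * cst k H (iH g ⊗ₜ[k] (1 : E)) *
            (m c * toConv l₂.toLinearMap) := by rw [h1]; simp only [mul_assoc, mul_one]
          _ = toConv l₁.toLinearMap * (cst k H (iH g ⊗ₜ[k] (1 : E)) * toConv l₂.toLinearMap) *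
              cst k H (1 ⊗ₜ iR c) := by rw [hm]; simp only [mul_assoc]
          _ = _ := by rw [hcomm]; simp only [mul_assoc]
      · intro h
        exact (conj_conv Y iH iR g c h).symm
  obtain ⟨f, hf, hf'⟩ := key (Y.coact b)
  have hfb : f = toConv (coactMap Y iR iH ∘ₗ Y.actL.flip b) := by
    ext h
    rw [hf', ← coact_act_eq hR.yd]
    rfl
  rw [hΔ, ← hfb, hf]
  rfl

end SmashPair

/-! ### Comultiplication and `H`-action; coassociativity and counit -/

section SmashPair

variable {k : Type*} [Field k] {H : Type*} [Ring H] [HopfAlgebra k H]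
variable {R : Type*} [AddCommGroup R] [Module k R] {E : Type*} [Ring E] [Algebra k E]
variable {𝓡 : HopfOps k R} {Y : YDOps k H R} {iR : R →ₗ[k] E} {iH : H →ₐ[k] E}

theorem comulH_mul_includeLeft (hE : SmashPair 𝓡 Y iR iH) (a : R) :
    toConv (comulH iH).toLinearMap * cst k H (iR a ⊗ₜ[k] (1 : E)) =
      toConv ((TensorProduct.mk k E E).flip 1 ∘ₗ iR ∘ₗ Y.actL.flip a) *
        toConv (comulH iH).toLinearMap := by
  let l₁ : H →ₐ[k] E ⊗[k] E := Algebra.TensorProduct.includeLeft.comp iH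
  let l₂ : H →ₐ[k] E ⊗[k] E := Algebra.TensorProduct.includeRight.comp iH
  have hΔ : toConv (comulH iH).toLinearMap = toConv l₁.toLinearMap * toConv l₂.toLinearMap := by
    ext h
    change comulH iH h = LinearMap.mul' k (E ⊗[k] E)
      (TensorProduct.map l₁.toLinearMap l₂.toLinearMap (Coalgebra.comul h))
    rw [comulH_apply]
    induction (Coalgebra.comul h : H ⊗[k] H) with
    | zero => simp
    | add x y hx hy => simp only [map_add, hx, hy]
    | tmul x y => simp [l₁, l₂]
  have hcomm : cst k H (iR a ⊗ₜ[k] (1 : E)) * toConv l₂.toLinearMap =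
      toConv l₂.toLinearMap * cst k H (iR a ⊗ₜ[k] (1 : E)) := by
    ext h
    rw [conv_mul_cst_apply, cst_mul_conv_apply]
    change (iR a ⊗ₜ[k] (1 : E)) * (1 ⊗ₜ[k] iH h) = (1 ⊗ₜ[k] iH h) * (iR a ⊗ₜ[k] (1 : E))
    simp
  have hex : toConv l₁.toLinearMap * cst k H (iR a ⊗ₜ[k] (1 : E)) =
      toConv ((TensorProduct.mk k E E).flip 1 ∘ₗ iR ∘ₗ Y.actL.flip a) * toConv l₁.toLinearMap := by
    ext h
    rw [conv_mul_cst_apply]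
    change (iH h ⊗ₜ[k] (1 : E)) * (iR a ⊗ₜ 1) = LinearMap.mul' k (E ⊗[k] E) (TensorProduct.map
      ((TensorProduct.mk k E E).flip 1 ∘ₗ iR ∘ₗ Y.actL.flip a) l₁.toLinearMap (Coalgebra.comul h))
    rw [Algebra.TensorProduct.tmul_mul_tmul, hE.exch]
    induction (Coalgebra.comul h : H ⊗[k] H) with
    | zero => simp
    | add x y hx hy => simp only [map_add, ← hx, ← hy, TensorProduct.add_tmul]
    | tmul x y => simp [l₁]
  rw [hΔ, mul_assoc, ← hcomm, ← mul_assoc, hex, mul_assoc]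

/-- The factors `a ⊗ 1` and `b₋₁ ⊗ b₀` are moved past `Δ(h)` one after the other. They pick up the
actions of `h₁` and `h₂`, which together form the diagonal action. -/
theorem comulH_mul_coactMap₂ (hR : IsBraidedHopf (HopfOps.of k H) 𝓡 Y)
    (hE : SmashPair 𝓡 Y iR iH) (t : R ⊗[k] R) :
    toConv (comulH iH).toLinearMap * cst k H (coactMap₂ Y iR iH t) =
      toConv (coactMap₂ Y iR iH ∘ₗ (Y.tensor (HopfOps.of k H) Y).actL.flip t) *
        toConv (comulH iH).toLinearMap := by
  induction t with
  | zero => ext h; simp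
  | add x y hx hy =>
    simp only [map_add, mul_add, hx, hy, ← add_mul, LinearMap.comp_add, toConv_add]
  | tmul a b =>
    rw [coactMap₂_tmul, cst_mul, ← mul_assoc, comulH_mul_includeLeft hE, mul_assoc,
      comulH_mul_coactMap hR hE, ← mul_assoc]
    congr 1
    ext h
    change LinearMap.mul' k (E ⊗[k] E) (TensorProduct.map _ _ (Coalgebra.comul h)) =
      coactMap₂ Y iR iH ((Y.tensor (HopfOps.of k H) Y).act (h ⊗ₜ (a ⊗ₜ b)))
    simp only [YDOps.tensor, LinearMap.comp_apply, HopfOps.of, LinearMap.rTensor_tmul]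
    induction (Coalgebra.comul h : H ⊗[k] H) with
    | zero => simp
    | add x y hx hy => simp only [map_add, hx, hy, TensorProduct.add_tmul]
    | tmul x y => simp

theorem comulH_mul_comul (hR : IsBraidedHopf (HopfOps.of k H) 𝓡 Y)
    (hE : SmashPair 𝓡 Y iR iH) (h : H) (r : R) :
    comulH iH h * coactMap₂ Y iR iH (𝓡.comul r) =
      LinearMap.mul' k (E ⊗[k] E) (TensorProduct.map
        (coactMap₂ Y iR iH ∘ₗ 𝓡.comul ∘ₗ Y.actL.flip r) (comulH iH).toLinearMap
          (Coalgebra.comul h)) := by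
  have h1 := congrArg (fun f => f.ofConv h) (comulH_mul_coactMap₂ hR hE (𝓡.comul r))
  have h2 : (Y.tensor (HopfOps.of k H) Y).actL.flip (𝓡.comul r) = 𝓡.comul ∘ₗ Y.actL.flip r := by
    ext g
    exact (LinearMap.congr_fun hR.comul_hom.map_act (g ⊗ₜ r)).symm
  rw [h2] at h1
  exact (conv_mul_cst_apply _ _ _).symm.trans h1

/-- The data of a comultiplication, a counit and an antipode on `E = R # H`. -/
structure SmashHopf (𝓡 : HopfOps k R) (Y : YDOps k H R) (iR : R →ₗ[k] E) (iH : H →ₐ[k] E)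
    (Δ : E →ₐ[k] E ⊗[k] E) (ε : E →ₐ[k] k) (S : E →ₗ[k] E) : Prop extends
    SmashPair 𝓡 Y iR iH where
  surj : ∀ x : E, ∃ t : R ⊗[k] H, LinearMap.mul' k E (TensorProduct.map iR iH.toLinearMap t) = x
  comul_R : ∀ r, Δ (iR r) = coactMap₂ Y iR iH (𝓡.comul r)
  comul_H : ∀ h, Δ (iH h) = comulH iH h
  counit_R : ∀ r, ε (iR r) = 𝓡.counit r
  counit_H : ∀ h, ε (iH h) = Coalgebra.counit h
  antipode : ∀ r h, S (iR r * iH h) = LinearMap.mul' k E (TensorProduct.map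
    (iH.toLinearMap ∘ₗ HopfAlgebra.antipode k ∘ₗ LinearMap.mulRight k h)
    (iR ∘ₗ 𝓡.antipode) (Y.coact r))

variable {Δ : E →ₐ[k] E ⊗[k] E} {ε : E →ₐ[k] k} {S : E →ₗ[k] E}

theorem SmashHopf.algHom_ext (hE : SmashHopf 𝓡 Y iR iH Δ ε S) {B : Type*} [Ring B] [Algebra k B]
    {f g : E →ₐ[k] B} (h₁ : ∀ r, f (iR r) = g (iR r)) (h₂ : ∀ h, f (iH h) = g (iH h)) : f = g := by
  ext x
  obtain ⟨t, rfl⟩ := hE.surj x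
  induction t with
  | zero => simp
  | add x y hx hy => simp only [map_add, hx, hy]
  | tmul r h => simp [h₁, h₂]

theorem comul_coact (hR : IsBraidedHopf (HopfOps.of k H) 𝓡 Y) (r : R) :
    LinearMap.lTensor H 𝓡.comul (Y.coact r) =
      (Y.tensor (HopfOps.of k H) Y).coact (𝓡.comul r) :=
  (LinearMap.congr_fun hR.comul_hom.map_coact r).symm

theorem counit_coact' (hR : IsBraidedHopf (HopfOps.of k H) 𝓡 Y) (r : R) :
    LinearMap.lTensor H 𝓡.counit (Y.coact r) = 1 ⊗ₜ 𝓡.counit r :=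
  (LinearMap.congr_fun hR.counit_hom.map_coact r).symm

/-- Both sides are algebra maps, so they need only be compared on `R` and on `H`. On `R` the inputs
are coassociativity of `R` and of its coaction, and colinearity of the comultiplication of `R`. -/
theorem SmashHopf.coassoc (hR : IsBraidedHopf (HopfOps.of k H) 𝓡 Y)
    (hE : SmashHopf 𝓡 Y iR iH Δ ε S) (x : E) :
    TensorProduct.assoc k E E E (LinearMap.rTensor E Δ.toLinearMap (Δ x)) =
      LinearMap.lTensor E Δ.toLinearMap (Δ x) := by
  let f : E →ₐ[k] E ⊗[k] (E ⊗[k] E) :=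
    (Algebra.TensorProduct.assoc k k k E E E).toAlgHom.comp
      ((Algebra.TensorProduct.map Δ (AlgHom.id k E)).comp Δ)
  let g : E →ₐ[k] E ⊗[k] (E ⊗[k] E) := (Algebra.TensorProduct.map (AlgHom.id k E) Δ).comp Δ
  suffices f = g from DFunLike.congr_fun this x
  refine hE.algHom_ext (fun r => ?_) (fun h => ?_)
  · let D₃ : R →ₗ[k] E ⊗[k] (E ⊗[k] E) :=
      TensorProduct.map iH.toLinearMap (coactMap Y iR iH) ∘ₗ Y.coact
    -- `Ω (a ⊗ b ⊗ c) = a b₋₁ c₋₂ ⊗ b₀ c₋₁ ⊗ c₀`; both sides will be `Ω` of an iterated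
    -- comultiplication of `r`.
    let Ω : (R ⊗[k] R) ⊗[k] R →ₗ[k] E ⊗[k] (E ⊗[k] E) :=
      LinearMap.mul' k _ ∘ₗ TensorProduct.map ((TensorProduct.assoc k E E E).toLinearMap ∘ₗ
        (TensorProduct.mk k (E ⊗[k] E) E).flip 1 ∘ₗ coactMap₂ Y iR iH) D₃
    have h1 : ∀ t : R ⊗[k] R, (Algebra.TensorProduct.assoc k k k E E E).toAlgHom
        (Algebra.TensorProduct.map Δ (AlgHom.id k E) (coactMap₂ Y iR iH t)) =
        Ω (LinearMap.rTensor R 𝓡.comul t) := by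
      intro t
      induction t with
      | zero => simp
      | add x y hx hy => simp only [map_add, hx, hy]
      | tmul a b =>
        rw [coactMap₂_tmul, map_mul, map_mul]
        change _ = (TensorProduct.assoc k E E E (coactMap₂ Y iR iH (𝓡.comul a) ⊗ₜ 1)) * D₃ b
        congr 1
        · simp [hE.comul_R]
          rfl
        · have h3 := hR.yd.coassoc b
          simp only [HopfOps.of] at h3
          have h4 : D₃ b = TensorProduct.map iH.toLinearMap (TensorProduct.map iH.toLinearMap iR)
            (LinearMap.lTensor H Y.coact (Y.coact b)) := by
            rw [← LinearMap.comp_apply (TensorProduct.map _ _), LinearMap.map_comp_lTensor]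
            rfl
          rw [h4, ← h3, coactMap, LinearMap.comp_apply]
          induction Y.coact b with
          | zero => simp
          | add x y hx hy => simp only [map_add, hx, hy]
          | tmul x y =>
            simp only [TensorProduct.map_tmul, AlgHom.toLinearMap_apply,
              Algebra.TensorProduct.map_tmul, hE.comul_H, comulH_apply, AlgHom.id_apply,
              LinearMap.rTensor_tmul]
            induction (Coalgebra.comul x : H ⊗[k] H) with
            | zero => simp
            | add x y hx hy => simp only [map_add, hx, hy, TensorProduct.add_tmul]
            | tmul x y => simp
    have h2 : ∀ t : R ⊗[k] R,
        (Algebra.TensorProduct.map (AlgHom.id k E) Δ (coactMap₂ Y iR iH t)) =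
        Ω ((TensorProduct.assoc k R R R).symm (LinearMap.lTensor R 𝓡.comul t)) := by
      intro t
      induction t with
      | zero => simp
      | add x y hx hy => simp only [map_add, hx, hy]
      | tmul a b =>
        have h5 : Algebra.TensorProduct.map (AlgHom.id k E) Δ (coactMap Y iR iH b) =
            TensorProduct.map iH.toLinearMap (coactMap₂ Y iR iH)
              (LinearMap.lTensor H 𝓡.comul (Y.coact b)) := by
          rw [coactMap, LinearMap.comp_apply]
          induction Y.coact b with
          | zero => simp
          | add x y hx hy => simp only [map_add, hx, hy]
          | tmul x y => simp [hE.comul_R]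
        rw [coactMap₂_tmul, map_mul, h5, comul_coact hR, LinearMap.lTensor_tmul]
        induction 𝓡.comul b with
        | zero => simp
        | add x y hx hy => simp only [map_add, hx, hy, mul_add, TensorProduct.tmul_add]
        | tmul c d =>
          have h6 : TensorProduct.map iH.toLinearMap (coactMap₂ Y iR iH)
              ((Y.tensor (HopfOps.of k H) Y).coact (c ⊗ₜ d)) =
              (TensorProduct.assoc k E E E (coactMap Y iR iH c ⊗ₜ 1)) * D₃ d := by
            simp only [YDOps.tensor, LinearMap.comp_apply, TensorProduct.map_tmul, D₃]
            rw [coactMap, LinearMap.comp_apply]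
            induction Y.coact c with
            | zero => simp
            | add x y hx hy => simp only [map_add, hx, hy, add_mul, TensorProduct.add_tmul]
            | tmul u v =>
              induction Y.coact d with
              | zero => simp
              | add x y hx hy => simp only [map_add, hx, hy, mul_add, TensorProduct.tmul_add]
              | tmul x y => simp [HopfOps.of, coactMap]
          rw [h6, ← mul_assoc]
          change _ = (TensorProduct.assoc k E E E (coactMap₂ Y iR iH (a ⊗ₜ c) ⊗ₜ 1)) * D₃ d
          congr 1
          rw [coactMap₂_tmul]
          induction coactMap Y iR iH c with
          | zero => simp
          | add x y hx hy => simp only [map_add, hx, hy, mul_add, TensorProduct.add_tmul]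
          | tmul x y => simp [Algebra.TensorProduct.one_def]
    have h7 := hR.coassoc r
    rw [← LinearEquiv.eq_symm_apply] at h7
    simp only [f, g, AlgHom.comp_apply, hE.comul_R]
    rw [h1, h2, h7]
  · simp only [f, g, AlgHom.comp_apply, hE.comul_H, comulH_apply]
    let Φ : H ⊗[k] (H ⊗[k] H) →ₗ[k] E ⊗[k] (E ⊗[k] E) :=
      TensorProduct.map iH.toLinearMap (TensorProduct.map iH.toLinearMap iH.toLinearMap)
    trans Φ (TensorProduct.assoc k H H H (LinearMap.rTensor H Coalgebra.comul (Coalgebra.comul h)))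
    · induction (Coalgebra.comul h : H ⊗[k] H) with
      | zero => simp
      | add x y hx hy => simp only [map_add, hx, hy]
      | tmul x y =>
        simp only [TensorProduct.map_tmul, AlgHom.toLinearMap_apply, Algebra.TensorProduct.map_tmul,
          hE.comul_H, comulH_apply, AlgHom.id_apply, LinearMap.rTensor_tmul]
        induction (Coalgebra.comul x : H ⊗[k] H) with
        | zero => simp
        | add x y hx hy => simp only [map_add, hx, hy, TensorProduct.add_tmul]
        | tmul x y => simp [Φ]
    · rw [Coalgebra.coassoc_apply]
      induction (Coalgebra.comul h : H ⊗[k] H) with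
      | zero => simp
      | add x y hx hy => simp only [map_add, hx, hy]
      | tmul x y => simp [Φ, hE.comul_H, comulH_apply]

/-- Again an identity of algebra maps. On `R` the counit law of the coaction removes the factor
`b₋₁`. -/
theorem SmashHopf.counit_left (hR : IsBraidedHopf (HopfOps.of k H) 𝓡 Y)
    (hE : SmashHopf 𝓡 Y iR iH Δ ε S) (x : E) :
    LinearMap.rTensor E ε.toLinearMap (Δ x) = 1 ⊗ₜ x := by
  suffices ((Algebra.TensorProduct.map ε (AlgHom.id k E)).comp Δ) =
      Algebra.TensorProduct.includeRight from DFunLike.congr_fun this x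
  refine hE.algHom_ext (fun r => ?_) (fun h => ?_)
  · rw [AlgHom.comp_apply, hE.comul_R]
    have h1 : ∀ t : R ⊗[k] R, Algebra.TensorProduct.map ε (AlgHom.id k E) (coactMap₂ Y iR iH t) =
        LinearMap.lTensor k iR (LinearMap.rTensor R 𝓡.counit t) := by
      intro t
      induction t with
      | zero => simp
      | add x y hx hy => simp only [map_add, hx, hy]
      | tmul a b =>
        have h2 : Algebra.TensorProduct.map ε (AlgHom.id k E) (coactMap Y iR iH b) =
            LinearMap.lTensor k iR (LinearMap.rTensor R Coalgebra.counit (Y.coact b)) := by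
          rw [coactMap, LinearMap.comp_apply]
          induction Y.coact b with
          | zero => simp
          | add x y hx hy => simp only [map_add, hx, hy]
          | tmul x y => simp [hE.counit_H]
        have h3 : LinearMap.rTensor R Coalgebra.counit (Y.coact b) = 1 ⊗ₜ b :=
          ((LinearEquiv.eq_symm_apply _).2 (hR.yd.counit_coact b)).trans
            (TensorProduct.lid_symm_apply _)
        rw [coactMap₂_tmul, map_mul, h2, h3]
        simp [hE.counit_R]
    have h4 : LinearMap.rTensor R 𝓡.counit (𝓡.comul r) = 1 ⊗ₜ r :=
      ((LinearEquiv.eq_symm_apply _).2 (hR.counit_left r)).trans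
        (TensorProduct.lid_symm_apply _)
    rw [h1, h4]; simp
  · rw [AlgHom.comp_apply, hE.comul_H, comulH_apply]
    trans LinearMap.lTensor k iH.toLinearMap (LinearMap.rTensor H Coalgebra.counit
      (Coalgebra.comul h))
    · induction (Coalgebra.comul h : H ⊗[k] H) with
      | zero => simp
      | add x y hx hy => simp only [map_add, hx, hy]
      | tmul x y => simp [hE.counit_H]
    · simp

/-- Here the counit of `R` meets `b₀`, and its colinearity replaces `b₋₁ ⊗ ε(b₀)` by `1 ⊗ ε(b)`. -/
theorem SmashHopf.counit_right (hR : IsBraidedHopf (HopfOps.of k H) 𝓡 Y)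
    (hE : SmashHopf 𝓡 Y iR iH Δ ε S) (x : E) :
    LinearMap.lTensor E ε.toLinearMap (Δ x) = x ⊗ₜ 1 := by
  suffices ((Algebra.TensorProduct.map (AlgHom.id k E) ε).comp Δ) =
      Algebra.TensorProduct.includeLeft from DFunLike.congr_fun this x
  refine hE.algHom_ext (fun r => ?_) (fun h => ?_)
  · rw [AlgHom.comp_apply, hE.comul_R]
    have h1 : ∀ t : R ⊗[k] R, Algebra.TensorProduct.map (AlgHom.id k E) ε (coactMap₂ Y iR iH t) =
        LinearMap.rTensor k iR (LinearMap.lTensor R 𝓡.counit t) := by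
      intro t
      induction t with
      | zero => simp
      | add x y hx hy => simp only [map_add, hx, hy]
      | tmul a b =>
        have h2 : Algebra.TensorProduct.map (AlgHom.id k E) ε (coactMap Y iR iH b) =
            LinearMap.rTensor k iH.toLinearMap (LinearMap.lTensor H 𝓡.counit (Y.coact b)) := by
          rw [coactMap, LinearMap.comp_apply]
          induction Y.coact b with
          | zero => simp
          | add x y hx hy => simp only [map_add, hx, hy]
          | tmul x y => simp [hE.counit_R]
        rw [coactMap₂_tmul, map_mul, h2, counit_coact' hR]
        simp
    have h4 : LinearMap.lTensor R 𝓡.counit (𝓡.comul r) = r ⊗ₜ 1 :=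
      ((LinearEquiv.eq_symm_apply _).2 (hR.counit_right r)).trans
        (TensorProduct.rid_symm_apply _)
    rw [h1, h4]; simp
  · rw [AlgHom.comp_apply, hE.comul_H, comulH_apply]
    trans LinearMap.rTensor k iH.toLinearMap (LinearMap.lTensor H Coalgebra.counit
      (Coalgebra.comul h))
    · induction (Coalgebra.comul h : H ⊗[k] H) with
      | zero => simp
      | add x y hx hy => simp only [map_add, hx, hy]
      | tmul x y => simp [hE.counit_H]
    · simp

end SmashPair

/-! ### The antipode and the universal property of the smash product -/

section SmashPair

variable {k : Type*} [Field k] {H : Type*} [Ring H] [HopfAlgebra k H]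
variable {R : Type*} [AddCommGroup R] [Module k R] {E : Type*} [Ring E] [Algebra k E]
variable {𝓡 : HopfOps k R} {Y : YDOps k H R} {iR : R →ₗ[k] E} {iH : H →ₐ[k] E}
variable {Δ : E →ₐ[k] E ⊗[k] E} {ε : E →ₐ[k] k} {S : E →ₗ[k] E}

/-- Antimultiplicativity with respect to right factors from `H` can be read off from the formula for
`S`. It is all that is needed, since `E` is spanned by the products `r h`. -/
theorem SmashHopf.antipode_mul_right (hE : SmashHopf 𝓡 Y iR iH Δ ε S) (x : E) (h : H) :
    S (x * iH h) = iH (HopfAlgebra.antipode k h) * S x := by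
  obtain ⟨t, rfl⟩ := hE.surj x
  induction t with
  | zero => simp
  | add x y hx hy => simp only [map_add, hx, hy, add_mul, mul_add]
  | tmul r g =>
    simp only [TensorProduct.map_tmul, LinearMap.mul'_apply, AlgHom.toLinearMap_apply, mul_assoc]
    rw [← map_mul, hE.antipode, hE.antipode]
    induction Y.coact r with
    | zero => simp
    | add x y hx hy => simp only [map_add, hx, hy, mul_add]
    | tmul a b => simp [HopfAlgebra.antipode_mul_antidistrib, ← mul_assoc]

theorem SmashHopf.antipode_R (hE : SmashHopf 𝓡 Y iR iH Δ ε S) (r : R) :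
    S (iR r) = LinearMap.mul' k E (TensorProduct.map
      (iH.toLinearMap ∘ₗ HopfAlgebra.antipode k) (iR ∘ₗ 𝓡.antipode) (Y.coact r)) := by
  have := hE.antipode r 1
  rwa [map_one, mul_one, LinearMap.mulRight_one, LinearMap.comp_id] at this

theorem SmashHopf.antipode_left (hR : IsBraidedHopf (HopfOps.of k H) 𝓡 Y)
    (hE : SmashHopf 𝓡 Y iR iH Δ ε S) (x : E) :
    LinearMap.mul' k E (LinearMap.rTensor E S (Δ x)) = ε x • 1 := by
  -- With `u = Δ(r)` and `t = Δ(h)` this reduces the antipode equation for `r h` to that for `r`: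
  -- the scalar coming from `u` is central, and `S(h₁) h₂` is left over.
  have hmul : ∀ (u : E ⊗[k] E) (t : H ⊗[k] H) (c : k),
      LinearMap.mul' k E (LinearMap.rTensor E S u) = c • 1 →
      LinearMap.mul' k E (LinearMap.rTensor E S
        (u * TensorProduct.map iH.toLinearMap iH.toLinearMap t)) =
      c • iH (LinearMap.mul' k H (LinearMap.rTensor H (HopfAlgebra.antipode k) t)) := by
    intro u t c hu
    induction t with
    | zero => simp
    | add x y hx hy => simp only [map_add, hx, hy, mul_add, smul_add]
    | tmul a b =>
      have : ∀ u : E ⊗[k] E, LinearMap.mul' k E (LinearMap.rTensor E S (u * (iH a ⊗ₜ iH b))) =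
          iH (HopfAlgebra.antipode k a) * LinearMap.mul' k E (LinearMap.rTensor E S u) * iH b := by
        intro u
        induction u with
        | zero => simp
        | add x y hx hy => simp only [map_add, hx, hy, mul_add, add_mul]
        | tmul x y => simp [hE.antipode_mul_right, mul_assoc]
      simp [this, hu]
  have hΥ : ∀ r, LinearMap.mul' k E (LinearMap.rTensor E S (Δ (iR r))) = ε (iR r) • 1 := by
    intro r
    -- `Υ (h ⊗ (a ⊗ b)) = S(h) S(a) b`. Colinearity of the comultiplication turns the coactions of
    -- `r⁽¹⁾` and `r⁽²⁾` into the one of `r`, after which the antipode equation of `R` applies.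
    let Υ : H ⊗[k] (R ⊗[k] R) →ₗ[k] E := LinearMap.mul' k E ∘ₗ
      TensorProduct.map (iH.toLinearMap ∘ₗ HopfAlgebra.antipode k)
        (iR ∘ₗ 𝓡.mul ∘ₗ LinearMap.rTensor R 𝓡.antipode)
    have h1 : ∀ t : R ⊗[k] R, LinearMap.mul' k E (LinearMap.rTensor E S (coactMap₂ Y iR iH t)) =
        Υ ((Y.tensor (HopfOps.of k H) Y).coact t) := by
      intro t
      induction t with
      | zero => simp
      | add x y hx hy => simp only [map_add, hx, hy]
      | tmul a b =>
        simp only [YDOps.tensor, LinearMap.comp_apply, TensorProduct.map_tmul, coactMap₂_tmul,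
          coactMap]
        induction Y.coact b with
        | zero => simp
        | add x y hx hy => simp only [map_add, hx, hy, mul_add, TensorProduct.tmul_add]
        | tmul c d =>
          simp only [TensorProduct.map_tmul, Algebra.TensorProduct.tmul_mul_tmul, one_mul,
            LinearMap.rTensor_tmul, LinearMap.mul'_apply, AlgHom.toLinearMap_apply]
          rw [hE.antipode]
          induction Y.coact a with
          | zero => simp
          | add x y hx hy => simp only [map_add, hx, hy, add_mul, TensorProduct.add_tmul]
          | tmul x y => simp [Υ, HopfOps.of, hE.map_mul, mul_assoc]
    rw [hE.comul_R, h1, ← comul_coact hR, hE.counit_R]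
    have h2 : ∀ t : H ⊗[k] R, Υ (LinearMap.lTensor H 𝓡.comul t) =
        LinearMap.mul' k E (TensorProduct.map (iH.toLinearMap ∘ₗ HopfAlgebra.antipode k)
          (Algebra.linearMap k E) (LinearMap.lTensor H 𝓡.counit t)) := by
      intro t
      induction t with
      | zero => simp
      | add x y hx hy => simp only [map_add, hx, hy]
      | tmul x y => simp [Υ, hR.antipode_left, hE.map_one, Algebra.algebraMap_eq_smul_one]
    rw [h2, counit_coact' hR]
    simp [Algebra.algebraMap_eq_smul_one]
  obtain ⟨t, rfl⟩ := hE.surj x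
  induction t with
  | zero => simp
  | add x y hx hy => simp only [map_add, hx, hy, add_smul]
  | tmul r h =>
    simp only [TensorProduct.map_tmul, LinearMap.mul'_apply, AlgHom.toLinearMap_apply, map_mul]
    rw [hE.comul_H, comulH_apply, hmul _ _ _ (hΥ r), hE.counit_H]
    simp [Algebra.algebraMap_eq_smul_one, smul_smul]

theorem SmashHopf.antipode_right (hR : IsBraidedHopf (HopfOps.of k H) 𝓡 Y)
    (hE : SmashHopf 𝓡 Y iR iH Δ ε S) (x : E) :
    LinearMap.mul' k E (LinearMap.lTensor E S (Δ x)) = ε x • 1 := by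
  have hmul : ∀ (u : E ⊗[k] E) (t : H ⊗[k] H),
      LinearMap.mul' k E (LinearMap.lTensor E S
        (u * TensorProduct.map iH.toLinearMap iH.toLinearMap t)) =
      LinearMap.mul' k E (TensorProduct.map (LinearMap.mulRight k
        (iH (LinearMap.mul' k H (LinearMap.lTensor H (HopfAlgebra.antipode k) t)))) S u) := by
    intro u t
    induction u with
    | zero => simp
    | add x y hx hy => simp only [map_add, hx, hy, add_mul]
    | tmul x y =>
      induction t with
      | zero => simp
      | add x y hx hy =>
        simp only [map_add, hx, hy, mul_add, TensorProduct.map_tmul, LinearMap.mulRight_apply,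
          LinearMap.mul'_apply, add_mul]
      | tmul a b => simp [hE.antipode_mul_right, mul_assoc]
  -- `b₋₁ S(b₀) = S_R(b)`, because `b₋₂ S(b₋₁)` collapses. The right antipode equation for `r` is
  -- then that of `R`.
  have hD : ∀ b, LinearMap.mul' k E (LinearMap.lTensor E S (coactMap Y iR iH b)) =
      iR (𝓡.antipode b) := by
    intro b
    let Ξ : (H ⊗[k] H) ⊗[k] R →ₗ[k] E := LinearMap.mul' k E ∘ₗ
      TensorProduct.map (iH.toLinearMap ∘ₗ LinearMap.mul' k H ∘ₗ
        LinearMap.lTensor H (HopfAlgebra.antipode k)) (iR ∘ₗ 𝓡.antipode)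
    have h1 : LinearMap.mul' k E (LinearMap.lTensor E S (coactMap Y iR iH b)) =
        Ξ ((TensorProduct.assoc k H H R).symm (LinearMap.lTensor H Y.coact (Y.coact b))) := by
      rw [coactMap, LinearMap.comp_apply]
      induction Y.coact b with
      | zero => simp
      | add x y hx hy => simp only [map_add, hx, hy]
      | tmul x y =>
        simp only [TensorProduct.map_tmul, LinearMap.lTensor_tmul, LinearMap.mul'_apply,
          hE.antipode_R, AlgHom.toLinearMap_apply]
        induction Y.coact y with
        | zero => simp
        | add x y hx hy => simp only [map_add, hx, hy, mul_add, TensorProduct.tmul_add]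
        | tmul c d => simp [Ξ, mul_assoc]
    have h2 : ∀ t : H ⊗[k] R, Ξ (LinearMap.rTensor R Coalgebra.comul t) =
        iR (𝓡.antipode (TensorProduct.lid k R (LinearMap.rTensor R Coalgebra.counit t))) := by
      intro t
      induction t with
      | zero => simp
      | add x y hx hy => simp only [map_add, hx, hy]
      | tmul x y => simp [Ξ, Algebra.algebraMap_eq_smul_one]
    have h3 := hR.yd.coassoc b
    rw [← LinearEquiv.eq_symm_apply] at h3
    rw [h1, ← h3]
    exact (h2 _).trans (by rw [show TensorProduct.lid k R (LinearMap.rTensor R Coalgebra.counit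
      (Y.coact b)) = b from hR.yd.counit_coact b])
  have hΥ : ∀ r, LinearMap.mul' k E (LinearMap.lTensor E S (Δ (iR r))) = ε (iR r) • 1 := by
    intro r
    have h1 : ∀ t : R ⊗[k] R, LinearMap.mul' k E (LinearMap.lTensor E S (coactMap₂ Y iR iH t)) =
        iR (𝓡.mul (LinearMap.lTensor R 𝓡.antipode t)) := by
      intro t
      induction t with
      | zero => simp
      | add x y hx hy => simp only [map_add, hx, hy]
      | tmul a b =>
        rw [LinearMap.lTensor_tmul, hE.map_mul, ← hD, coactMap₂_tmul]
        induction coactMap Y iR iH b with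
        | zero => simp
        | add x y hx hy => simp only [map_add, hx, hy, mul_add]
        | tmul x y => simp [mul_assoc]
    rw [hE.comul_R, h1, hR.antipode_right, map_smul, hE.map_one, hE.counit_R]
  obtain ⟨t, rfl⟩ := hE.surj x
  induction t with
  | zero => simp
  | add x y hx hy => simp only [map_add, hx, hy, add_smul]
  | tmul r h =>
    simp only [TensorProduct.map_tmul, LinearMap.mul'_apply, AlgHom.toLinearMap_apply, map_mul]
    rw [hE.comul_H, comulH_apply, hmul, hE.counit_H, HopfAlgebra.mul_antipode_lTensor_comul_apply,
      Algebra.algebraMap_eq_smul_one, map_smul, map_one]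
    have h2 : ∀ u : E ⊗[k] E, LinearMap.mul' k E (TensorProduct.map
        (LinearMap.mulRight k ((Coalgebra.counit (R := k) h) • (1 : E))) S u) =
        (Coalgebra.counit (R := k) h) • LinearMap.mul' k E (LinearMap.lTensor E S u) := by
      intro u
      induction u with
      | zero => simp
      | add x y hx hy => simp only [map_add, hx, hy, smul_add]
      | tmul x y => simp
    rw [h2, hΥ, smul_smul, mul_comm]

/-- The universal property of the smash product. -/
theorem SmashPair.map_mul_of {B : Type*} [Ring B] [Algebra k B] {fR : R →ₗ[k] B} {fH : H →ₐ[k] B}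
    (hE : SmashPair 𝓡 Y iR iH) (hB : SmashPair 𝓡 Y fR fH)
    (surj : ∀ x : E, ∃ t : R ⊗[k] H, LinearMap.mul' k E (TensorProduct.map iR iH.toLinearMap t) = x)
    {F : E →ₗ[k] B} (hF : ∀ r h, F (iR r * iH h) = fR r * fH h) (x y : E) :
    F (x * y) = F x * F y := by
  obtain ⟨s, rfl⟩ := surj x
  obtain ⟨t, rfl⟩ := surj y
  induction s with
  | zero => simp
  | add x y hx hy => simp only [map_add, hx, hy, add_mul]
  | tmul r h =>
    induction t with
    | zero => simp
    | add x y hx hy => simp only [map_add, hx, hy, mul_add]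
    | tmul s g =>
      simp only [TensorProduct.map_tmul, LinearMap.mul'_apply, AlgHom.toLinearMap_apply]
      rw [hF, hF, mul_assoc, ← mul_assoc (iH h), hE.exch, mul_assoc, ← mul_assoc (fH h), hB.exch]
      induction (Coalgebra.comul h : H ⊗[k] H) with
      | zero => simp
      | add x y hx hy => simp only [map_add, hx, hy, mul_add, add_mul]
      | tmul a b =>
        simp only [TensorProduct.map_tmul, LinearMap.mul'_apply, AlgHom.toLinearMap_apply,
          LinearMap.comp_apply]
        rw [mul_assoc, ← _root_.map_mul iH, ← mul_assoc (iR r), ← hE.map_mul, hF, hB.map_mul, _root_.map_mul fH]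
        simp only [mul_assoc]

theorem smashPair_comul (hR : IsBraidedHopf (HopfOps.of k H) 𝓡 Y) (hE : SmashPair 𝓡 Y iR iH) :
    SmashPair 𝓡 Y (coactMap₂ Y iR iH ∘ₗ 𝓡.comul) (comulH iH) where
  map_one := coactMap₂_comul_one hR hE
  map_mul := coactMap₂_comul_mul hR hE
  exch := comulH_mul_comul hR hE

theorem counit_act (hR : IsBraidedHopf (HopfOps.of k H) 𝓡 Y) (h : H) (r : R) :
    𝓡.counit (Y.act (h ⊗ₜ r)) = Coalgebra.counit (R := k) h * 𝓡.counit r := by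
  simpa [YDOps.trivial, HopfOps.of] using LinearMap.congr_fun hR.counit_hom.map_act (h ⊗ₜ r)

theorem smashPair_counit (hR : IsBraidedHopf (HopfOps.of k H) 𝓡 Y) :
    SmashPair 𝓡 Y 𝓡.counit (Bialgebra.counitAlgHom k H) where
  map_one := hR.counit_one
  map_mul := hR.counit_mul
  exch h r := by
    have : ∀ t : H ⊗[k] H, LinearMap.mul' k k (TensorProduct.map (𝓡.counit ∘ₗ Y.actL.flip r)
        (Bialgebra.counitAlgHom k H).toLinearMap t) = Coalgebra.counit (R := k)
          (TensorProduct.lid k H (LinearMap.rTensor H Coalgebra.counit t)) * 𝓡.counit r := by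
      intro t
      induction t with
      | zero => simp
      | add x y hx hy => simp only [map_add, hx, hy, add_mul]
      | tmul x y => simp [counit_act hR]; ring
    rw [this]; simp

end SmashPair

/-! ### The Radford biproduct is a Hopf algebra -/

section Radford

variable {k : Type*} [Field k] {H : Type*} [Ring H] [HopfAlgebra k H]
variable {R : Type*} [AddCommGroup R] [Module k R]
variable {𝓡 : HopfOps k R} {Y : YDOps k H R}

/-- The inclusion `R → R # H`, `r ↦ r # 1`. -/
def radfordInclR (H : Type*) [Ring H] [HopfAlgebra k H] (R : Type*) [AddCommGroup R] [Module k R] :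
    R →ₗ[k] R ⊗[k] H := (TensorProduct.mk k R H).flip 1

theorem radford_mul_incl (hR : IsBraidedHopf (HopfOps.of k H) 𝓡 Y) (r : R) (h : H) :
    (radford (HopfOps.of k H) 𝓡 Y).mul (radfordInclR H R r ⊗ₜ radfordIncl 𝓡 h) = r ⊗ₜ h := by
  simp [radfordInclR, radfordIncl, radford_mul_tmul, smashAct_one hR.yd, hR.mul_one]

theorem radford_mul_incl' (hR : IsBraidedHopf (HopfOps.of k H) 𝓡 Y) (g h : H) :
    (radford (HopfOps.of k H) 𝓡 Y).mul (radfordIncl 𝓡 g ⊗ₜ radfordIncl 𝓡 h) =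
      radfordIncl 𝓡 (g * h) := by
  have h1 : 𝓡.mulL 𝓡.one = LinearMap.id := LinearMap.ext hR.one_mul
  have h2 : ∀ t : H ⊗[k] H, TensorProduct.map₂ Y.actL (LinearMap.mul k H) t (𝓡.one ⊗ₜ h) =
      𝓡.one ⊗ₜ (TensorProduct.lid k H (LinearMap.rTensor H Coalgebra.counit t) * h) := by
    intro t
    induction t with
    | zero => simp
    | add x y hx hy => simp only [map_add, LinearMap.add_apply, hx, hy, TensorProduct.tmul_add, add_mul]
    | tmul x y => simp [act_one hR, TensorProduct.smul_tmul']
  simp [radfordIncl, radford_mul_tmul, h1, smashAct, h2]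

/-- Comultiplication and counit of `R # H` are the linear maps belonging to the smash pairs
`smashPair_comul` and `smashPair_counit`, so they are multiplicative by `SmashPair.map_mul_of`. The
other axioms are those of `SmashHopf`. -/
theorem isHopf_radford (hR : IsBraidedHopf (HopfOps.of k H) 𝓡 Y) :
    IsHopf (radford (HopfOps.of k H) 𝓡 Y) := by
  let hA := isAlg_radford hR
  let := hA.ring
  let := hA.algebra
  have hmul : ∀ x y : R ⊗[k] H, x * y = (radford (HopfOps.of k H) 𝓡 Y).mul (x ⊗ₜ y) :=
    fun _ _ => rfl
  let iR : R →ₗ[k] R ⊗[k] H := radfordInclR H R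
  let iH : H →ₐ[k] R ⊗[k] H := AlgHom.ofLinearMap (radfordIncl 𝓡) rfl
    (fun g h => (radford_mul_incl' hR g h).symm)
  have hRH : ∀ r h, iR r * iH h = r ⊗ₜ h := radford_mul_incl hR
  have hp : SmashPair 𝓡 Y iR iH :=
    { map_one := rfl
      map_mul := fun r s => by
        change _ = (radford (HopfOps.of k H) 𝓡 Y).mul ((r ⊗ₜ 1) ⊗ₜ (s ⊗ₜ 1))
        rw [radford_mul_tmul, smashAct_one hR.yd]
        simp [iR, radfordInclR]
      exch := fun h r => by
        have h1 : 𝓡.mulL 𝓡.one = LinearMap.id := LinearMap.ext hR.one_mul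
        change (radford (HopfOps.of k H) 𝓡 Y).mul ((𝓡.one ⊗ₜ h) ⊗ₜ (r ⊗ₜ 1)) = _
        rw [radford_mul_tmul, h1, LinearMap.rTensor_id, LinearMap.id_apply, smashAct,
          LinearMap.comp_apply]
        induction (Coalgebra.comul h : H ⊗[k] H) with
        | zero => simp
        | add x y hx hy => simp only [map_add, LinearMap.add_apply, hx, hy]
        | tmul a b => simp [hRH] }
  have surj : ∀ x : R ⊗[k] H, ∃ t : R ⊗[k] H,
      LinearMap.mul' k (R ⊗[k] H) (TensorProduct.map iR iH.toLinearMap t) = x := fun x => ⟨x, by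
    induction x with
    | zero => simp
    | add x y hx hy => simp only [map_add, hx, hy]
    | tmul a b => simp [hRH]⟩
  have hΔ : ∀ r h, (radford (HopfOps.of k H) 𝓡 Y).comul (iR r * iH h) =
      coactMap₂ Y iR iH (𝓡.comul r) * comulH iH h := by
    intro r h
    rw [hRH, comulH_apply]
    simp only [radford, LinearMap.comp_apply, TensorProduct.map_tmul, HopfOps.of]
    induction 𝓡.comul r with
    | zero => simp
    | add x y hx hy => simp only [map_add, hx, hy, TensorProduct.add_tmul, add_mul]
    | tmul a b =>
      induction (Coalgebra.comul h : H ⊗[k] H) with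
      | zero => simp
      | add x y hx hy => simp only [map_add, hx, hy, TensorProduct.tmul_add, mul_add]
      | tmul c d =>
        rw [middle_tmul]
        refine (congrArg _ (crossCoact_tmul Y b c)).trans ?_
        rw [coactMap₂_tmul, coactMap, LinearMap.comp_apply]
        induction Y.coact b with
        | zero => simp
        | add x y hx hy => simp only [map_add, hx, hy, mul_add, add_mul]
        | tmul x y =>
          have : a ⊗ₜ[k] (x * c) = a ⊗ₜ[k] x * iH c := by rw [← hRH, map_mul, ← mul_assoc, hRH]
          simp [hRH, this]
  have hε : ∀ r h, (radford (HopfOps.of k H) 𝓡 Y).counit (iR r * iH h) =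
      𝓡.counit r * Bialgebra.counitAlgHom k H h := by
    intro r h
    rw [hRH]
    simp [radford, HopfOps.of]
  have hΔmul := hp.map_mul_of (smashPair_comul hR hp) surj hΔ
  have hεmul := hp.map_mul_of (smashPair_counit hR) surj hε
  have hΔone : (radford (HopfOps.of k H) 𝓡 Y).comul 1 = 1 := by
    have := hΔ 𝓡.one 1
    rwa [hp.map_one, map_one, map_one, mul_one, mul_one, coactMap₂_comul_one hR hp] at this
  have hεone : (radford (HopfOps.of k H) 𝓡 Y).counit 1 = 1 := by
    have := hε 𝓡.one 1
    rwa [hp.map_one, map_one, map_one, mul_one, mul_one, hR.counit_one] at this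
  have hE : SmashHopf 𝓡 Y iR iH
      (AlgHom.ofLinearMap (radford (HopfOps.of k H) 𝓡 Y).comul hΔone hΔmul)
      (AlgHom.ofLinearMap (radford (HopfOps.of k H) 𝓡 Y).counit hεone hεmul)
      (radford (HopfOps.of k H) 𝓡 Y).antipode :=
    { hp with
      surj := surj
      comul_R := fun r => by simpa using hΔ r 1
      comul_H := fun h => by simpa [hp.map_one, hR.comul_one, coactMap_one hR hp,
        ← Algebra.TensorProduct.one_def] using hΔ 𝓡.one h
      counit_R := fun r => by simpa using hε r 1
      counit_H := fun h => by simpa [hp.map_one, hR.counit_one] using hε 𝓡.one h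
      antipode := fun r h => by
        rw [hRH]
        simp only [radford, LinearMap.comp_apply, crossCoact_tmul]
        induction Y.coact r with
        | zero => simp
        | add x y hx hy => simp only [map_add, hx, hy]
        | tmul a b =>
          simp only [LinearMap.rTensor_tmul, TensorProduct.map_tmul, LinearMap.mul'_apply,
            LinearMap.comp_apply, AlgHom.toLinearMap_apply]
          rw [hp.exch]
          refine (crossAct_tmul Y _ _).trans ?_
          simp only [HopfOps.of]
          induction (Coalgebra.comul (HopfAlgebra.antipode k
            (LinearMap.mulRight k h a)) : H ⊗[k] H) with
          | zero => simp
          | add x y hx hy => simp only [map_add, hx, hy]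
          | tmul x y => simp [hRH] }
  have hΔ' : (AlgHom.ofLinearMap (radford (HopfOps.of k H) 𝓡 Y).comul hΔone hΔmul).toLinearMap =
    (radford (HopfOps.of k H) 𝓡 Y).comul := rfl
  have hε' : (AlgHom.ofLinearMap (radford (HopfOps.of k H) 𝓡 Y).counit hεone hεmul).toLinearMap =
    (radford (HopfOps.of k H) 𝓡 Y).counit := rfl
  have c1 := hE.coassoc hR
  have c2 := hE.counit_left hR
  have c3 := hE.counit_right hR
  have c4 := hE.antipode_left hR
  have c5 := hE.antipode_right hR
  simp only [hΔ', hε', AlgHom.ofLinearMap_apply] at c1 c2 c3 c4 c5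
  rw [hA.mul'_eq] at c4 c5
  refine ⟨hA, ?_, ?_, ?_, ?_, ?_, ?_, ?_, ?_, ?_⟩
  · exact c1
  · exact c2
  · exact c3
  · exact hεone
  · exact hεmul
  · exact hΔone
  · exact hΔmul
  · exact c4
  · exact c5

end Radford

/-! ## Coinvariants of a Hopf algebra projection -/

/-! ### Convolution products under algebra and coalgebra maps -/

section ConvComp

variable {k : Type*} [Field k] {C C' : Type*} [AddCommGroup C] [Module k C] [Coalgebra k C]
  [AddCommGroup C'] [Module k C'] [Coalgebra k C']
variable {B B' : Type*} [Ring B] [Algebra k B] [Ring B'] [Algebra k B']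

theorem conv_apply (f g : C →ₗ[k] B) (c : C) : (toConv f * toConv g) c =
    LinearMap.mul' k B (TensorProduct.map f g (Coalgebra.comul c)) := rfl

theorem algHom_comp_conv (φ : B →ₐ[k] B') (f g : WithConv (C →ₗ[k] B)) :
    toConv (φ.toLinearMap ∘ₗ (f * g).ofConv) =
      toConv (φ.toLinearMap ∘ₗ f.ofConv) * toConv (φ.toLinearMap ∘ₗ g.ofConv) :=
  congrArg toConv (LinearMap.algHom_comp_convMul_distrib φ f g)

theorem conv_comp_coalg (f g : WithConv (C →ₗ[k] B)) (c : C' →ₗ[k] C)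
    (hc : ∀ x, Coalgebra.comul (R := k) (c x) = TensorProduct.map c c (Coalgebra.comul x)) :
    toConv ((f * g).ofConv ∘ₗ c) = toConv (f.ofConv ∘ₗ c) * toConv (g.ofConv ∘ₗ c) := by
  ext x
  change LinearMap.mul' k B (TensorProduct.map f.ofConv g.ofConv (Coalgebra.comul (c x))) =
    LinearMap.mul' k B (TensorProduct.map _ _ (Coalgebra.comul x))
  rw [hc, TensorProduct.map_comp]
  rfl

theorem conv_one_comp_coalg (c : C' →ₗ[k] C)
    (hc : ∀ x, Coalgebra.counit (R := k) (c x) = Coalgebra.counit (R := k) x) :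
    toConv ((1 : WithConv (C →ₗ[k] B)).ofConv ∘ₗ c) = 1 := by
  ext x
  change algebraMap k B (Coalgebra.counit (c x)) = algebraMap k B (Coalgebra.counit x)
  rw [hc]

/-- An algebra map on `A ⊗ B` applied to `Δ` is a convolution product. -/
theorem map_comul_eq_conv (f : C →ₗ[k] B) (g : C →ₗ[k] B') :
    toConv (TensorProduct.map f g ∘ₗ Coalgebra.comul) =
      toConv ((Algebra.TensorProduct.includeLeft : B →ₐ[k] B ⊗[k] B').toLinearMap ∘ₗ f) *
      toConv ((Algebra.TensorProduct.includeRight : B' →ₐ[k] B ⊗[k] B').toLinearMap ∘ₗ g) := by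
  ext x
  rw [conv_apply]
  change TensorProduct.map f g (Coalgebra.comul x) = _
  induction (Coalgebra.comul x : C ⊗[k] C) with
  | zero => simp
  | add x y hx hy => simp only [map_add, hx, hy]
  | tmul x y => simp

end ConvComp

/-! ### The projection `θ` onto the coinvariants -/

section Coinv

variable {k : Type*} [Field k] {H : Type*} [Ring H] [HopfAlgebra k H]
variable {E : Type*} [Ring E] [HopfAlgebra k E]
variable {X : Type*} [AddCommGroup X] [Module k X]

/-- Hopf algebra maps `ι : H → E` and `π : E → H` with `π ι = id`, and an identification
`i : X → E` of `X` with the coinvariants of `π`, inverse to `p : E → X`. -/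
structure CoinvModel (ι : H →ₐ[k] E) (π : E →ₐ[k] H) (i : X →ₗ[k] E) (p : E →ₗ[k] X) : Prop where
  comul_ι : ∀ h, Coalgebra.comul (R := k) (ι h) =
    TensorProduct.map ι.toLinearMap ι.toLinearMap (Coalgebra.comul h)
  counit_ι : ∀ h, Coalgebra.counit (R := k) (ι h) = Coalgebra.counit (R := k) h
  comul_π : ∀ x, Coalgebra.comul (R := k) (π x) =
    TensorProduct.map π.toLinearMap π.toLinearMap (Coalgebra.comul x)
  counit_π : ∀ x, Coalgebra.counit (R := k) (π x) = Coalgebra.counit (R := k) x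
  π_ι : ∀ h, π (ι h) = h
  p_i : ∀ x, p (i x) = x
  i_p : ∀ a, i (p a) = theta (HopfOps.of k H) (HopfOps.of k E) ι.toLinearMap π.toLinearMap a

variable {ι : H →ₐ[k] E} {π : E →ₐ[k] H} {i : X →ₗ[k] E} {p : E →ₗ[k] X}

/-- The projection `a ↦ a₍₁₎ ι S π(a₍₂₎)` to the coinvariants. -/
def thetaMap (ι : H →ₐ[k] E) (π : E →ₐ[k] H) : E →ₗ[k] E :=
  LinearMap.mul' k E ∘ₗ LinearMap.lTensor E
    (ι.toLinearMap ∘ₗ HopfAlgebra.antipode k ∘ₗ π.toLinearMap) ∘ₗ Coalgebra.comul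

/-- `a ↦ ι π(a₍₁₎) S(a₍₂₎)`. -/
def coinvAntipode (ι : H →ₐ[k] E) (π : E →ₐ[k] H) : E →ₗ[k] E :=
  LinearMap.mul' k E ∘ₗ TensorProduct.map (ι.toLinearMap ∘ₗ π.toLinearMap)
    (HopfAlgebra.antipode k) ∘ₗ Coalgebra.comul

theorem toConv_thetaMap (ι : H →ₐ[k] E) (π : E →ₐ[k] H) : toConv (thetaMap ι π) =
    toConv LinearMap.id *
      toConv (ι.toLinearMap ∘ₗ HopfAlgebra.antipode k ∘ₗ π.toLinearMap) := rfl

theorem toConv_coinvAntipode (ι : H →ₐ[k] E) (π : E →ₐ[k] H) : toConv (coinvAntipode ι π) =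
    toConv (ι.comp π).toLinearMap * toConv (HopfAlgebra.antipode k) := rfl

theorem CoinvModel.conv_mul_antipode_comp (hE : CoinvModel ι π i p) {B : Type*} [Ring B]
    [Algebra k B] (φ : H →ₐ[k] B) :
    toConv (φ.toLinearMap ∘ₗ π.toLinearMap) *
      toConv (φ.toLinearMap ∘ₗ HopfAlgebra.antipode k ∘ₗ π.toLinearMap) = 1 := by
  have := conv_comp_coalg (toConv φ.toLinearMap)
    (toConv (φ.toLinearMap ∘ₗ HopfAlgebra.antipode k)) π.toLinearMap hE.comul_π
  rw [conv_algHom_mul_antipode, conv_one_comp_coalg _ hE.counit_π] at this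
  exact this.symm

theorem CoinvModel.conv_antipode_mul_comp (hE : CoinvModel ι π i p) {B : Type*} [Ring B]
    [Algebra k B] (φ : H →ₐ[k] B) :
    toConv (φ.toLinearMap ∘ₗ HopfAlgebra.antipode k ∘ₗ π.toLinearMap) *
      toConv (φ.toLinearMap ∘ₗ π.toLinearMap) = 1 := by
  have := conv_comp_coalg (toConv (φ.toLinearMap ∘ₗ HopfAlgebra.antipode k))
    (toConv φ.toLinearMap) π.toLinearMap hE.comul_π
  rw [conv_antipode_mul_algHom, conv_one_comp_coalg _ hE.counit_π] at this
  exact this.symm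

theorem CoinvModel.thetaMap_i (hE : CoinvModel ι π i p) (x : X) : thetaMap ι π (i x) = i x :=
  (hE.i_p (i x)).symm.trans (congrArg i (hE.p_i x))

theorem CoinvModel.i_p' (hE : CoinvModel ι π i p) (a : E) : i (p a) = thetaMap ι π a :=
  hE.i_p a

theorem CoinvModel.p_theta (hE : CoinvModel ι π i p) (a : E) : p (thetaMap ι π a) = p a := by
  rw [← hE.i_p', hE.p_i]

theorem CoinvModel.i_injective (hE : CoinvModel ι π i p) : Function.Injective i :=
  Function.LeftInverse.injective hE.p_i

theorem CoinvModel.map_i_injective (hE : CoinvModel ι π i p) {W W' : Type*} [AddCommGroup W]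
    [Module k W] [AddCommGroup W'] [Module k W'] {f : W →ₗ[k] W'} (hf : Function.Injective f) :
    Function.Injective (TensorProduct.map f i) :=
  TensorProduct.map_injective_of_flat_flat _ _ hf hE.i_injective

/-- Because `π ι = id`, the element `h` contributes `ι (h₁ S(h₂))`, standing between `x₁` and `ι S
π(x₂)`. -/
theorem CoinvModel.theta_mul_ι (hE : CoinvModel ι π i p) (x : E) (h : H) :
    thetaMap ι π (x * ι h) = Coalgebra.counit (R := k) h • thetaMap ι π x := by
  have hu : ∀ (u : E ⊗[k] E) (t : H ⊗[k] H), LinearMap.mul' k E (LinearMap.lTensor E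
      (ι.toLinearMap ∘ₗ HopfAlgebra.antipode k ∘ₗ π.toLinearMap)
        (u * TensorProduct.map ι.toLinearMap ι.toLinearMap t)) =
      LinearMap.mul' k E (TensorProduct.map (LinearMap.mulRight k (ι (LinearMap.mul' k H
        (LinearMap.lTensor H (HopfAlgebra.antipode k) t))))
          (ι.toLinearMap ∘ₗ HopfAlgebra.antipode k ∘ₗ π.toLinearMap) u) := by
    intro u t
    induction u with
    | zero => simp
    | add x y hx hy => simp only [map_add, hx, hy, add_mul]
    | tmul x y =>
      induction t with
      | zero => simp
      | add x y hx hy =>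
        simp only [map_add, hx, hy, mul_add, TensorProduct.map_tmul, LinearMap.mulRight_apply,
          LinearMap.mul'_apply, add_mul]
      | tmul a b => simp [HopfAlgebra.antipode_mul_antidistrib, mul_assoc, hE.π_ι]
  simp only [thetaMap, LinearMap.comp_apply, Bialgebra.comul_mul, hE.comul_ι]
  refine (hu _ _).trans ?_
  rw [HopfAlgebra.mul_antipode_lTensor_comul_apply]
  induction (Coalgebra.comul x : E ⊗[k] E) with
  | zero => simp
  | add x y hx hy => simp only [map_add, hx, hy, smul_add]
  | tmul x y => simp [Algebra.algebraMap_eq_smul_one]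

theorem CoinvModel.p_mul_ι (hE : CoinvModel ι π i p) (x : E) (h : H) :
    p (x * ι h) = Coalgebra.counit (R := k) h • p x := by
  rw [← hE.p_theta, hE.theta_mul_ι, map_smul, hE.p_theta]

/-- A map that is trivial for right multiplication by `H` factors over `θ`. -/
theorem CoinvModel.comp_theta (hE : CoinvModel ι π i p) {Z : Type*} [AddCommGroup Z] [Module k Z]
    (N : E →ₗ[k] Z) (hN : ∀ x h, N (x * ι h) = Coalgebra.counit (R := k) h • N x) (a : E) :
    N (thetaMap ι π a) = N a := by
  have : ∀ t : E ⊗[k] E, N (LinearMap.mul' k E (LinearMap.lTensor E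
      (ι.toLinearMap ∘ₗ HopfAlgebra.antipode k ∘ₗ π.toLinearMap) t)) =
      N (TensorProduct.rid k E (LinearMap.lTensor E Coalgebra.counit t)) := by
    intro t
    induction t with
    | zero => simp
    | add x y hx hy => simp only [map_add, hx, hy]
    | tmul x y => simp [hN, hE.counit_π]
  exact (this _).trans (by simp)

theorem CoinvModel.map_comul_mul_ι (hE : CoinvModel ι π i p) {Z Z' : Type*} [AddCommGroup Z]
    [Module k Z] [AddCommGroup Z'] [Module k Z'] (N : E →ₗ[k] Z) (N' : E →ₗ[k] Z')
    (hN : ∀ x h, N (x * ι h) = Coalgebra.counit (R := k) h • N x)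
    (hN' : ∀ x h, N' (x * ι h) = Coalgebra.counit (R := k) h • N' x) (x : E) (h : H) :
    TensorProduct.map N N' (Coalgebra.comul (x * ι h)) =
      Coalgebra.counit (R := k) h • TensorProduct.map N N' (Coalgebra.comul x) := by
  have : ∀ t : H ⊗[k] H, TensorProduct.map N N' (Coalgebra.comul x *
      TensorProduct.map ι.toLinearMap ι.toLinearMap t) = Coalgebra.counit (R := k)
        (TensorProduct.lid k H (LinearMap.rTensor H Coalgebra.counit t)) •
          TensorProduct.map N N' (Coalgebra.comul x) := by
    intro t
    induction t with
    | zero => simp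
    | add x y hx hy => simp only [map_add, hx, hy, mul_add, add_smul]
    | tmul a b =>
      induction (Coalgebra.comul x : E ⊗[k] E) with
      | zero => simp
      | add x y hx hy => simp only [map_add, hx, hy, add_mul, smul_add]
      | tmul x y => simp [hN, hN', TensorProduct.smul_tmul', smul_smul, mul_comm]
  rw [Bialgebra.comul_mul, hE.comul_ι, this]
  simp

/-- So `p` is a surjective coalgebra map, while `i` is an injective algebra map. Coalgebra laws for
`X` are pushed forward along `p` and algebra laws are pulled back along `i`. -/
theorem CoinvModel.comul_p (hE : CoinvModel ι π i p) (a : E) :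
    (coinvOps (HopfOps.of k H) (HopfOps.of k E) ι.toLinearMap π.toLinearMap i p).comul (p a) =
      TensorProduct.map p p (Coalgebra.comul a) := by
  have h1 : p ∘ₗ theta (HopfOps.of k H) (HopfOps.of k E) ι.toLinearMap π.toLinearMap = p :=
    LinearMap.ext hE.p_theta
  simp only [coinvOps, LinearMap.comp_apply, h1, hE.i_p']
  exact hE.comp_theta (TensorProduct.map p p ∘ₗ Coalgebra.comul)
    (hE.map_comul_mul_ι p p hE.p_mul_ι hE.p_mul_ι) a

theorem CoinvModel.counit_p (hE : CoinvModel ι π i p) (a : E) :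
    (coinvOps (HopfOps.of k H) (HopfOps.of k E) ι.toLinearMap π.toLinearMap i p).counit (p a) =
      Coalgebra.counit a := by
  simp only [coinvOps, LinearMap.comp_apply, hE.i_p']
  exact hE.comp_theta (Coalgebra.counit (R := k) (A := E))
    (fun x h => by rw [Bialgebra.counit_mul, hE.counit_ι, mul_comm, smul_eq_mul]) a

theorem CoinvModel.surj (hE : CoinvModel ι π i p) (x : X) : ∃ a, p a = x := ⟨i x, hE.p_i x⟩

/-- The antipode reverses products, so `h` ends up on both outer sides: `θ` turns left
multiplication by `ι h` into the adjoint action of `h`. -/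
theorem CoinvModel.theta_ι_mul (hE : CoinvModel ι π i p) (h : H) (x : E) :
    thetaMap ι π (ι h * x) =
      (toConv ι.toLinearMap * cst k H (thetaMap ι π x) *
        toConv (ι.toLinearMap ∘ₗ HopfAlgebra.antipode k)) h := by
  rw [LinearMap.convMul_apply]
  simp only [thetaMap, LinearMap.comp_apply, Bialgebra.comul_mul, hE.comul_ι]
  induction (Coalgebra.comul h : H ⊗[k] H) with
  | zero => simp
  | add x y hx hy => simp only [map_add, hx, hy, add_mul]
  | tmul a b =>
    have e1 : ∀ y : E, (toConv ι.toLinearMap * cst k H y).ofConv a = ι a * y :=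
      fun y => conv_mul_cst_apply _ _ _
    simp only [TensorProduct.map_tmul, LinearMap.mul'_apply, e1]
    induction (Coalgebra.comul x : E ⊗[k] E) with
    | zero => simp
    | add x y hx hy => simp only [map_add, hx, hy, mul_add, add_mul]
    | tmul x y => simp [hE.π_ι, HopfAlgebra.antipode_mul_antidistrib, mul_assoc]

theorem theta_mulRight (ι : H →ₐ[k] E) (π : E →ₐ[k] H) (b : E) :
    toConv (thetaMap ι π ∘ₗ LinearMap.mulRight k b) =
      toConv LinearMap.id * cst k E (thetaMap ι π b) *
        toConv (ι.toLinearMap ∘ₗ HopfAlgebra.antipode k ∘ₗ π.toLinearMap) := by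
  ext a
  rw [LinearMap.convMul_apply]
  change thetaMap ι π (a * b) = _
  simp only [thetaMap, LinearMap.comp_apply, Bialgebra.comul_mul]
  induction (Coalgebra.comul a : E ⊗[k] E) with
  | zero => simp
  | add x y hx hy => simp only [map_add, hx, hy, add_mul]
  | tmul a a' =>
    have e1 : ∀ y : E, (toConv LinearMap.id * cst k E y).ofConv a = a * y :=
      fun y => conv_mul_cst_apply _ _ _
    simp only [TensorProduct.map_tmul, LinearMap.mul'_apply, e1]
    induction (Coalgebra.comul b : E ⊗[k] E) with
    | zero => simp
    | add x y hx hy => simp only [map_add, hx, hy, mul_add, add_mul]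
    | tmul x y => simp [HopfAlgebra.antipode_mul_antidistrib, mul_assoc]

/-- `x ↦ x₍₁₎ ⊗ π(x₍₂₎)`. -/
def rightCoact (π : E →ₐ[k] H) : E →ₐ[k] E ⊗[k] H :=
  (Algebra.TensorProduct.map (AlgHom.id k E) π).comp (Bialgebra.comulAlgHom k E)

/-- `x ↦ π(x₍₁₎) ⊗ x₍₂₎`. -/
def leftCoact (π : E →ₐ[k] H) : E →ₐ[k] H ⊗[k] E :=
  (Algebra.TensorProduct.map π (AlgHom.id k E)).comp (Bialgebra.comulAlgHom k E)

theorem toConv_rightCoact (π : E →ₐ[k] H) : toConv (rightCoact π).toLinearMap =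
    toConv (Algebra.TensorProduct.includeLeft : E →ₐ[k] E ⊗[k] H).toLinearMap *
    toConv ((Algebra.TensorProduct.includeRight : H →ₐ[k] E ⊗[k] H).comp π).toLinearMap := by
  have h := map_comul_eq_conv (LinearMap.id (R := k) (M := E)) π.toLinearMap
  rw [LinearMap.comp_id] at h
  exact h

theorem toConv_leftCoact (π : E →ₐ[k] H) : toConv (leftCoact π).toLinearMap =
    toConv ((Algebra.TensorProduct.includeLeft : H →ₐ[k] H ⊗[k] E).comp π).toLinearMap *
    toConv (Algebra.TensorProduct.includeRight : E →ₐ[k] H ⊗[k] E).toLinearMap := by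
  have h := map_comul_eq_conv π.toLinearMap (LinearMap.id (R := k) (M := E))
  rw [LinearMap.comp_id] at h
  exact h

/-- The right coaction of `a₁ ι S π(a₂)` is `a₁ ι S π(a₄) ⊗ π(a₂) S π(a₃)`, and the second leg
collapses. -/
theorem CoinvModel.rightCoact_theta (hE : CoinvModel ι π i p) (a : E) :
    rightCoact π (thetaMap ι π a) = thetaMap ι π a ⊗ₜ 1 := by
  let i₁ : E →ₐ[k] E ⊗[k] H := Algebra.TensorProduct.includeLeft
  let i₂ : H →ₐ[k] E ⊗[k] H := Algebra.TensorProduct.includeRight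
  have h1 : toConv ((rightCoact π).comp ι).toLinearMap =
      toConv (i₁.comp ι).toLinearMap * toConv i₂.toLinearMap := by
    have h := conv_comp_coalg (toConv i₁.toLinearMap) (toConv (i₂.comp π).toLinearMap)
      ι.toLinearMap hE.comul_ι
    rw [← toConv_rightCoact] at h
    refine h.trans ?_
    congr 1
    ext x
    simp [hE.π_ι]
  -- That the antipode reverses the comultiplication is obtained from uniqueness of convolution
  -- inverses.
  have h2 : toConv (((rightCoact π).comp ι).toLinearMap ∘ₗ HopfAlgebra.antipode k) =
      toConv (i₂.toLinearMap ∘ₗ HopfAlgebra.antipode k) *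
        toConv ((i₁.comp ι).toLinearMap ∘ₗ HopfAlgebra.antipode k) := by
    refine left_inv_eq_right_inv (conv_antipode_mul_algHom _) ?_
    rw [h1, mul_assoc, ← mul_assoc (toConv i₂.toLinearMap), conv_algHom_mul_antipode, one_mul,
      conv_algHom_mul_antipode]
  have h3 := conv_comp_coalg (toConv (i₂.toLinearMap ∘ₗ HopfAlgebra.antipode k))
    (toConv ((i₁.comp ι).toLinearMap ∘ₗ HopfAlgebra.antipode k)) π.toLinearMap hE.comul_π
  rw [← h2] at h3
  have h4 : toConv ((rightCoact π).toLinearMap ∘ₗ thetaMap ι π) =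
      toConv (i₁.toLinearMap ∘ₗ thetaMap ι π) := by
    have e1 := algHom_comp_conv (rightCoact π) (toConv LinearMap.id)
      (toConv (ι.toLinearMap ∘ₗ HopfAlgebra.antipode k ∘ₗ π.toLinearMap))
    have e2 := algHom_comp_conv i₁ (toConv LinearMap.id)
      (toConv (ι.toLinearMap ∘ₗ HopfAlgebra.antipode k ∘ₗ π.toLinearMap))
    rw [← toConv_thetaMap] at e1 e2
    refine e1.trans (Eq.trans ?_ e2.symm)
    refine (congrArg₂ (· * ·) (toConv_rightCoact π) h3).trans ?_
    change toConv i₁.toLinearMap * toConv (i₂.toLinearMap ∘ₗ π.toLinearMap) *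
      (toConv (i₂.toLinearMap ∘ₗ HopfAlgebra.antipode k ∘ₗ π.toLinearMap) * _) = _
    rw [mul_assoc, ← mul_assoc (toConv (i₂.toLinearMap ∘ₗ π.toLinearMap)),
      hE.conv_mul_antipode_comp, one_mul]
    rfl
  exact LinearMap.congr_fun (toConv_injective h4) a

/-- Since `rightCoact π` is an algebra map, this description makes it evident that the image of `θ`
is a subalgebra. -/
theorem CoinvModel.theta_eq_iff (hE : CoinvModel ι π i p) (a : E) :
    thetaMap ι π a = a ↔ rightCoact π a = a ⊗ₜ 1 := by
  refine ⟨fun h => by rw [← h, hE.rightCoact_theta], fun h => ?_⟩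
  have : thetaMap ι π a = LinearMap.mul' k E (LinearMap.lTensor E
      (ι.toLinearMap ∘ₗ HopfAlgebra.antipode k) (rightCoact π a)) := by
    change _ = LinearMap.mul' k E (LinearMap.lTensor E _ (TensorProduct.map LinearMap.id
      π.toLinearMap (Coalgebra.comul a)))
    rw [← LinearMap.comp_apply (LinearMap.lTensor E _), LinearMap.lTensor_comp_map]
    rfl
  rw [this, h]; simp

theorem CoinvModel.theta_mul_mem (hE : CoinvModel ι π i p) {a b : E} (ha : thetaMap ι π a = a)
    (hb : thetaMap ι π b = b) : thetaMap ι π (a * b) = a * b := by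
  rw [hE.theta_eq_iff] at ha hb ⊢
  rw [map_mul, ha, hb]; simp

/-- The coinvariants are a left coideal: `a₁ ⊗ a₂ ι S π(a₃) = Δ(a₁) (1 ⊗ ι S π(a₂))`, and `a₁ ⊗
π(a₂) = a ⊗ 1`. -/
theorem CoinvModel.lTensor_theta_comul (hE : CoinvModel ι π i p) {a : E}
    (ha : thetaMap ι π a = a) : LinearMap.lTensor E (thetaMap ι π) (Coalgebra.comul a) =
      Coalgebra.comul (R := k) a := by
  rw [hE.theta_eq_iff] at ha
  let Φ : E ⊗[k] (E ⊗[k] E) →ₗ[k] E ⊗[k] E := LinearMap.lTensor E (LinearMap.mul' k E ∘ₗ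
    LinearMap.lTensor E (ι.toLinearMap ∘ₗ HopfAlgebra.antipode k ∘ₗ π.toLinearMap))
  have h1 : LinearMap.lTensor E (thetaMap ι π) (Coalgebra.comul a) =
      Φ (LinearMap.lTensor E Coalgebra.comul (Coalgebra.comul a)) := by
    rw [← LinearMap.comp_apply Φ, ← LinearMap.lTensor_comp]
    rfl
  have h2 : ∀ t : E ⊗[k] E, Φ (TensorProduct.assoc k E E E
      (LinearMap.rTensor E Coalgebra.comul t)) =
      TensorProduct.lift (LinearMap.mul k (E ⊗[k] E) ∘ₗ Coalgebra.comul)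
        (TensorProduct.map LinearMap.id (TensorProduct.mk k E E 1 ∘ₗ
          ι.toLinearMap ∘ₗ HopfAlgebra.antipode k)
          (TensorProduct.map LinearMap.id π.toLinearMap t)) := by
    intro t
    induction t with
    | zero => simp
    | add x y hx hy => simp only [map_add, hx, hy]
    | tmul x y =>
      simp only [LinearMap.rTensor_tmul, TensorProduct.map_tmul, LinearMap.id_apply,
        TensorProduct.lift.tmul, LinearMap.comp_apply]
      induction (Coalgebra.comul x : E ⊗[k] E) with
      | zero => simp
      | add x y hx hy => simp only [map_add, hx, hy, LinearMap.add_apply, TensorProduct.add_tmul]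
      | tmul u v => simp [Φ]
  rw [h1, ← Coalgebra.coassoc_apply, h2]
  change TensorProduct.lift _ (TensorProduct.map _ _ (rightCoact π a)) = _
  rw [ha]
  simp [← Algebra.TensorProduct.one_def]

end Coinv

/-! ### The Yetter-Drinfel'd structure of the coinvariants -/

section Coinv

variable {k : Type*} [Field k] {H : Type*} [Ring H] [HopfAlgebra k H]
variable {E : Type*} [Ring E] [HopfAlgebra k E]
variable {X : Type*} [AddCommGroup X] [Module k X]
variable {ι : H →ₐ[k] E} {π : E →ₐ[k] H} {i : X →ₗ[k] E} {p : E →ₗ[k] X}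

local notation "𝓞" => coinvOps (HopfOps.of k H) (HopfOps.of k E) (AlgHom.toLinearMap ι) (AlgHom.toLinearMap π) i p
local notation "𝓨" => coinvYD (HopfOps.of k H) (HopfOps.of k E) (AlgHom.toLinearMap ι) (AlgHom.toLinearMap π) i p

theorem CoinvModel.theta_one (hE : CoinvModel ι π i p) : thetaMap ι π 1 = 1 := by
  rw [hE.theta_eq_iff, map_one, Algebra.TensorProduct.one_def]

theorem CoinvModel.i_one (hE : CoinvModel ι π i p) : i (𝓞).one = 1 :=
  (hE.i_p' 1).trans hE.theta_one

theorem CoinvModel.i_mul (hE : CoinvModel ι π i p) (x y : X) :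
    i ((𝓞).mul (x ⊗ₜ y)) = i x * i y :=
  (hE.i_p' _).trans (hE.theta_mul_mem (hE.thetaMap_i x) (hE.thetaMap_i y))

theorem CoinvModel.i_act (hE : CoinvModel ι π i p) (h : H) (x : X) :
    i ((𝓨).act (h ⊗ₜ x)) = (toConv ι.toLinearMap * cst k H (i x) *
        toConv (ι.toLinearMap ∘ₗ HopfAlgebra.antipode k)) h := by
  have h1 : (𝓨).act (h ⊗ₜ x) = p ((toConv ι.toLinearMap * cst k H (i x) *
        toConv (ι.toLinearMap ∘ₗ HopfAlgebra.antipode k)) h) := by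
    rw [LinearMap.convMul_apply]
    simp only [coinvYD, LinearMap.comp_apply, LinearMap.rTensor_tmul, HopfOps.of]
    congr 1
    induction (Coalgebra.comul h : H ⊗[k] H) with
    | zero => simp
    | add x y hx hy => simp only [map_add, hx, hy, TensorProduct.add_tmul]
    | tmul a b =>
      have e1 : (toConv ι.toLinearMap * cst k H (i x)).ofConv a = ι a * i x :=
        conv_mul_cst_apply _ _ _
      simp [e1]
  have h2 := hE.theta_ι_mul h (i x)
  rw [hE.thetaMap_i] at h2
  rw [h1, ← h2, hE.p_theta, hE.i_p', h2]

/-- Since `p` absorbs right factors from `H`, the adjoint action is induced by left multiplication.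
The module axioms are then immediate. -/
theorem CoinvModel.act_p (hE : CoinvModel ι π i p) (h : H) (a : E) :
    (𝓨).act (h ⊗ₜ p a) = p (ι h * a) := by
  apply hE.i_injective
  rw [hE.i_act, hE.i_p', hE.i_p', hE.theta_ι_mul]

/-- The right leg of the comultiplication of a coinvariant consists of coinvariants, so `p` does not
alter it. The coaction is thus the restriction of an algebra map. -/
theorem CoinvModel.i_coact (hE : CoinvModel ι π i p) (x : X) :
    LinearMap.lTensor H i ((𝓨).coact x) = leftCoact π (i x) := by
  have h1 : i ∘ₗ p = thetaMap ι π := LinearMap.ext hE.i_p'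
  change LinearMap.lTensor H i (TensorProduct.map π.toLinearMap p (Coalgebra.comul (i x))) =
    TensorProduct.map π.toLinearMap LinearMap.id (Coalgebra.comul (i x))
  rw [← LinearMap.comp_apply (LinearMap.lTensor H i), LinearMap.lTensor_comp_map, h1]
  conv_rhs => rw [← hE.lTensor_theta_comul (hE.thetaMap_i x)]
  rw [← LinearMap.comp_apply (TensorProduct.map _ _) (LinearMap.lTensor E _),
    LinearMap.map_comp_lTensor, LinearMap.id_comp]

theorem CoinvModel.lTensor_i_injective (hE : CoinvModel ι π i p) (W : Type*) [AddCommGroup W]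
    [Module k W] : Function.Injective (LinearMap.lTensor W i) :=
  Module.Flat.lTensor_preserves_injective_linearMap _ hE.i_injective

theorem CoinvModel.coact_of_i_eq (hE : CoinvModel ι π i p) {x : X} {t : H ⊗[k] X}
    (h : LinearMap.lTensor H i t = leftCoact π (i x)) : (𝓨).coact x = t :=
  hE.lTensor_i_injective H ((hE.i_coact x).trans h.symm)

theorem conv_sandwich_one (ι : H →ₐ[k] E) (c : k) (h : H) :
    (toConv ι.toLinearMap * cst k H (c • (1 : E)) *
        toConv (ι.toLinearMap ∘ₗ HopfAlgebra.antipode k)) h =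
      (Coalgebra.counit (R := k) h * c) • (1 : E) := by
  rw [map_smul, cst_one, mul_smul_comm, mul_one, smul_mul_assoc, conv_algHom_mul_antipode]
  change c • algebraMap k E _ = _
  rw [Algebra.algebraMap_eq_smul_one, smul_smul, mul_comm]

/-- The left coaction of `ι h` is `h₁ ⊗ ι h₂`; its convolution inverse is computed in two ways. -/
theorem CoinvModel.leftCoact_ι_antipode (hE : CoinvModel ι π i p) :
    toConv ((leftCoact π).toLinearMap ∘ₗ ι.toLinearMap ∘ₗ HopfAlgebra.antipode k) =
      toConv (((Algebra.TensorProduct.includeRight : E →ₐ[k] H ⊗[k] E).comp ι).toLinearMap ∘ₗ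
          HopfAlgebra.antipode k) *
      toConv ((Algebra.TensorProduct.includeLeft : H →ₐ[k] H ⊗[k] E).toLinearMap ∘ₗ
          HopfAlgebra.antipode k) ∧
    toConv ((leftCoact π).toLinearMap ∘ₗ ι.toLinearMap) =
      toConv (Algebra.TensorProduct.includeLeft : H →ₐ[k] H ⊗[k] E).toLinearMap *
      toConv ((Algebra.TensorProduct.includeRight : E →ₐ[k] H ⊗[k] E).comp ι).toLinearMap := by
  let l₁ : H →ₐ[k] H ⊗[k] E := Algebra.TensorProduct.includeLeft
  let l₂ : E →ₐ[k] H ⊗[k] E := Algebra.TensorProduct.includeRight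
  have h1 : toConv ((leftCoact π).comp ι).toLinearMap =
      toConv l₁.toLinearMap * toConv (l₂.comp ι).toLinearMap := by
    have h := conv_comp_coalg (toConv (l₁.comp π).toLinearMap) (toConv l₂.toLinearMap)
      ι.toLinearMap hE.comul_ι
    rw [← toConv_leftCoact] at h
    refine h.trans ?_
    congr 1
    ext x
    simp [hE.π_ι]
  have h2 : toConv (((leftCoact π).comp ι).toLinearMap ∘ₗ HopfAlgebra.antipode k) =
      toConv ((l₂.comp ι).toLinearMap ∘ₗ HopfAlgebra.antipode k) *
        toConv (l₁.toLinearMap ∘ₗ HopfAlgebra.antipode k) := by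
    refine left_inv_eq_right_inv (conv_antipode_mul_algHom _) ?_
    rw [h1, mul_assoc, ← mul_assoc (toConv (l₂.comp ι).toLinearMap), conv_algHom_mul_antipode,
      one_mul, conv_algHom_mul_antipode]
  exact ⟨h2, h1⟩

theorem CoinvModel.isYD (hE : CoinvModel ι π i p) : IsYD (HopfOps.of k H) 𝓨 where
  one_act x := by
    obtain ⟨a, rfl⟩ := hE.surj x
    exact (hE.act_p 1 a).trans (by rw [map_one, one_mul])
  mul_act g h x := by
    obtain ⟨a, rfl⟩ := hE.surj x
    refine (hE.act_p (g * h) a).trans ?_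
    rw [hE.act_p, hE.act_p, map_mul ι, mul_assoc]
  counit_coact x := by
    have : ∀ t : E ⊗[k] E, TensorProduct.lid k X (LinearMap.rTensor X Coalgebra.counit
        (TensorProduct.map π.toLinearMap p t)) =
        p (TensorProduct.lid k E (LinearMap.rTensor E Coalgebra.counit t)) := by
      intro t
      induction t with
      | zero => simp
      | add x y hx hy => simp only [map_add, hx, hy]
      | tmul x y => simp [hE.counit_π]
    refine (this _).trans ?_
    change p (TensorProduct.lid k E (LinearMap.rTensor E Coalgebra.counit
      (Coalgebra.comul (R := k) (i x)))) = x
    simp [hE.p_i]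
  coassoc x := by
    have e1 : ∀ t : E ⊗[k] E, LinearMap.lTensor H (𝓨).coact (TensorProduct.map π.toLinearMap p t) =
        TensorProduct.map π.toLinearMap (TensorProduct.map π.toLinearMap p ∘ₗ Coalgebra.comul)
          (LinearMap.lTensor E (thetaMap ι π) t) := by
      intro t
      induction t with
      | zero => simp
      | add x y hx hy => simp only [map_add, hx, hy]
      | tmul x y =>
        simp only [TensorProduct.map_tmul, LinearMap.lTensor_tmul, ← hE.i_p']
        rfl
    have e2 : ∀ t : E ⊗[k] E, TensorProduct.assoc k H H X (LinearMap.rTensor X Coalgebra.comul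
        (TensorProduct.map π.toLinearMap p t)) =
        TensorProduct.map π.toLinearMap (TensorProduct.map π.toLinearMap p)
          (TensorProduct.assoc k E E E (LinearMap.rTensor E Coalgebra.comul t)) := by
      intro t
      induction t with
      | zero => simp
      | add x y hx hy => simp only [map_add, hx, hy]
      | tmul x y =>
        simp only [TensorProduct.map_tmul, LinearMap.rTensor_tmul, AlgHom.toLinearMap_apply,
          hE.comul_π]
        induction (Coalgebra.comul x : E ⊗[k] E) with
        | zero => simp
        | add x y hx hy => simp only [map_add, hx, hy, TensorProduct.add_tmul]
        | tmul x y => simp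
    refine (e2 _).trans (Eq.trans ?_ (e1 _).symm)
    change TensorProduct.map _ _ (TensorProduct.assoc k E E E (LinearMap.rTensor E Coalgebra.comul
      (Coalgebra.comul (R := k) (i x)))) = TensorProduct.map _ _ (LinearMap.lTensor E (thetaMap ι π)
      (Coalgebra.comul (R := k) (i x)))
    rw [hE.lTensor_theta_comul (hE.thetaMap_i x), Coalgebra.coassoc_apply,
      ← LinearMap.comp_apply (TensorProduct.map _ _), LinearMap.map_comp_lTensor]
  -- Apply the algebra map `leftCoact π` to `ι(h₁) x ι(S h₂)`. The result is the coaction of `x`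
  -- conjugated by `h₁ ⊗ ι h₂`, which is the convolution form of the Yetter-Drinfel'd condition in
  -- `key`.
  coact_act := by
    refine TensorProduct.ext' fun h x => ?_
    apply hE.coact_of_i_eq
    let l₁ : H →ₐ[k] H ⊗[k] E := Algebra.TensorProduct.includeLeft
    let l₂ : E →ₐ[k] H ⊗[k] E := Algebra.TensorProduct.includeRight
    have hcomm : ∀ g, cst k H (g ⊗ₜ[k] (1 : E)) * toConv (l₂.comp ι).toLinearMap =
        toConv (l₂.comp ι).toLinearMap * cst k H (g ⊗ₜ[k] (1 : E)) := by
      intro g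
      ext h
      rw [conv_mul_cst_apply, cst_mul_conv_apply]
      change (g ⊗ₜ[k] (1 : E)) * (1 ⊗ₜ[k] ι h) = (1 ⊗ₜ[k] ι h) * (g ⊗ₜ[k] (1 : E))
      simp
    have key : ∀ t : H ⊗[k] X, LinearMap.lTensor H i
        (TensorProduct.map (HopfOps.of k H).conj (𝓨).act
        (TensorProduct.tensorTensorTensorComm k (H ⊗[k] H) H H X
        ((TensorProduct.assoc k H H H).symm (LinearMap.lTensor H
          ((TensorProduct.comm k H H).toLinearMap ∘ₗ Coalgebra.comul) (Coalgebra.comul h)) ⊗ₜ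
            t))) =
        (toConv l₁.toLinearMap * toConv (l₂.comp ι).toLinearMap *
          cst k H (LinearMap.lTensor H i t) *
          (toConv ((l₂.comp ι).toLinearMap ∘ₗ HopfAlgebra.antipode k) *
            toConv (l₁.toLinearMap ∘ₗ HopfAlgebra.antipode k))) h := by
      intro t
      induction t with
      | zero => simp
      | add x y hx hy =>
        simp only [TensorProduct.tmul_add, map_add, hx, hy, mul_add, add_mul]
        rfl
      | tmul g c =>
        have hm : toConv ((TensorProduct.mk k H E 1) ∘ₗ i ∘ₗ (𝓨).actL.flip c) =
            toConv (l₂.comp ι).toLinearMap * cst k H (1 ⊗ₜ i c) *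
              toConv ((l₂.comp ι).toLinearMap ∘ₗ HopfAlgebra.antipode k) := by
          have e1 := algHom_comp_conv l₂ (toConv ι.toLinearMap * cst k H (i c))
            (toConv (ι.toLinearMap ∘ₗ HopfAlgebra.antipode k))
          rw [algHom_comp_conv l₂ (toConv ι.toLinearMap)] at e1
          have e2 : toConv (l₂.toLinearMap ∘ₗ (cst k H (i c)).ofConv) = cst k H (1 ⊗ₜ i c) := by
            ext a
            change l₂ (Coalgebra.counit (R := k) a • i c) = Coalgebra.counit (R := k) a • (1 ⊗ₜ i c)
            rw [map_smul]; rfl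
          rw [e2] at e1
          refine Eq.trans ?_ e1
          ext a
          exact congrArg (fun z => (1 : H) ⊗ₜ[k] z) (hE.i_act a c)
        have h3 := conj_conv (𝓨) (AlgHom.id k H) i g c h
        rw [hm] at h3
        refine h3.trans ?_
        change (toConv l₁.toLinearMap * cst k H (g ⊗ₜ[k] (1 : E)) *
          (toConv (l₂.comp ι).toLinearMap * cst k H ((1 : H) ⊗ₜ[k] i c) *
          toConv ((l₂.comp ι).toLinearMap ∘ₗ HopfAlgebra.antipode k) *
          toConv (l₁.toLinearMap ∘ₗ HopfAlgebra.antipode k))) h = _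
        have h4 : cst k H (LinearMap.lTensor H i (g ⊗ₜ c)) =
            cst k H (g ⊗ₜ[k] (1 : E)) * cst k H (1 ⊗ₜ[k] i c) := by
          rw [← cst_mul]; simp
        rw [h4]
        congr 2
        calc _ = toConv l₁.toLinearMap * (cst k H (g ⊗ₜ[k] (1 : E)) *
              toConv (l₂.comp ι).toLinearMap) * cst k H (1 ⊗ₜ i c) *
              (toConv ((l₂.comp ι).toLinearMap ∘ₗ HopfAlgebra.antipode k) *
              toConv (l₁.toLinearMap ∘ₗ HopfAlgebra.antipode k)) := by simp only [mul_assoc]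
          _ = _ := by rw [hcomm]; simp only [mul_assoc]
    refine (key ((𝓨).coact x)).trans ?_
    rw [hE.i_coact]
    refine Eq.trans ?_ (congrArg (leftCoact π) (hE.i_act h x).symm)
    have e1 := algHom_comp_conv (leftCoact π) (toConv ι.toLinearMap * cst k H (i x))
      (toConv (ι.toLinearMap ∘ₗ HopfAlgebra.antipode k))
    rw [algHom_comp_conv (leftCoact π) (toConv ι.toLinearMap)] at e1
    have e2 : toConv ((leftCoact π).toLinearMap ∘ₗ (cst k H (i x)).ofConv) =
        cst k H (leftCoact π (i x)) := by
      ext a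
      change leftCoact π (Coalgebra.counit (R := k) a • i x) = _
      rw [map_smul]; rfl
    rw [e2] at e1
    refine Eq.trans ?_ (congrArg (fun f => f.ofConv h) e1).symm
    change _ = (toConv ((leftCoact π).toLinearMap ∘ₗ ι.toLinearMap) * cst k H (leftCoact π (i x)) *
      toConv ((leftCoact π).toLinearMap ∘ₗ ι.toLinearMap ∘ₗ HopfAlgebra.antipode k)) h
    rw [hE.leftCoact_ι_antipode.1, hE.leftCoact_ι_antipode.2]

end Coinv

/-! ### The antipode of the coinvariants and colinearity of their comultiplication -/

section Coinv

variable {k : Type*} [Field k] {H : Type*} [Ring H] [HopfAlgebra k H]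
variable {E : Type*} [Ring E] [HopfAlgebra k E]
variable {X : Type*} [AddCommGroup X] [Module k X]
variable {ι : H →ₐ[k] E} {π : E →ₐ[k] H} {i : X →ₗ[k] E} {p : E →ₗ[k] X}

local notation "𝓞" => coinvOps (HopfOps.of k H) (HopfOps.of k E) (AlgHom.toLinearMap ι) (AlgHom.toLinearMap π) i p
local notation "𝓨" => coinvYD (HopfOps.of k H) (HopfOps.of k E) (AlgHom.toLinearMap ι) (AlgHom.toLinearMap π) i p

theorem CoinvModel.π_theta (hE : CoinvModel ι π i p) (a : E) :
    π (thetaMap ι π a) = algebraMap k H (Coalgebra.counit a) := by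
  have h := algHom_comp_conv π (toConv LinearMap.id)
      (toConv (ι.toLinearMap ∘ₗ HopfAlgebra.antipode k ∘ₗ π.toLinearMap))
  rw [← toConv_thetaMap] at h
  have h2 := hE.conv_mul_antipode_comp (AlgHom.id k H)
  have h3 : π.toLinearMap ∘ₗ ι.toLinearMap ∘ₗ HopfAlgebra.antipode k ∘ₗ π.toLinearMap =
      HopfAlgebra.antipode k ∘ₗ π.toLinearMap := LinearMap.ext fun x => hE.π_ι _
  have h4 : toConv (π.toLinearMap ∘ₗ thetaMap ι π) = 1 := by
    refine h.trans (Eq.trans ?_ h2)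
    change toConv π.toLinearMap * toConv (π.toLinearMap ∘ₗ ι.toLinearMap ∘ₗ
      HopfAlgebra.antipode k ∘ₗ π.toLinearMap) = toConv π.toLinearMap * toConv
        (HopfAlgebra.antipode k ∘ₗ π.toLinearMap)
    rw [h3]
  exact congrArg (fun f => f.ofConv a) h4

/-- The map `a ↦ ι π(a₁) S(a₂)` sees a right factor `ι h` only through `ι h₁ S(ι h₂) = ε(h)`, so it
factors over `θ`. -/
theorem CoinvModel.antipode_theta (hE : CoinvModel ι π i p) (a : E) :
    coinvAntipode ι π (thetaMap ι π a) = coinvAntipode ι π a := by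
  refine hE.comp_theta _ (fun x h => ?_) a
  have hS : LinearMap.mul' k E (TensorProduct.map ι.toLinearMap
      (HopfAlgebra.antipode k ∘ₗ ι.toLinearMap) (Coalgebra.comul h)) =
      algebraMap k E (Coalgebra.counit h) := by
    have := HopfAlgebra.mul_antipode_lTensor_comul_apply (R := k) (ι h)
    rw [hE.comul_ι, hE.counit_ι, ← LinearMap.comp_apply (LinearMap.lTensor E _),
      LinearMap.lTensor_comp_map] at this
    exact this
  have hu : ∀ (u : E ⊗[k] E) (t : H ⊗[k] H), LinearMap.mul' k E (TensorProduct.map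
      (ι.toLinearMap ∘ₗ π.toLinearMap) (HopfAlgebra.antipode k)
        (u * TensorProduct.map ι.toLinearMap ι.toLinearMap t)) =
      LinearMap.mul' k E (TensorProduct.map (LinearMap.mulRight k (LinearMap.mul' k E
        (TensorProduct.map ι.toLinearMap (HopfAlgebra.antipode k ∘ₗ ι.toLinearMap) t)) ∘ₗ
          ι.toLinearMap ∘ₗ π.toLinearMap) (HopfAlgebra.antipode k) u) := by
    intro u t
    induction u with
    | zero => simp
    | add x y hx hy => simp only [map_add, hx, hy, add_mul]
    | tmul x y =>
      induction t with
      | zero => simp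
      | add x y hx hy =>
        simp only [map_add, hx, hy, mul_add, TensorProduct.map_tmul, LinearMap.mulRight_apply,
          LinearMap.mul'_apply, add_mul, LinearMap.comp_apply]
      | tmul a b => simp [HopfAlgebra.antipode_mul_antidistrib, mul_assoc, hE.π_ι]
  simp only [coinvAntipode, LinearMap.comp_apply, Bialgebra.comul_mul, hE.comul_ι]
  refine (hu _ _).trans ?_
  rw [hS]
  induction (Coalgebra.comul x : E ⊗[k] E) with
  | zero => simp
  | add x y hx hy => simp only [map_add, hx, hy, smul_add]
  | tmul x y => simp [Algebra.algebraMap_eq_smul_one]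

/-- The right coaction of `ι π(a₁) S(a₂)` is `ι π(a₁) S(a₄) ⊗ π(a₂) S π(a₃)`, and the second leg
collapses. -/
theorem CoinvModel.theta_antipode (hE : CoinvModel ι π i p) (a : E) :
    thetaMap ι π (coinvAntipode ι π a) = coinvAntipode ι π a := by
  rw [hE.theta_eq_iff]
  let i₁ : E →ₐ[k] E ⊗[k] H := Algebra.TensorProduct.includeLeft
  let i₂ : H →ₐ[k] E ⊗[k] H := Algebra.TensorProduct.includeRight
  have h1 : toConv ((rightCoact π).toLinearMap ∘ₗ (ι.comp π).toLinearMap) =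
      toConv (i₁.toLinearMap ∘ₗ (ι.comp π).toLinearMap) *
        toConv (i₂.comp π).toLinearMap := by
    have h := conv_comp_coalg (toConv i₁.toLinearMap) (toConv (i₂.comp π).toLinearMap)
      (ι.comp π).toLinearMap (fun x => by
        change Coalgebra.comul (R := k) (ι (π x)) = _
        rw [hE.comul_ι, hE.comul_π, ← LinearMap.comp_apply (TensorProduct.map _ _),
          ← TensorProduct.map_comp]
        rfl)
    rw [← toConv_rightCoact] at h
    refine h.trans ?_
    congr 1
    ext x
    simp [hE.π_ι]
  have h2 : toConv ((rightCoact π).toLinearMap ∘ₗ HopfAlgebra.antipode k) =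
      toConv ((i₂.comp π).toLinearMap ∘ₗ HopfAlgebra.antipode k) *
        toConv (i₁.toLinearMap ∘ₗ HopfAlgebra.antipode k) := by
    refine left_inv_eq_right_inv (conv_antipode_mul_algHom _) ?_
    rw [toConv_rightCoact, mul_assoc, ← mul_assoc (toConv (i₂.comp π).toLinearMap),
      conv_algHom_mul_antipode, one_mul, conv_algHom_mul_antipode]
  have e1 := algHom_comp_conv (rightCoact π) (toConv (ι.comp π).toLinearMap)
      (toConv (HopfAlgebra.antipode k))
  have e2 := algHom_comp_conv i₁ (toConv (ι.comp π).toLinearMap) (toConv (HopfAlgebra.antipode k))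
  rw [← toConv_coinvAntipode] at e1 e2
  have h3 : toConv ((rightCoact π).toLinearMap ∘ₗ coinvAntipode ι π) =
      toConv (i₁.toLinearMap ∘ₗ coinvAntipode ι π) := by
    refine e1.trans (Eq.trans ?_ e2.symm)
    refine (congrArg₂ (· * ·) h1 h2).trans ?_
    change _ * _ * (_ * _) = _ * _
    rw [mul_assoc, ← mul_assoc (toConv (i₂.comp π).toLinearMap), conv_algHom_mul_antipode, one_mul]
  exact LinearMap.congr_fun (toConv_injective h3) a

theorem CoinvModel.i_antipode_p (hE : CoinvModel ι π i p) (a : E) :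
    i ((𝓞).antipode (p a)) = coinvAntipode ι π a := by
  change i (p (coinvAntipode ι π (i (p a)))) = _
  rw [hE.i_p', hE.i_p', hE.theta_antipode, hE.antipode_theta]

theorem CoinvModel.theta_conv (hE : CoinvModel ι π i p) :
    toConv (thetaMap ι π) * toConv (ι.comp π).toLinearMap = toConv LinearMap.id := by
  rw [toConv_thetaMap, mul_assoc]
  exact (congrArg _ (hE.conv_antipode_mul_comp ι)).trans (mul_one _)

/-- In the convolution algebra, `θ = id * ι S π` and the antipode is `ι π * S`; these are inverse to
each other factor by factor. -/
theorem CoinvModel.antipode_conv_theta (hE : CoinvModel ι π i p) :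
    toConv (coinvAntipode ι π) * toConv (thetaMap ι π) = 1 := by
  rw [toConv_coinvAntipode, toConv_thetaMap, mul_assoc, ← mul_assoc (toConv (HopfAlgebra.antipode k)),
    LinearMap.antipode_mul_id, one_mul]
  exact hE.conv_mul_antipode_comp ι

theorem CoinvModel.theta_conv_antipode (hE : CoinvModel ι π i p) :
    toConv (thetaMap ι π) * toConv (coinvAntipode ι π) = 1 := by
  rw [toConv_coinvAntipode, ← mul_assoc, hE.theta_conv, LinearMap.id_mul_antipode]

/-- In Sweedler notation, `δ(θ(a)) = π(a₁) S π(a₃) ⊗ θ(a₂)`. -/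
theorem CoinvModel.leftCoact_theta (hE : CoinvModel ι π i p) :
    toConv ((leftCoact π).toLinearMap ∘ₗ thetaMap ι π) =
      toConv ((Algebra.TensorProduct.includeLeft : H →ₐ[k] H ⊗[k] E).toLinearMap ∘ₗ
        π.toLinearMap) *
      toConv ((Algebra.TensorProduct.includeRight : E →ₐ[k] H ⊗[k] E).toLinearMap ∘ₗ
        thetaMap ι π) *
      toConv ((Algebra.TensorProduct.includeLeft : H →ₐ[k] H ⊗[k] E).toLinearMap ∘ₗ
        HopfAlgebra.antipode k ∘ₗ π.toLinearMap) := by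
  let l₁ : H →ₐ[k] H ⊗[k] E := Algebra.TensorProduct.includeLeft
  let l₂ : E →ₐ[k] H ⊗[k] E := Algebra.TensorProduct.includeRight
  have e1 := algHom_comp_conv (leftCoact π) (toConv LinearMap.id)
      (toConv (ι.toLinearMap ∘ₗ HopfAlgebra.antipode k ∘ₗ π.toLinearMap))
  have e2 := algHom_comp_conv l₂ (toConv LinearMap.id)
      (toConv (ι.toLinearMap ∘ₗ HopfAlgebra.antipode k ∘ₗ π.toLinearMap))
  rw [← toConv_thetaMap] at e1 e2
  have h3 := conv_comp_coalg (toConv ((l₂.comp ι).toLinearMap ∘ₗ HopfAlgebra.antipode k))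
    (toConv (l₁.toLinearMap ∘ₗ HopfAlgebra.antipode k)) π.toLinearMap hE.comul_π
  rw [← hE.leftCoact_ι_antipode.1] at h3
  refine e1.trans ((congrArg₂ (· * ·) (toConv_leftCoact π) h3).trans ?_)
  refine Eq.trans ?_ (congrArg (fun z => toConv (l₁.toLinearMap ∘ₗ π.toLinearMap) * z *
    toConv (l₁.toLinearMap ∘ₗ HopfAlgebra.antipode k ∘ₗ π.toLinearMap)) e2.symm)
  change toConv (l₁.toLinearMap ∘ₗ π.toLinearMap) * toConv l₂.toLinearMap *
    (toConv (l₂.toLinearMap ∘ₗ ι.toLinearMap ∘ₗ HopfAlgebra.antipode k ∘ₗ π.toLinearMap) *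
      toConv (l₁.toLinearMap ∘ₗ HopfAlgebra.antipode k ∘ₗ π.toLinearMap)) =
    toConv (l₁.toLinearMap ∘ₗ π.toLinearMap) * (toConv l₂.toLinearMap *
    toConv (l₂.toLinearMap ∘ₗ ι.toLinearMap ∘ₗ HopfAlgebra.antipode k ∘ₗ π.toLinearMap)) *
      toConv (l₁.toLinearMap ∘ₗ HopfAlgebra.antipode k ∘ₗ π.toLinearMap)
  simp only [mul_assoc]

theorem conv_left_module {C B B' : Type*} [AddCommGroup C] [Module k C] [Coalgebra k C] [Ring B]
    [Algebra k B] [Ring B'] [Algebra k B'] (N : B →ₗ[k] B') (φ : C →ₗ[k] B) (φ' : C →ₗ[k] B')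
    (h : ∀ c y, N (φ c * y) = φ' c * N y) (f : WithConv (C →ₗ[k] B)) :
    toConv (N ∘ₗ (toConv φ * f).ofConv) = toConv φ' * toConv (N ∘ₗ f.ofConv) := by
  ext c
  change N (LinearMap.mul' k B (TensorProduct.map φ f.ofConv (Coalgebra.comul c))) =
    LinearMap.mul' k B' (TensorProduct.map φ' (N ∘ₗ f.ofConv) (Coalgebra.comul c))
  induction (Coalgebra.comul c : C ⊗[k] C) with
  | zero => simp
  | add x y hx hy => simp only [map_add, hx, hy]
  | tmul x y => simp [h]

theorem conv_right_module {C B B' : Type*} [AddCommGroup C] [Module k C] [Coalgebra k C] [Ring B]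
    [Algebra k B] [Ring B'] [Algebra k B'] (N : B →ₗ[k] B') (φ : C →ₗ[k] B) (φ' : C →ₗ[k] B')
    (h : ∀ c y, N (y * φ c) = N y * φ' c) (f : WithConv (C →ₗ[k] B)) :
    toConv (N ∘ₗ (f * toConv φ).ofConv) = toConv (N ∘ₗ f.ofConv) * toConv φ' := by
  ext c
  change N (LinearMap.mul' k B (TensorProduct.map f.ofConv φ (Coalgebra.comul c))) =
    LinearMap.mul' k B' (TensorProduct.map (N ∘ₗ f.ofConv) φ' (Coalgebra.comul c))
  induction (Coalgebra.comul c : C ⊗[k] C) with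
  | zero => simp
  | add x y hx hy => simp only [map_add, hx, hy]
  | tmul x y => simp [h]

/-- The codiagonal coaction of `θ(a₁) ⊗ θ(a₂)` has first leg `π(a₁) S π(a₃) π(a₄) S π(a₆)` over
`θ(a₂) ⊗ θ(a₅)`. The two inner factors cancel and leave the coaction of `θ(a)` followed by the
comultiplication. -/
theorem CoinvModel.comul_coact (hE : CoinvModel ι π i p) :
    ((𝓨).tensor (HopfOps.of k H) 𝓨).coact ∘ₗ (𝓞).comul =
      LinearMap.lTensor H (𝓞).comul ∘ₗ (𝓨).coact := by
  refine LinearMap.ext fun x => ?_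
  obtain ⟨a, rfl⟩ := hE.surj x
  have hinj : Function.Injective (LinearMap.lTensor H (TensorProduct.map i i)) :=
    Module.Flat.lTensor_preserves_injective_linearMap _ (hE.map_i_injective hE.i_injective)
  apply hinj
  let l₁ : H →ₐ[k] H ⊗[k] E := Algebra.TensorProduct.includeLeft
  let l₂ : E →ₐ[k] H ⊗[k] E := Algebra.TensorProduct.includeRight
  let i₁ : E →ₐ[k] E ⊗[k] E := Algebra.TensorProduct.includeLeft
  let i₂ : E →ₐ[k] E ⊗[k] E := Algebra.TensorProduct.includeRight
  let k₁ : H →ₐ[k] H ⊗[k] (E ⊗[k] E) := Algebra.TensorProduct.includeLeft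
  let k₂ : E ⊗[k] E →ₐ[k] H ⊗[k] (E ⊗[k] E) := Algebra.TensorProduct.includeRight
  let j₁ : H ⊗[k] E →ₐ[k] H ⊗[k] (E ⊗[k] E) := Algebra.TensorProduct.map (AlgHom.id k H) i₁
  let j₂ : H ⊗[k] E →ₐ[k] H ⊗[k] (E ⊗[k] E) := Algebra.TensorProduct.map (AlgHom.id k H) i₂
  let αθ : E →ₗ[k] H ⊗[k] E := (leftCoact π).toLinearMap ∘ₗ thetaMap ι π
  have hαθ : ∀ b, LinearMap.lTensor H i ((𝓨).coact (p b)) = αθ b := fun b => by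
    rw [hE.i_coact, hE.i_p']; rfl
  have L : LinearMap.lTensor H (TensorProduct.map i i)
      (((𝓨).tensor (HopfOps.of k H) 𝓨).coact ((𝓞).comul (p a))) =
      (toConv (j₁.toLinearMap ∘ₗ αθ) * toConv (j₂.toLinearMap ∘ₗ αθ)) a := by
    rw [hE.comul_p, conv_apply]
    induction (Coalgebra.comul a : E ⊗[k] E) with
    | zero => simp
    | add x y hx hy => simp only [map_add, hx, hy]
    | tmul u v =>
      simp only [YDOps.tensor, LinearMap.comp_apply, TensorProduct.map_tmul, LinearMap.mul'_apply,
        ← hαθ]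
      induction (𝓨).coact (p u) with
      | zero => simp
      | add x y hx hy => simp only [map_add, hx, hy, add_mul, TensorProduct.add_tmul]
      | tmul g x =>
        induction (𝓨).coact (p v) with
        | zero => simp
        | add x y hx hy => simp only [map_add, hx, hy, mul_add, TensorProduct.tmul_add]
        | tmul g' y => simp [HopfOps.of, j₁, j₂, i₁, i₂]
  let D : E →ₗ[k] E ⊗[k] E := TensorProduct.map (thetaMap ι π) (thetaMap ι π) ∘ₗ Coalgebra.comul
  have hD : TensorProduct.map i i ∘ₗ (𝓞).comul = D ∘ₗ i := by
    refine LinearMap.ext fun x => ?_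
    have h1 : i ∘ₗ p = thetaMap ι π := LinearMap.ext hE.i_p'
    conv_lhs => rw [← hE.p_i x]
    rw [LinearMap.comp_apply, hE.comul_p, ← LinearMap.comp_apply (TensorProduct.map _ _),
      ← TensorProduct.map_comp, h1]
    rfl
  have Rr : LinearMap.lTensor H (TensorProduct.map i i)
      (LinearMap.lTensor H (𝓞).comul ((𝓨).coact (p a))) =
      toConv (LinearMap.lTensor H D ∘ₗ αθ) a := by
    rw [← LinearMap.comp_apply (LinearMap.lTensor H _), ← LinearMap.lTensor_comp, hD,
      LinearMap.lTensor_comp, LinearMap.comp_apply, hαθ]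
    rfl
  refine L.trans (Eq.trans ?_ Rr.symm)
  have hA : toConv αθ = toConv (l₁.toLinearMap ∘ₗ π.toLinearMap) *
      toConv (l₂.toLinearMap ∘ₗ thetaMap ι π) *
      toConv (l₁.toLinearMap ∘ₗ HopfAlgebra.antipode k ∘ₗ π.toLinearMap) := hE.leftCoact_theta
  have hj : ∀ (j : H ⊗[k] E →ₐ[k] H ⊗[k] (E ⊗[k] E)), (∀ g, j (g ⊗ₜ 1) = k₁ g) →
      toConv (j.toLinearMap ∘ₗ αθ) = toConv (k₁.toLinearMap ∘ₗ π.toLinearMap) *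
        toConv (j.toLinearMap ∘ₗ l₂.toLinearMap ∘ₗ thetaMap ι π) *
        toConv (k₁.toLinearMap ∘ₗ HopfAlgebra.antipode k ∘ₗ π.toLinearMap) := by
    intro j hj
    have h1 : toConv (j.toLinearMap ∘ₗ αθ) = toConv (j.toLinearMap ∘ₗ (toConv αθ).ofConv) := rfl
    rw [h1, hA, algHom_comp_conv, algHom_comp_conv]
    have h2 : j.toLinearMap ∘ₗ l₁.toLinearMap = k₁.toLinearMap := LinearMap.ext hj
    simp only [← LinearMap.comp_assoc, h2]
  have hk : toConv (LinearMap.lTensor H D ∘ₗ αθ) = toConv (k₁.toLinearMap ∘ₗ π.toLinearMap) *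
        toConv (k₂.toLinearMap ∘ₗ D) *
        toConv (k₁.toLinearMap ∘ₗ HopfAlgebra.antipode k ∘ₗ π.toLinearMap) := by
    have h1 : toConv (LinearMap.lTensor H D ∘ₗ αθ) =
      toConv (LinearMap.lTensor H D ∘ₗ (toConv αθ).ofConv) := rfl
    rw [h1, hA, conv_right_module _ _ (k₁.toLinearMap ∘ₗ HopfAlgebra.antipode k ∘ₗ π.toLinearMap),
      conv_left_module _ _ (k₁.toLinearMap ∘ₗ π.toLinearMap)]
    · congr 2
      refine congrArg toConv (LinearMap.ext fun b => ?_)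
      change LinearMap.lTensor H D (1 ⊗ₜ thetaMap ι π b) = 1 ⊗ₜ D b
      rw [LinearMap.lTensor_tmul, hE.comp_theta D
        (hE.map_comul_mul_ι _ _ hE.theta_mul_ι hE.theta_mul_ι)]
    · intro c y
      induction y with
      | zero => simp
      | add x y hx hy => simp only [map_add, hx, hy, mul_add]
      | tmul g y => simp [l₁, k₁]
    · intro c y
      induction y with
      | zero => simp
      | add x y hx hy => simp only [map_add, hx, hy, add_mul]
      | tmul g y => simp [l₁, k₁]
  have hD2 : toConv (k₂.toLinearMap ∘ₗ D) =
      toConv (j₁.toLinearMap ∘ₗ l₂.toLinearMap ∘ₗ thetaMap ι π) *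
      toConv (j₂.toLinearMap ∘ₗ l₂.toLinearMap ∘ₗ thetaMap ι π) := by
    have h1 : toConv (k₂.toLinearMap ∘ₗ D) = toConv (k₂.toLinearMap ∘ₗ (toConv D).ofConv) := rfl
    rw [h1, map_comul_eq_conv, algHom_comp_conv]
    congr 1
  rw [hj j₁ (fun g => by simp [j₁, k₁, i₁, Algebra.TensorProduct.one_def]),
    hj j₂ (fun g => by simp [j₂, k₁, i₂, Algebra.TensorProduct.one_def]), hk, hD2]
  congr 2
  have h5 := hE.conv_antipode_mul_comp k₁
  calc _ = toConv (k₁.toLinearMap ∘ₗ π.toLinearMap) *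
        toConv (j₁.toLinearMap ∘ₗ l₂.toLinearMap ∘ₗ thetaMap ι π) *
        (toConv (k₁.toLinearMap ∘ₗ HopfAlgebra.antipode k ∘ₗ π.toLinearMap) *
        toConv (k₁.toLinearMap ∘ₗ π.toLinearMap)) *
        toConv (j₂.toLinearMap ∘ₗ l₂.toLinearMap ∘ₗ thetaMap ι π) *
        toConv (k₁.toLinearMap ∘ₗ HopfAlgebra.antipode k ∘ₗ π.toLinearMap) := by
          simp only [mul_assoc]
    _ = _ := by rw [h5]; simp only [mul_assoc, mul_one]

end Coinv

/-! ### The coinvariants are a braided Hopf algebra -/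

section Coinv

variable {k : Type*} [Field k] {H : Type*} [Ring H] [HopfAlgebra k H]
variable {E : Type*} [Ring E] [HopfAlgebra k E]
variable {X : Type*} [AddCommGroup X] [Module k X]
variable {ι : H →ₐ[k] E} {π : E →ₐ[k] H} {i : X →ₗ[k] E} {p : E →ₗ[k] X}

local notation "𝓞" => coinvOps (HopfOps.of k H) (HopfOps.of k E) (AlgHom.toLinearMap ι) (AlgHom.toLinearMap π) i p
local notation "𝓨" => coinvYD (HopfOps.of k H) (HopfOps.of k E) (AlgHom.toLinearMap ι) (AlgHom.toLinearMap π) i p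

theorem CoinvModel.i_comul (hE : CoinvModel ι π i p) (x : X) :
    TensorProduct.map i i ((𝓞).comul x) =
      LinearMap.rTensor E (thetaMap ι π) (Coalgebra.comul (i x)) := by
  have h1 : i ∘ₗ p = thetaMap ι π := LinearMap.ext hE.i_p'
  conv_lhs => rw [← hE.p_i x]
  rw [hE.comul_p, ← LinearMap.comp_apply (TensorProduct.map _ _), ← TensorProduct.map_comp, h1,
    ← LinearMap.rTensor_comp_lTensor, LinearMap.comp_apply,
    hE.lTensor_theta_comul (hE.thetaMap_i x)]

theorem CoinvModel.comul_eq (hE : CoinvModel ι π i p) (x : X) :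
    (𝓞).comul x = TensorProduct.map p p (Coalgebra.comul (i x)) := by
  conv_lhs => rw [← hE.p_i x]
  rw [hE.comul_p]

theorem CoinvModel.i_braiding (hE : CoinvModel ι π i p) (b c : E) (hb : thetaMap ι π b = b) :
    TensorProduct.map i i (braiding 𝓨 𝓨 (p b ⊗ₜ p c)) =
      LinearMap.rTensor E (toConv ι.toLinearMap * cst k H (thetaMap ι π c) *
        toConv (ι.toLinearMap ∘ₗ HopfAlgebra.antipode k)).ofConv (leftCoact π b) := by
  have h1 : LinearMap.lTensor H i ((𝓨).coact (p b)) = leftCoact π b := by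
    rw [hE.i_coact, hE.i_p', hb]
  rw [← h1]
  simp only [braiding, LinearMap.comp_apply, LinearMap.rTensor_tmul, LinearEquiv.coe_coe]
  induction (𝓨).coact (p b) with
  | zero => simp
  | add x y hx hy => simp only [map_add, hx, hy, TensorProduct.add_tmul]
  | tmul g x =>
    simp only [TensorProduct.rightComm_tmul, LinearMap.rTensor_tmul, TensorProduct.map_tmul,
      LinearMap.lTensor_tmul]
    rw [hE.i_act, hE.i_p']

/-- By `theta_mulRight`, `θ(x c) = x₁ θ(c) ι S π(x₂)`. Writing `id = θ * ι π` there gives `θ(x₁)`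
times `π(x₂)` acting adjointly on `θ(c)`; the pair `π(x₂) ⊗ x₃` is the coaction that enters the
braiding. -/
theorem CoinvModel.theta_mul_comul (hE : CoinvModel ι π i p) (x c : E) :
    LinearMap.rTensor E (thetaMap ι π) (Coalgebra.comul x * (c ⊗ₜ 1)) =
      LinearMap.mul' k (E ⊗[k] E) (TensorProduct.map
        ((Algebra.TensorProduct.includeLeft : E →ₐ[k] E ⊗[k] E).toLinearMap ∘ₗ thetaMap ι π)
        (LinearMap.rTensor E (toConv ι.toLinearMap * cst k H (thetaMap ι π c) *
          toConv (ι.toLinearMap ∘ₗ HopfAlgebra.antipode k)).ofConv ∘ₗ (leftCoact π).toLinearMap)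
        (Coalgebra.comul x)) := by
  let i₁ : E →ₐ[k] E ⊗[k] E := Algebra.TensorProduct.includeLeft
  let i₂ : E →ₐ[k] E ⊗[k] E := Algebra.TensorProduct.includeRight
  set A : WithConv (H →ₗ[k] E) := toConv ι.toLinearMap * cst k H (thetaMap ι π c) *
    toConv (ι.toLinearMap ∘ₗ HopfAlgebra.antipode k) with hA
  have h1 : toConv (thetaMap ι π ∘ₗ LinearMap.mulRight k c) =
      toConv (thetaMap ι π) * toConv (A.ofConv ∘ₗ π.toLinearMap) := by
    have e1 : toConv (A.ofConv ∘ₗ π.toLinearMap) = toConv (ι.comp π).toLinearMap *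
        cst k E (thetaMap ι π c) *
        toConv (ι.toLinearMap ∘ₗ HopfAlgebra.antipode k ∘ₗ π.toLinearMap) := by
      rw [hA, conv_comp_coalg _ _ _ hE.comul_π, conv_comp_coalg _ _ _ hE.comul_π]
      congr 2
      ext a
      change Coalgebra.counit (R := k) (π a) • thetaMap ι π c =
        Coalgebra.counit (R := k) a • thetaMap ι π c
      rw [hE.counit_π]
    rw [theta_mulRight, e1, ← mul_assoc, ← mul_assoc, hE.theta_conv]
  have h2 : toConv (TensorProduct.map (thetaMap ι π ∘ₗ LinearMap.mulRight k c) LinearMap.id ∘ₗ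
      Coalgebra.comul) = toConv (i₁.toLinearMap ∘ₗ thetaMap ι π) *
        toConv (LinearMap.rTensor E A.ofConv ∘ₗ (leftCoact π).toLinearMap) := by
    have e2 : LinearMap.rTensor E A.ofConv ∘ₗ (leftCoact π).toLinearMap =
        TensorProduct.map (A.ofConv ∘ₗ π.toLinearMap) LinearMap.id ∘ₗ Coalgebra.comul := by
      change LinearMap.rTensor E A.ofConv ∘ₗ (TensorProduct.map π.toLinearMap LinearMap.id ∘ₗ
        Coalgebra.comul) = _
      rw [← LinearMap.comp_assoc, LinearMap.rTensor_comp_map]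
    have e3 := algHom_comp_conv i₁ (toConv (thetaMap ι π)) (toConv (A.ofConv ∘ₗ π.toLinearMap))
    rw [← h1] at e3
    rw [e2, map_comul_eq_conv, map_comul_eq_conv, ← mul_assoc]
    exact congrArg (· * _) e3
  have h3 : LinearMap.rTensor E (thetaMap ι π) (Coalgebra.comul x * (c ⊗ₜ 1)) =
      TensorProduct.map (thetaMap ι π ∘ₗ LinearMap.mulRight k c) LinearMap.id
        (Coalgebra.comul x) := by
    induction (Coalgebra.comul x : E ⊗[k] E) with
    | zero => simp
    | add x y hx hy => simp only [map_add, hx, hy, add_mul]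
    | tmul x y => simp
  rw [h3]
  exact congrArg (fun f => f.ofConv x) h2

/-- Inside `E` the comultiplication of `x y` is `θ(x₁ y₁) ⊗ x₂ y₂`. The only braided phenomenon is
that `θ` is not multiplicative, and its defect is exactly the one described by
`CoinvModel.theta_mul_comul`. -/
theorem CoinvModel.comul_mul (hE : CoinvModel ι π i p) : (𝓞).comul ∘ₗ (𝓞).mul =
    TensorProduct.map (𝓞).mul (𝓞).mul ∘ₗ middle (braiding 𝓨 𝓨) ∘ₗ
      TensorProduct.map (𝓞).comul (𝓞).comul := by
  refine TensorProduct.ext' fun x y => ?_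
  apply hE.map_i_injective hE.i_injective
  simp only [LinearMap.comp_apply, TensorProduct.map_tmul]
  have hθθ : ∀ b, thetaMap ι π (thetaMap ι π b) = thetaMap ι π b := fun b => by
    rw [← hE.i_p' (thetaMap ι π b), hE.p_theta, hE.i_p']
  have key : ∀ w : E ⊗[k] E, TensorProduct.map i i (TensorProduct.map (𝓞).mul (𝓞).mul
      (middle (braiding 𝓨 𝓨) (TensorProduct.map p p (Coalgebra.comul (i x)) ⊗ₜ
        TensorProduct.map p p w))) =
      LinearMap.rTensor E (thetaMap ι π) (Coalgebra.comul (i x) *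
        LinearMap.lTensor E (thetaMap ι π) w) := by
    intro w
    induction w with
    | zero => simp
    | add x y hx hy => simp only [map_add, TensorProduct.tmul_add, hx, hy, mul_add]
    | tmul c d =>
      have e1 : ∀ u : E ⊗[k] E, LinearMap.rTensor E (thetaMap ι π)
          (u * LinearMap.lTensor E (thetaMap ι π) (c ⊗ₜ d)) =
          LinearMap.rTensor E (thetaMap ι π) (u * (c ⊗ₜ 1)) * (1 ⊗ₜ thetaMap ι π d) := by
        intro u
        induction u with
        | zero => simp
        | add x y hx hy => simp only [map_add, hx, hy, add_mul]
        | tmul a b => simp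
      rw [e1, hE.theta_mul_comul, ← hE.lTensor_theta_comul (hE.thetaMap_i x)]
      induction (Coalgebra.comul (i x) : E ⊗[k] E) with
      | zero => simp
      | add x y hx hy => simp only [map_add, TensorProduct.add_tmul, hx, hy, add_mul]
      | tmul a b =>
        simp only [LinearMap.lTensor_tmul, TensorProduct.map_tmul, middle_tmul,
          LinearMap.mul'_apply, LinearMap.comp_apply, AlgHom.toLinearMap_apply]
        rw [← hE.i_braiding _ c (hθθ b)]
        induction braiding 𝓨 𝓨 (p (thetaMap ι π b) ⊗ₜ p c) with
        | zero => simp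
        | add x y hx hy => simp only [map_add, hx, hy, add_mul, mul_add]
        | tmul s t => simp [hE.i_mul, hE.i_p']
  rw [hE.comul_eq x, hE.comul_eq y, key, hE.i_comul, hE.i_mul, Bialgebra.comul_mul,
    hE.lTensor_theta_comul (hE.thetaMap_i y)]

theorem CoinvModel.isBraidedHopf (hE : CoinvModel ι π i p) :
    IsBraidedHopf (HopfOps.of k H) 𝓞 𝓨 where
  yd := hE.isYD
  one_mul x := hE.i_injective (by rw [hE.i_mul, hE.i_one, one_mul])
  mul_one x := hE.i_injective (by rw [hE.i_mul, hE.i_one, mul_one])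
  mul_assoc x y z := hE.i_injective (by simp only [hE.i_mul, mul_assoc])
  coassoc x := by
    obtain ⟨a, rfl⟩ := hE.surj x
    have e1 : ∀ t : E ⊗[k] E, TensorProduct.assoc k X X X (LinearMap.rTensor X (𝓞).comul
        (TensorProduct.map p p t)) = TensorProduct.map p (TensorProduct.map p p)
        (TensorProduct.assoc k E E E (LinearMap.rTensor E Coalgebra.comul t)) := by
      intro t
      induction t with
      | zero => simp
      | add x y hx hy => simp only [map_add, hx, hy]
      | tmul x y =>
        simp only [TensorProduct.map_tmul, LinearMap.rTensor_tmul, hE.comul_p]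
        induction (Coalgebra.comul x : E ⊗[k] E) with
        | zero => simp
        | add x y hx hy => simp only [map_add, hx, hy, TensorProduct.add_tmul]
        | tmul x y => simp
    have e2 : ∀ t : E ⊗[k] E, LinearMap.lTensor X (𝓞).comul (TensorProduct.map p p t) =
        TensorProduct.map p (TensorProduct.map p p) (LinearMap.lTensor E Coalgebra.comul t) := by
      intro t
      induction t with
      | zero => simp
      | add x y hx hy => simp only [map_add, hx, hy]
      | tmul x y => simp [hE.comul_p]
    rw [hE.comul_p, e1, e2, Coalgebra.coassoc_apply]
  counit_left x := by
    obtain ⟨a, rfl⟩ := hE.surj x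
    have e1 : ∀ t : E ⊗[k] E, TensorProduct.lid k X (LinearMap.rTensor X (𝓞).counit
        (TensorProduct.map p p t)) =
        p (TensorProduct.lid k E (LinearMap.rTensor E Coalgebra.counit t)) := by
      intro t
      induction t with
      | zero => simp
      | add x y hx hy => simp only [map_add, hx, hy]
      | tmul x y => simp [hE.counit_p]
    rw [hE.comul_p, e1]; simp
  counit_right x := by
    obtain ⟨a, rfl⟩ := hE.surj x
    have e1 : ∀ t : E ⊗[k] E, TensorProduct.rid k X (LinearMap.lTensor X (𝓞).counit
        (TensorProduct.map p p t)) =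
        p (TensorProduct.rid k E (LinearMap.lTensor E Coalgebra.counit t)) := by
      intro t
      induction t with
      | zero => simp
      | add x y hx hy => simp only [map_add, hx, hy]
      | tmul x y => simp [hE.counit_p]
    rw [hE.comul_p, e1]; simp
  one_hom :=
    { map_act := by
        refine TensorProduct.ext' fun h c => hE.i_injective ?_
        have h1 := hE.i_act h (c • (𝓞).one)
        rw [map_smul i, hE.i_one, conv_sandwich_one] at h1
        simp only [LinearMap.comp_apply, LinearMap.lTensor_tmul, LinearMap.toSpanSingleton_apply]
        rw [h1]
        have h2 : (YDOps.trivial (HopfOps.of k H)).act (h ⊗ₜ c) = Coalgebra.counit h * c := by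
          simp [YDOps.trivial, HopfOps.of]
        rw [h2, map_smul i, hE.i_one]
      map_coact := by
        refine LinearMap.ext_ring ?_
        apply hE.coact_of_i_eq
        simp only [YDOps.trivial, LinearMap.comp_apply, TensorProduct.mk_apply,
          LinearMap.lTensor_tmul, LinearMap.toSpanSingleton_apply, one_smul]
        rw [hE.i_one, map_one]
        rfl }
  mul_hom :=
    { map_act := by
        refine TensorProduct.ext' fun h t => ?_
        induction t with
        | zero => simp
        | add x y hx hy => simp only [TensorProduct.tmul_add, map_add, hx, hy]
        | tmul x y =>
          apply hE.i_injective
          simp only [LinearMap.comp_apply, LinearMap.lTensor_tmul]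
          rw [hE.i_act, hE.i_mul, cst_mul]
          have h1 : toConv ι.toLinearMap * (cst k H (i x) * cst k H (i y)) *
              toConv (ι.toLinearMap ∘ₗ HopfAlgebra.antipode k) =
              (toConv ι.toLinearMap * cst k H (i x) *
                toConv (ι.toLinearMap ∘ₗ HopfAlgebra.antipode k)) *
              (toConv ι.toLinearMap * cst k H (i y) *
                toConv (ι.toLinearMap ∘ₗ HopfAlgebra.antipode k)) := by
            have h2 := conv_antipode_mul_algHom ι
            calc _ = toConv ι.toLinearMap * cst k H (i x) * 1 * cst k H (i y) *
                  toConv (ι.toLinearMap ∘ₗ HopfAlgebra.antipode k) := by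
                    simp only [mul_assoc, one_mul]
              _ = _ := by rw [← h2]; simp only [mul_assoc]
          rw [h1, LinearMap.convMul_apply]
          simp only [YDOps.tensor, LinearMap.comp_apply, LinearMap.rTensor_tmul]
          change i ((𝓞).mul (TensorProduct.map (𝓨).act (𝓨).act
            (TensorProduct.tensorTensorTensorComm k H H X X
              ((Coalgebra.comul h : H ⊗[k] H) ⊗ₜ (x ⊗ₜ y))))) = _
          induction (Coalgebra.comul h : H ⊗[k] H) with
          | zero => simp
          | add x y hx hy => simp only [map_add, hx, hy, TensorProduct.add_tmul]
          | tmul a b =>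
            simp only [TensorProduct.tensorTensorTensorComm_tmul, TensorProduct.map_tmul,
              hE.i_mul, hE.i_act, LinearMap.mul'_apply]
      map_coact := by
        refine TensorProduct.ext' fun x y => ?_
        apply hE.coact_of_i_eq
        rw [hE.i_mul, map_mul, ← hE.i_coact, ← hE.i_coact]
        simp only [YDOps.tensor, LinearMap.comp_apply, TensorProduct.map_tmul]
        induction (𝓨).coact x with
        | zero => simp
        | add x y hx hy => simp only [map_add, hx, hy, TensorProduct.add_tmul, add_mul]
        | tmul a b =>
          induction (𝓨).coact y with
          | zero => simp
          | add x y hx hy => simp only [map_add, hx, hy, TensorProduct.tmul_add, mul_add]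
          | tmul c d =>
            simp only [LinearEquiv.coe_coe, TensorProduct.tensorTensorTensorComm_tmul,
              LinearMap.rTensor_tmul, LinearMap.lTensor_tmul, hE.i_mul, Algebra.TensorProduct.tmul_mul_tmul]
            rfl }
  counit_hom :=
    { map_act := by
        refine TensorProduct.ext' fun h x => ?_
        obtain ⟨a, rfl⟩ := hE.surj x
        simp only [LinearMap.comp_apply, LinearMap.lTensor_tmul]
        rw [hE.act_p, hE.counit_p, hE.counit_p, Bialgebra.counit_mul, hE.counit_ι]
        simp [YDOps.trivial, HopfOps.of]
      map_coact := by
        refine LinearMap.ext fun x => ?_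
        have e1 : ∀ t : E ⊗[k] E, LinearMap.lTensor H (𝓞).counit
            (TensorProduct.map π.toLinearMap p t) =
            LinearMap.rTensor k π.toLinearMap (LinearMap.lTensor E Coalgebra.counit t) := by
          intro t
          induction t with
          | zero => simp
          | add x y hx hy => simp only [map_add, hx, hy]
          | tmul x y => simp [hE.counit_p]
        refine Eq.trans ?_ (e1 (Coalgebra.comul (i x))).symm
        rw [Coalgebra.lTensor_counit_comul, LinearMap.rTensor_tmul, AlgHom.toLinearMap_apply]
        have h1 := hE.π_theta (i x)
        rw [hE.thetaMap_i] at h1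
        rw [h1, Algebra.algebraMap_eq_smul_one, TensorProduct.smul_tmul, smul_eq_mul, mul_one]
        rfl }
  comul_hom :=
    { map_act := by
        refine TensorProduct.ext' fun h x => ?_
        obtain ⟨a, rfl⟩ := hE.surj x
        simp only [LinearMap.comp_apply, LinearMap.lTensor_tmul]
        rw [hE.act_p, hE.comul_p, hE.comul_p, Bialgebra.comul_mul, hE.comul_ι]
        simp only [YDOps.tensor, LinearMap.comp_apply, LinearMap.rTensor_tmul]
        change _ = TensorProduct.map (𝓨).act (𝓨).act
            (TensorProduct.tensorTensorTensorComm k H H X X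
              ((Coalgebra.comul h : H ⊗[k] H) ⊗ₜ (TensorProduct.map p p (Coalgebra.comul a))))
        induction (Coalgebra.comul h : H ⊗[k] H) with
        | zero => simp
        | add x y hx hy => simp only [map_add, hx, hy, TensorProduct.add_tmul, add_mul]
        | tmul c d =>
          induction (Coalgebra.comul a : E ⊗[k] E) with
          | zero => simp
          | add x y hx hy => simp only [map_add, hx, hy, TensorProduct.tmul_add, mul_add]
          | tmul x y => simp [hE.act_p]
      map_coact := hE.comul_coact }
  counit_one := (hE.counit_p 1).trans Bialgebra.counit_one
  counit_mul x y := by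
    change Coalgebra.counit (R := k) (i ((𝓞).mul (x ⊗ₜ y))) = Coalgebra.counit (R := k) (i x) *
      Coalgebra.counit (R := k) (i y)
    rw [hE.i_mul, Bialgebra.counit_mul]
  comul_one := by
    refine (hE.comul_p 1).trans ?_
    rw [Bialgebra.comul_one, Algebra.TensorProduct.one_def, TensorProduct.map_tmul]
    rfl
  comul_mul := hE.comul_mul
  antipode_left x := by
    obtain ⟨a, rfl⟩ := hE.surj x
    apply hE.i_injective
    have e1 : ∀ t : E ⊗[k] E, i ((𝓞).mul (LinearMap.rTensor X (𝓞).antipode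
        (TensorProduct.map p p t))) = LinearMap.mul' k E
          (TensorProduct.map (coinvAntipode ι π) (thetaMap ι π) t) := by
      intro t
      induction t with
      | zero => simp
      | add x y hx hy => simp only [map_add, hx, hy]
      | tmul x y =>
        simp only [TensorProduct.map_tmul, LinearMap.rTensor_tmul, hE.i_mul, LinearMap.mul'_apply,
          hE.i_antipode_p, hE.i_p']
    rw [hE.comul_p, e1, map_smul i, hE.i_one, hE.counit_p, ← conv_apply, hE.antipode_conv_theta,
      ← Algebra.algebraMap_eq_smul_one]
    rfl
  antipode_right x := by
    obtain ⟨a, rfl⟩ := hE.surj x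
    apply hE.i_injective
    have e1 : ∀ t : E ⊗[k] E, i ((𝓞).mul (LinearMap.lTensor X (𝓞).antipode
        (TensorProduct.map p p t))) = LinearMap.mul' k E
          (TensorProduct.map (thetaMap ι π) (coinvAntipode ι π) t) := by
      intro t
      induction t with
      | zero => simp
      | add x y hx hy => simp only [map_add, hx, hy]
      | tmul x y =>
        simp only [TensorProduct.map_tmul, LinearMap.lTensor_tmul, hE.i_mul, LinearMap.mul'_apply,
          hE.i_antipode_p, hE.i_p']
    rw [hE.comul_p, e1, map_smul i, hE.i_one, hE.counit_p, ← conv_apply, hE.theta_conv_antipode,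
      ← Algebra.algebraMap_eq_smul_one]
    rfl

end Coinv

/-! ### Bialgebra maps and coinvariants for bare structure maps -/

section HopfMap

variable {k : Type*} [Field k] {A B C : Type*} [AddCommGroup A] [Module k A] [AddCommGroup B]
  [Module k B] [AddCommGroup C] [Module k C]

/-- Morphisms of bialgebras. -/
structure IsBialgHom (𝓐 : HopfOps k A) (𝓑 : HopfOps k B) (f : A →ₗ[k] B) : Prop where
  map_one : f 𝓐.one = 𝓑.one
  map_mul : ∀ x y, f (𝓐.mul (x ⊗ₜ y)) = 𝓑.mul (f x ⊗ₜ f y)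
  map_comul : ∀ x, 𝓑.comul (f x) = TensorProduct.map f f (𝓐.comul x)
  map_counit : ∀ x, 𝓑.counit (f x) = 𝓐.counit x

theorem IsBialgHom.comp {𝓐 : HopfOps k A} {𝓑 : HopfOps k B} {𝓒 : HopfOps k C} {g : B →ₗ[k] C}
    {f : A →ₗ[k] B} (hg : IsBialgHom 𝓑 𝓒 g) (hf : IsBialgHom 𝓐 𝓑 f) :
    IsBialgHom 𝓐 𝓒 (g ∘ₗ f) where
  map_one := by simp [hf.map_one, hg.map_one]
  map_mul x y := by simp [hf.map_mul, hg.map_mul]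
  map_comul x := by
    rw [LinearMap.comp_apply, hg.map_comul, hf.map_comul, TensorProduct.map_comp,
      LinearMap.comp_apply]
  map_counit x := by simp [hf.map_counit, hg.map_counit]

end HopfMap

section Coinv

variable {k : Type*} [Field k] {H : Type*} [Ring H] [HopfAlgebra k H]
variable {E : Type*} [AddCommGroup E] [Module k E] {X : Type*} [AddCommGroup X] [Module k X]

/-- A Hopf algebra `𝓔` with a projection to `H` and a model `X` of the coinvariants. -/
structure IsCoinvModel (𝓔 : HopfOps k E) (ι : H →ₗ[k] E) (π : E →ₗ[k] H) (i : X →ₗ[k] E)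
    (p : E →ₗ[k] X) : Prop where
  hopf : IsHopf 𝓔
  ι_hom : IsBialgHom (HopfOps.of k H) 𝓔 ι
  π_hom : IsBialgHom 𝓔 (HopfOps.of k H) π
  π_ι : ∀ h, π (ι h) = h
  p_i : ∀ x, p (i x) = x
  i_p : ∀ a, i (p a) = theta (HopfOps.of k H) 𝓔 ι π a

variable {𝓔 : HopfOps k E} {ι : H →ₗ[k] E} {π : E →ₗ[k] H} {i : X →ₗ[k] E} {p : E →ₗ[k] X}

/-- Replaces the structure maps `𝓔` by a Hopf algebra instance. -/
theorem IsCoinvModel.elim (h : IsCoinvModel 𝓔 ι π i p)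
    (motive : HopfOps k E → (H →ₗ[k] E) → (E →ₗ[k] H) → Prop)
    (ind : letI := h.hopf.ring; letI := h.hopf.hopfAlgebra;
      ∀ (ι' : H →ₐ[k] E) (π' : E →ₐ[k] H), CoinvModel ι' π' i p →
        motive (HopfOps.of k E) ι'.toLinearMap π'.toLinearMap) : motive 𝓔 ι π := by
  let := h.hopf.ring
  let := h.hopf.hopfAlgebra
  have e : HopfOps.of k E = 𝓔 := h.hopf.of_eq
  let ι' : H →ₐ[k] E := AlgHom.ofLinearMap ι h.ι_hom.map_one h.ι_hom.map_mul
  let π' : E →ₐ[k] H := AlgHom.ofLinearMap π h.π_hom.map_one h.π_hom.map_mul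
  have hm : CoinvModel ι' π' i p :=
    { comul_ι := h.ι_hom.map_comul
      counit_ι := h.ι_hom.map_counit
      comul_π := h.π_hom.map_comul
      counit_π := h.π_hom.map_counit
      π_ι := h.π_ι
      p_i := h.p_i
      i_p := fun a => by rw [e]; exact h.i_p a }
  have := ind ι' π' hm
  rw [e] at this
  exact this

theorem IsCoinvModel.isBraidedHopf (h : IsCoinvModel 𝓔 ι π i p) :
    IsBraidedHopf (HopfOps.of k H) (coinvOps (HopfOps.of k H) 𝓔 ι π i p)
      (coinvYD (HopfOps.of k H) 𝓔 ι π i p) :=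
  h.elim (fun 𝓔 ι π => IsBraidedHopf (HopfOps.of k H) (coinvOps (HopfOps.of k H) 𝓔 ι π i p)
      (coinvYD (HopfOps.of k H) 𝓔 ι π i p)) (by let := h.hopf.ring; let := h.hopf.hopfAlgebra; intro _ _ hm; exact hm.isBraidedHopf)

theorem IsCoinvModel.comul_p (h : IsCoinvModel 𝓔 ι π i p) (a : E) :
    (coinvOps (HopfOps.of k H) 𝓔 ι π i p).comul (p a) = TensorProduct.map p p (𝓔.comul a) :=
  h.elim (fun 𝓔 ι π => (coinvOps (HopfOps.of k H) 𝓔 ι π i p).comul (p a) =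
    TensorProduct.map p p (𝓔.comul a)) (by let := h.hopf.ring; let := h.hopf.hopfAlgebra; intro _ _ hm; exact hm.comul_p a)

theorem IsCoinvModel.act_p (h : IsCoinvModel 𝓔 ι π i p) (g : H) (a : E) :
    (coinvYD (HopfOps.of k H) 𝓔 ι π i p).act (g ⊗ₜ p a) = p (𝓔.mul (ι g ⊗ₜ a)) :=
  h.elim (fun 𝓔 ι π => (coinvYD (HopfOps.of k H) 𝓔 ι π i p).act (g ⊗ₜ p a) =
    p (𝓔.mul (ι g ⊗ₜ a))) (by let := h.hopf.ring; let := h.hopf.hopfAlgebra; intro _ _ hm; exact hm.act_p g a)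

end Coinv

/-! ### Inclusion and projection between `H` and `R # H` -/

section Radford

variable {k : Type*} [Field k] {H : Type*} [Ring H] [HopfAlgebra k H]
variable {R : Type*} [AddCommGroup R] [Module k R]
variable {𝓡 : HopfOps k R} {Y : YDOps k H R}

theorem radford_comul_tmul (𝓡 : HopfOps k R) (Y : YDOps k H R) (r : R) (h : H) :
    (radford (HopfOps.of k H) 𝓡 Y).comul (r ⊗ₜ h) =
      middle (crossCoact (HopfOps.of k H) Y) (𝓡.comul r ⊗ₜ Coalgebra.comul h) := rfl

theorem radford_mul_one_right (hR : IsBraidedHopf (HopfOps.of k H) 𝓡 Y) (r : R) (g h : H) :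
    (radford (HopfOps.of k H) 𝓡 Y).mul ((r ⊗ₜ g) ⊗ₜ (𝓡.one ⊗ₜ h)) = r ⊗ₜ (g * h) := by
  have := (isAlg_radford hR).mul_assoc (radfordInclR H R r) (radfordIncl 𝓡 g) (radfordIncl 𝓡 h)
  rw [radford_mul_incl hR, radford_mul_incl' hR, radford_mul_incl hR] at this
  exact this

theorem isBialgHom_radfordIncl (hR : IsBraidedHopf (HopfOps.of k H) 𝓡 Y) :
    IsBialgHom (HopfOps.of k H) (radford (HopfOps.of k H) 𝓡 Y) (radfordIncl 𝓡) where
  map_one := rfl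
  map_mul g h := (radford_mul_incl' hR g h).symm
  map_comul h := by
    refine (radford_comul_tmul 𝓡 Y 𝓡.one h).trans ?_
    rw [hR.comul_one]
    change _ = TensorProduct.map (radfordIncl 𝓡) (radfordIncl 𝓡) (Coalgebra.comul h)
    induction (Coalgebra.comul h : H ⊗[k] H) with
    | zero => simp
    | add x y hx hy => simp only [map_add, hx, hy, TensorProduct.tmul_add]
    | tmul a b =>
      rw [middle_tmul]
      refine (congrArg _ (crossCoact_tmul Y _ _)).trans ?_
      rw [coact_one hR]
      simp [radfordIncl]
  map_counit h := by simp [radford, radfordIncl, hR.counit_one]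

theorem radfordProj_tmul (𝓡 : HopfOps k R) (r : R) (h : H) :
    radfordProj 𝓡 (r ⊗ₜ h) = 𝓡.counit r • h := by simp [radfordProj]

/-- The projection applies the counit of `R` to `r⁽²⁾₍₀₎`. By colinearity of the counit the coaction
disappears, and the counit law of `R` restores `r`. -/
theorem lTensor_radfordProj_comul (hR : IsBraidedHopf (HopfOps.of k H) 𝓡 Y) (r : R) (h : H) :
    LinearMap.lTensor (R ⊗[k] H) (radfordProj 𝓡) ((radford (HopfOps.of k H) 𝓡 Y).comul (r ⊗ₜ h)) =
      LinearMap.rTensor H (TensorProduct.mk k R H r) (Coalgebra.comul h) := by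
  rw [radford_comul_tmul]
  have h4 : LinearMap.lTensor R 𝓡.counit (𝓡.comul r) = r ⊗ₜ 1 :=
    ((LinearEquiv.eq_symm_apply _).2 (hR.counit_right r)).trans
      (TensorProduct.rid_symm_apply _)
  have key : ∀ t : R ⊗[k] R, ∀ u : H ⊗[k] H, LinearMap.lTensor (R ⊗[k] H) (radfordProj 𝓡)
      (middle (crossCoact (HopfOps.of k H) Y) (t ⊗ₜ u)) =
      LinearMap.rTensor H (TensorProduct.mk k R H
        (TensorProduct.rid k R (LinearMap.lTensor R 𝓡.counit t))) u := by
    intro t u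
    induction t with
    | zero => simp
    | add x y hx hy => simp only [map_add, hx, hy, TensorProduct.add_tmul,
        LinearMap.rTensor_add, LinearMap.add_apply]
    | tmul a b =>
      induction u with
      | zero => simp
      | add x y hx hy => simp only [map_add, hx, hy, TensorProduct.tmul_add]
      | tmul c d =>
        rw [middle_tmul, crossCoact_tmul]
        have e1 : ∀ v : H ⊗[k] R, LinearMap.lTensor (R ⊗[k] H) (radfordProj 𝓡)
            (TensorProduct.map (TensorProduct.mk k R H a) ((TensorProduct.mk k R H).flip d)
              (LinearMap.rTensor R (LinearMap.mulRight k c) v)) =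
            (a ⊗ₜ (TensorProduct.rid k H (LinearMap.lTensor H 𝓡.counit v) * c)) ⊗ₜ d := by
          intro v
          induction v with
          | zero => simp
          | add x y hx hy => simp only [map_add, hx, hy, TensorProduct.tmul_add,
              TensorProduct.add_tmul, add_mul]
          | tmul x y => simp [radfordProj_tmul, TensorProduct.smul_tmul']
        rw [e1, counit_coact' hR]
        simp [TensorProduct.smul_tmul']
  rw [key, h4]
  simp

theorem isBialgHom_radfordProj (hR : IsBraidedHopf (HopfOps.of k H) 𝓡 Y) :
    IsBialgHom (radford (HopfOps.of k H) 𝓡 Y) (HopfOps.of k H) (radfordProj 𝓡) where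
  map_one := by simp [radford, radfordProj_tmul, hR.counit_one]
  map_mul x y := by
    induction x with
    | zero => simp
    | add x y hx hy => simp only [map_add, hx, hy, TensorProduct.add_tmul]
    | tmul r g =>
      induction y with
      | zero => simp
      | add x y hx hy => simp only [map_add, hx, hy, TensorProduct.tmul_add]
      | tmul s h =>
        rw [radford_mul_tmul]
        have key : ∀ u : H ⊗[k] H, radfordProj 𝓡 (LinearMap.rTensor H (𝓡.mulL r)
            (TensorProduct.map₂ Y.actL (LinearMap.mul k H) u (s ⊗ₜ h))) =
            (𝓡.counit r * 𝓡.counit s) •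
              (TensorProduct.lid k H (LinearMap.rTensor H Coalgebra.counit u) * h) := by
          intro u
          induction u with
          | zero => simp
          | add x y hx hy => simp only [map_add, LinearMap.add_apply, hx, hy, add_mul, smul_add]
          | tmul a b =>
            simp [radfordProj_tmul, hR.counit_mul, counit_act hR, smul_smul,
              mul_comm, mul_left_comm]
        refine (key (Coalgebra.comul g)).trans ?_
        simp [radfordProj_tmul, HopfOps.of, smul_smul, mul_comm]
  map_comul x := by
    induction x with
    | zero => simp
    | add x y hx hy => simp only [map_add, hx, hy]
    | tmul r h =>
      have h1 : TensorProduct.map (radfordProj 𝓡) (radfordProj 𝓡) =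
        LinearMap.rTensor H (radfordProj 𝓡) ∘ₗ
          LinearMap.lTensor (R ⊗[k] H) (radfordProj (H := H) 𝓡) := by
          rw [LinearMap.rTensor_comp_lTensor]
      rw [h1, LinearMap.comp_apply, lTensor_radfordProj_comul hR, radfordProj_tmul, map_smul]
      change _ • Coalgebra.comul h = _
      induction (Coalgebra.comul h : H ⊗[k] H) with
      | zero => simp
      | add x y hx hy => simp only [map_add, hx, hy, smul_add]
      | tmul a b => simp [radfordProj_tmul, TensorProduct.smul_tmul']
  map_counit x := by
    induction x with
    | zero => simp
    | add x y hx hy => simp only [map_add, hx, hy]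
    | tmul r h => simp [radfordProj_tmul, radford]

end Radford

/-! ### The same results over an arbitrary base Hopf algebra -/

section IsHopf

variable {k : Type*} [Field k] {A : Type*} [AddCommGroup A] [Module k A] {𝓐 : HopfOps k A}
variable {Q : Type*} [AddCommGroup Q] [Module k Q] {𝓠 : HopfOps k Q} {Z : YDOps k A Q}

/-- Replaces the structure maps `𝓐` by a Hopf algebra instance. -/
theorem IsHopf.elim (h : IsHopf 𝓐) (motive : HopfOps k A → Prop)
    (ind : letI := h.ring; letI := h.hopfAlgebra; motive (HopfOps.of k A)) : motive 𝓐 :=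
  h.of_eq ▸ ind

theorem IsHopf.isHopf_radford (h : IsHopf 𝓐) (hQ : IsBraidedHopf 𝓐 𝓠 Z) :
    IsHopf (radford 𝓐 𝓠 Z) :=
  h.elim (fun 𝓐 => IsBraidedHopf 𝓐 𝓠 Z → IsHopf (radford 𝓐 𝓠 Z))
    (by let := h.ring; let := h.hopfAlgebra; intro hQ; exact NicholsExt.isHopf_radford hQ) hQ

theorem IsHopf.isBialgHom_radfordIncl (h : IsHopf 𝓐) (hQ : IsBraidedHopf 𝓐 𝓠 Z) :
    IsBialgHom 𝓐 (radford 𝓐 𝓠 Z) (radfordIncl 𝓠) :=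
  h.elim (fun 𝓐 => IsBraidedHopf 𝓐 𝓠 Z → IsBialgHom 𝓐 (radford 𝓐 𝓠 Z) (radfordIncl 𝓠))
    (by let := h.ring; let := h.hopfAlgebra; intro hQ; exact NicholsExt.isBialgHom_radfordIncl hQ) hQ

theorem IsHopf.isBialgHom_radfordProj (h : IsHopf 𝓐) (hQ : IsBraidedHopf 𝓐 𝓠 Z) :
    IsBialgHom (radford 𝓐 𝓠 Z) 𝓐 (radfordProj 𝓠) :=
  h.elim (fun 𝓐 => IsBraidedHopf 𝓐 𝓠 Z → IsBialgHom (radford 𝓐 𝓠 Z) 𝓐 (radfordProj 𝓠))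
    (by let := h.ring; let := h.hopfAlgebra; intro hQ; exact NicholsExt.isBialgHom_radfordProj hQ) hQ

theorem IsHopf.radford_mul_one_right (h : IsHopf 𝓐) (hQ : IsBraidedHopf 𝓐 𝓠 Z) (x : Q)
    (a b : A) : (radford 𝓐 𝓠 Z).mul ((x ⊗ₜ a) ⊗ₜ (𝓠.one ⊗ₜ b)) = x ⊗ₜ 𝓐.mul (a ⊗ₜ b) :=
  h.elim (fun 𝓐 => IsBraidedHopf 𝓐 𝓠 Z →
    (radford 𝓐 𝓠 Z).mul ((x ⊗ₜ a) ⊗ₜ (𝓠.one ⊗ₜ b)) = x ⊗ₜ 𝓐.mul (a ⊗ₜ b))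
    (by let := h.ring; let := h.hopfAlgebra; intro hQ; exact NicholsExt.radford_mul_one_right hQ x a b) hQ

theorem IsHopf.lTensor_radfordProj_comul (h : IsHopf 𝓐) (hQ : IsBraidedHopf 𝓐 𝓠 Z) (x : Q)
    (a : A) : LinearMap.lTensor (Q ⊗[k] A) (radfordProj 𝓠) ((radford 𝓐 𝓠 Z).comul (x ⊗ₜ a)) =
      LinearMap.rTensor A (TensorProduct.mk k Q A x) (𝓐.comul a) :=
  h.elim (fun 𝓐 => IsBraidedHopf 𝓐 𝓠 Z →
    LinearMap.lTensor (Q ⊗[k] A) (radfordProj 𝓠) ((radford 𝓐 𝓠 Z).comul (x ⊗ₜ a)) =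
      LinearMap.rTensor A (TensorProduct.mk k Q A x) (𝓐.comul a))
    (by let := h.ring; let := h.hopfAlgebra; intro hQ; exact NicholsExt.lTensor_radfordProj_comul hQ x a) hQ

end IsHopf

/-! ### The braided biproduct as the coinvariants of `Q # (R # H) → H` -/

section Biproduct

variable {k : Type*} [Field k] {H : Type*} [Ring H] [HopfAlgebra k H]
variable {R : Type*} [AddCommGroup R] [Module k R] {Q : Type*} [AddCommGroup Q] [Module k Q]
variable {𝓡 : HopfOps k R} {Y : YDOps k H R} {𝓠 : HopfOps k Q} {Z : YDOps k (R ⊗[k] H) Q}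

@[simp] theorem toCoinv_tmul (x : Q) (r : R) :
    toCoinv (HopfOps.of k H) (x ⊗ₜ[k] r) = x ⊗ₜ (r ⊗ₜ (1 : H)) := rfl

@[simp] theorem ofCoinv_tmul (x : Q) (r : R) (h : H) :
    ofCoinv (HopfOps.of k H) (x ⊗ₜ[k] (r ⊗ₜ[k] h)) = x ⊗ₜ (Coalgebra.counit (R := k) h • r) := rfl

/-- Two applications of `lTensor_radfordProj_comul` leave only the comultiplication of `h`. Hence
`θ(x # r # h) = x # r # h₁ S(h₂) = ε(h) x # r # 1`. -/
theorem isCoinvModel_biproduct (hR : IsBraidedHopf (HopfOps.of k H) 𝓡 Y)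
    (hQ : IsBraidedHopf (radford (HopfOps.of k H) 𝓡 Y) 𝓠 Z) :
    IsCoinvModel (radford (radford (HopfOps.of k H) 𝓡 Y) 𝓠 Z) (biIncl 𝓡 𝓠) (biProj 𝓡 𝓠)
      (toCoinv (HopfOps.of k H)) (ofCoinv (HopfOps.of k H)) where
  hopf := (isHopf_radford hR).isHopf_radford hQ
  ι_hom := ((isHopf_radford hR).isBialgHom_radfordIncl hQ).comp (isBialgHom_radfordIncl hR)
  π_hom := (isBialgHom_radfordProj hR).comp ((isHopf_radford hR).isBialgHom_radfordProj hQ)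
  π_ι h := by simp [biProj, biIncl, radfordProj, radfordIncl, hR.counit_one, hQ.counit_one]
  p_i x := by
    induction x with
    | zero => simp
    | add x y hx hy => simp only [map_add, hx, hy]
    | tmul x r => simp
  i_p a := by
    induction a with
    | zero => simp
    | add x y hx hy => simp only [map_add, hx, hy]
    | tmul x a =>
      induction a with
      | zero => simp
      | add x y hx hy => simp only [map_add, hx, hy, TensorProduct.tmul_add]
      | tmul r h =>
        have h1 : LinearMap.lTensor (Q ⊗[k] (R ⊗[k] H)) (biProj 𝓡 𝓠)
            ((radford (radford (HopfOps.of k H) 𝓡 Y) 𝓠 Z).comul (x ⊗ₜ (r ⊗ₜ h))) =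
            LinearMap.rTensor H (TensorProduct.mk k Q (R ⊗[k] H) x ∘ₗ TensorProduct.mk k R H r)
              (Coalgebra.comul h) := by
          rw [biProj, LinearMap.lTensor_comp, LinearMap.comp_apply,
            (isHopf_radford hR).lTensor_radfordProj_comul hQ, ← LinearMap.comp_apply,
            LinearMap.lTensor_comp_rTensor, ← LinearMap.rTensor_comp_lTensor,
            LinearMap.comp_apply, lTensor_radfordProj_comul hR, ← LinearMap.comp_apply,
            ← LinearMap.rTensor_comp]
        simp only [theta, LinearMap.lTensor_comp, LinearMap.comp_apply]
        rw [h1, ofCoinv_tmul, toCoinv_tmul]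
        have h2 : ∀ u : H ⊗[k] H, (radford (radford (HopfOps.of k H) 𝓡 Y) 𝓠 Z).mul
            (LinearMap.lTensor (Q ⊗[k] (R ⊗[k] H)) (biIncl 𝓡 𝓠)
              (LinearMap.lTensor (Q ⊗[k] (R ⊗[k] H)) (HopfOps.of k H).antipode
              (LinearMap.rTensor H (TensorProduct.mk k Q (R ⊗[k] H) x ∘ₗ TensorProduct.mk k R H r)
                u))) =
            x ⊗ₜ (r ⊗ₜ LinearMap.mul' k H (LinearMap.lTensor H (HopfAlgebra.antipode k) u)) := by
          intro u
          induction u with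
          | zero => simp
          | add x y hx hy => simp only [map_add, hx, hy, TensorProduct.tmul_add]
          | tmul a b =>
            simp only [LinearMap.rTensor_tmul, LinearMap.lTensor_tmul, LinearMap.comp_apply,
              TensorProduct.mk_apply, biIncl, radfordIncl]
            rw [(isHopf_radford hR).radford_mul_one_right hQ, radford_mul_one_right hR]
            rfl
        rw [h2, HopfAlgebra.mul_antipode_lTensor_comul_apply, Algebra.algebraMap_eq_smul_one,
          TensorProduct.tmul_smul, TensorProduct.smul_tmul']

theorem isBraidedHopf_biproduct (hR : IsBraidedHopf (HopfOps.of k H) 𝓡 Y)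
    (hQ : IsBraidedHopf (radford (HopfOps.of k H) 𝓡 Y) 𝓠 Z) :
    IsBraidedHopf (HopfOps.of k H) (biOps (HopfOps.of k H) 𝓡 Y 𝓠 Z)
      (biYD (HopfOps.of k H) 𝓡 Y 𝓠 Z) :=
  (isCoinvModel_biproduct hR hQ).isBraidedHopf

end Biproduct

/-! ### Gradings given by projections, and tensor product gradings -/

section Proj

variable {k : Type*} [Field k] {M N : Type*} [AddCommGroup M] [Module k M] [AddCommGroup N]
  [Module k N] {F : ℕ → Submodule k M} {G : ℕ → Submodule k N}

/-- `p n` is the projection to the component `F n` of the graded vector space `M`. -/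
structure IsProj (F : ℕ → Submodule k M) (p : ℕ → M →ₗ[k] M) : Prop where
  iSup_eq : ⨆ n, F n = ⊤
  proj : ∀ m n, ∀ x ∈ F m, p n x = if m = n then x else 0

theorem exists_isProj (h : DirectSum.IsInternal F) : ∃ p, IsProj F p := by
  classical
  let e : (DirectSum ℕ fun n => F n) ≃ₗ[k] M :=
    LinearEquiv.ofBijective (DirectSum.coeLinearMap F) h
  refine ⟨fun n => (F n).subtype ∘ₗ DirectSum.component k ℕ (fun n => F n) n ∘ₗ e.symm.toLinearMap,
    h.submodule_iSup_eq_top, fun m n x hx => ?_⟩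
  have h1 : e (DirectSum.lof k ℕ (fun n => F n) m ⟨x, hx⟩) = x := DirectSum.coeLinearMap_lof F m _
  have h2 : e.symm x = DirectSum.lof k ℕ (fun n => F n) m ⟨x, hx⟩ :=
    (LinearEquiv.symm_apply_eq e).2 h1.symm
  simp only [LinearMap.comp_apply, LinearEquiv.coe_coe, h2, Submodule.subtype_apply]
  split_ifs with hmn
  · subst hmn
    rw [DirectSum.component.lof_self]
  · rw [DirectSum.component.of, dif_neg hmn]
    rfl

/-- Projections are easier to produce than uniqueness of decompositions: for tensor products they
are sums of tensor products of projections, for weights they come from maps on words. -/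
theorem IsProj.isInternal {p : ℕ → M →ₗ[k] M} (h : IsProj F p) : DirectSum.IsInternal F := by
  classical
  constructor
  · refine (injective_iff_map_eq_zero _).2 fun z hz => ?_
    have h1 : ∀ n, p n ∘ₗ DirectSum.coeLinearMap F =
        (F n).subtype ∘ₗ DirectSum.component k ℕ (fun n => F n) n := by
      intro n
      refine DirectSum.linearMap_ext k fun m => LinearMap.ext fun x => ?_
      simp only [LinearMap.comp_apply, DirectSum.coeLinearMap_lof, Submodule.subtype_apply]
      rw [h.proj m n x x.2]
      split_ifs with hmn
      · subst hmn
        rw [DirectSum.component.lof_self]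
      · rw [DirectSum.component.of, dif_neg hmn]
        rfl
    refine DFinsupp.ext fun n => Subtype.ext ?_
    have h2 := LinearMap.congr_fun (h1 n) z
    have hz' : DirectSum.coeLinearMap F z = 0 := hz
    rw [LinearMap.comp_apply, hz', map_zero] at h2
    exact h2.symm
  · have h1 : LinearMap.range (DirectSum.coeLinearMap F) = ⊤ := by
      rw [← h.iSup_eq, Submodule.iSup_eq_range_dfinsupp_lsum]
      rfl
    exact LinearMap.range_eq_top.1 h1

theorem IsProj.mem {p : ℕ → M →ₗ[k] M} (h : IsProj F p) (n : ℕ) (x : M) : p n x ∈ F n := by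
  have hx : x ∈ ⨆ n, F n := h.iSup_eq ▸ Submodule.mem_top
  induction hx using Submodule.iSup_induction' with
  | mem m x hx =>
    rw [h.proj m n x hx]
    split_ifs with hmn
    · exact hmn ▸ hx
    · exact zero_mem _
  | zero => simp
  | add x y _ _ hx hy => rw [map_add]; exact add_mem hx hy

theorem IsProj.self {p : ℕ → M →ₗ[k] M} (h : IsProj F p) {n : ℕ} {x : M} (hx : x ∈ F n) :
    p n x = x := by rw [h.proj n n x hx, if_pos rfl]

theorem IsProj.ne {p : ℕ → M →ₗ[k] M} (h : IsProj F p) {m n : ℕ} (hmn : m ≠ n) {x : M}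
    (hx : x ∈ F m) : p n x = 0 := by rw [h.proj m n x hx, if_neg hmn]

theorem tmul_mem_tensorGrading {m n : ℕ} {x : M} {y : N} (hx : x ∈ F m) (hy : y ∈ G n) :
    x ⊗ₜ[k] y ∈ tensorGrading F G (m + n) :=
  Submodule.mem_iSup_of_mem (m, n) (Submodule.mem_iSup_of_mem
    (Finset.HasAntidiagonal.mem_antidiagonal.2 rfl) (Submodule.apply_mem_map₂ _ hx hy))

theorem tmul_mem_tensorGrading_of_eq {l m n : ℕ} (h : m + n = l) {x : M} {y : N} (hx : x ∈ F m)
    (hy : y ∈ G n) : x ⊗ₜ[k] y ∈ tensorGrading F G l :=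
  h ▸ tmul_mem_tensorGrading hx hy

theorem tensorGrading_le {n : ℕ} {P : Submodule k (M ⊗[k] N)}
    (h : ∀ i j, i + j = n → ∀ x ∈ F i, ∀ y ∈ G j, x ⊗ₜ[k] y ∈ P) : tensorGrading F G n ≤ P :=
  iSup₂_le fun p hp => Submodule.map₂_le.2 fun x hx y hy =>
    h p.1 p.2 (Finset.HasAntidiagonal.mem_antidiagonal.1 hp) x hx y hy

theorem iSup_tensorGrading (hF : ⨆ n, F n = ⊤) (hG : ⨆ n, G n = ⊤) :
    ⨆ n, tensorGrading F G n = ⊤ := by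
  rw [eq_top_iff, ← TensorProduct.span_tmul_eq_top, Submodule.span_le]
  rintro _ ⟨x, y, rfl⟩
  have hx : x ∈ ⨆ n, F n := hF ▸ Submodule.mem_top
  have hy : y ∈ ⨆ n, G n := hG ▸ Submodule.mem_top
  change x ⊗ₜ[k] y ∈ ⨆ n, tensorGrading F G n
  induction hx using Submodule.iSup_induction' with
  | mem m x hx =>
    induction hy using Submodule.iSup_induction' with
    | mem n y hy => exact Submodule.mem_iSup_of_mem (m + n) (tmul_mem_tensorGrading hx hy)
    | zero => simp
    | add x y _ _ hx hy => rw [TensorProduct.tmul_add]; exact add_mem hx hy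
  | zero => simp
  | add x y _ _ hx hy => rw [TensorProduct.add_tmul]; exact add_mem hx hy

/-- The projections to the components of the tensor product grading. -/
def tensorProj (p : ℕ → M →ₗ[k] M) (q : ℕ → N →ₗ[k] N) (n : ℕ) : M ⊗[k] N →ₗ[k] M ⊗[k] N :=
  ∑ i ∈ Finset.HasAntidiagonal.antidiagonal n, TensorProduct.map (p i.1) (q i.2)

theorem IsProj.tensor {p : ℕ → M →ₗ[k] M} {q : ℕ → N →ₗ[k] N} (hp : IsProj F p)
    (hq : IsProj G q) : IsProj (tensorGrading F G) (tensorProj p q) where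
  iSup_eq := iSup_tensorGrading hp.iSup_eq hq.iSup_eq
  proj m n := by
    suffices tensorGrading F G m ≤
        LinearMap.eqLocus (tensorProj p q n) (if m = n then LinearMap.id else 0) by
      intro x hx
      have := this hx
      rw [LinearMap.mem_eqLocus] at this
      rw [this]
      split_ifs <;> rfl
    refine tensorGrading_le fun i j hij x hx y hy => ?_
    rw [LinearMap.mem_eqLocus, tensorProj, LinearMap.sum_apply]
    simp only [TensorProduct.map_tmul]
    split_ifs with hmn
    · rw [Finset.sum_eq_single (i, j)]
      · rw [hp.self hx, hq.self hy]; rfl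
      · rintro ⟨a, b⟩ hab hne
        rw [Finset.HasAntidiagonal.mem_antidiagonal] at hab
        have : i ≠ a := by rintro rfl; exact hne (by ext <;> simp; omega)
        rw [hp.ne this hx, TensorProduct.zero_tmul]
      · intro h; exact absurd (Finset.HasAntidiagonal.mem_antidiagonal.2 (hij.trans hmn)) h
    · refine Finset.sum_eq_zero ?_
      rintro ⟨a, b⟩ hab
      rw [Finset.HasAntidiagonal.mem_antidiagonal] at hab
      by_cases h : i = a
      · have : j ≠ b := by omega
        rw [hq.ne this hy, TensorProduct.tmul_zero]
      · rw [hp.ne h hx, TensorProduct.zero_tmul]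

theorem isInternal_tensorGrading (hF : DirectSum.IsInternal F) (hG : DirectSum.IsInternal G) :
    DirectSum.IsInternal (tensorGrading F G) := by
  obtain ⟨p, hp⟩ := exists_isProj hF
  obtain ⟨q, hq⟩ := exists_isProj hG
  exact (hp.tensor hq).isInternal

end Proj

/-! ### Linear maps of degree zero -/

section GradedMap

variable {k : Type*} [Field k] {M N P M' N' : Type*} [AddCommGroup M] [Module k M]
  [AddCommGroup N] [Module k N] [AddCommGroup P] [Module k P] [AddCommGroup M'] [Module k M']
  [AddCommGroup N'] [Module k N']
  {F : ℕ → Submodule k M} {G : ℕ → Submodule k N} {K : ℕ → Submodule k P}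
  {F' : ℕ → Submodule k M'} {G' : ℕ → Submodule k N'}

/-- Linear maps of degree zero. -/
def IsGradedMap (F : ℕ → Submodule k M) (G : ℕ → Submodule k N) (f : M →ₗ[k] N) : Prop :=
  ∀ n, ∀ x ∈ F n, f x ∈ G n

/-- The grading concentrated in degree `0`. -/
def trivGrading (k M : Type*) [Field k] [AddCommGroup M] [Module k M] (n : ℕ) : Submodule k M :=
  if n = 0 then ⊤ else ⊥

theorem mem_trivGrading_zero (x : M) : x ∈ trivGrading k M 0 := by simp [trivGrading]

theorem eq_zero_of_mem_trivGrading {n : ℕ} (hn : n ≠ 0) {x : M} (hx : x ∈ trivGrading k M n) :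
    x = 0 := by simpa [trivGrading, hn] using hx

theorem isGradedMap_triv (f : M →ₗ[k] N) (h : ∀ x, f x ∈ G 0) :
    IsGradedMap (trivGrading k M) G f := by
  intro n x hx
  rcases eq_or_ne n 0 with rfl | hn
  · exact h x
  · rw [eq_zero_of_mem_trivGrading hn hx, map_zero]; exact zero_mem _

theorem IsGradedMap.id : IsGradedMap F F LinearMap.id := fun _ _ h => h

theorem IsGradedMap.comp {f : M →ₗ[k] N} {g : N →ₗ[k] P} (hg : IsGradedMap G K g)
    (hf : IsGradedMap F G f) : IsGradedMap F K (g ∘ₗ f) := fun n x hx => hg n _ (hf n x hx)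

theorem isGradedMap_tensor {f : M ⊗[k] N →ₗ[k] P}
    (h : ∀ i j, ∀ x ∈ F i, ∀ y ∈ G j, f (x ⊗ₜ y) ∈ K (i + j)) :
    IsGradedMap (tensorGrading F G) K f := fun n _ ht =>
  (tensorGrading_le (P := (K n).comap f) fun i j hij x hx y hy => by
    subst hij
    exact h i j x hx y hy) ht

theorem IsGradedMap.map {f : M →ₗ[k] M'} {g : N →ₗ[k] N'} (hf : IsGradedMap F F' f)
    (hg : IsGradedMap G G' g) :
    IsGradedMap (tensorGrading F G) (tensorGrading F' G') (TensorProduct.map f g) :=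
  isGradedMap_tensor fun i j x hx y hy => tmul_mem_tensorGrading (hf i x hx) (hg j y hy)

theorem IsGradedMap.lTensor {g : N →ₗ[k] N'} (hg : IsGradedMap G G' g) :
    IsGradedMap (tensorGrading F G) (tensorGrading F G') (LinearMap.lTensor M g) :=
  IsGradedMap.id.map hg

theorem IsGradedMap.rTensor {f : M →ₗ[k] M'} (hf : IsGradedMap F F' f) :
    IsGradedMap (tensorGrading F G) (tensorGrading F' G) (LinearMap.rTensor N f) :=
  hf.map IsGradedMap.id

theorem isGradedMap_tensor_left {f : (M ⊗[k] N) ⊗[k] P →ₗ[k] M'}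
    (h : ∀ a b c, ∀ x ∈ F a, ∀ y ∈ G b, ∀ z ∈ K c, f ((x ⊗ₜ y) ⊗ₜ z) ∈ F' (a + b + c)) :
    IsGradedMap (tensorGrading (tensorGrading F G) K) F' f := by
  refine isGradedMap_tensor fun n c t ht z hz => ?_
  refine (tensorGrading_le (P := (F' (n + c)).comap (f ∘ₗ (TensorProduct.mk k _ _).flip z))
    fun a b hab x hx y hy => ?_) ht
  subst hab
  exact h a b c x hx y hy z hz

theorem isGradedMap_tensor_right {f : M ⊗[k] (N ⊗[k] P) →ₗ[k] M'}
    (h : ∀ a b c, ∀ x ∈ F a, ∀ y ∈ G b, ∀ z ∈ K c, f (x ⊗ₜ (y ⊗ₜ z)) ∈ F' (a + b + c)) :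
    IsGradedMap (tensorGrading F (tensorGrading G K)) F' f := by
  refine isGradedMap_tensor fun a n x hx t ht => ?_
  refine (tensorGrading_le (P := (F' (a + n)).comap (f ∘ₗ TensorProduct.mk k _ _ x))
    fun b c hbc y hy z hz => ?_) ht
  subst hbc
  rw [← add_assoc]
  exact h a b c x hx y hy z hz

theorem isGradedMap_assoc : IsGradedMap (tensorGrading (tensorGrading F G) K)
    (tensorGrading F (tensorGrading G K)) (TensorProduct.assoc k M N P).toLinearMap :=
  isGradedMap_tensor_left fun a b c x hx y hy z hz => by
    rw [add_assoc]
    exact tmul_mem_tensorGrading hx (tmul_mem_tensorGrading hy hz)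

theorem isGradedMap_assoc_symm : IsGradedMap (tensorGrading F (tensorGrading G K))
    (tensorGrading (tensorGrading F G) K) (TensorProduct.assoc k M N P).symm.toLinearMap :=
  isGradedMap_tensor_right fun _ _ _ _ hx _ hy _ hz =>
    tmul_mem_tensorGrading (tmul_mem_tensorGrading hx hy) hz

theorem isGradedMap_rightComm : IsGradedMap (tensorGrading (tensorGrading F G) K)
    (tensorGrading (tensorGrading F K) G) (TensorProduct.rightComm k M N P).toLinearMap :=
  isGradedMap_tensor_left fun a b c x hx y hy z hz => by
    rw [add_right_comm]
    exact tmul_mem_tensorGrading (tmul_mem_tensorGrading hx hz) hy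

theorem IsGradedMap.middle {f : N ⊗[k] P →ₗ[k] M' ⊗[k] N'} {Q : Type*} [AddCommGroup Q]
    [Module k Q] {L : ℕ → Submodule k Q}
    (hf : IsGradedMap (tensorGrading G K) (tensorGrading F' G') f) :
    IsGradedMap (tensorGrading (tensorGrading F G) (tensorGrading K L))
      (tensorGrading (tensorGrading F F') (tensorGrading G' L)) (middle f) :=
  isGradedMap_assoc_symm.comp ((IsGradedMap.lTensor (isGradedMap_assoc.comp
    (hf.rTensor.comp isGradedMap_assoc_symm))).comp isGradedMap_assoc)

theorem tensorGrading_triv_left (n : ℕ) :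
    tensorGrading (trivGrading k M) G n = tensorSub ⊤ (G n) := by
  refine le_antisymm (tensorGrading_le fun i j hij x hx y hy => ?_)
    (Submodule.map₂_le.2 fun x _ y hy => ?_)
  · rcases eq_or_ne i 0 with rfl | hi
    · rw [zero_add] at hij
      exact Submodule.apply_mem_map₂ _ Submodule.mem_top (hij ▸ hy)
    · rw [eq_zero_of_mem_trivGrading hi hx, TensorProduct.zero_tmul]; exact zero_mem _
  · have := tmul_mem_tensorGrading (mem_trivGrading_zero (k := k) x) hy
    rwa [zero_add] at this

theorem tensorGrading_triv_right (n : ℕ) :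
    tensorGrading F (trivGrading k N) n = tensorSub (F n) ⊤ := by
  refine le_antisymm (tensorGrading_le fun i j hij x hx y hy => ?_)
    (Submodule.map₂_le.2 fun x hx y _ => ?_)
  · rcases eq_or_ne j 0 with rfl | hj
    · rw [add_zero] at hij
      exact Submodule.apply_mem_map₂ _ (hij ▸ hx) Submodule.mem_top
    · rw [eq_zero_of_mem_trivGrading hj hy, TensorProduct.tmul_zero]; exact zero_mem _
  · have := tmul_mem_tensorGrading hx (mem_trivGrading_zero (k := k) y)
    rwa [add_zero] at this

/-- With `H` concentrated in degree zero, the grading of the biproduct is a tensor product grading,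
and the general results on such gradings apply. -/
theorem radfordGrading_eq {H : Type*} [AddCommGroup H] [Module k H] :
    radfordGrading H F = tensorGrading F (trivGrading k H) :=
  funext fun n => (tensorGrading_triv_right n).symm

theorem isInternal_trivGrading : DirectSum.IsInternal (trivGrading k M) := by
  let p : ℕ → M →ₗ[k] M := fun n => if n = 0 then LinearMap.id else 0
  suffices IsProj (trivGrading k M) p from this.isInternal
  refine ⟨?_, ?_⟩
  · exact eq_top_iff.2 fun x _ => Submodule.mem_iSup_of_mem 0 (mem_trivGrading_zero x)
  · intro m n x hx
    rcases eq_or_ne m 0 with rfl | hm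
    · rcases eq_or_ne n 0 with rfl | hn
      · simp [p]
      · simp [p, hn, hn.symm]
    · simp [eq_zero_of_mem_trivGrading hm hx]

end GradedMap

/-! ### Primitive maps and the comultiplication of products -/

section Braided

variable {k : Type*} [Field k] {H M N R : Type*} [AddCommGroup H] [Module k H]
  [AddCommGroup M] [Module k M] [AddCommGroup N] [Module k N] [AddCommGroup R] [Module k R]
variable {𝓗 : HopfOps k H} {𝓡 : HopfOps k R} {Y : YDOps k H R} {Z : YDOps k H M} {j : M →ₗ[k] R}

theorem braiding_tmul (Y : YDOps k H M) (Z : YDOps k H N) (m : M) (n : N) :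
    braiding Y Z (m ⊗ₜ n) = LinearMap.rTensor M (Z.actL.flip n) (Y.coact m) := by
  simp only [braiding, LinearMap.comp_apply, LinearEquiv.coe_coe, LinearMap.rTensor_tmul]
  induction Y.coact m with
  | zero => simp
  | add x y hx hy => simp only [map_add, hx, hy, TensorProduct.add_tmul]
  | tmul a b => simp

namespace IsBraidedHopf

theorem act_one (hR : IsBraidedHopf 𝓗 𝓡 Y) (h : H) :
    Y.act (h ⊗ₜ 𝓡.one) = 𝓗.counit h • 𝓡.one := by
  have := LinearMap.congr_fun hR.one_hom.map_act (h ⊗ₜ 1)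
  simpa [YDOps.trivial] using this.symm

theorem coact_one (hR : IsBraidedHopf 𝓗 𝓡 Y) : Y.coact 𝓡.one = 𝓗.one ⊗ₜ 𝓡.one := by
  have := LinearMap.congr_fun hR.one_hom.map_coact 1
  simpa [YDOps.trivial] using this

theorem act_mul (hR : IsBraidedHopf 𝓗 𝓡 Y) (h : H) (r s : R) :
    Y.act (h ⊗ₜ 𝓡.mul (r ⊗ₜ s)) =
      𝓡.mul (TensorProduct.map (Y.actL.flip r) (Y.actL.flip s) (𝓗.comul h)) := by
  have := LinearMap.congr_fun hR.mul_hom.map_act (h ⊗ₜ (r ⊗ₜ s))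
  simp only [LinearMap.comp_apply, LinearMap.lTensor_tmul, YDOps.tensor,
    LinearMap.rTensor_tmul, LinearEquiv.coe_coe] at this
  rw [← this]
  congr 1
  induction 𝓗.comul h with
  | zero => simp
  | add x y hx hy => simp only [map_add, hx, hy, TensorProduct.add_tmul]
  | tmul a b => simp

theorem coact_mul (hR : IsBraidedHopf 𝓗 𝓡 Y) (r s : R) :
    Y.coact (𝓡.mul (r ⊗ₜ s)) = TensorProduct.map 𝓗.mul 𝓡.mul
      (TensorProduct.tensorTensorTensorComm k H R H R (Y.coact r ⊗ₜ Y.coact s)) := by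
  have := LinearMap.congr_fun hR.mul_hom.map_coact (r ⊗ₜ s)
  simp only [LinearMap.comp_apply, YDOps.tensor, TensorProduct.map_tmul,
    LinearEquiv.coe_coe] at this
  rw [this, ← LinearMap.comp_apply, LinearMap.lTensor_comp_rTensor]

theorem braiding_one (hR : IsBraidedHopf 𝓗 𝓡 Y) (x : R) :
    braiding Y Y (𝓡.one ⊗ₜ x) = x ⊗ₜ 𝓡.one := by
  simp [braiding_tmul, hR.coact_one, hR.yd.one_act]

end IsBraidedHopf

/-- A Yetter-Drinfel'd module map `j` from `M` to the primitive elements of a braided Hopf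
algebra. -/
structure IsPrimitiveMap (𝓗 : HopfOps k H) (Z : YDOps k H M) (𝓡 : HopfOps k R) (Y : YDOps k H R)
    (j : M →ₗ[k] R) : Prop where
  hopf : IsBraidedHopf 𝓗 𝓡 Y
  ydHom : IsYDHom Z Y j
  comul_j : ∀ m, 𝓡.comul (j m) = 𝓡.one ⊗ₜ j m + j m ⊗ₜ 𝓡.one

theorem IsNichols.isPrimitiveMap {G : ℕ → Submodule k R} (h : IsNichols 𝓗 Z 𝓡 Y G j) :
    IsPrimitiveMap 𝓗 Z 𝓡 Y j :=
  ⟨h.hopf, h.ydHom, fun m => (h.primitive_iff _).1 (h.range_eq ▸ LinearMap.mem_range_self j m)⟩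

/-- `(h ⊗ m) ↦ (x ⊗ y ↦ h x ⊗ j(m) y)`. -/
def actMul (𝓡 : HopfOps k R) (Y : YDOps k H R) (j : M →ₗ[k] R) :
    H ⊗[k] M →ₗ[k] R ⊗[k] R →ₗ[k] R ⊗[k] R :=
  TensorProduct.map₂ Y.actL (𝓡.mulL ∘ₗ j)

@[simp] theorem actMul_tmul (h : H) (m : M) (x y : R) : actMul 𝓡 Y j (h ⊗ₜ m) (x ⊗ₜ y) =
    Y.act (h ⊗ₜ x) ⊗ₜ 𝓡.mul (j m ⊗ₜ y) := rfl

theorem IsPrimitiveMap.act_j (h : IsPrimitiveMap 𝓗 Z 𝓡 Y j) (a : H) (m : M) :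
    Y.act (a ⊗ₜ j m) = j (Z.act (a ⊗ₜ m)) :=
  (LinearMap.congr_fun h.ydHom.map_act (a ⊗ₜ m)).symm

theorem IsPrimitiveMap.coact_j (h : IsPrimitiveMap 𝓗 Z 𝓡 Y j) (m : M) :
    Y.coact (j m) = LinearMap.lTensor H j (Z.coact m) :=
  LinearMap.congr_fun h.ydHom.map_coact m

/-- `Δ(m x) = m x₁ ⊗ x₂ + m₋₁ x₁ ⊗ m₀ x₂`. This recursion computes the comultiplication of words
from the structure of `M` alone, hence by the same formula in every algebra with a primitive map
from `M`. -/
theorem IsPrimitiveMap.comul_j_mul (h : IsPrimitiveMap 𝓗 Z 𝓡 Y j) (m : M) (x : R) :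
    𝓡.comul (𝓡.mul (j m ⊗ₜ x)) = LinearMap.rTensor R (𝓡.mulL (j m)) (𝓡.comul x) +
      actMul 𝓡 Y j (Z.coact m) (𝓡.comul x) := by
  have := LinearMap.congr_fun h.hopf.comul_mul (j m ⊗ₜ x)
  simp only [LinearMap.comp_apply, TensorProduct.map_tmul] at this
  rw [this, h.comul_j]
  induction 𝓡.comul x with
  | zero => simp
  | add x y hx hy => simp only [map_add, hx, hy, TensorProduct.tmul_add]; abel
  | tmul a b =>
    rw [TensorProduct.add_tmul, map_add, map_add, middle_tmul, middle_tmul, h.hopf.braiding_one,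
      braiding_tmul, h.coact_j, add_comm]
    congr 1
    · simp [h.hopf.one_mul]
    · induction Z.coact m with
      | zero => simp
      | add x y hx hy => simp only [map_add, hx, hy, LinearMap.add_apply]
      | tmul c d => simp [h.hopf.one_mul]

end Braided

/-! ### Graded structure maps of biproducts -/

section GradedOps

variable {k : Type*} [Field k] {H M R : Type*} [AddCommGroup H] [Module k H]
  [AddCommGroup M] [Module k M] [AddCommGroup R] [Module k R]

/-- The structure maps of `𝓗`, except the antipode, are of degree zero. -/
structure IsGradedOps (𝓗 : HopfOps k H) (L : ℕ → Submodule k H) : Prop where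
  one_mem : 𝓗.one ∈ L 0
  mul : IsGradedMap (tensorGrading L L) L 𝓗.mul
  comul : IsGradedMap L (tensorGrading L L) 𝓗.comul
  counit : IsGradedMap L (trivGrading k k) 𝓗.counit

/-- Action and coaction of `Z` are of degree zero. -/
structure IsGradedYDOps (L : ℕ → Submodule k H) (Z : YDOps k H M) (D : ℕ → Submodule k M) :
    Prop where
  act : IsGradedMap (tensorGrading L D) D Z.act
  coact : IsGradedMap D (tensorGrading L D) Z.coact

theorem isGradedOps_triv (𝓗 : HopfOps k H) : IsGradedOps 𝓗 (trivGrading k H) where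
  one_mem := mem_trivGrading_zero _
  mul := isGradedMap_tensor fun i j x hx y hy => by
    rcases eq_or_ne i 0 with rfl | hi
    · rcases eq_or_ne j 0 with rfl | hj
      · exact mem_trivGrading_zero _
      · rw [eq_zero_of_mem_trivGrading hj hy, TensorProduct.tmul_zero, map_zero]
        exact zero_mem _
    · rw [eq_zero_of_mem_trivGrading hi hx, TensorProduct.zero_tmul, map_zero]
      exact zero_mem _
  comul := isGradedMap_triv _ fun x => by
    induction 𝓗.comul x with
    | zero => exact zero_mem _
    | add x y hx hy => exact add_mem hx hy
    | tmul a b =>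
      exact tmul_mem_tensorGrading_of_eq (add_zero 0) (mem_trivGrading_zero (k := k) a)
        (mem_trivGrading_zero (k := k) b)
  counit := isGradedMap_triv _ fun x => mem_trivGrading_zero _

variable {𝓗 : HopfOps k H} {L : ℕ → Submodule k H} {𝓡 : HopfOps k R} {Y : YDOps k H R}
  {G : ℕ → Submodule k R}

theorem IsGraded.isGradedOps (h : IsGraded 𝓡 G) : IsGradedOps 𝓡 G where
  one_mem := h.one_mem
  mul := isGradedMap_tensor h.mul_mem
  comul := h.comul_mem
  counit n x hx := by
    rcases eq_or_ne n 0 with rfl | hn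
    · exact mem_trivGrading_zero _
    · rw [h.counit_eq_zero n hn x hx]; exact zero_mem _

theorem IsGradedOps.isGraded (h : IsGradedOps 𝓡 G) (hG : DirectSum.IsInternal G) :
    IsGraded 𝓡 G where
  isInternal := hG
  one_mem := h.one_mem
  mul_mem _ _ _ hx _ hy := h.mul _ _ (tmul_mem_tensorGrading hx hy)
  comul_mem := h.comul
  counit_eq_zero n hn x hx := eq_zero_of_mem_trivGrading hn (h.counit n x hx)

theorem IsGradedYDOps.crossAct (h𝓗 : IsGradedOps 𝓗 L) (hY : IsGradedYDOps L Y G) :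
    IsGradedMap (tensorGrading L G) (tensorGrading G L) (crossAct 𝓗 Y) :=
  hY.act.rTensor.comp (isGradedMap_rightComm.comp h𝓗.comul.rTensor)

theorem IsGradedYDOps.crossCoact (h𝓗 : IsGradedOps 𝓗 L) (hY : IsGradedYDOps L Y G) :
    IsGradedMap (tensorGrading G L) (tensorGrading L G) (crossCoact 𝓗 Y) :=
  h𝓗.mul.rTensor.comp (isGradedMap_rightComm.comp hY.coact.rTensor)

theorem isGradedMap_lid_triv : IsGradedMap (tensorGrading (trivGrading k k) G) G
    (TensorProduct.lid k R).toLinearMap :=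
  isGradedMap_tensor fun i j c hc x hx => by
    rcases eq_or_ne i 0 with rfl | hi
    · rw [zero_add]
      exact (G j).smul_mem c hx
    · rw [eq_zero_of_mem_trivGrading hi hc, TensorProduct.zero_tmul, map_zero]
      exact zero_mem _

theorem isGradedMap_rid_triv : IsGradedMap (tensorGrading G (trivGrading k k)) G
    (TensorProduct.rid k R).toLinearMap :=
  isGradedMap_tensor fun i j x hx c hc => by
    rcases eq_or_ne j 0 with rfl | hj
    · rw [add_zero]
      exact (G i).smul_mem c hx
    · rw [eq_zero_of_mem_trivGrading hj hc, TensorProduct.tmul_zero, map_zero]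
      exact zero_mem _

theorem IsGradedOps.radford (h𝓗 : IsGradedOps 𝓗 L) (h𝓡 : IsGradedOps 𝓡 G)
    (hY : IsGradedYDOps L Y G) : IsGradedOps (radford 𝓗 𝓡 Y) (tensorGrading G L) where
  one_mem := tmul_mem_tensorGrading_of_eq (add_zero 0) h𝓡.one_mem h𝓗.one_mem
  mul := (h𝓡.mul.map h𝓗.mul).comp (hY.crossAct h𝓗).middle
  comul := (hY.crossCoact h𝓗).middle.comp (h𝓡.comul.map h𝓗.comul)
  counit := isGradedMap_lid_triv.comp (h𝓡.counit.map h𝓗.counit)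

end GradedOps

/-! ### Linear maps from linear relations -/

section LinearAlgebra

variable {k : Type*} [Field k] {V N N' : Type*} [AddCommGroup V] [Module k V]
  [AddCommGroup N] [Module k N] [AddCommGroup N'] [Module k N']

theorem exists_comp_eq_of_ker_le (f : V →ₗ[k] N) (g : V →ₗ[k] N')
    (h : LinearMap.ker f ≤ LinearMap.ker g) : ∃ ψ : N →ₗ[k] N', ψ ∘ₗ f = g := by
  obtain ⟨s, hs⟩ := f.rangeRestrict.exists_rightInverse_of_surjective f.range_rangeRestrict
  obtain ⟨ψ, hψ⟩ := LinearMap.exists_extend (g ∘ₗ s)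
  refine ⟨ψ, LinearMap.ext fun v => ?_⟩
  have h1 : ψ (f v) = g (s (f.rangeRestrict v)) := LinearMap.congr_fun hψ (f.rangeRestrict v)
  have h2 : f (s (f.rangeRestrict v)) = f v :=
    congrArg Subtype.val (LinearMap.congr_fun hs (f.rangeRestrict v))
  rw [LinearMap.comp_apply, h1]
  refine sub_eq_zero.1 ?_
  rw [← map_sub]
  exact h (by rw [LinearMap.mem_ker, map_sub, h2, sub_self])

/-- A family of linear relations whose sum is single-valued in each component is contained in the
graphs of linear maps. -/
theorem exists_linearMap_of_relations (S : ℕ → Submodule k (N × N'))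
    (h : ∀ z : DirectSum ℕ fun w => S w,
      DirectSum.toModule k ℕ N (fun w => LinearMap.fst k N N' ∘ₗ (S w).subtype) z = 0 →
      ∀ w, (z w : N × N').2 = 0) :
    ∃ ψ : ℕ → N →ₗ[k] N', ∀ w w', ∀ x ∈ S w', ψ w x.1 = if w' = w then x.2 else 0 := by
  let σ : (DirectSum ℕ fun w => S w) →ₗ[k] N :=
    DirectSum.toModule k ℕ N (fun w => LinearMap.fst k N N' ∘ₗ (S w).subtype)
  let τ : ℕ → (DirectSum ℕ fun w => S w) →ₗ[k] N' := fun w =>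
    LinearMap.snd k N N' ∘ₗ (S w).subtype ∘ₗ DirectSum.component k ℕ (fun w => S w) w
  have : ∀ w, ∃ ψ : N →ₗ[k] N', ψ ∘ₗ σ = τ w := by
    intro w
    refine exists_comp_eq_of_ker_le (k := k) (V := DirectSum ℕ fun w => S w) σ (τ w) fun z hz => ?_
    rw [LinearMap.mem_ker] at hz ⊢
    exact h z hz w
  choose ψ hψ using this
  refine ⟨ψ, fun w w' x hx => ?_⟩
  have h1 := LinearMap.congr_fun (hψ w) (DirectSum.lof k ℕ (fun w => S w) w' ⟨x, hx⟩)
  simp only [σ, τ, LinearMap.comp_apply, DirectSum.toModule_lof, Submodule.subtype_apply,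
    LinearMap.fst_apply] at h1
  rw [h1]
  split_ifs with hw
  · subst hw
    rw [DirectSum.component.lof_self]
    rfl
  · rw [DirectSum.component.of, dif_neg hw]
    rfl

end LinearAlgebra

/-! ### Corresponding words in two braided Hopf algebras -/

section BiWord

variable {k : Type*} [Field k] {H M N N' : Type*} [AddCommGroup H] [Module k H]
  [AddCommGroup M] [Module k M] [AddCommGroup N] [Module k N] [AddCommGroup N'] [Module k N']

/-- Pairs of corresponding products of `r` factors of total degree `n` in two algebras. -/
inductive IsBiWord (𝓝 : HopfOps k N) (j : M →ₗ[k] N) (𝓝' : HopfOps k N') (j' : M →ₗ[k] N')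
    (D : ℕ → Submodule k M) : ℕ → ℕ → N × N' → Prop
  | one : IsBiWord 𝓝 j 𝓝' j' D 0 0 (𝓝.one, 𝓝'.one)
  | cons {r i n : ℕ} {m : M} {x : N × N'} : m ∈ D i → IsBiWord 𝓝 j 𝓝' j' D r n x →
      IsBiWord 𝓝 j 𝓝' j' D (r + 1) (i + n) (𝓝.mul (j m ⊗ₜ x.1), 𝓝'.mul (j' m ⊗ₜ x.2))

/-- The span of the pairs of corresponding products. -/
def biSpan (𝓝 : HopfOps k N) (j : M →ₗ[k] N) (𝓝' : HopfOps k N') (j' : M →ₗ[k] N')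
    (D : ℕ → Submodule k M) (r n : ℕ) : Submodule k (N × N') :=
  Submodule.span k {x | IsBiWord 𝓝 j 𝓝' j' D r n x}

/-- The span of the pairs of tensor products of corresponding products. -/
def biTensor (𝓝 : HopfOps k N) (j : M →ₗ[k] N) (𝓝' : HopfOps k N') (j' : M →ₗ[k] N')
    (D : ℕ → Submodule k M) (r n : ℕ) : Submodule k ((N ⊗[k] N) × (N' ⊗[k] N')) :=
  Submodule.span k {t | ∃ r₁ r₂ n₁ n₂, r₁ + r₂ = r ∧ n₁ + n₂ = n ∧
    ∃ x ∈ biSpan 𝓝 j 𝓝' j' D r₁ n₁, ∃ y ∈ biSpan 𝓝 j 𝓝' j' D r₂ n₂,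
      t = (x.1 ⊗ₜ y.1, x.2 ⊗ₜ y.2)}

variable {𝓗 : HopfOps k H} {Z : YDOps k H M} {𝓝 : HopfOps k N} {Y : YDOps k H N}
  {j : M →ₗ[k] N} {𝓝' : HopfOps k N'} {Y' : YDOps k H N'} {j' : M →ₗ[k] N'}
  {L : ℕ → Submodule k H} {D : ℕ → Submodule k M}

theorem one_mem_biSpan : (𝓝.one, 𝓝'.one) ∈ biSpan 𝓝 j 𝓝' j' D 0 0 :=
  Submodule.subset_span IsBiWord.one

theorem cons_mem_biSpan {r i n : ℕ} {m : M} (hm : m ∈ D i) {x : N × N'}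
    (hx : x ∈ biSpan 𝓝 j 𝓝' j' D r n) :
    (𝓝.mul (j m ⊗ₜ x.1), 𝓝'.mul (j' m ⊗ₜ x.2)) ∈ biSpan 𝓝 j 𝓝' j' D (r + 1) (i + n) := by
  suffices biSpan 𝓝 j 𝓝' j' D r n ≤ (biSpan 𝓝 j 𝓝' j' D (r + 1) (i + n)).comap
      (LinearMap.prodMap (𝓝.mulL (j m)) (𝓝'.mulL (j' m))) from this hx
  exact Submodule.span_le.2 fun x hx => Submodule.subset_span (IsBiWord.cons hm hx)

/-- The action on a word is determined by the action on its letters, so it takes corresponding words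
to corresponding combinations of words of the same length. -/
theorem act_mem_biSpan (h : IsPrimitiveMap 𝓗 Z 𝓝 Y j) (h' : IsPrimitiveMap 𝓗 Z 𝓝' Y' j')
    (hL : IsGradedOps 𝓗 L) (hD : IsGradedYDOps L Z D) {r n c : ℕ} {a : H} (ha : a ∈ L c)
    {x : N × N'} (hx : x ∈ biSpan 𝓝 j 𝓝' j' D r n) :
    (Y.act (a ⊗ₜ x.1), Y'.act (a ⊗ₜ x.2)) ∈ biSpan 𝓝 j 𝓝' j' D r (c + n) := by
  -- The element `a` and its degree `c` stay general in the induction, because the rest of the word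
  -- is acted on by the second leg of `Δ(a)`.
  suffices ∀ x, IsBiWord 𝓝 j 𝓝' j' D r n x → ∀ c, ∀ a ∈ L c,
      (Y.act (a ⊗ₜ x.1), Y'.act (a ⊗ₜ x.2)) ∈ biSpan 𝓝 j 𝓝' j' D r (c + n) by
    have : biSpan 𝓝 j 𝓝' j' D r n ≤ (biSpan 𝓝 j 𝓝' j' D r (c + n)).comap
        (LinearMap.prodMap (Y.actL a) (Y'.actL a)) :=
      Submodule.span_le.2 fun x hx => this x hx c a ha
    exact this hx
  clear hx
  intro x hx
  induction hx with
  | one =>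
    intro c a ha
    rw [h.hopf.act_one, h'.hopf.act_one]
    rcases eq_or_ne c 0 with rfl | hc
    · exact Submodule.smul_mem _ _ one_mem_biSpan
    · rw [eq_zero_of_mem_trivGrading hc (hL.counit c a ha), zero_smul, zero_smul]
      exact zero_mem _
  | @cons r i n m x hm hx ih =>
    intro c a ha
    rw [h.hopf.act_mul, h'.hopf.act_mul]
    have : tensorGrading L L c ≤ (biSpan 𝓝 j 𝓝' j' D (r + 1) (c + (i + n))).comap
        (LinearMap.prod (𝓝.mul ∘ₗ TensorProduct.map (Y.actL.flip (j m)) (Y.actL.flip x.1))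
          (𝓝'.mul ∘ₗ TensorProduct.map (Y'.actL.flip (j' m)) (Y'.actL.flip x.2))) := by
      refine tensorGrading_le fun c₁ c₂ hc a ha b hb => ?_
      have h1 := cons_mem_biSpan (hD.act _ _ (tmul_mem_tensorGrading ha hm)) (ih c₂ b hb)
      rw [show c + (i + n) = c₁ + i + (c₂ + n) by omega]
      simpa [h.act_j, h'.act_j] using h1
    exact this (hL.comul c a ha)

theorem mul_mem_biSpan (h : IsBraidedHopf 𝓗 𝓝 Y) (h' : IsBraidedHopf 𝓗 𝓝' Y') {r n s l : ℕ}
    {x y : N × N'} (hx : x ∈ biSpan 𝓝 j 𝓝' j' D r n) (hy : y ∈ biSpan 𝓝 j 𝓝' j' D s l) :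
    (𝓝.mul (x.1 ⊗ₜ y.1), 𝓝'.mul (x.2 ⊗ₜ y.2)) ∈ biSpan 𝓝 j 𝓝' j' D (r + s) (n + l) := by
  suffices ∀ x, IsBiWord 𝓝 j 𝓝' j' D r n x →
      (𝓝.mul (x.1 ⊗ₜ y.1), 𝓝'.mul (x.2 ⊗ₜ y.2)) ∈ biSpan 𝓝 j 𝓝' j' D (r + s) (n + l) by
    have : biSpan 𝓝 j 𝓝' j' D r n ≤ (biSpan 𝓝 j 𝓝' j' D (r + s) (n + l)).comap
        (LinearMap.prodMap (𝓝.mulL.flip y.1) (𝓝'.mulL.flip y.2)) :=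
      Submodule.span_le.2 this
    exact this hx
  clear hx
  intro x hx
  induction hx with
  | one => rwa [h.one_mul, h'.one_mul, zero_add, zero_add]
  | @cons r i n m x hm hx ih =>
    rw [h.mul_assoc, h'.mul_assoc, add_right_comm, add_assoc i]
    exact cons_mem_biSpan hm ih

theorem tmul_mem_biTensor {r₁ r₂ n₁ n₂ r n : ℕ} (hr : r₁ + r₂ = r) (hn : n₁ + n₂ = n)
    {x y : N × N'} (hx : x ∈ biSpan 𝓝 j 𝓝' j' D r₁ n₁) (hy : y ∈ biSpan 𝓝 j 𝓝' j' D r₂ n₂) :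
    (x.1 ⊗ₜ y.1, x.2 ⊗ₜ y.2) ∈ biTensor 𝓝 j 𝓝' j' D r n :=
  Submodule.subset_span ⟨r₁, r₂, n₁, n₂, hr, hn, x, hx, y, hy, rfl⟩

/-- By the recursion `IsPrimitiveMap.comul_j_mul`, the comultiplications of corresponding words are
the same expression in tensor products of corresponding words, with total length and total weight
preserved. -/
theorem comul_mem_biTensor (h : IsPrimitiveMap 𝓗 Z 𝓝 Y j) (h' : IsPrimitiveMap 𝓗 Z 𝓝' Y' j')
    (hL : IsGradedOps 𝓗 L) (hD : IsGradedYDOps L Z D) {r n : ℕ} {x : N × N'}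
    (hx : x ∈ biSpan 𝓝 j 𝓝' j' D r n) :
    (𝓝.comul x.1, 𝓝'.comul x.2) ∈ biTensor 𝓝 j 𝓝' j' D r n := by
  suffices ∀ x, IsBiWord 𝓝 j 𝓝' j' D r n x →
      (𝓝.comul x.1, 𝓝'.comul x.2) ∈ biTensor 𝓝 j 𝓝' j' D r n by
    have : biSpan 𝓝 j 𝓝' j' D r n ≤ (biTensor 𝓝 j 𝓝' j' D r n).comap
        (LinearMap.prodMap 𝓝.comul 𝓝'.comul) := Submodule.span_le.2 this
    exact this hx
  clear hx
  intro x hx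
  induction hx with
  | one =>
    rw [h.hopf.comul_one, h'.hopf.comul_one]
    exact tmul_mem_biTensor (add_zero 0) (add_zero 0) one_mem_biSpan one_mem_biSpan
  | @cons r i n m x hm hx ih =>
    rw [h.comul_j_mul, h'.comul_j_mul]
    have : biTensor 𝓝 j 𝓝' j' D r n ≤ (biTensor 𝓝 j 𝓝' j' D (r + 1) (i + n)).comap
        (LinearMap.prodMap
          (LinearMap.rTensor N (𝓝.mulL (j m)) + actMul 𝓝 Y j (Z.coact m))
          (LinearMap.rTensor N' (𝓝'.mulL (j' m)) + actMul 𝓝' Y' j' (Z.coact m))) := by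
      refine Submodule.span_le.2 ?_
      rintro _ ⟨r₁, r₂, n₁, n₂, hr, hn, x, hx, y, hy, rfl⟩
      have h1 : (LinearMap.rTensor N (𝓝.mulL (j m)) (x.1 ⊗ₜ y.1),
          LinearMap.rTensor N' (𝓝'.mulL (j' m)) (x.2 ⊗ₜ y.2)) ∈
          biTensor 𝓝 j 𝓝' j' D (r + 1) (i + n) :=
        tmul_mem_biTensor (by omega) (by omega) (cons_mem_biSpan hm hx) hy
      have h2 : tensorGrading L D i ≤ (biTensor 𝓝 j 𝓝' j' D (r + 1) (i + n)).comap
          (LinearMap.prod ((actMul 𝓝 Y j).flip (x.1 ⊗ₜ y.1))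
            ((actMul 𝓝' Y' j').flip (x.2 ⊗ₜ y.2))) :=
        tensorGrading_le fun c i' hc a ha m hm =>
          tmul_mem_biTensor (by omega) (by omega) (act_mem_biSpan h h' hL hD ha hx)
            (cons_mem_biSpan hm hy)
      exact add_mem h1 (h2 (hD.coact i m hm))
    exact this ih

end BiWord

/-! ### Relations between words in Nichols algebras -/

section Nichols

variable {k : Type*} [Field k] {H M N N' : Type*} [AddCommGroup H] [Module k H]
  [AddCommGroup M] [Module k M] [AddCommGroup N] [Module k N] [AddCommGroup N'] [Module k N']
variable {𝓗 : HopfOps k H} {Z : YDOps k H M} {𝓝 : HopfOps k N} {Y : YDOps k H N}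
  {j : M →ₗ[k] N} {F : ℕ → Submodule k N} {𝓝' : HopfOps k N'} {Y' : YDOps k H N'}
  {j' : M →ₗ[k] N'} {F' : ℕ → Submodule k N'}
  {L : ℕ → Submodule k H} {D : ℕ → Submodule k M}

theorem IsNichols.j_mem (h : IsNichols 𝓗 Z 𝓝 Y F j) (m : M) : j m ∈ F 1 :=
  h.range_eq ▸ LinearMap.mem_range_self j m

/-- The elements `t` with `t T ⊆ T` form a subalgebra `T'`, which contains the generators and so is
everything. Applying it to the unit gives `T = ⊤`. -/
theorem IsNichols.eq_top_of_mul_mem (h : IsNichols 𝓗 Z 𝓝 Y F j) (T : Submodule k N)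
    (h1 : 𝓝.one ∈ T) (hT : ∀ m, ∀ x ∈ T, 𝓝.mul (j m ⊗ₜ x) ∈ T) : T = ⊤ := by
  let T' : Submodule k N :=
    { carrier := {t | ∀ x ∈ T, 𝓝.mul (t ⊗ₜ x) ∈ T}
      add_mem' := fun {a b} ha hb x hx => by
        rw [TensorProduct.add_tmul, map_add]; exact add_mem (ha x hx) (hb x hx)
      zero_mem' := fun x _ => by rw [TensorProduct.zero_tmul, map_zero]; exact zero_mem _
      smul_mem' := fun c a ha x hx => by
        rw [← TensorProduct.smul_tmul', map_smul]; exact T.smul_mem c (ha x hx) }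
  have hT' : T' = ⊤ := by
    refine h.generates T' (fun x hx => ?_) ?_ (fun a ha b hb x hx => ?_)
    · rwa [h.hopf.one_mul]
    · rw [← h.range_eq]
      rintro _ ⟨m, rfl⟩
      exact hT m
    · rw [h.hopf.mul_assoc]
      exact ha _ (hb x hx)
  refine eq_top_iff.2 fun x _ => ?_
  have hx : x ∈ T' := hT' ▸ Submodule.mem_top
  have := hx _ h1
  rwa [h.hopf.mul_one] at this

/-- Connectedness is not among the axioms of `IsNichols`. It follows from generation in degree one:
a word of positive length has no component in degree zero, and its counit vanishes. -/
theorem IsNichols.proj_zero (h : IsNichols 𝓗 Z 𝓝 Y F j) {p : ℕ → N →ₗ[k] N} (hp : IsProj F p) :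
    p 0 = LinearMap.toSpanSingleton k N 𝓝.one ∘ₗ 𝓝.counit := by
  suffices LinearMap.eqLocus (p 0) (LinearMap.toSpanSingleton k N 𝓝.one ∘ₗ 𝓝.counit) = ⊤ from
    LinearMap.ext fun x => LinearMap.mem_eqLocus.1 (this ▸ Submodule.mem_top)
  refine h.eq_top_of_mul_mem _ ?_ fun m x _ => ?_
  · simp [hp.self h.graded.one_mem, h.hopf.counit_one]
  · have h1 : p 0 ∘ₗ 𝓝.mulL (j m) = 0 := by
      refine LinearMap.ext fun x => ?_
      have hx : x ∈ ⨆ n, F n := hp.iSup_eq ▸ Submodule.mem_top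
      induction hx using Submodule.iSup_induction' with
      | mem n x hx =>
        exact hp.ne (by omega) (h.graded.mul_mem 1 n _ (h.j_mem m) x hx)
      | zero => simp
      | add x y _ _ hx hy => rw [map_add, hx, hy, map_add]
    rw [LinearMap.mem_eqLocus]
    refine (LinearMap.congr_fun h1 x).trans ?_
    simp [h.hopf.counit_mul, h.graded.counit_eq_zero 1 one_ne_zero _ (h.j_mem m)]

theorem IsNichols.eq_smul_one (h : IsNichols 𝓗 Z 𝓝 Y F j) {x : N} (hx : x ∈ F 0) :
    x = 𝓝.counit x • 𝓝.one := by
  obtain ⟨p, hp⟩ := exists_isProj h.graded.isInternal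
  rw [← hp.self hx, h.proj_zero hp]
  simp [h.hopf.counit_one]

theorem IsBraidedHopf.map_proj_comul_left (h : IsBraidedHopf 𝓗 𝓝 Y) {p : ℕ → N →ₗ[k] N}
    (hp : IsProj F p) (h0 : p 0 = LinearMap.toSpanSingleton k N 𝓝.one ∘ₗ 𝓝.counit) {r : ℕ}
    {y : N} (hy : y ∈ F r) : TensorProduct.map (p 0) (p r) (𝓝.comul y) = 𝓝.one ⊗ₜ y := by
  have h1 : TensorProduct.map (p 0) (p r) (𝓝.comul y) =
      𝓝.one ⊗ₜ p r (TensorProduct.lid k N (LinearMap.rTensor N 𝓝.counit (𝓝.comul y))) := by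
    rw [h0]
    induction 𝓝.comul y with
    | zero => simp
    | add x y hx hy => simp only [map_add, hx, hy, TensorProduct.tmul_add]
    | tmul a b => simp [TensorProduct.smul_tmul']
  rw [h1, h.counit_left, hp.self hy]

theorem IsBraidedHopf.map_proj_comul_right (h : IsBraidedHopf 𝓗 𝓝 Y) {p : ℕ → N →ₗ[k] N}
    (hp : IsProj F p) (h0 : p 0 = LinearMap.toSpanSingleton k N 𝓝.one ∘ₗ 𝓝.counit) {r : ℕ}
    {y : N} (hy : y ∈ F r) : TensorProduct.map (p r) (p 0) (𝓝.comul y) = y ⊗ₜ 𝓝.one := by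
  have h1 : TensorProduct.map (p r) (p 0) (𝓝.comul y) =
      p r (TensorProduct.rid k N (LinearMap.lTensor N 𝓝.counit (𝓝.comul y))) ⊗ₜ 𝓝.one := by
    rw [h0]
    induction 𝓝.comul y with
    | zero => simp
    | add x y hx hy => simp only [map_add, hx, hy, TensorProduct.add_tmul]
    | tmul a b => simp [TensorProduct.smul_tmul']
  rw [h1, h.counit_right, hp.self hy]

/-- By the counit laws the outer components of the comultiplication of `y` are `1 ⊗ y` and `y ⊗ 1`.
When the inner ones vanish, nothing else remains. -/
theorem IsBraidedHopf.comul_eq_of_proj (h : IsBraidedHopf 𝓗 𝓝 Y) (hF : IsGraded 𝓝 F)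
    {p : ℕ → N →ₗ[k] N} (hp : IsProj F p)
    (hp0 : p 0 = LinearMap.toSpanSingleton k N 𝓝.one ∘ₗ 𝓝.counit) {r : ℕ} (hr : 1 ≤ r) {y : N}
    (hy : y ∈ F r)
    (h0 : ∀ i l, i + l = r → i ≠ 0 → l ≠ 0 → TensorProduct.map (p i) (p l) (𝓝.comul y) = 0) :
    𝓝.comul y = 𝓝.one ⊗ₜ y + y ⊗ₜ 𝓝.one := by
  rw [← (hp.tensor hp).self (hF.comul_mem r y hy), tensorProj, LinearMap.sum_apply,
    Finset.sum_eq_add (0, r) (r, 0), h.map_proj_comul_left hp hp0 hy,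
    h.map_proj_comul_right hp hp0 hy]
  · simp; omega
  · rintro ⟨i, l⟩ hil hne
    rw [Finset.HasAntidiagonal.mem_antidiagonal] at hil
    refine h0 i l hil ?_ ?_
    · rintro rfl
      exact hne.1 (by ext <;> simp; omega)
    · rintro rfl
      exact hne.2 (by ext <;> simp; omega)
  · intro hn; exact absurd (Finset.HasAntidiagonal.mem_antidiagonal.2 (by simp)) hn
  · intro hn; exact absurd (Finset.HasAntidiagonal.mem_antidiagonal.2 (by simp)) hn

/-- Such an element is primitive, hence of degree one, but also of degree `r ≥ 2`. Only here does
the comparison of words use that primitive elements have degree one. -/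
theorem IsNichols.eq_zero_of_proj_comul (h : IsNichols 𝓗 Z 𝓝 Y F j) {p : ℕ → N →ₗ[k] N}
    (hp : IsProj F p) {r : ℕ} (hr : 2 ≤ r) {y : N} (hy : y ∈ F r)
    (h0 : ∀ i l, i + l = r → i ≠ 0 → l ≠ 0 → TensorProduct.map (p i) (p l) (𝓝.comul y) = 0) :
    y = 0 := by
  have hy1 := (h.primitive_iff y).2
    (h.hopf.comul_eq_of_proj h.graded hp (h.proj_zero hp) (by omega) hy h0)
  rw [← hp.self hy, hp.ne (by omega) hy1]

theorem IsBraidedHopf.comul_eq_of_mem_one (h : IsBraidedHopf 𝓗 𝓝 Y) (hF : IsGraded 𝓝 F)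
    (h0 : ∀ x ∈ F 0, x = 𝓝.counit x • 𝓝.one) {x : N} (hx : x ∈ F 1) :
    𝓝.comul x = 𝓝.one ⊗ₜ x + x ⊗ₜ 𝓝.one := by
  obtain ⟨p, hp⟩ := exists_isProj hF.isInternal
  refine h.comul_eq_of_proj hF hp ?_ le_rfl hx fun i l _ _ _ => by omega
  refine LinearMap.ext fun x => ?_
  have hx : x ∈ ⨆ n, F n := hp.iSup_eq ▸ Submodule.mem_top
  induction hx using Submodule.iSup_induction' with
  | mem n x hx =>
    rcases eq_or_ne n 0 with rfl | hn
    · rw [hp.self hx]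
      exact h0 x hx
    · rw [hp.ne hn hx]
      simp [hF.counit_eq_zero n hn x hx]
  | zero => simp
  | add x y _ _ hx hy => rw [map_add, map_add, hx, hy]

theorem IsNichols.isBiWord_mem (h : IsNichols 𝓗 Z 𝓝 Y F j) (h' : IsNichols 𝓗 Z 𝓝' Y' F' j')
    {r n : ℕ} {x : N × N'} (hx : IsBiWord 𝓝 j 𝓝' j' D r n x) : x.1 ∈ F r ∧ x.2 ∈ F' r := by
  induction hx with
  | one => exact ⟨h.graded.one_mem, h'.graded.one_mem⟩
  | @cons r i n m x hm hx ih =>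
    rw [add_comm]
    exact ⟨h.graded.mul_mem 1 r _ (h.j_mem m) _ ih.1, h'.graded.mul_mem 1 r _ (h'.j_mem m) _ ih.2⟩

theorem IsNichols.biSpan_mem (h : IsNichols 𝓗 Z 𝓝 Y F j) (h' : IsNichols 𝓗 Z 𝓝' Y' F' j')
    {r n : ℕ} {x : N × N'} (hx : x ∈ biSpan 𝓝 j 𝓝' j' D r n) : x.1 ∈ F r ∧ x.2 ∈ F' r := by
  have : biSpan 𝓝 j 𝓝' j' D r n ≤ Submodule.prod (F r) (F' r) :=
    Submodule.span_le.2 fun x hx => h.isBiWord_mem h' hx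
  exact this hx

theorem biSpan_ite_of_isBiWord {ψ : ℕ → N →ₗ[k] N'} {r : ℕ}
    (H : ∀ w w' x, IsBiWord 𝓝 j 𝓝' j' D r w' x → ψ w x.1 = if w' = w then x.2 else 0)
    (w w' : ℕ) (x : N × N') (hx : x ∈ biSpan 𝓝 j 𝓝' j' D r w') :
    ψ w x.1 = if w' = w then x.2 else 0 := by
  have : biSpan 𝓝 j 𝓝' j' D r w' ≤ LinearMap.eqLocus (ψ w ∘ₗ LinearMap.fst k N N')
      (if w' = w then LinearMap.snd k N N' else 0) := by
    refine Submodule.span_le.2 fun x hx => ?_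
    refine (H w w' x hx).trans ?_
    split_ifs <;> rfl
  refine (LinearMap.mem_eqLocus.1 (this hx)).trans ?_
  split_ifs <;> rfl

theorem IsNichols.exists_wordMap_zero (h : IsNichols 𝓗 Z 𝓝 Y F j) :
    ∃ ψ : ℕ → N →ₗ[k] N', ∀ w w', ∀ x ∈ biSpan 𝓝 j 𝓝' j' D 0 w',
      ψ w x.1 = if w' = w then x.2 else 0 := by
  let ψ : ℕ → N →ₗ[k] N' := fun w =>
    if 0 = w then LinearMap.toSpanSingleton k N' 𝓝'.one ∘ₗ 𝓝.counit else 0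
  refine ⟨ψ, biSpan_ite_of_isBiWord fun w w' x hx => ?_⟩
  cases hx
  simp only [ψ]
  split_ifs <;> simp [h.hopf.counit_one]

/-- Words of length one are the `j m`. As `j` is injective, the weight components of `m` can be
recovered. -/
theorem IsNichols.exists_wordMap_one (h : IsNichols 𝓗 Z 𝓝 Y F j)
    (h' : IsNichols 𝓗 Z 𝓝' Y' F' j') (hD : DirectSum.IsInternal D) :
    ∃ ψ : ℕ → N →ₗ[k] N', ∀ w w', ∀ x ∈ biSpan 𝓝 j 𝓝' j' D 1 w',
      ψ w x.1 = if w' = w then x.2 else 0 := by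
  obtain ⟨q, hq⟩ := exists_isProj hD
  obtain ⟨i, hi⟩ := j.exists_leftInverse_of_injective (LinearMap.ker_eq_bot.2 h.injective)
  refine ⟨fun w => j' ∘ₗ q w ∘ₗ i, biSpan_ite_of_isBiWord fun w w' x hx => ?_⟩
  cases hx with
  | @cons r l n m x hm hx =>
    cases hx
    have hi' : i (j m) = m := LinearMap.congr_fun hi m
    simp only [h.hopf.mul_one, h'.hopf.mul_one, LinearMap.comp_apply, hi', add_zero]
    rw [hq.proj l w m hm]
    split_ifs <;> simp

/-- A relation between words of length `r` in `N` must be shown to hold in `N'` for each weight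
separately. By `IsNichols.eq_zero_of_proj_comul` it suffices that the inner components of the
comultiplication vanish in `N'`. These are tensor products of shorter words, to which the maps given
by induction apply, so they are the image of the comultiplication of the relation in `N`, which is
zero. -/
theorem IsNichols.exists_wordMap (h : IsNichols 𝓗 Z 𝓝 Y F j)
    (h' : IsNichols 𝓗 Z 𝓝' Y' F' j') (hL : IsGradedOps 𝓗 L) (hZ : IsGradedYDOps L Z D)
    (hD : DirectSum.IsInternal D) (r : ℕ) :
    ∃ ψ : ℕ → N →ₗ[k] N', ∀ w w', ∀ x ∈ biSpan 𝓝 j 𝓝' j' D r w',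
      ψ w x.1 = if w' = w then x.2 else 0 := by
  induction r using Nat.strong_induction_on with
  | _ r ih =>
  rcases Nat.lt_or_ge r 2 with hr | hr
  -- Lengths zero and one are separate: the argument by primitive elements says nothing below degree
  -- two.
  · interval_cases r
    · exact h.exists_wordMap_zero
    · exact h.exists_wordMap_one h' hD
  obtain ⟨p, hp⟩ := exists_isProj h.graded.isInternal
  obtain ⟨p', hp'⟩ := exists_isProj h'.graded.isInternal
  refine exists_linearMap_of_relations (fun w => biSpan 𝓝 j 𝓝' j' D r w) fun z hz w => ?_
  refine h'.eq_zero_of_proj_comul hp' hr (h.biSpan_mem h' (z w).2).2 fun i l hil hi hl => ?_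
  obtain ⟨ψ, hψ⟩ := ih i (by omega)
  obtain ⟨φ, hφ⟩ := ih l (by omega)
  -- `Φ` selects the bidegree `(i, l)` and total weight `w`, and replaces words of `N` by the
  -- corresponding words of `N'`.
  let Φ : N ⊗[k] N →ₗ[k] N' ⊗[k] N' := ∑ a ∈ Finset.HasAntidiagonal.antidiagonal w,
    TensorProduct.map (ψ a.1 ∘ₗ p i) (φ a.2 ∘ₗ p l)
  have hΦ : ∀ w', ∀ t ∈ biTensor 𝓝 j 𝓝' j' D r w', Φ t.1 =
      if w' = w then TensorProduct.map (p' i) (p' l) t.2 else 0 := by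
    intro w'
    suffices biTensor 𝓝 j 𝓝' j' D r w' ≤ LinearMap.eqLocus (Φ ∘ₗ LinearMap.fst k _ _)
        (if w' = w then TensorProduct.map (p' i) (p' l) ∘ₗ LinearMap.snd k _ _ else 0) by
      intro t ht
      refine (LinearMap.mem_eqLocus.1 (this ht)).trans ?_
      split_ifs <;> rfl
    refine Submodule.span_le.2 ?_
    rintro _ ⟨r₁, r₂, n₁, n₂, hr', hn, x, hx, y, hy, rfl⟩
    have mx := h.biSpan_mem h' hx
    have my := h.biSpan_mem h' hy
    change Φ (x.1 ⊗ₜ y.1) = _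
    simp only [Φ, LinearMap.sum_apply, TensorProduct.map_tmul, LinearMap.comp_apply]
    by_cases h1 : r₁ = i
    · have h2 : r₂ = l := by omega
      subst h1 h2
      rw [hp.self mx.1, hp.self my.1]
      simp only [hψ _ _ x hx, hφ _ _ y hy]
      split_ifs with hw
      · rw [Finset.sum_eq_single (n₁, n₂)]
        · simp [hp'.self mx.2, hp'.self my.2]
        · rintro ⟨a, b⟩ hab hne
          rw [Finset.HasAntidiagonal.mem_antidiagonal] at hab
          have : n₁ ≠ a := by rintro rfl; exact hne (by ext <;> simp; omega)
          simp [this]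
        · intro hne; exact absurd (Finset.HasAntidiagonal.mem_antidiagonal.2 (hn.trans hw)) hne
      · refine Finset.sum_eq_zero ?_
        rintro ⟨a, b⟩ hab
        rw [Finset.HasAntidiagonal.mem_antidiagonal] at hab
        by_cases ha : n₁ = a
        · have : n₂ ≠ b := by omega
          simp [this]
        · simp [ha]
    · rw [hp.ne h1 mx.1]
      simp only [map_zero, TensorProduct.zero_tmul, Finset.sum_const_zero]
      split_ifs
      · simp [hp'.ne h1 mx.2]
      · rfl
  -- For a formal combination of pairs of words: the `(i, l)` component of the comultiplication of
  -- its weight `w` part in `N'` depends only on its total value in `N`.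
  have key : TensorProduct.map (p' i) (p' l) ∘ₗ 𝓝'.comul ∘ₗ LinearMap.snd k N N' ∘ₗ
      (biSpan 𝓝 j 𝓝' j' D r w).subtype ∘ₗ
        DirectSum.component k ℕ (fun w => biSpan 𝓝 j 𝓝' j' D r w) w =
      Φ ∘ₗ 𝓝.comul ∘ₗ DirectSum.toModule k ℕ N
        (fun w => LinearMap.fst k N N' ∘ₗ (biSpan 𝓝 j 𝓝' j' D r w).subtype) := by
    refine DirectSum.linearMap_ext k fun w' => LinearMap.ext fun s => ?_
    simp only [LinearMap.comp_apply, DirectSum.toModule_lof, Submodule.subtype_apply]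
    refine Eq.trans ?_ (hΦ w' _ (comul_mem_biTensor h.isPrimitiveMap h'.isPrimitiveMap hL hZ
      s.2)).symm
    split_ifs with hw
    · subst hw
      rw [DirectSum.component.lof_self]
      rfl
    · rw [DirectSum.component.of, dif_neg hw]
      simp
  refine (LinearMap.congr_fun key z).trans ?_
  rw [LinearMap.comp_apply, LinearMap.comp_apply, hz, map_zero, map_zero]

end Nichols

/-! ### The weight grading of a Nichols algebra -/

section Weight

variable {k : Type*} [Field k] {H M N N' : Type*} [AddCommGroup H] [Module k H]
  [AddCommGroup M] [Module k M] [AddCommGroup N] [Module k N] [AddCommGroup N'] [Module k N']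
variable {𝓗 : HopfOps k H} {Z : YDOps k H M} {𝓝 : HopfOps k N} {Y : YDOps k H N}
  {j : M →ₗ[k] N} {F : ℕ → Submodule k N} {L : ℕ → Submodule k H} {D : ℕ → Submodule k M}

theorem exists_linearMap_eq_on (hF : DirectSum.IsInternal F) (f : ℕ → N →ₗ[k] N') :
    ∃ g : N →ₗ[k] N', ∀ n, ∀ x ∈ F n, g x = f n x := by
  let e : (DirectSum ℕ fun n => F n) ≃ₗ[k] N :=
    LinearEquiv.ofBijective (DirectSum.coeLinearMap F) hF
  refine ⟨DirectSum.toModule k ℕ N' (fun n => f n ∘ₗ (F n).subtype) ∘ₗ e.symm.toLinearMap,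
    fun n x hx => ?_⟩
  have h1 : e (DirectSum.lof k ℕ (fun n => F n) n ⟨x, hx⟩) = x := DirectSum.coeLinearMap_lof F n _
  rw [LinearMap.comp_apply, LinearEquiv.coe_coe, (LinearEquiv.symm_apply_eq e).2 h1.symm,
    DirectSum.toModule_lof]
  rfl

theorem IsWord.exists_isBiWord {n : ℕ} {x : N} (hx : IsWord 𝓝 j D n x) :
    ∃ r, IsBiWord 𝓝 j 𝓝 j D r n (x, x) := by
  induction hx with
  | one => exact ⟨0, IsBiWord.one⟩
  | cons hm _ ih =>
    obtain ⟨r, hr⟩ := ih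
    exact ⟨r + 1, IsBiWord.cons hm hr⟩

theorem IsBiWord.isWord {r n : ℕ} {x : N × N} (hx : IsBiWord 𝓝 j 𝓝 j D r n x) :
    x.1 = x.2 ∧ IsWord 𝓝 j D n x.1 := by
  induction hx with
  | one => exact ⟨rfl, IsWord.one⟩
  | cons hm _ ih => exact ⟨by rw [ih.1], IsWord.cons hm ih.2⟩

theorem fst_mem_weightGrading {r n : ℕ} {x : N × N} (hx : x ∈ biSpan 𝓝 j 𝓝 j D r n) :
    x.1 ∈ weightGrading 𝓝 j D n := by
  have : biSpan 𝓝 j 𝓝 j D r n ≤ (weightGrading 𝓝 j D n).comap (LinearMap.fst k N N) :=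
    Submodule.span_le.2 fun x hx => Submodule.subset_span hx.isWord.2
  exact this hx

theorem weightGrading_le {n : ℕ} {P : Submodule k N}
    (h : ∀ r x, (x, x) ∈ biSpan 𝓝 j 𝓝 j D r n → x ∈ P) : weightGrading 𝓝 j D n ≤ P :=
  Submodule.span_le.2 fun x hx => by
    obtain ⟨r, hr⟩ := IsWord.exists_isBiWord hx
    exact h r x (Submodule.subset_span hr)

theorem cons_mem_weightGrading {i n : ℕ} {m : M} (hm : m ∈ D i) {x : N}
    (hx : x ∈ weightGrading 𝓝 j D n) : 𝓝.mul (j m ⊗ₜ x) ∈ weightGrading 𝓝 j D (i + n) := by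
  have : weightGrading 𝓝 j D n ≤ (weightGrading 𝓝 j D (i + n)).comap (𝓝.mulL (j m)) :=
    Submodule.span_le.2 fun x hx => Submodule.subset_span (IsWord.cons hm hx)
  exact this hx

theorem one_mem_weightGrading : 𝓝.one ∈ weightGrading 𝓝 j D 0 :=
  Submodule.subset_span IsWord.one

theorem IsNichols.counit_j_mul (h : IsNichols 𝓗 Z 𝓝 Y F j) (m : M) (x : N) :
    𝓝.counit (𝓝.mul (j m ⊗ₜ x)) = 0 := by
  rw [h.hopf.counit_mul, h.graded.counit_eq_zero 1 one_ne_zero _ (h.j_mem m), zero_mul]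

/-- The closure properties of pairs of words, used with both algebras equal, say that the structure
maps preserve weights. -/
theorem IsNichols.isGradedOps_weightGrading (h : IsNichols 𝓗 Z 𝓝 Y F j) (hL : IsGradedOps 𝓗 L)
    (hZ : IsGradedYDOps L Z D) : IsGradedOps 𝓝 (weightGrading 𝓝 j D) where
  one_mem := one_mem_weightGrading
  mul := isGradedMap_tensor fun n l x hx y hy => by
    have : weightGrading 𝓝 j D n ≤ (weightGrading 𝓝 j D (n + l)).comap (𝓝.mulL.flip y) :=
      weightGrading_le fun r x hx => by
        have : weightGrading 𝓝 j D l ≤ (weightGrading 𝓝 j D (n + l)).comap (𝓝.mulL x) :=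
          weightGrading_le fun s y hy => fst_mem_weightGrading (mul_mem_biSpan h.hopf h.hopf hx hy)
        exact this hy
    exact this hx
  comul n := by
    suffices weightGrading 𝓝 j D n ≤
        (tensorGrading (weightGrading 𝓝 j D) (weightGrading 𝓝 j D) n).comap 𝓝.comul from
      fun x hx => this hx
    refine weightGrading_le fun r x hx => ?_
    have h1 := comul_mem_biTensor h.isPrimitiveMap h.isPrimitiveMap hL hZ hx
    have h2 : biTensor 𝓝 j 𝓝 j D r n ≤
        (tensorGrading (weightGrading 𝓝 j D) (weightGrading 𝓝 j D) n).comap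
          (LinearMap.fst k _ _) := by
      refine Submodule.span_le.2 ?_
      rintro _ ⟨r₁, r₂, n₁, n₂, hr, hn, x, hx, y, hy, rfl⟩
      exact tmul_mem_tensorGrading_of_eq hn (fst_mem_weightGrading hx) (fst_mem_weightGrading hy)
    exact h2 h1
  counit n := by
    suffices weightGrading 𝓝 j D n ≤ (trivGrading k k n).comap 𝓝.counit from fun x hx => this hx
    refine Submodule.span_le.2 fun x hx => ?_
    cases hx with
    | one => exact mem_trivGrading_zero _
    | @cons i n m x hm hx =>
      change 𝓝.counit (𝓝.mul (j m ⊗ₜ x)) ∈ trivGrading k k (i + n)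
      rw [h.counit_j_mul]
      exact zero_mem _

theorem IsNichols.isGradedYDOps_weightGrading (h : IsNichols 𝓗 Z 𝓝 Y F j)
    (hL : IsGradedOps 𝓗 L) (hZ : IsGradedYDOps L Z D) :
    IsGradedYDOps L Y (weightGrading 𝓝 j D) where
  act := isGradedMap_tensor fun c n a ha x hx => by
    have : weightGrading 𝓝 j D n ≤ (weightGrading 𝓝 j D (c + n)).comap (Y.actL a) :=
      weightGrading_le fun r x hx => fst_mem_weightGrading
        (act_mem_biSpan h.isPrimitiveMap h.isPrimitiveMap hL hZ ha hx)
    exact this hx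
  coact n := by
    suffices weightGrading 𝓝 j D n ≤
        (tensorGrading L (weightGrading 𝓝 j D) n).comap Y.coact from fun x hx => this hx
    refine Submodule.span_le.2 fun x hx => ?_
    change Y.coact x ∈ tensorGrading L (weightGrading 𝓝 j D) n
    induction hx with
    | one =>
      rw [h.hopf.coact_one]
      exact tmul_mem_tensorGrading_of_eq (add_zero 0) hL.one_mem one_mem_weightGrading
    | @cons i n m x hm hx ih =>
      rw [h.hopf.coact_mul, h.isPrimitiveMap.coact_j]
      have h1 : tensorGrading L D i ≤ (tensorGrading L (weightGrading 𝓝 j D) (i + n)).comap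
          (TensorProduct.map 𝓗.mul 𝓝.mul ∘ₗ
            (TensorProduct.tensorTensorTensorComm k H N H N).toLinearMap ∘ₗ
            (TensorProduct.mk k _ _).flip (Y.coact x) ∘ₗ LinearMap.lTensor H j) := by
        refine tensorGrading_le fun c i' hc a ha m hm => ?_
        have h2 : tensorGrading L (weightGrading 𝓝 j D) n ≤
            (tensorGrading L (weightGrading 𝓝 j D) (i + n)).comap
            (TensorProduct.map 𝓗.mul 𝓝.mul ∘ₗ
            (TensorProduct.tensorTensorTensorComm k H N H N).toLinearMap ∘ₗ
            TensorProduct.mk k _ _ (a ⊗ₜ j m)) := by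
          refine tensorGrading_le fun d n' hd b hb y hy => ?_
          exact tmul_mem_tensorGrading_of_eq (show c + d + (i' + n') = i + n by omega)
            (hL.mul _ _ (tmul_mem_tensorGrading ha hb)) (cons_mem_weightGrading hm hy)
        exact h2 ih
      exact h1 (hZ.coact i m hm)

theorem IsNichols.iSup_weightGrading (h : IsNichols 𝓗 Z 𝓝 Y F j) (hD : ⨆ n, D n = ⊤) :
    ⨆ n, weightGrading 𝓝 j D n = ⊤ := by
  refine h.eq_top_of_mul_mem _ (Submodule.mem_iSup_of_mem 0 one_mem_weightGrading)
    fun m x hx => ?_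
  have hm : m ∈ ⨆ n, D n := hD ▸ Submodule.mem_top
  induction hm using Submodule.iSup_induction' with
  | mem i m hm =>
    induction hx using Submodule.iSup_induction' with
    | mem n x hx => exact Submodule.mem_iSup_of_mem (i + n) (cons_mem_weightGrading hm hx)
    | zero => rw [TensorProduct.tmul_zero, map_zero]; exact zero_mem _
    | add x y _ _ hx hy => rw [TensorProduct.tmul_add, map_add]; exact add_mem hx hy
  | zero => rw [map_zero, TensorProduct.zero_tmul, map_zero]; exact zero_mem _
  | add x y _ _ hx hy => rw [map_add, TensorProduct.add_tmul, map_add]; exact add_mem hx hy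

/-- With both Nichols algebras equal, the maps of `IsNichols.exists_wordMap` are the weight
projections on words of fixed length. They are assembled over all lengths by means of the grading
`F`. -/
theorem IsNichols.isInternal_weightGrading (h : IsNichols 𝓗 Z 𝓝 Y F j) (hL : IsGradedOps 𝓗 L)
    (hZ : IsGradedYDOps L Z D) (hD : DirectSum.IsInternal D) :
    DirectSum.IsInternal (weightGrading 𝓝 j D) := by
  choose ψ hψ using h.exists_wordMap h hL hZ hD
  choose P hP using fun w => exists_linearMap_eq_on h.graded.isInternal (fun r => ψ r w)
  refine IsProj.isInternal (p := P) ⟨h.iSup_weightGrading hD.submodule_iSup_eq_top,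
    fun n w => ?_⟩
  suffices weightGrading 𝓝 j D n ≤
      LinearMap.eqLocus (P w) (if n = w then LinearMap.id else 0) by
    intro x hx
    refine (LinearMap.mem_eqLocus.1 (this hx)).trans ?_
    split_ifs <;> rfl
  refine weightGrading_le fun r x hx => ?_
  rw [LinearMap.mem_eqLocus, hP w r x (h.biSpan_mem h hx).1]
  refine (hψ r w n _ hx).trans ?_
  split_ifs <;> rfl

/-- The grading with `M` in degree `1`. -/
def degreeOne (k M : Type*) [Field k] [AddCommGroup M] [Module k M] (n : ℕ) : Submodule k M :=
  if n = 1 then ⊤ else ⊥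

theorem isGradedYDOps_degreeOne (Z : YDOps k H M) :
    IsGradedYDOps (trivGrading k H) Z (degreeOne k M) where
  act n t ht := by
    rcases eq_or_ne n 1 with rfl | hn
    · simp [degreeOne]
    · rw [tensorGrading_triv_left] at ht
      simp only [degreeOne, if_neg hn, tensorSub, Submodule.map₂_bot_right] at ht ⊢
      rw [(Submodule.mem_bot k).1 ht, map_zero]
      exact zero_mem _
  coact n x hx := by
    rcases eq_or_ne n 1 with rfl | hn
    · rw [tensorGrading_triv_left]
      simp [degreeOne, tensorSub, TensorProduct.map₂_mk_top_top_eq_top]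
    · simp only [degreeOne, if_neg hn, Submodule.mem_bot] at hx
      rw [hx, map_zero]
      exact zero_mem _

/-- The words of length `n` lie in `F n` and together span the algebra, so the projections of `F`
are projections for the weight grading too, and the two coincide. -/
theorem IsNichols.weightGrading_degreeOne (h : IsNichols 𝓗 Z 𝓝 Y F j) :
    weightGrading 𝓝 j (degreeOne k M) = F := by
  have h1 : ∀ n, weightGrading 𝓝 j (degreeOne k M) n ≤ F n := by
    intro n
    refine Submodule.span_le.2 fun x hx => ?_
    change x ∈ F n
    induction hx with
    | one => exact h.graded.one_mem
    | @cons i n m x hm hx ih =>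
      rcases eq_or_ne i 1 with rfl | hi
      · exact h.graded.mul_mem 1 n _ (h.j_mem m) x ih
      · simp only [degreeOne, if_neg hi, Submodule.mem_bot] at hm
        rw [hm, map_zero, TensorProduct.zero_tmul, map_zero]
        exact zero_mem _
  have h2 : ⨆ n, weightGrading 𝓝 j (degreeOne k M) n = ⊤ :=
    h.iSup_weightGrading (eq_top_iff.2 fun x _ => Submodule.mem_iSup_of_mem 1
      (by simp [degreeOne]))
  obtain ⟨p, hp⟩ := exists_isProj h.graded.isInternal
  have h3 : IsProj (weightGrading 𝓝 j (degreeOne k M)) p :=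
    ⟨h2, fun m n x hx => hp.proj m n x (h1 m hx)⟩
  refine funext fun n => le_antisymm (h1 n) fun x hx => ?_
  rw [← hp.self hx]
  exact h3.mem n x

/-- The axioms only make the braiding compatible with the grading. For action and coaction this is a
consequence, as the grading is one by word length. -/
theorem IsNichols.isGradedYDOps (h : IsNichols 𝓗 Z 𝓝 Y F j) :
    IsGradedYDOps (trivGrading k H) Y F := by
  have := h.isGradedYDOps_weightGrading (isGradedOps_triv 𝓗) (isGradedYDOps_degreeOne Z)
  rwa [h.weightGrading_degreeOne] at this

end Weight

/-! ### Uniqueness of the antipode -/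

section Antipode

variable {k : Type*} [Field k] {H N : Type*} [AddCommGroup H] [Module k H]
  [AddCommGroup N] [Module k N] {𝓗 : HopfOps k H} {𝓝 : HopfOps k N} {Y : YDOps k H N}

/-- The antipode of a braided Hopf algebra is determined by one of the two antipode equations. -/
theorem IsBraidedHopf.antipode_unique (h : IsBraidedHopf 𝓗 𝓝 Y) (S : N →ₗ[k] N)
    (hS : ∀ x, 𝓝.mul (LinearMap.rTensor N S (𝓝.comul x)) = 𝓝.counit x • 𝓝.one) :
    S = 𝓝.antipode := by
  have hA : IsAlg 𝓝 := ⟨h.one_mul, h.mul_one, h.mul_assoc⟩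
  let := hA.ring
  let := hA.algebra
  let : Coalgebra k N :=
    { comul := 𝓝.comul
      counit := 𝓝.counit
      coassoc := LinearMap.ext h.coassoc
      rTensor_counit_comp_comul := LinearMap.ext fun x =>
        ((LinearEquiv.eq_symm_apply _).2 (h.counit_left x)).trans (TensorProduct.lid_symm_apply _)
      lTensor_counit_comp_comul := LinearMap.ext fun x =>
        ((LinearEquiv.eq_symm_apply _).2 (h.counit_right x)).trans
          (TensorProduct.rid_symm_apply _) }
  have hmul : LinearMap.mul' k N = 𝓝.mul := hA.mul'_eq
  have h1 : WithConv.toConv S * WithConv.toConv LinearMap.id = 1 := by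
    ext x
    rw [LinearMap.convMul_apply, hmul]
    exact (hS x).trans (Algebra.algebraMap_eq_smul_one _).symm
  have h2 : WithConv.toConv LinearMap.id * WithConv.toConv 𝓝.antipode = 1 := by
    ext x
    rw [LinearMap.convMul_apply, hmul]
    exact (h.antipode_right x).trans (Algebra.algebraMap_eq_smul_one _).symm
  exact WithConv.toConv_injective (left_inv_eq_right_inv h1 h2)

end Antipode

/-! ### Uniqueness of the Nichols algebra -/

section Uniqueness

variable {k : Type*} [Field k] {H M N N' : Type*} [AddCommGroup H] [Module k H]
  [AddCommGroup M] [Module k M] [AddCommGroup N] [Module k N] [AddCommGroup N'] [Module k N']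
variable {𝓗 : HopfOps k H} {Z : YDOps k H M} {𝓝 : HopfOps k N} {Y : YDOps k H N}
  {j : M →ₗ[k] N} {F : ℕ → Submodule k N} {𝓝' : HopfOps k N'} {Y' : YDOps k H N'}
  {j' : M →ₗ[k] N'} {F' : ℕ → Submodule k N'}

theorem isGradedYDOps_triv (Z : YDOps k H M) :
    IsGradedYDOps (trivGrading k H) Z (trivGrading k M) where
  act n t ht := by
    rcases eq_or_ne n 0 with rfl | hn
    · exact mem_trivGrading_zero _
    · rw [tensorGrading_triv_left] at ht
      simp only [trivGrading, if_neg hn, tensorSub, Submodule.map₂_bot_right] at ht ⊢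
      rw [(Submodule.mem_bot k).1 ht, map_zero]
      exact zero_mem _
  coact := isGradedMap_triv _ fun x => by
    rw [tensorGrading_triv_left]
    simp [trivGrading, tensorSub, TensorProduct.map₂_mk_top_top_eq_top]

/-- The maps of algebras and coalgebras between Nichols algebras of `M` that are the identity
on `M`. -/
structure IsNicholsHom (𝓝 : HopfOps k N) (j : M →ₗ[k] N) (F : ℕ → Submodule k N)
    (𝓝' : HopfOps k N') (j' : M →ₗ[k] N') (F' : ℕ → Submodule k N') (g : N →ₗ[k] N') :
    Prop where
  map_one : g 𝓝.one = 𝓝'.one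
  map_j : ∀ m, g (j m) = j' m
  map_mul : ∀ x y, g (𝓝.mul (x ⊗ₜ y)) = 𝓝'.mul (g x ⊗ₜ g y)
  map_comul : ∀ x, 𝓝'.comul (g x) = TensorProduct.map g g (𝓝.comul x)
  map_mem : ∀ n, ∀ x ∈ F n, g x ∈ F' n

/-- With all of `M` in weight zero, `IsNichols.exists_wordMap` sends each word of `N` to the
corresponding word of `N'`. The closure properties of pairs of words make the resulting map one of
algebras and coalgebras. -/
theorem IsNichols.exists_isNicholsHom (h : IsNichols 𝓗 Z 𝓝 Y F j)
    (h' : IsNichols 𝓗 Z 𝓝' Y' F' j') :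
    ∃ g : N →ₗ[k] N', IsNicholsHom 𝓝 j F 𝓝' j' F' g := by
  have hL := isGradedOps_triv 𝓗
  have hZ := isGradedYDOps_triv Z
  choose ψ hψ using h.exists_wordMap h' hL hZ isInternal_trivGrading
  obtain ⟨g, hg⟩ := exists_linearMap_eq_on h.graded.isInternal (fun r => ψ r 0)
  let B : ℕ → Submodule k (N × N') := fun r => biSpan 𝓝 j 𝓝' j' (trivGrading k M) r 0
  have hgB : ∀ r, ∀ x ∈ B r, g x.1 = x.2 := fun r x hx =>
    (hg r x.1 (h.biSpan_mem h' hx).1).trans ((hψ r 0 0 x hx).trans (if_pos rfl))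
  have hcons : ∀ r m, ∀ x ∈ B r, (𝓝.mul (j m ⊗ₜ x.1), 𝓝'.mul (j' m ⊗ₜ x.2)) ∈ B (r + 1) :=
    fun r m x hx => by
      have := cons_mem_biSpan (mem_trivGrading_zero (k := k) m) hx
      rwa [add_zero] at this
  have htop : ⨆ r, (B r).map (LinearMap.fst k N N') = ⊤ := by
    refine h.eq_top_of_mul_mem _ (Submodule.mem_iSup_of_mem 0 ⟨_, one_mem_biSpan, rfl⟩)
      fun m x hx => ?_
    induction hx using Submodule.iSup_induction' with
    | mem r x hx =>
      obtain ⟨y, hy, rfl⟩ := hx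
      exact Submodule.mem_iSup_of_mem (r + 1) ⟨_, hcons r m y hy, rfl⟩
    | zero => rw [TensorProduct.tmul_zero, map_zero]; exact zero_mem _
    | add x y _ _ hx hy => rw [TensorProduct.tmul_add, map_add]; exact add_mem hx hy
  -- Every element is a sum of first components of pairs, so additive properties may be checked on
  -- pairs, where `g` is known.
  have hind : ∀ {P : N → Prop}, (∀ r, ∀ y ∈ B r, P y.1) → (∀ x y, P x → P y → P (x + y)) →
      ∀ x, P x := by
    intro P h1 h2 x
    have hx : x ∈ ⨆ r, (B r).map (LinearMap.fst k N N') := htop ▸ Submodule.mem_top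
    induction hx using Submodule.iSup_induction' with
    | mem r x hx =>
      obtain ⟨y, hy, rfl⟩ := hx
      exact h1 r y hy
    | zero => exact h1 0 0 (zero_mem _)
    | add x y _ _ hx hy => exact h2 x y hx hy
  have hj : ∀ m, (j m, j' m) ∈ B 1 := fun m => by
    have := hcons 0 m _ one_mem_biSpan
    rwa [h.hopf.mul_one, h'.hopf.mul_one] at this
  obtain ⟨p, hp⟩ := exists_isProj h.graded.isInternal
  refine ⟨g, hgB 0 _ one_mem_biSpan, fun m => hgB 1 _ (hj m), fun x y => ?_, fun x => ?_,
    fun n x hx => ?_⟩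
  · refine hind (P := fun x => g (𝓝.mul (x ⊗ₜ y)) = 𝓝'.mul (g x ⊗ₜ g y)) (fun r x hx => ?_)
      (fun x y hx hy => by simp only [TensorProduct.add_tmul, map_add, hx, hy]) x
    refine hind (P := fun y => g (𝓝.mul (x.1 ⊗ₜ y)) = 𝓝'.mul (g x.1 ⊗ₜ g y)) (fun s y hy => ?_)
      (fun x y hx hy => by simp only [TensorProduct.tmul_add, map_add, hx, hy]) y
    have := mul_mem_biSpan h.hopf h'.hopf hx hy
    rw [add_zero] at this
    rw [hgB r x hx, hgB s y hy]
    exact hgB (r + s) _ this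
  · refine hind (P := fun x => 𝓝'.comul (g x) = TensorProduct.map g g (𝓝.comul x))
      (fun r x hx => ?_) (fun x y hx hy => by simp only [map_add, hx, hy]) x
    rw [hgB r x hx]
    have h1 : biTensor 𝓝 j 𝓝' j' (trivGrading k M) r 0 ≤
        LinearMap.eqLocus (LinearMap.snd k _ _)
          (TensorProduct.map g g ∘ₗ LinearMap.fst k _ _) := by
      refine Submodule.span_le.2 ?_
      rintro _ ⟨r₁, r₂, n₁, n₂, hr, hn, x, hx, y, hy, rfl⟩
      have hn₁ : n₁ = 0 := by omega
      have hn₂ : n₂ = 0 := by omega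
      subst hn₁ hn₂
      change x.2 ⊗ₜ y.2 = TensorProduct.map g g (x.1 ⊗ₜ y.1)
      rw [TensorProduct.map_tmul, hgB _ x hx, hgB _ y hy]
    exact h1 (comul_mem_biTensor h.isPrimitiveMap h'.isPrimitiveMap hL hZ hx)
  · rw [← hp.self hx]
    refine hind (P := fun x => g (p n x) ∈ F' n) (fun r y hy => ?_)
      (fun x y hx hy => by simp only [map_add]; exact add_mem hx hy) x
    rw [hp.proj r n _ (h.biSpan_mem h' hy).1]
    split_ifs with hrn
    · subst hrn
      rw [hgB _ y hy]
      exact (h.biSpan_mem h' hy).2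
    · rw [map_zero]; exact zero_mem _

theorem IsNichols.comp_eq_id (h : IsNichols 𝓗 Z 𝓝 Y F j) {g : N →ₗ[k] N'} {g' : N' →ₗ[k] N}
    (hg : IsNicholsHom 𝓝 j F 𝓝' j' F' g) (hg' : IsNicholsHom 𝓝' j' F' 𝓝 j F g') :
    g' ∘ₗ g = LinearMap.id := by
  suffices LinearMap.eqLocus (g' ∘ₗ g) LinearMap.id = ⊤ from
    LinearMap.ext fun x => LinearMap.mem_eqLocus.1 (this ▸ Submodule.mem_top)
  refine h.eq_top_of_mul_mem _ ?_ fun m x hx => ?_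
  · simp [hg.map_one, hg'.map_one]
  · rw [LinearMap.mem_eqLocus, LinearMap.comp_apply, LinearMap.id_apply] at hx ⊢
    rw [hg.map_mul, hg'.map_mul, hg.map_j, hg'.map_j, hx]

theorem IsNicholsHom.map_counit (h : IsNichols 𝓗 Z 𝓝 Y F j) (h' : IsNichols 𝓗 Z 𝓝' Y' F' j')
    {g : N →ₗ[k] N'} (hg : IsNicholsHom 𝓝 j F 𝓝' j' F' g) (x : N) :
    𝓝'.counit (g x) = 𝓝.counit x := by
  suffices LinearMap.eqLocus (𝓝'.counit ∘ₗ g) 𝓝.counit = ⊤ from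
    LinearMap.mem_eqLocus.1 (this ▸ Submodule.mem_top : x ∈ _)
  refine h.eq_top_of_mul_mem _ ?_ fun m x hx => ?_
  · simp [hg.map_one, h.hopf.counit_one, h'.hopf.counit_one]
  · rw [LinearMap.mem_eqLocus, LinearMap.comp_apply, hg.map_mul, hg.map_j, h'.counit_j_mul,
      h.counit_j_mul]

theorem IsNicholsHom.isYDHom (h : IsNichols 𝓗 Z 𝓝 Y F j) (h' : IsNichols 𝓗 Z 𝓝' Y' F' j')
    {g : N →ₗ[k] N'} (hg : IsNicholsHom 𝓝 j F 𝓝' j' F' g) : IsYDHom Y Y' g where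
  map_act := by
    let T : Submodule k N :=
      { carrier := {x | ∀ a, g (Y.act (a ⊗ₜ x)) = Y'.act (a ⊗ₜ g x)}
        add_mem' := fun {x y} hx hy a => by simp only [TensorProduct.tmul_add, map_add, hx a, hy a]
        zero_mem' := fun a => by simp
        smul_mem' := fun c x hx a => by simp only [TensorProduct.tmul_smul, map_smul, hx a] }
    have hT : T = ⊤ := by
      refine h.eq_top_of_mul_mem T (fun a => ?_) fun m x hx a => ?_
      · rw [h.hopf.act_one, hg.map_one, h'.hopf.act_one, map_smul, hg.map_one]
      · rw [h.hopf.act_mul, hg.map_mul, h'.hopf.act_mul, hg.map_j]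
        induction 𝓗.comul a with
        | zero => simp
        | add x y hx hy => simp only [map_add, hx, hy]
        | tmul b c =>
          simp only [TensorProduct.map_tmul, LinearMap.flip_apply, YDOps.actL_apply, hg.map_mul,
            h.isPrimitiveMap.act_j, h'.isPrimitiveMap.act_j, hg.map_j, hx c]
    refine TensorProduct.ext' fun a x => ?_
    have hx : x ∈ T := hT ▸ Submodule.mem_top
    exact hx a
  map_coact := by
    suffices LinearMap.eqLocus (Y'.coact ∘ₗ g) (LinearMap.lTensor H g ∘ₗ Y.coact) = ⊤ from
      LinearMap.ext fun x => LinearMap.mem_eqLocus.1 (this ▸ Submodule.mem_top)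
    refine h.eq_top_of_mul_mem _ ?_ fun m x hx => ?_
    · simp [hg.map_one, h.hopf.coact_one, h'.hopf.coact_one]
    · rw [LinearMap.mem_eqLocus, LinearMap.comp_apply, LinearMap.comp_apply] at hx ⊢
      rw [hg.map_mul, hg.map_j, h'.hopf.coact_mul, h.hopf.coact_mul, hx,
        h.isPrimitiveMap.coact_j, h'.isPrimitiveMap.coact_j]
      induction Z.coact m with
      | zero => simp
      | add x y hx hy => simp only [map_add, TensorProduct.add_tmul, hx, hy]
      | tmul a m =>
        induction Y.coact x with
        | zero => simp
        | add x y hx hy => simp only [map_add, TensorProduct.tmul_add, hx, hy]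
        | tmul b y => simp [hg.map_mul, hg.map_j]

theorem IsNichols.exists_iso (h : IsNichols 𝓗 Z 𝓝 Y F j) (h' : IsNichols 𝓗 Z 𝓝' Y' F' j') :
    ∃ e : N ≃ₗ[k] N', IsGradedBraidedHopfIso 𝓝 Y F 𝓝' Y' F' e := by
  obtain ⟨g, hg⟩ := h.exists_isNicholsHom h'
  obtain ⟨g', hg'⟩ := h'.exists_isNicholsHom h
  have e1 := h'.comp_eq_id hg' hg
  have e2 := h.comp_eq_id hg hg'
  -- The transported antipode satisfies one antipode equation in `N'`, and this characterises the
  -- antipode.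
  have hS : g ∘ₗ 𝓝.antipode ∘ₗ g' = 𝓝'.antipode := by
    refine h'.hopf.antipode_unique _ fun x => ?_
    have hx : g (g' x) = x := LinearMap.congr_fun e1 x
    have h1 : ∀ t : N ⊗[k] N, 𝓝'.mul (LinearMap.rTensor N' (g ∘ₗ 𝓝.antipode ∘ₗ g')
        (TensorProduct.map g g t)) = g (𝓝.mul (LinearMap.rTensor N 𝓝.antipode t)) := by
      intro t
      induction t with
      | zero => simp
      | add x y hx hy => simp only [map_add, hx, hy]
      | tmul a b =>
        have ha : g' (g a) = a := LinearMap.congr_fun e2 a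
        simp [hg.map_mul, ha]
    rw [← hx, hg.map_comul, h1, h.hopf.antipode_left, hg.map_counit h h', map_smul, hg.map_one]
  refine ⟨LinearEquiv.ofLinearMap g g' e1 e2, hg.map_one, hg.map_mul, hg.map_comul,
    hg.map_counit h h', fun x => ?_, hg.isYDHom h h', fun n => le_antisymm ?_ fun x hx => ?_⟩
  · have hx : g' (g x) = x := LinearMap.congr_fun e2 x
    have := LinearMap.congr_fun hS (g x)
    simp only [LinearMap.comp_apply, hx] at this
    exact this
  · rintro _ ⟨x, hx, rfl⟩
    exact hg.map_mem n x hx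
  · exact ⟨g' x, hg'.map_mem n x hx, LinearMap.congr_fun e1 x⟩

end Uniqueness

/-! ### Gradings on coinvariants -/

section Coinv

variable {k : Type*} [Field k] {H E X : Type*} [AddCommGroup H] [Module k H]
  [AddCommGroup E] [Module k E] [AddCommGroup X] [Module k X]
variable {𝓗 : HopfOps k H} {𝓔 : HopfOps k E} {ι : H →ₗ[k] E} {π : E →ₗ[k] H} {i : X →ₗ[k] E}
  {p : E →ₗ[k] X} {LE : ℕ → Submodule k E} {K : ℕ → Submodule k X}

/-- Only the antipode of `H` enters `θ`, and with `H` in degree zero it is trivially graded. -/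
theorem isGradedMap_theta (hE : IsGradedOps 𝓔 LE)
    (hι : IsGradedMap (trivGrading k H) LE ι) (hπ : IsGradedMap LE (trivGrading k H) π) :
    IsGradedMap LE LE (theta 𝓗 𝓔 ι π) :=
  hE.mul.comp ((IsGradedMap.lTensor (hι.comp
    ((isGradedMap_triv 𝓗.antipode fun _ => mem_trivGrading_zero _).comp hπ))).comp hE.comul)

theorem isGradedOps_coinvOps (hE : IsGradedOps 𝓔 LE)
    (hι : IsGradedMap (trivGrading k H) LE ι) (hπ : IsGradedMap LE (trivGrading k H) π)
    (hi : IsGradedMap K LE i) (hp : IsGradedMap LE K p) :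
    IsGradedOps (coinvOps 𝓗 𝓔 ι π i p) K where
  one_mem := hp 0 _ hE.one_mem
  mul := hp.comp (hE.mul.comp (hi.map hi))
  comul := ((hp.comp (isGradedMap_theta hE hι hπ)).map hp).comp (hE.comul.comp hi)
  counit := hE.counit.comp hi

theorem isGradedYDOps_coinvYD (hE : IsGradedOps 𝓔 LE)
    (hι : IsGradedMap (trivGrading k H) LE ι) (hπ : IsGradedMap LE (trivGrading k H) π)
    (hi : IsGradedMap K LE i) (hp : IsGradedMap LE K p) :
    IsGradedYDOps (trivGrading k H) (coinvYD 𝓗 𝓔 ι π i p) K where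
  act := hp.comp (hE.mul.comp (((hE.mul.comp (hι.map hi)).map
    (hι.comp (isGradedMap_triv 𝓗.antipode fun _ => mem_trivGrading_zero _))).comp
      (isGradedMap_rightComm.comp (isGradedOps_triv 𝓗).comul.rTensor)))
  coact := (hπ.map hp).comp (hE.comul.comp hi)

end Coinv

/-! ### The tensor product grading of the braided biproduct -/

section Biproduct

variable {k : Type*} [Field k] {H R Q : Type*} [AddCommGroup H] [Module k H]
  [AddCommGroup R] [Module k R] [AddCommGroup Q] [Module k Q]
variable {𝓗 : HopfOps k H} {𝓡 : HopfOps k R} {Y : YDOps k H R} {𝓠 : HopfOps k Q}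
  {Z : YDOps k (R ⊗[k] H) Q} {G : ℕ → Submodule k R} {W : ℕ → Submodule k Q}

theorem isGradedMap_radfordIncl {L : ℕ → Submodule k H} (h𝓡 : IsGradedOps 𝓡 G) :
    IsGradedMap L (tensorGrading G L) (radfordIncl 𝓡) := fun n _ hx =>
  tmul_mem_tensorGrading_of_eq (zero_add n) h𝓡.one_mem hx

theorem isGradedMap_radfordProj {L : ℕ → Submodule k H} (h𝓡 : IsGradedOps 𝓡 G) :
    IsGradedMap (tensorGrading G L) L (radfordProj 𝓡) :=
  isGradedMap_lid_triv.comp h𝓡.counit.rTensor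

theorem isGradedMap_biIncl (h𝓡 : IsGradedOps 𝓡 G) (h𝓠 : IsGradedOps 𝓠 W) :
    IsGradedMap (trivGrading k H) (tensorGrading W (tensorGrading G (trivGrading k H)))
      (biIncl 𝓡 𝓠) :=
  (isGradedMap_radfordIncl h𝓠).comp (isGradedMap_radfordIncl h𝓡)

theorem isGradedMap_biProj (h𝓡 : IsGradedOps 𝓡 G) (h𝓠 : IsGradedOps 𝓠 W) :
    IsGradedMap (tensorGrading W (tensorGrading G (trivGrading k H))) (trivGrading k H)
      (biProj 𝓡 𝓠) :=
  (isGradedMap_radfordProj h𝓡).comp (isGradedMap_radfordProj h𝓠)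

theorem isGradedMap_toCoinv (𝓗 : HopfOps k H) : IsGradedMap (tensorGrading W G)
    (tensorGrading W (tensorGrading G (trivGrading k H))) (toCoinv 𝓗) :=
  IsGradedMap.lTensor fun n _ hx => tmul_mem_tensorGrading_of_eq (add_zero n) hx
    (mem_trivGrading_zero (k := k) 𝓗.one)

theorem isGradedMap_ofCoinv (𝓗 : HopfOps k H) : IsGradedMap
    (tensorGrading W (tensorGrading G (trivGrading k H))) (tensorGrading W G) (ofCoinv 𝓗) :=
  IsGradedMap.lTensor (isGradedMap_rid_triv.comp
    (IsGradedMap.lTensor (isGradedOps_triv 𝓗).counit))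

theorem isGradedOps_biOps (h𝓡 : IsGradedOps 𝓡 G) (hY : IsGradedYDOps (trivGrading k H) Y G)
    (h𝓠 : IsGradedOps 𝓠 W) (hZ : IsGradedYDOps (tensorGrading G (trivGrading k H)) Z W) :
    IsGradedOps (biOps 𝓗 𝓡 Y 𝓠 Z) (tensorGrading W G) :=
  isGradedOps_coinvOps (((isGradedOps_triv 𝓗).radford h𝓡 hY).radford h𝓠 hZ)
    (isGradedMap_biIncl h𝓡 h𝓠) (isGradedMap_biProj h𝓡 h𝓠) (isGradedMap_toCoinv 𝓗)
    (isGradedMap_ofCoinv 𝓗)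

theorem isGradedYDOps_biYD (h𝓡 : IsGradedOps 𝓡 G) (hY : IsGradedYDOps (trivGrading k H) Y G)
    (h𝓠 : IsGradedOps 𝓠 W) (hZ : IsGradedYDOps (tensorGrading G (trivGrading k H)) Z W) :
    IsGradedYDOps (trivGrading k H) (biYD 𝓗 𝓡 Y 𝓠 Z) (tensorGrading W G) :=
  isGradedYDOps_coinvYD (((isGradedOps_triv 𝓗).radford h𝓡 hY).radford h𝓠 hZ)
    (isGradedMap_biIncl h𝓡 h𝓠) (isGradedMap_biProj h𝓡 h𝓠) (isGradedMap_toCoinv 𝓗)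
    (isGradedMap_ofCoinv 𝓗)

end Biproduct

/-! ### The biproduct is a graded braided Hopf algebra -/

section Setting

variable {k : Type*} [Field k] {H : Type*} [Ring H] [HopfAlgebra k H]
  {V R M Q : Type*} [AddCommGroup V] [Module k V] [AddCommGroup R] [Module k R]
  [AddCommGroup M] [Module k M] [AddCommGroup Q] [Module k Q]
  {YV : YDOps k H V} {𝓡 : HopfOps k R} {YR : YDOps k H R} {G : ℕ → Submodule k R}
  {jV : V →ₗ[k] R} {YM : YDOps k (R ⊗[k] H) M} {D : ℕ → Submodule k M}
  {𝓠 : HopfOps k Q} {YQ : YDOps k (R ⊗[k] H) Q} {F : ℕ → Submodule k Q} {jM : M →ₗ[k] Q}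

theorem IsHighestWeight.isGradedYDOps {𝓗 : HopfOps k H} (hM : IsHighestWeight 𝓗 𝓡 YR G YM D) :
    IsGradedYDOps (tensorGrading G (trivGrading k H)) YM D where
  act := by
    rw [← radfordGrading_eq]
    exact isGradedMap_tensor hM.gradedYD.act_mem
  coact := by
    rw [← radfordGrading_eq]
    exact hM.gradedYD.coact_mem

theorem isGradedBraidedHopf_biproduct (hR : IsNichols (HopfOps.of k H) YV 𝓡 YR G jV)
    (hM : IsHighestWeight (HopfOps.of k H) 𝓡 YR G YM D)
    (hQ : IsNichols (radford (HopfOps.of k H) 𝓡 YR) YM 𝓠 YQ F jM) :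
    IsGradedBraidedHopf (HopfOps.of k H)
      (biOps (HopfOps.of k H) 𝓡 YR 𝓠 YQ) (biYD (HopfOps.of k H) 𝓡 YR 𝓠 YQ)
      (tensorGrading (weightGrading 𝓠 jM D) G) := by
  have hA := (isGradedOps_triv (HopfOps.of k H)).radford hR.graded.isGradedOps hR.isGradedYDOps
  have hW := hQ.isGradedOps_weightGrading hA hM.isGradedYDOps
  have hW' := hQ.isGradedYDOps_weightGrading hA hM.isGradedYDOps
  have hB := isGradedYDOps_biYD (𝓗 := HopfOps.of k H) hR.graded.isGradedOps hR.isGradedYDOps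
    hW hW'
  refine ⟨isBraidedHopf_biproduct hR.hopf hQ.hopf,
    (isGradedOps_biOps hR.graded.isGradedOps hR.isGradedYDOps hW hW').isGraded
      (isInternal_tensorGrading (hQ.isInternal_weightGrading hA hM.isGradedYDOps
        hM.gradedYD.isInternal) hR.graded.isInternal), fun n h x hx => ?_, fun n x hx => ?_⟩
  · have := hB.act _ _ (tmul_mem_tensorGrading_of_eq (zero_add n)
      (mem_trivGrading_zero (k := k) h) hx)
    exact this
  · have := hB.coact n x hx
    rwa [tensorGrading_triv_left] at this

end Setting

/-! ### Explicit formulas in a Radford biproduct -/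

section Radford

variable {k : Type*} [Field k] {A : Type*} [AddCommGroup A] [Module k A] {𝓐 : HopfOps k A}
variable {Q : Type*} [AddCommGroup Q] [Module k Q] {𝓠 : HopfOps k Q} {Z : YDOps k A Q}

theorem isHopf_of (k H : Type*) [Field k] [Ring H] [HopfAlgebra k H] :
    IsHopf (HopfOps.of k H) where
  one_mul := _root_.one_mul
  mul_one := _root_.mul_one
  mul_assoc := _root_.mul_assoc
  coassoc := Coalgebra.coassoc_apply
  counit_left := Coalgebra.rTensor_counit_comul
  counit_right := Coalgebra.lTensor_counit_comul
  counit_one := Bialgebra.counit_one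
  counit_mul := Bialgebra.counit_mul
  comul_one := Bialgebra.comul_one
  comul_mul x y := Bialgebra.comul_mul x y
  antipode_left x := by
    refine (HopfAlgebra.mul_antipode_rTensor_comul_apply x).trans ?_
    exact Algebra.algebraMap_eq_smul_one _
  antipode_right x := by
    refine (HopfAlgebra.mul_antipode_lTensor_comul_apply x).trans ?_
    exact Algebra.algebraMap_eq_smul_one _

theorem crossAct_apply (𝓐 : HopfOps k A) (Z : YDOps k A Q) (a : A) (x : Q) :
    crossAct 𝓐 Z (a ⊗ₜ x) = LinearMap.rTensor A (Z.actL.flip x) (𝓐.comul a) := by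
  simp only [crossAct, LinearMap.comp_apply, LinearEquiv.coe_coe, LinearMap.rTensor_tmul]
  induction 𝓐.comul a with
  | zero => simp
  | add x y hx hy => simp only [map_add, hx, hy, TensorProduct.add_tmul]
  | tmul a b => simp

theorem crossCoact_apply (𝓐 : HopfOps k A) (Z : YDOps k A Q) (x : Q) (a : A) :
    crossCoact 𝓐 Z (x ⊗ₜ a) = LinearMap.rTensor Q (𝓐.mulL.flip a) (Z.coact x) := by
  simp only [crossCoact, LinearMap.comp_apply, LinearEquiv.coe_coe, LinearMap.rTensor_tmul]
  induction Z.coact x with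
  | zero => simp
  | add x y hx hy => simp only [map_add, hx, hy, TensorProduct.add_tmul]
  | tmul a b => simp

theorem radford_mul_apply (𝓐 : HopfOps k A) (𝓠 : HopfOps k Q) (Z : YDOps k A Q) (x y : Q)
    (a b : A) : (radford 𝓐 𝓠 Z).mul ((x ⊗ₜ a) ⊗ₜ (y ⊗ₜ b)) =
      TensorProduct.map (𝓠.mulL x) (𝓐.mulL.flip b) (crossAct 𝓐 Z (a ⊗ₜ y)) := by
  simp only [radford, LinearMap.comp_apply, middle_tmul]
  induction crossAct 𝓐 Z (a ⊗ₜ y) with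
  | zero => simp
  | add x y hx hy => simp only [map_add, hx, hy]
  | tmul c d => simp

theorem IsHopf.radford_mul_left (h : IsHopf 𝓐) (hQ : IsBraidedHopf 𝓐 𝓠 Z) (x y : Q) (a : A) :
    (radford 𝓐 𝓠 Z).mul ((x ⊗ₜ 𝓐.one) ⊗ₜ (y ⊗ₜ a)) = 𝓠.mul (x ⊗ₜ y) ⊗ₜ a := by
  rw [radford_mul_apply, crossAct_apply, h.comul_one]
  simp [hQ.yd.one_act, h.one_mul]

theorem IsHopf.radford_mul_cross (h : IsHopf 𝓐) (hQ : IsBraidedHopf 𝓐 𝓠 Z) (x : Q) (a : A) :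
    (radford 𝓐 𝓠 Z).mul ((𝓠.one ⊗ₜ a) ⊗ₜ (x ⊗ₜ 𝓐.one)) =
      LinearMap.rTensor A (Z.actL.flip x) (𝓐.comul a) := by
  have h1 : 𝓠.mulL 𝓠.one = LinearMap.id := LinearMap.ext hQ.one_mul
  have h2 : 𝓐.mulL.flip 𝓐.one = LinearMap.id := LinearMap.ext h.mul_one
  rw [radford_mul_apply, crossAct_apply, h1, h2, TensorProduct.map_id, LinearMap.id_apply]

/-- `Δ(x # 1) = (x⁽¹⁾ # x⁽²⁾₍₋₁₎) ⊗ (x⁽²⁾₍₀₎ # 1)`. Applying projections to either leg isolates the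
coaction or the comultiplication of `x`. -/
theorem IsHopf.radford_comul_one (h : IsHopf 𝓐) (Z : YDOps k A Q) (x : Q) :
    (radford 𝓐 𝓠 Z).comul (x ⊗ₜ 𝓐.one) =
      LinearMap.lTensor (Q ⊗[k] A) ((TensorProduct.mk k Q A).flip 𝓐.one)
        ((TensorProduct.assoc k Q A Q).symm (LinearMap.lTensor Q Z.coact (𝓠.comul x))) := by
  have h2 : 𝓐.mulL.flip 𝓐.one = LinearMap.id := LinearMap.ext h.mul_one
  simp only [radford, LinearMap.comp_apply, TensorProduct.map_tmul, h.comul_one]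
  induction 𝓠.comul x with
  | zero => simp
  | add x y hx hy => simp only [map_add, hx, hy, TensorProduct.add_tmul]
  | tmul y z =>
    rw [middle_tmul, crossCoact_apply, h2, LinearMap.rTensor_id, LinearMap.id_apply,
      LinearMap.lTensor_tmul]
    induction Z.coact z with
    | zero => simp
    | add x y hx hy => simp only [map_add, hx, hy, TensorProduct.tmul_add]
    | tmul a b => simp

theorem IsHopf.rTensor_radfordProj_comul (h : IsHopf 𝓐) (hQ : IsBraidedHopf 𝓐 𝓠 Z) (x : Q) :
    LinearMap.rTensor (Q ⊗[k] A) (radfordProj 𝓠) ((radford 𝓐 𝓠 Z).comul (x ⊗ₜ 𝓐.one)) =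
      LinearMap.lTensor A ((TensorProduct.mk k Q A).flip 𝓐.one) (Z.coact x) := by
  have h1 : ∀ u : Q ⊗[k] Q, LinearMap.rTensor (Q ⊗[k] A) (radfordProj 𝓠)
      (LinearMap.lTensor (Q ⊗[k] A) ((TensorProduct.mk k Q A).flip 𝓐.one)
        ((TensorProduct.assoc k Q A Q).symm (LinearMap.lTensor Q Z.coact u))) =
      LinearMap.lTensor A ((TensorProduct.mk k Q A).flip 𝓐.one) (Z.coact
        (TensorProduct.lid k Q (LinearMap.rTensor Q 𝓠.counit u))) := by
    intro u
    induction u with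
    | zero => simp
    | add x y hx hy => simp only [map_add, hx, hy]
    | tmul y z =>
      simp only [LinearMap.lTensor_tmul, LinearMap.rTensor_tmul, TensorProduct.lid_tmul, map_smul]
      induction Z.coact z with
      | zero => simp
      | add x y hx hy => simp only [map_add, hx, hy, TensorProduct.tmul_add, smul_add]
      | tmul a b => simp [radfordProj, TensorProduct.smul_tmul']
  rw [h.radford_comul_one, h1, hQ.counit_left]

/-- The map `R # H → R`, `r # h ↦ ε(h) r`. -/
def radfordCoproj (𝓐 : HopfOps k A) (Q : Type*) [AddCommGroup Q] [Module k Q] :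
    Q ⊗[k] A →ₗ[k] Q :=
  (TensorProduct.rid k Q).toLinearMap ∘ₗ LinearMap.lTensor Q 𝓐.counit

@[simp] theorem radfordCoproj_tmul (x : Q) (a : A) :
    radfordCoproj 𝓐 Q (x ⊗ₜ a) = 𝓐.counit a • x := by simp [radfordCoproj]

theorem IsHopf.map_radfordCoproj_comul (h : IsHopf 𝓐) (hQ : IsBraidedHopf 𝓐 𝓠 Z) (x : Q) :
    TensorProduct.map (radfordCoproj 𝓐 Q) (radfordCoproj 𝓐 Q)
      ((radford 𝓐 𝓠 Z).comul (x ⊗ₜ 𝓐.one)) = 𝓠.comul x := by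
  rw [h.radford_comul_one]
  induction 𝓠.comul x with
  | zero => simp
  | add x y hx hy => simp only [map_add, hx, hy]
  | tmul y z =>
    have h1 : ∀ u : A ⊗[k] Q, TensorProduct.map (radfordCoproj 𝓐 Q) (radfordCoproj 𝓐 Q)
        (LinearMap.lTensor (Q ⊗[k] A) ((TensorProduct.mk k Q A).flip 𝓐.one)
          ((TensorProduct.assoc k Q A Q).symm (y ⊗ₜ u))) =
        y ⊗ₜ TensorProduct.lid k Q (LinearMap.rTensor Q 𝓐.counit u) := by
      intro u
      induction u with
      | zero => simp
      | add x y hx hy => simp only [map_add, hx, hy, TensorProduct.tmul_add]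
      | tmul a b => simp [h.counit_one, TensorProduct.smul_tmul']
    rw [LinearMap.lTensor_tmul, h1, hQ.yd.counit_coact]

/-- An element of the biproduct is recovered from its comultiplication by projecting the left leg to
the braided part and the right leg to the base. -/
theorem IsHopf.map_radfordCoproj_radfordProj_comul (h : IsHopf 𝓐) (hQ : IsBraidedHopf 𝓐 𝓠 Z)
    (t : Q ⊗[k] A) : TensorProduct.map (radfordCoproj 𝓐 Q) (radfordProj 𝓠)
      ((radford 𝓐 𝓠 Z).comul t) = t := by
  induction t with
  | zero => simp
  | add x y hx hy => simp only [map_add, hx, hy]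
  | tmul x a =>
    have h1 : TensorProduct.map (radfordCoproj 𝓐 Q) (radfordProj 𝓠) =
      LinearMap.rTensor A (radfordCoproj 𝓐 Q) ∘ₗ
        LinearMap.lTensor (Q ⊗[k] A) (radfordProj 𝓠) := by
        rw [LinearMap.rTensor_comp_lTensor]
    have h2 : ∀ u : A ⊗[k] A, LinearMap.rTensor A (radfordCoproj 𝓐 Q)
        (LinearMap.rTensor A (TensorProduct.mk k Q A x) u) =
        LinearMap.rTensor A (LinearMap.toSpanSingleton k Q x)
          (LinearMap.rTensor A 𝓐.counit u) := by
      intro u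
      induction u with
      | zero => simp
      | add x y hx hy => simp only [map_add, hx, hy]
      | tmul a b => simp
    rw [h1, LinearMap.comp_apply, h.lTensor_radfordProj_comul hQ, h2, h.counit_left]
    simp

end Radford

/-! ### Explicit formulas in the braided biproduct `Q # R` -/

section Biproduct

variable {k : Type*} [Field k] {H : Type*} [Ring H] [HopfAlgebra k H]
variable {R : Type*} [AddCommGroup R] [Module k R] {Q : Type*} [AddCommGroup Q] [Module k Q]
variable {𝓡 : HopfOps k R} {Y : YDOps k H R} {𝓠 : HopfOps k Q} {Z : YDOps k (R ⊗[k] H) Q}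

local notation "𝓗" => HopfOps.of k H
local notation "𝓐" => radford (HopfOps.of k H) 𝓡 Y
local notation "𝓔" => radford (radford (HopfOps.of k H) 𝓡 Y) 𝓠 Z
local notation "𝓑" => biOps (HopfOps.of k H) 𝓡 Y 𝓠 Z
local notation "YB" => biYD (HopfOps.of k H) 𝓡 Y 𝓠 Z

theorem biOps_mul (x y : Q) (r s : R) : (𝓑).mul ((x ⊗ₜ r) ⊗ₜ (y ⊗ₜ s)) =
    ofCoinv 𝓗 ((𝓔).mul ((x ⊗ₜ (r ⊗ₜ (1 : H))) ⊗ₜ (y ⊗ₜ (s ⊗ₜ (1 : H))))) := rfl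

theorem biOps_one : (𝓑).one = 𝓠.one ⊗ₜ 𝓡.one := by
  change ofCoinv 𝓗 (𝓠.one ⊗ₜ (𝓡.one ⊗ₜ (1 : H))) = _
  simp

theorem biOps_mul_right (hR : IsBraidedHopf 𝓗 𝓡 Y) (hQ : IsBraidedHopf 𝓐 𝓠 Z) (x : Q) (r s : R) :
    (𝓑).mul ((x ⊗ₜ r) ⊗ₜ (𝓠.one ⊗ₜ s)) = x ⊗ₜ 𝓡.mul (r ⊗ₜ s) := by
  rw [biOps_mul, (isHopf_radford hR).radford_mul_one_right hQ]
  refine (congrArg (fun t => ofCoinv 𝓗 (x ⊗ₜ[k] t))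
    ((isHopf_of k H).radford_mul_left hR r s 1)).trans ?_
  simp

theorem biOps_mul_left (hR : IsBraidedHopf 𝓗 𝓡 Y) (hQ : IsBraidedHopf 𝓐 𝓠 Z) (x y : Q) (s : R) :
    (𝓑).mul ((x ⊗ₜ 𝓡.one) ⊗ₜ (y ⊗ₜ s)) = 𝓠.mul (x ⊗ₜ y) ⊗ₜ s := by
  rw [biOps_mul]
  refine (congrArg (ofCoinv 𝓗)
    ((isHopf_radford hR).radford_mul_left hQ x y (s ⊗ₜ (1 : H)))).trans ?_
  simp

theorem radford_comul_primitive (hR : IsBraidedHopf 𝓗 𝓡 Y) {v : R}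
    (hv : 𝓡.comul v = 𝓡.one ⊗ₜ v + v ⊗ₜ 𝓡.one) : (𝓐).comul (v ⊗ₜ 1) =
      TensorProduct.map (radfordIncl 𝓡) (radfordInclR H R) (Y.coact v) +
        (v ⊗ₜ (1 : H)) ⊗ₜ (𝓡.one ⊗ₜ (1 : H)) := by
  refine ((isHopf_of k H).radford_comul_one Y v).trans ?_
  rw [hv, map_add, map_add, map_add, LinearMap.lTensor_tmul, LinearMap.lTensor_tmul,
    hR.coact_one]
  congr 1
  induction Y.coact v with
  | zero => simp
  | add x y hx hy => simp only [map_add, hx, hy, TensorProduct.tmul_add]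
  | tmul a b => rfl

/-- The product of a primitive element of `R` with an element of `Q` in the braided biproduct. -/
theorem biOps_mul_primitive (hR : IsBraidedHopf 𝓗 𝓡 Y) (hQ : IsBraidedHopf 𝓐 𝓠 Z) {v : R}
    (hv : 𝓡.comul v = 𝓡.one ⊗ₜ v + v ⊗ₜ 𝓡.one) (x : Q) :
    (𝓑).mul ((𝓠.one ⊗ₜ v) ⊗ₜ (x ⊗ₜ 𝓡.one)) =
      LinearMap.rTensor R (Z.actL.flip x ∘ₗ radfordIncl 𝓡) (Y.coact v) +
        Z.act ((v ⊗ₜ (1 : H)) ⊗ₜ x) ⊗ₜ 𝓡.one := by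
  rw [biOps_mul]
  refine (congrArg (ofCoinv 𝓗)
    ((isHopf_radford hR).radford_mul_cross hQ x (v ⊗ₜ (1 : H)))).trans ?_
  rw [radford_comul_primitive hR hv, map_add, map_add]
  congr 1
  · induction Y.coact v with
    | zero => simp
    | add x y hx hy => simp only [map_add, hx, hy]
    | tmul a b => simp [radfordInclR]
  · simp

/-- By `act_p` the action is left multiplication by `1 # 1 # h`. The exchange rule in `Q # A` moves
`h₁` onto `x`, and `h₂` is killed by the counit. -/
theorem biYD_act_left (hR : IsBraidedHopf 𝓗 𝓡 Y) (hQ : IsBraidedHopf 𝓐 𝓠 Z) (h : H) (x : Q) :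
    (YB).act (h ⊗ₜ (x ⊗ₜ 𝓡.one)) = Z.act (radfordIncl 𝓡 h ⊗ₜ x) ⊗ₜ 𝓡.one := by
  have h1 := (isCoinvModel_biproduct hR hQ).act_p h (x ⊗ₜ (𝓡.one ⊗ₜ (1 : H)))
  rw [ofCoinv_tmul, Bialgebra.counit_one, one_smul] at h1
  refine h1.trans ?_
  refine (congrArg (ofCoinv 𝓗)
    ((isHopf_radford hR).radford_mul_cross hQ x (radfordIncl 𝓡 h))).trans ?_
  rw [(isBialgHom_radfordIncl hR).map_comul]
  have h2 : ∀ u : H ⊗[k] H, ofCoinv 𝓗 (LinearMap.rTensor (R ⊗[k] H) (Z.actL.flip x)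
      (TensorProduct.map (radfordIncl 𝓡) (radfordIncl 𝓡) u)) =
      Z.act (radfordIncl 𝓡 (TensorProduct.rid k H
        (LinearMap.lTensor H Coalgebra.counit u)) ⊗ₜ x) ⊗ₜ 𝓡.one := by
    intro u
    induction u with
    | zero => simp
    | add x y hx hy => simp only [map_add, hx, hy, TensorProduct.add_tmul]
    | tmul a b => simp [radfordIncl, ← TensorProduct.smul_tmul']
  refine (h2 (Coalgebra.comul h)).trans ?_
  simp

theorem biYD_act_right (hR : IsBraidedHopf 𝓗 𝓡 Y) (hQ : IsBraidedHopf 𝓐 𝓠 Z) (h : H) (r : R) :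
    (YB).act (h ⊗ₜ (𝓠.one ⊗ₜ r)) = 𝓠.one ⊗ₜ Y.act (h ⊗ₜ r) := by
  have h1 := (isCoinvModel_biproduct hR hQ).act_p h (𝓠.one ⊗ₜ (r ⊗ₜ (1 : H)))
  rw [ofCoinv_tmul, Bialgebra.counit_one, one_smul] at h1
  refine h1.trans ?_
  change ofCoinv 𝓗 ((𝓔).mul ((𝓠.one ⊗ₜ radfordIncl 𝓡 h) ⊗ₜ (𝓠.one ⊗ₜ (r ⊗ₜ (1 : H))))) = _
  rw [(isHopf_radford hR).radford_mul_one_right hQ]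
  refine (congrArg (fun t => ofCoinv 𝓗 (𝓠.one ⊗ₜ[k] t))
    ((isHopf_of k H).radford_mul_cross hR r h)).trans ?_
  have h2 : ∀ u : H ⊗[k] H, ofCoinv 𝓗 (𝓠.one ⊗ₜ LinearMap.rTensor H (Y.actL.flip r) u) =
      𝓠.one ⊗ₜ Y.act (TensorProduct.rid k H (LinearMap.lTensor H Coalgebra.counit u) ⊗ₜ r) := by
    intro u
    induction u with
    | zero => simp
    | add x y hx hy => simp only [map_add, hx, hy, TensorProduct.add_tmul, TensorProduct.tmul_add]
    | tmul a b => simp [← TensorProduct.smul_tmul']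
  refine (h2 (Coalgebra.comul h)).trans ?_
  simp

/-- The projection to `H` passes through `A`, where the left leg of `Δ(x # 1)` gives the coaction of
`Q` over `A`. -/
theorem biYD_coact_left (hR : IsBraidedHopf 𝓗 𝓡 Y) (hQ : IsBraidedHopf 𝓐 𝓠 Z) (x : Q) :
    (YB).coact (x ⊗ₜ 𝓡.one) =
      TensorProduct.map (radfordProj 𝓡) ((TensorProduct.mk k Q R).flip 𝓡.one) (Z.coact x) := by
  have h1 := (isHopf_radford hR).rTensor_radfordProj_comul hQ x
  have h2 : TensorProduct.map (biProj 𝓡 𝓠) (ofCoinv 𝓗) =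
      TensorProduct.map (radfordProj 𝓡) (ofCoinv 𝓗) ∘ₗ
        LinearMap.rTensor (Q ⊗[k] (R ⊗[k] H)) (radfordProj (H := R ⊗[k] H) 𝓠) := by
    rw [LinearMap.map_comp_rTensor]
    rfl
  change TensorProduct.map (biProj 𝓡 𝓠) (ofCoinv 𝓗) ((𝓔).comul (x ⊗ₜ (𝓐).one)) = _
  rw [h2, LinearMap.comp_apply, h1]
  induction Z.coact x with
  | zero => simp
  | add x y hx hy => simp only [map_add, hx, hy]
  | tmul a b =>
    have : (𝓐).one = 𝓡.one ⊗ₜ 1 := rfl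
    simp [this]

theorem biYD_coact_right (hR : IsBraidedHopf 𝓗 𝓡 Y) (hQ : IsBraidedHopf 𝓐 𝓠 Z) (r : R) :
    (YB).coact (𝓠.one ⊗ₜ r) =
      LinearMap.lTensor H (TensorProduct.mk k Q R 𝓠.one) (Y.coact r) := by
  have h1 := (isHopf_of k H).rTensor_radfordProj_comul hR r
  change TensorProduct.map (biProj 𝓡 𝓠) (ofCoinv 𝓗)
    ((𝓔).comul (radfordIncl 𝓠 (r ⊗ₜ (1 : H)))) = _
  rw [((isHopf_radford hR).isBialgHom_radfordIncl hQ).map_comul, ← LinearMap.comp_apply,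
    ← TensorProduct.map_comp]
  have h2 : biProj 𝓡 𝓠 ∘ₗ radfordIncl 𝓠 = radfordProj (H := H) 𝓡 :=
    LinearMap.ext fun a => by simp [biProj, radfordProj, radfordIncl, hQ.counit_one]
  have h3 : TensorProduct.map (radfordProj (H := H) 𝓡) (ofCoinv 𝓗 ∘ₗ radfordIncl 𝓠) =
      LinearMap.lTensor H (ofCoinv 𝓗 ∘ₗ radfordIncl 𝓠) ∘ₗ
        LinearMap.rTensor (R ⊗[k] H) (radfordProj (H := H) 𝓡) := by
    rw [LinearMap.lTensor_comp_rTensor]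
  rw [h2, h3, LinearMap.comp_apply]
  refine (congrArg _ h1).trans ?_
  induction Y.coact r with
  | zero => simp
  | add x y hx hy => simp only [map_add, hx, hy]
  | tmul a b =>
    have : (𝓗).one = 1 := rfl
    simp [radfordIncl, this]

/-- The coaction of `R` on `Q # R` along the projection `x # r ↦ ε(x) r`. -/
theorem biOps_comul_proj (hR : IsBraidedHopf 𝓗 𝓡 Y) (hQ : IsBraidedHopf 𝓐 𝓠 Z) (x : Q) (r : R) :
    LinearMap.lTensor (Q ⊗[k] R) (radfordProj 𝓠) ((𝓑).comul (x ⊗ₜ r)) =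
      LinearMap.rTensor R (TensorProduct.mk k Q R x) (𝓡.comul r) := by
  have h1 := (isCoinvModel_biproduct hR hQ).comul_p (x ⊗ₜ (r ⊗ₜ (1 : H)))
  rw [ofCoinv_tmul, Bialgebra.counit_one, one_smul] at h1
  refine (congrArg _ h1).trans ?_
  have h2 : radfordProj 𝓠 ∘ₗ ofCoinv 𝓗 =
      radfordCoproj 𝓗 R ∘ₗ radfordProj (H := R ⊗[k] H) 𝓠 := by
    ext x r h
    simp [radfordProj, radfordCoproj]
    exact smul_comm _ _ _
  rw [← LinearMap.comp_apply, LinearMap.lTensor_comp_map, h2, ← LinearMap.map_comp_lTensor,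
    LinearMap.comp_apply, (isHopf_radford hR).lTensor_radfordProj_comul hQ,
    ← (isHopf_of k H).map_radfordCoproj_comul hR r]
  change _ = LinearMap.rTensor R _ (TensorProduct.map _ _ ((𝓐).comul (r ⊗ₜ (1 : H))))
  induction (𝓐).comul (r ⊗ₜ (1 : H)) with
  | zero => simp
  | add x y hx hy => simp only [map_add, hx, hy]
  | tmul a b =>
    simp only [LinearMap.rTensor_tmul, TensorProduct.map_tmul]
    rfl

/-- `Δ(x # 1) = (x⁽¹⁾ # ϑ(x⁽²⁾₍₋₁₎)) ⊗ (x⁽²⁾₍₀₎ # 1)`, where `ϑ(r # h) = ε(h) r`: both the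
comultiplication of `Q` and the `R`-part of its coaction are visible. -/
theorem biOps_comul_left (hR : IsBraidedHopf 𝓗 𝓡 Y) (hQ : IsBraidedHopf 𝓐 𝓠 Z) (x : Q) :
    (𝓑).comul (x ⊗ₜ 𝓡.one) = LinearMap.lTensor (Q ⊗[k] R) ((TensorProduct.mk k Q R).flip 𝓡.one)
      ((TensorProduct.assoc k Q R Q).symm (LinearMap.lTensor Q
        (LinearMap.rTensor Q (radfordCoproj 𝓗 R) ∘ₗ Z.coact) (𝓠.comul x))) := by
  have h1 := (isCoinvModel_biproduct hR hQ).comul_p (x ⊗ₜ (𝓐).one)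
  have h0 : ofCoinv 𝓗 (x ⊗ₜ[k] (𝓐).one) = x ⊗ₜ 𝓡.one := by
    change ofCoinv 𝓗 (x ⊗ₜ[k] (𝓡.one ⊗ₜ (1 : H))) = x ⊗ₜ 𝓡.one
    simp
  rw [h0, (isHopf_radford hR).radford_comul_one] at h1
  refine h1.trans ?_
  induction 𝓠.comul x with
  | zero => simp
  | add x y hx hy => simp only [map_add, hx, hy]
  | tmul y z =>
    simp only [LinearMap.lTensor_tmul, LinearMap.comp_apply]
    induction Z.coact z with
    | zero => simp
    | add x y hx hy => simp only [map_add, hx, hy, TensorProduct.tmul_add]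
    | tmul a b =>
      have h2 : ofCoinv 𝓗 (b ⊗ₜ[k] (𝓐).one) = b ⊗ₜ 𝓡.one := by
        change ofCoinv 𝓗 (b ⊗ₜ[k] (𝓡.one ⊗ₜ (1 : H))) = b ⊗ₜ 𝓡.one
        simp
      simp only [TensorProduct.assoc_symm_tmul, LinearMap.lTensor_tmul, LinearMap.flip_apply,
        TensorProduct.mk_apply, TensorProduct.map_tmul, LinearMap.rTensor_tmul, h2]
      rfl

end Biproduct

/-! ### Weights zero and one -/

section LowDegree

variable {k : Type*} [Field k] {H M Q : Type*} [AddCommGroup H] [Module k H]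
  [AddCommGroup M] [Module k M] [AddCommGroup Q] [Module k Q]
  {𝓗 : HopfOps k H} {𝓠 : HopfOps k Q} {Y : YDOps k H Q} {j : M →ₗ[k] Q} {D : ℕ → Submodule k M}

theorem IsWord.mem_span_one (hD : D 0 = ⊥) {n : ℕ} {x : Q} (hx : IsWord 𝓠 j D n x) (hn : n = 0) :
    x ∈ Submodule.span k {𝓠.one} := by
  cases hx with
  | one => exact Submodule.mem_span_singleton_self _
  | @cons i n m x hm hx =>
    have hi : i = 0 := by omega
    subst hi
    rw [hD, Submodule.mem_bot] at hm
    rw [hm, map_zero, TensorProduct.zero_tmul, map_zero]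
    exact zero_mem _

theorem weightGrading_zero (hD : D 0 = ⊥) :
    weightGrading 𝓠 j D 0 = Submodule.span k {𝓠.one} :=
  le_antisymm (Submodule.span_le.2 fun _ hx => IsWord.mem_span_one hD hx rfl)
    (Submodule.span_le.2 (Set.singleton_subset_iff.2 one_mem_weightGrading))

/-- Letters have positive weight. In a nonzero word of weight one the first letter therefore has
weight one and the rest of the word is a scalar. -/
theorem IsBraidedHopf.weightGrading_one (h : IsBraidedHopf 𝓗 𝓠 Y) (hD : D 0 = ⊥) :
    weightGrading 𝓠 j D 1 = (D 1).map j := by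
  refine le_antisymm (Submodule.span_le.2 fun x hx => ?_) ?_
  · suffices ∀ n, IsWord 𝓠 j D n x → n = 1 → x ∈ (D 1).map j from this 1 hx rfl
    clear hx
    intro n hx hn
    cases hx with
    | one => omega
    | @cons i n m x hm hx =>
      rcases Nat.eq_zero_or_pos i with rfl | hi
      · rw [hD, Submodule.mem_bot] at hm
        rw [hm, map_zero, TensorProduct.zero_tmul, map_zero]
        exact zero_mem _
      · have hi : i = 1 := by omega
        subst hi
        obtain ⟨c, rfl⟩ := Submodule.mem_span_singleton.1 (hx.mem_span_one hD (by omega))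
        rw [TensorProduct.tmul_smul, map_smul, h.mul_one]
        exact Submodule.smul_mem _ _ ⟨m, hm, rfl⟩
  · rintro _ ⟨m, hm, rfl⟩
    have := cons_mem_weightGrading (j := j) hm (one_mem_weightGrading (𝓝 := 𝓠))
    rwa [h.mul_one] at this

theorem IsGradedBraidedHopf.braiding_mem {G : ℕ → Submodule k Q}
    (h : IsGradedBraidedHopf 𝓗 𝓠 Y G) (m n : ℕ) (t : Q ⊗[k] Q) (ht : t ∈ tensorSub (G m) (G n)) :
    braiding Y Y t ∈ tensorSub (G n) (G m) := by
  suffices tensorSub (G m) (G n) ≤ (tensorSub (G n) (G m)).comap (braiding Y Y) from this ht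
  refine Submodule.map₂_le.2 fun x hx y hy => ?_
  change braiding Y Y (x ⊗ₜ y) ∈ tensorSub (G n) (G m)
  rw [braiding_tmul]
  have : tensorSub ⊤ (G m) ≤ (tensorSub (G n) (G m)).comap
      (LinearMap.rTensor Q (Y.actL.flip y)) :=
    Submodule.map₂_le.2 fun a _ x hx => Submodule.apply_mem_map₂ _ (h.act_mem n a y hy) hx
  exact this (h.coact_mem m x hx)

end LowDegree

/-! ### Highest weight vectors -/

section HighestWeight

variable {k : Type*} [Field k] {H R M : Type*} [AddCommGroup H] [Module k H]
  [AddCommGroup R] [Module k R] [AddCommGroup M] [Module k M]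
  {𝓗 : HopfOps k H} {𝓡 : HopfOps k R} {YR : YDOps k H R} {G : ℕ → Submodule k R}
  {Y : YDOps k (R ⊗[k] H) M} {D : ℕ → Submodule k M}

theorem hwYD_coact (h1 : 𝓡.one ∈ G 0) (hM : IsHighestWeight 𝓗 𝓡 YR G Y D) (m : hwSpace 𝓡 Y) :
    LinearMap.lTensor H (hwSpace 𝓡 Y).subtype ((hwYD h1 hM).coact m) =
      LinearMap.rTensor M (radfordProj 𝓡) (Y.coact m) := by
  have := LinearEquiv.apply_symm_apply (LinearEquiv.ofInjective
    (LinearMap.lTensor H (hwSpace 𝓡 Y).subtype)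
      (Module.Flat.lTensor_preserves_injective_linearMap _ (hwSpace 𝓡 Y).injective_subtype))
    (LinearMap.codRestrict _ ((Y.pull (radfordIncl 𝓡) (radfordProj 𝓡)).coact ∘ₗ
      (hwSpace 𝓡 Y).subtype) (fun m => hM.coact_mem m m.2) m)
  exact congrArg Subtype.val this

/-- `m` is a highest weight vector if `ϑ(m₍₋₁₎) ⊗ m₍₀₎ = 1 ⊗ m`, where `ϑ(r # h) = ε(h) r`. -/
theorem mem_hwSpace_of_coproj (h𝓗 : IsHopf 𝓗) (hR : IsBraidedHopf 𝓗 𝓡 YR)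
    (hY : IsYD (radford 𝓗 𝓡 YR) Y) {m : M}
    (hm : LinearMap.rTensor M (radfordCoproj 𝓗 R) (Y.coact m) = 𝓡.one ⊗ₜ m) :
    m ∈ hwSpace 𝓡 Y := by
  refine ⟨LinearMap.rTensor M (radfordProj 𝓡) (Y.coact m), ?_⟩
  -- By the recovery formula for `R # H`, `m₍₋₁₎` is the tensor of `ϑ(m₍₋₂₎)` and the projection of
  -- `m₍₋₁₎` to `H`. If the `ϑ`-coaction is trivial, the first factor is `1`, so the coaction of `m`
  -- comes from `1 # H`.
  have h1 : ∀ u : (R ⊗[k] H) ⊗[k] M, u = (TensorProduct.assoc k R H M).symm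
      (LinearMap.lTensor R (LinearMap.rTensor M (radfordProj 𝓡))
        (LinearMap.rTensor ((R ⊗[k] H) ⊗[k] M) (radfordCoproj 𝓗 R)
          (TensorProduct.assoc k _ _ _ (LinearMap.rTensor M (radford 𝓗 𝓡 YR).comul u)))) := by
    intro u
    induction u with
    | zero => simp
    | add x y hx hy => simp only [map_add]; rw [← hx, ← hy]
    | tmul a m =>
      conv_lhs => rw [← h𝓗.map_radfordCoproj_radfordProj_comul hR a]
      rw [LinearMap.rTensor_tmul]
      induction (radford 𝓗 𝓡 YR).comul a with
      | zero => simp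
      | add x y hx hy => simp only [map_add, TensorProduct.add_tmul, hx, hy]
      | tmul b c => simp
  have h2 : LinearMap.rTensor ((R ⊗[k] H) ⊗[k] M) (radfordCoproj 𝓗 R)
      (LinearMap.lTensor (R ⊗[k] H) Y.coact (Y.coact m)) = 𝓡.one ⊗ₜ Y.coact m := by
    rw [← LinearMap.comp_apply, LinearMap.rTensor_comp_lTensor, ← LinearMap.lTensor_comp_rTensor,
      LinearMap.comp_apply, hm, LinearMap.lTensor_tmul]
  refine Eq.trans ?_ (h1 (Y.coact m)).symm
  rw [hY.coassoc, h2, LinearMap.lTensor_tmul]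
  induction Y.coact m with
  | zero => simp
  | add x y hx hy => simp only [map_add, TensorProduct.tmul_add, hx, hy]
  | tmul a b => simp [radfordIncl]

end HighestWeight

/-! ### `Q # R` is a Nichols algebra of `M_H ⊕ V` -/

section Setting

variable {k : Type*} [Field k] {H : Type*} [Ring H] [HopfAlgebra k H]
  {V R M Q : Type*} [AddCommGroup V] [Module k V] [AddCommGroup R] [Module k R]
  [AddCommGroup M] [Module k M] [AddCommGroup Q] [Module k Q]
  {YV : YDOps k H V} {𝓡 : HopfOps k R} {YR : YDOps k H R} {G : ℕ → Submodule k R}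
  {jV : V →ₗ[k] R} {YM : YDOps k (R ⊗[k] H) M} {D : ℕ → Submodule k M}
  {𝓠 : HopfOps k Q} {YQ : YDOps k (R ⊗[k] H) Q} {F : ℕ → Submodule k Q} {jM : M →ₗ[k] Q}

local notation "𝓗" => HopfOps.of k H
local notation "𝓐" => radford (HopfOps.of k H) 𝓡 YR
local notation "𝓑" => biOps (HopfOps.of k H) 𝓡 YR 𝓠 YQ
local notation "YB" => biYD (HopfOps.of k H) 𝓡 YR 𝓠 YQ
local notation "KB" => tensorGrading (weightGrading 𝓠 jM D) G

/-- The map `(x, v) ↦ x # 1 + 1 # v`. -/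
def biprodMap (𝓡 : HopfOps k R) (YM : YDOps k (R ⊗[k] H) M) (𝓠 : HopfOps k Q) (jM : M →ₗ[k] Q)
    (jV : V →ₗ[k] R) : hwSpace 𝓡 YM × V →ₗ[k] Q ⊗[k] R :=
  LinearMap.coprod ((TensorProduct.mk k Q R).flip 𝓡.one ∘ₗ jM ∘ₗ (hwSpace 𝓡 YM).subtype)
    (TensorProduct.mk k Q R 𝓠.one ∘ₗ jV)

theorem biprodMap_apply (m : hwSpace 𝓡 YM) (v : V) : biprodMap 𝓡 YM 𝓠 jM jV (m, v) =
    jM m ⊗ₜ 𝓡.one + 𝓠.one ⊗ₜ jV v := rfl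

/-- Both factors have scalars in degree zero, so degree one is `Q[1] ⊗ 1` plus `1 ⊗ R(1)`. The first
is `M(1) = M_H`, the second is `V`. -/
theorem biprod_range_eq (hR : IsNichols 𝓗 YV 𝓡 YR G jV) (hM : IsHighestWeight 𝓗 𝓡 YR G YM D)
    (hQ : IsNichols 𝓐 YM 𝓠 YQ F jM) :
    LinearMap.range (biprodMap 𝓡 YM 𝓠 jM jV) = KB 1 := by
  have hD := hM.gradedYD.zero_eq
  refine le_antisymm ?_ (tensorGrading_le fun i l hil x hx y hy => ?_)
  · rintro _ ⟨⟨m, v⟩, rfl⟩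
    have hm : (m : M) ∈ D 1 := hM.hwSpace_eq ▸ m.2
    rw [biprodMap_apply]
    refine add_mem (tmul_mem_tensorGrading_of_eq (add_zero 1) ?_ hR.graded.one_mem)
      (tmul_mem_tensorGrading_of_eq (zero_add 1) one_mem_weightGrading (hR.j_mem v))
    rw [hQ.hopf.weightGrading_one hD]
    exact ⟨m, hm, rfl⟩
  · rcases Nat.eq_zero_or_pos i with rfl | hi
    · have hl : l = 1 := by omega
      subst hl
      rw [weightGrading_zero hD] at hx
      obtain ⟨c, rfl⟩ := Submodule.mem_span_singleton.1 hx
      rw [← hR.range_eq] at hy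
      obtain ⟨v, rfl⟩ := hy
      refine ⟨(0, c • v), ?_⟩
      rw [biprodMap_apply]
      simp [TensorProduct.smul_tmul']
    · have hi : i = 1 := by omega
      have hl : l = 0 := by omega
      subst hi hl
      rw [hQ.hopf.weightGrading_one hD, ← hM.hwSpace_eq] at hx
      obtain ⟨m, hm, rfl⟩ := hx
      rw [hR.eq_smul_one hy]
      refine ⟨(𝓡.counit y • ⟨m, hm⟩, 0), ?_⟩
      rw [biprodMap_apply]
      simp [TensorProduct.smul_tmul']

/-- The counits of the two factors vanish on `V` and `M`, and so separate the summands. -/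
theorem biprod_injective (hR : IsNichols 𝓗 YV 𝓡 YR G jV) (hQ : IsNichols 𝓐 YM 𝓠 YQ F jM) :
    Function.Injective (biprodMap 𝓡 YM 𝓠 jM jV) := by
  refine (injective_iff_map_eq_zero _).2 ?_
  rintro ⟨m, v⟩ h
  rw [biprodMap_apply] at h
  have hm := hQ.graded.counit_eq_zero 1 one_ne_zero _ (hQ.j_mem m)
  have hv := hR.graded.counit_eq_zero 1 one_ne_zero _ (hR.j_mem v)
  have h1 := congrArg (radfordCoproj 𝓡 Q) h
  have h2 := congrArg (radfordProj 𝓠) h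
  simp only [map_add, radfordCoproj_tmul, radfordProj, LinearMap.comp_apply,
    LinearMap.rTensor_tmul, LinearEquiv.coe_coe, TensorProduct.lid_tmul, hm, hv, zero_smul,
    hQ.hopf.counit_one, hR.hopf.counit_one, one_smul, map_zero, add_zero, zero_add] at h1 h2
  refine Prod.ext (Subtype.ext (hQ.injective ?_)) (hR.injective ?_)
  · rw [h1]; simp
  · rw [h2]; simp

theorem biprod_isYDHom (hR : IsNichols 𝓗 YV 𝓡 YR G jV) (hM : IsHighestWeight 𝓗 𝓡 YR G YM D)
    (hQ : IsNichols 𝓐 YM 𝓠 YQ F jM) :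
    IsYDHom ((hwYD hR.graded.one_mem hM).prod YV) YB (biprodMap 𝓡 YM 𝓠 jM jV) where
  map_act := by
    refine TensorProduct.ext' fun h => ?_
    rintro ⟨m, v⟩
    simp only [LinearMap.comp_apply, LinearMap.lTensor_tmul, biprodMap_apply,
      TensorProduct.tmul_add, map_add]
    rw [biYD_act_left hR.hopf hQ.hopf, biYD_act_right hR.hopf hQ.hopf,
      hQ.isPrimitiveMap.act_j, hR.isPrimitiveMap.act_j]
    rfl
  map_coact := by
    refine LinearMap.prod_ext (LinearMap.ext fun m => ?_) (LinearMap.ext fun v => ?_)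
    · have h1 : ∀ m, biprodMap 𝓡 YM 𝓠 jM jV (m, 0) = jM m ⊗ₜ 𝓡.one := fun m => by
        rw [biprodMap_apply]; simp
      have h2 := congrArg (LinearMap.lTensor H ((TensorProduct.mk k Q R).flip 𝓡.one ∘ₗ jM))
        (hwYD_coact hR.graded.one_mem hM m)
      simp only [LinearMap.comp_apply, LinearMap.inl_apply, h1]
      rw [biYD_coact_left hR.hopf hQ.hopf, hQ.isPrimitiveMap.coact_j]
      have h3 : ((hwYD hR.graded.one_mem hM).prod YV).coact (m, 0) =
          LinearMap.lTensor H (LinearMap.inl k _ V) ((hwYD hR.graded.one_mem hM).coact m) := by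
        simp [YDOps.prod]
      rw [h3, ← LinearMap.comp_apply (LinearMap.lTensor H _), ← LinearMap.lTensor_comp]
      have h4 : biprodMap 𝓡 YM 𝓠 jM jV ∘ₗ LinearMap.inl k _ V =
          ((TensorProduct.mk k Q R).flip 𝓡.one ∘ₗ jM) ∘ₗ (hwSpace 𝓡 YM).subtype := by
        ext m
        exact h1 m
      rw [h4, LinearMap.lTensor_comp _ ((TensorProduct.mk k Q R).flip 𝓡.one ∘ₗ jM),
        LinearMap.comp_apply, h2]
      induction YM.coact m with
      | zero => simp
      | add x y hx hy => simp only [map_add, hx, hy]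
      | tmul a b => simp
    · have h1 : ∀ v, biprodMap 𝓡 YM 𝓠 jM jV (0, v) = 𝓠.one ⊗ₜ jV v := fun v => by
        rw [biprodMap_apply]; simp
      simp only [LinearMap.comp_apply, LinearMap.inr_apply, h1]
      rw [biYD_coact_right hR.hopf hQ.hopf, hR.isPrimitiveMap.coact_j]
      have h3 : ((hwYD hR.graded.one_mem hM).prod YV).coact (0, v) =
          LinearMap.lTensor H (LinearMap.inr k (hwSpace 𝓡 YM) V) (YV.coact v) := by
        simp [YDOps.prod]
      rw [h3]
      induction YV.coact v with
      | zero => simp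
      | add x y hx hy => simp only [map_add, hx, hy]
      | tmul a b => simp [h1]

theorem biprod_generates (hR : IsNichols 𝓗 YV 𝓡 YR G jV) (hM : IsHighestWeight 𝓗 𝓡 YR G YM D)
    (hQ : IsNichols 𝓐 YM 𝓠 YQ F jM) : Generates 𝓑 (KB 1) := by
  intro T h1 hT hmul
  rw [biOps_one] at h1
  rw [← biprod_range_eq hR hM hQ] at hT
  have hTv : ∀ v, 𝓠.one ⊗ₜ jV v ∈ T := fun v => hT ⟨(0, v), by rw [biprodMap_apply]; simp⟩
  have hTm : ∀ m ∈ hwSpace 𝓡 YM, jM m ⊗ₜ 𝓡.one ∈ T := fun m hm =>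
    hT ⟨(⟨m, hm⟩, 0), by rw [biprodMap_apply]; simp⟩
  have hTR : ∀ r, 𝓠.one ⊗ₜ r ∈ T := by
    have := hR.generates (T.comap (TensorProduct.mk k Q R 𝓠.one)) h1 (by
      rw [← hR.range_eq]
      rintro _ ⟨v, rfl⟩
      exact hTv v) (fun r hr s hs => by
        have := hmul _ hr _ hs
        rwa [TensorProduct.mk_apply, TensorProduct.mk_apply,
          biOps_mul_right hR.hopf hQ.hopf] at this)
    intro r
    exact (this ▸ Submodule.mem_top : r ∈ T.comap (TensorProduct.mk k Q R 𝓠.one))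
  have hTmul : ∀ x r, x ⊗ₜ 𝓡.one ∈ T → x ⊗ₜ r ∈ T := fun x r hx => by
    have := hmul _ hx _ (hTR r)
    rwa [biOps_mul_right hR.hopf hQ.hopf, hR.hopf.one_mul] at this
  have hYM := hM.gradedYD.yd
  let T₀ : Submodule k M := T.comap ((TensorProduct.mk k Q R).flip 𝓡.one ∘ₗ jM)
  -- `T` is not assumed stable under `H`. Requiring that all `H`-translates of `m` lie in `T` gives
  -- an `H`-stable subspace, which will be shown to be stable under `R` as well.
  let T₁ : Submodule k M := ⨅ h : H, T₀.comap (YM.actL (radfordIncl 𝓡 h))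
  have hT₁ : ∀ m, m ∈ T₁ ↔ ∀ h, jM (YM.act (radfordIncl 𝓡 h ⊗ₜ m)) ⊗ₜ 𝓡.one ∈ T := fun m => by
    simp only [T₁, Submodule.mem_iInf]
    rfl
  have hT₁₀ : ∀ m ∈ T₁, jM m ⊗ₜ 𝓡.one ∈ T := fun m hm => by
    have := (hT₁ m).1 hm 1
    have h2 : YM.act (radfordIncl 𝓡 (1 : H) ⊗ₜ m) = m := hYM.one_act m
    rwa [h2] at this
  have hact : ∀ g, ∀ m ∈ T₁, YM.act (radfordIncl 𝓡 g ⊗ₜ m) ∈ T₁ := fun g m hm =>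
    (hT₁ _).2 fun h => by
      rw [← hYM.mul_act, radford_mul_incl' hR.hopf]
      exact (hT₁ m).1 hm (h * g)
  have hv : ∀ v, ∀ m ∈ T₁, jM (YM.act ((jV v ⊗ₜ (1 : H)) ⊗ₜ m)) ⊗ₜ 𝓡.one ∈ T := by
    intro v m hm
    -- `(1 # v)(m # 1) = v₋₁ m # v₀ + v m # 1`. The product lies in `T`, and so do the terms `v₋₁ m
    -- # v₀`, as `H`-translates of `m` times elements of `R`; hence `v m # 1` does too.
    have e1 := biOps_mul_primitive hR.hopf hQ.hopf (hR.isPrimitiveMap.comul_j v) (jM m)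
    have e2 := hmul _ (hTv v) _ (hT₁₀ m hm)
    rw [e1] at e2
    rw [← hQ.isPrimitiveMap.act_j]
    refine (Submodule.add_mem_iff_right T ?_).1 e2
    induction YR.coact (jV v) with
    | zero => simp
    | add x y hx hy => rw [map_add]; exact add_mem hx hy
    | tmul a b =>
      refine hTmul _ b ?_
      change YQ.act (radfordIncl 𝓡 a ⊗ₜ jM m) ⊗ₜ 𝓡.one ∈ T
      rw [hQ.isPrimitiveMap.act_j]
      exact (hT₁ m).1 hm a
  have hv' : ∀ v, ∀ m ∈ T₁, YM.act ((jV v ⊗ₜ (1 : H)) ⊗ₜ m) ∈ T₁ := fun v m hm =>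
    (hT₁ _).2 fun h => by
      rw [← hYM.mul_act]
      -- By the exchange rule `h v = (h₁ · v) h₂` in `A`, the translate by `h` of `v m` is again of
      -- the form treated in `hv`.
      have e1 := (isHopf_of k H).radford_mul_cross hR.hopf (jV v) h
      change jM (YM.act ((𝓐).mul ((𝓡.one ⊗ₜ h) ⊗ₜ (jV v ⊗ₜ (𝓗).one)) ⊗ₜ m)) ⊗ₜ 𝓡.one ∈ T
      rw [e1]
      induction (𝓗).comul h with
      | zero => simp
      | add x y hx hy =>
        simp only [map_add, TensorProduct.add_tmul]; exact add_mem hx hy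
      | tmul a b =>
        have e2 : YR.act (a ⊗ₜ jV v) ⊗ₜ[k] b =
            (𝓐).mul ((jV (YV.act (a ⊗ₜ v)) ⊗ₜ (1 : H)) ⊗ₜ radfordIncl 𝓡 b) := by
          rw [hR.isPrimitiveMap.act_j]
          exact (radford_mul_incl hR.hopf _ b).symm
        rw [LinearMap.rTensor_tmul, LinearMap.flip_apply, YDOps.actL_apply, e2, hYM.mul_act]
        exact hv _ _ (hact b m hm)
  have hr : ∀ r, ∀ m ∈ T₁, YM.act ((r ⊗ₜ (1 : H)) ⊗ₜ m) ∈ T₁ := by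
    let T₂ : Submodule k R := ⨅ m : T₁, T₁.comap
      (YM.actL.flip (m : M) ∘ₗ (TensorProduct.mk k R H).flip 1)
    have hT₂ : ∀ r, r ∈ T₂ ↔ ∀ m ∈ T₁, YM.act ((r ⊗ₜ (1 : H)) ⊗ₜ m) ∈ T₁ := fun r => by
      simp only [T₂, Submodule.mem_iInf, Subtype.forall]
      rfl
    have : T₂ = ⊤ := hR.generates T₂ ((hT₂ _).2 fun m hm => by
        have : YM.act ((𝓡.one ⊗ₜ (1 : H)) ⊗ₜ m) = m := hYM.one_act m
        rwa [this])
      (by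
        rw [← hR.range_eq]
        rintro _ ⟨v, rfl⟩
        exact (hT₂ _).2 (hv' v))
      (fun r hr s hs => (hT₂ _).2 fun m hm => by
        have e1 : (𝓐).mul ((r ⊗ₜ (1 : H)) ⊗ₜ (s ⊗ₜ (1 : H))) = 𝓡.mul (r ⊗ₜ s) ⊗ₜ (1 : H) :=
          (isHopf_of k H).radford_mul_left hR.hopf r s 1
        rw [← e1, hYM.mul_act]
        exact (hT₂ r).1 hr _ ((hT₂ s).1 hs m hm))
    exact fun r => (hT₂ r).1 (this ▸ Submodule.mem_top)
  have hMtop : T₁ = ⊤ := by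
    refine hM.generates T₁ (fun m hm => (hT₁ m).2 fun h =>
      hTm _ (hM.act_mem hR.graded.one_mem h m hm)) fun a m hm => ?_
    induction a with
    | zero => simp
    | add x y hx hy => rw [TensorProduct.add_tmul, map_add]; exact add_mem hx hy
    | tmul r h =>
      have e1 : (𝓐).mul ((r ⊗ₜ (1 : H)) ⊗ₜ radfordIncl 𝓡 h) = r ⊗ₜ h :=
        radford_mul_incl hR.hopf r h
      rw [← e1, hYM.mul_act]
      exact hr r _ (hact h m hm)
  have hTQ : ∀ x, x ⊗ₜ 𝓡.one ∈ T := by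
    have := hQ.generates (T.comap ((TensorProduct.mk k Q R).flip 𝓡.one)) h1 (by
      rw [← hQ.range_eq]
      rintro _ ⟨m, rfl⟩
      exact hT₁₀ m (hMtop ▸ Submodule.mem_top)) (fun x hx y hy => by
        have := hmul _ hx _ hy
        rwa [LinearMap.flip_apply, LinearMap.flip_apply, TensorProduct.mk_apply,
          TensorProduct.mk_apply, biOps_mul_left hR.hopf hQ.hopf] at this)
    intro x
    exact (this ▸ Submodule.mem_top : x ∈ T.comap ((TensorProduct.mk k Q R).flip 𝓡.one))
  rw [eq_top_iff, ← TensorProduct.span_tmul_eq_top, Submodule.span_le]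
  rintro _ ⟨x, r, rfl⟩
  exact hTmul x r (hTQ x)

/-- The component of degree zero consists of scalars, so the comultiplication of an element of
degree one has no inner components. -/
theorem biprod_comul_of_mem_one (hR : IsNichols 𝓗 YV 𝓡 YR G jV)
    (hM : IsHighestWeight 𝓗 𝓡 YR G YM D) (hQ : IsNichols 𝓐 YM 𝓠 YQ F jM) {b : Q ⊗[k] R}
    (hb : b ∈ KB 1) : (𝓑).comul b = (𝓑).one ⊗ₜ b + b ⊗ₜ (𝓑).one := by
  have hB := isGradedBraidedHopf_biproduct hR hM hQ
  refine hB.hopf.comul_eq_of_mem_one hB.graded (fun y hy => ?_) hb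
  have h1 : KB 0 ≤ Submodule.span k {(𝓑).one} := by
    refine tensorGrading_le fun i l hil x hx y hy => ?_
    have hi : i = 0 := by omega
    have hl : l = 0 := by omega
    subst hi hl
    rw [weightGrading_zero hM.gradedYD.zero_eq] at hx
    obtain ⟨c, rfl⟩ := Submodule.mem_span_singleton.1 hx
    rw [hR.eq_smul_one hy, biOps_one, TensorProduct.tmul_smul, ← TensorProduct.smul_tmul']
    exact Submodule.smul_mem _ _ (Submodule.smul_mem _ _ (Submodule.mem_span_singleton_self _))
  obtain ⟨c, rfl⟩ := Submodule.mem_span_singleton.1 (h1 hy)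
  rw [map_smul, hB.hopf.counit_one, smul_eq_mul, mul_one]

/-- A primitive element of `Q # R` is the sum of an element of `Q` and a primitive element
of `R`. -/
theorem biprod_primitive_decomp (hR : IsBraidedHopf 𝓗 𝓡 YR) (hQ : IsBraidedHopf 𝓐 𝓠 YQ)
    {b : Q ⊗[k] R} (hb : (𝓑).comul b = (𝓑).one ⊗ₜ b + b ⊗ₜ (𝓑).one) :
    ∃ x v, b = x ⊗ₜ 𝓡.one + 𝓠.one ⊗ₜ v ∧ 𝓡.comul v = 𝓡.one ⊗ₜ v + v ⊗ₜ 𝓡.one := by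
  have h1 : ∀ b, LinearMap.lTensor (Q ⊗[k] R) (radfordProj 𝓠) ((𝓑).comul b) =
      (TensorProduct.assoc k Q R R).symm (LinearMap.lTensor Q 𝓡.comul b) := by
    intro b
    induction b with
    | zero => simp
    | add x y hx hy => simp only [map_add, hx, hy]
    | tmul x r =>
      rw [biOps_comul_proj hR hQ, LinearMap.lTensor_tmul]
      induction 𝓡.comul r with
      | zero => simp
      | add x y hx hy => simp only [map_add, hx, hy, TensorProduct.tmul_add]
      | tmul a b => simp
  have h2 : ∀ b : Q ⊗[k] R, LinearMap.rTensor R (radfordCoproj 𝓡 Q)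
      ((TensorProduct.assoc k Q R R).symm (LinearMap.lTensor Q 𝓡.comul b)) = b := by
    intro b
    induction b with
    | zero => simp
    | add x y hx hy => simp only [map_add, hx, hy]
    | tmul x r =>
      have e : ∀ u : R ⊗[k] R, LinearMap.rTensor R (radfordCoproj 𝓡 Q)
          ((TensorProduct.assoc k Q R R).symm (x ⊗ₜ u)) =
          x ⊗ₜ TensorProduct.lid k R (LinearMap.rTensor R 𝓡.counit u) := by
        intro u
        induction u with
        | zero => simp
        | add x y hx hy => simp only [map_add, hx, hy, TensorProduct.tmul_add]
        | tmul a b => simp [TensorProduct.smul_tmul']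
      rw [LinearMap.lTensor_tmul, e, hR.counit_left]
  have h3 : ∀ b : Q ⊗[k] R, LinearMap.rTensor R (radfordProj 𝓠)
      ((TensorProduct.assoc k Q R R).symm (LinearMap.lTensor Q 𝓡.comul b)) =
      𝓡.comul (radfordProj 𝓠 b) := by
    intro b
    induction b with
    | zero => simp
    | add x y hx hy => simp only [map_add, hx, hy]
    | tmul x r =>
      simp only [LinearMap.lTensor_tmul, radfordProj, LinearMap.comp_apply, LinearEquiv.coe_coe,
        LinearMap.rTensor_tmul, TensorProduct.lid_tmul, map_smul]
      induction 𝓡.comul r with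
      | zero => simp
      | add x y hx hy => simp only [map_add, hx, hy, TensorProduct.tmul_add, smul_add]
      | tmul a b => simp [TensorProduct.smul_tmul']
  have e1 : radfordProj 𝓠 (𝓑).one = 𝓡.one := by
    rw [biOps_one]; simp [radfordProj, hQ.counit_one]
  have e2 : radfordCoproj 𝓡 Q (𝓑).one = 𝓠.one := by
    rw [biOps_one]; simp [hR.counit_one]
  have h4 := h1 b
  -- Projecting the right leg to `R` gives `id ⊗ Δ_R` applied to `b`, equal to `1 ⊗ v + b ⊗ 1` with
  -- `v` the image of `b` in `R`. The counit of `R` in the middle then recovers `b` (`h2`), and the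
  -- counit of `Q` on the left gives the comultiplication of `v` (`h3`).
  rw [hb, map_add, LinearMap.lTensor_tmul, LinearMap.lTensor_tmul, e1] at h4
  refine ⟨radfordCoproj 𝓡 Q b, radfordProj 𝓠 b, ?_, ?_⟩
  · conv_lhs => rw [← h2 b, ← h4]
    rw [map_add, LinearMap.rTensor_tmul, LinearMap.rTensor_tmul, e2, add_comm]
  · rw [← h3, ← h4, map_add, LinearMap.rTensor_tmul, LinearMap.rTensor_tmul, e1]

/-- If `x # 1` is primitive in `Q # R`, then `x` is primitive in `Q` and a highest weight
vector. -/
theorem biprod_primitive_left (hR : IsBraidedHopf 𝓗 𝓡 YR) (hQ : IsBraidedHopf 𝓐 𝓠 YQ) {x : Q}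
    (hx : (𝓑).comul (x ⊗ₜ 𝓡.one) = (𝓑).one ⊗ₜ (x ⊗ₜ 𝓡.one) + (x ⊗ₜ 𝓡.one) ⊗ₜ (𝓑).one) :
    𝓠.comul x = 𝓠.one ⊗ₜ x + x ⊗ₜ 𝓠.one ∧
      LinearMap.rTensor Q (radfordCoproj 𝓗 R) (YQ.coact x) =
        𝓡.one ⊗ₜ x + 𝓠.counit x • (𝓡.one ⊗ₜ 𝓠.one) := by
  rw [biOps_one, biOps_comul_left hR hQ] at hx
  constructor
  -- The counit of `R` in both legs removes the coaction and leaves the comultiplication of `Q`.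
  · have e1 : ∀ u : Q ⊗[k] Q, TensorProduct.map (radfordCoproj 𝓡 Q) (radfordCoproj 𝓡 Q)
        (LinearMap.lTensor (Q ⊗[k] R) ((TensorProduct.mk k Q R).flip 𝓡.one)
        ((TensorProduct.assoc k Q R Q).symm (LinearMap.lTensor Q
          (LinearMap.rTensor Q (radfordCoproj 𝓗 R) ∘ₗ YQ.coact) u))) = u := by
      intro u
      induction u with
      | zero => simp
      | add x y hx hy => simp only [map_add, hx, hy]
      | tmul y z =>
        rw [LinearMap.lTensor_tmul, LinearMap.comp_apply]
        have e2 : ∀ w : (R ⊗[k] H) ⊗[k] Q,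
            TensorProduct.map (radfordCoproj 𝓡 Q) (radfordCoproj 𝓡 Q)
            (LinearMap.lTensor (Q ⊗[k] R) ((TensorProduct.mk k Q R).flip 𝓡.one)
            ((TensorProduct.assoc k Q R Q).symm (y ⊗ₜ
              LinearMap.rTensor Q (radfordCoproj 𝓗 R) w))) =
            y ⊗ₜ TensorProduct.lid k Q (LinearMap.rTensor Q (𝓐).counit w) := by
          intro w
          induction w with
          | zero => simp
          | add x y hx hy => simp only [map_add, hx, hy, TensorProduct.tmul_add]
          | tmul a b =>
            have e3 : 𝓡.counit (radfordCoproj 𝓗 R a) = (𝓐).counit a := by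
              induction a with
              | zero => simp
              | add x y hx hy => simp only [map_add, hx, hy]
              | tmul r h => simp [radford, mul_comm]
            simp [e3, hR.counit_one, TensorProduct.smul_tmul']
        rw [e2, hQ.yd.counit_coact]
    rw [← e1 (𝓠.comul x), hx]
    simp [hR.counit_one]
  -- The counit of `Q` in the left leg and that of `R` in the right one leave `ϑ(x₋₁) ⊗ x₀`.
  · have e1 : ∀ u : Q ⊗[k] Q, TensorProduct.map (radfordProj 𝓠) (radfordCoproj 𝓡 Q)
        (LinearMap.lTensor (Q ⊗[k] R) ((TensorProduct.mk k Q R).flip 𝓡.one)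
        ((TensorProduct.assoc k Q R Q).symm (LinearMap.lTensor Q
          (LinearMap.rTensor Q (radfordCoproj 𝓗 R) ∘ₗ YQ.coact) u))) =
        LinearMap.rTensor Q (radfordCoproj 𝓗 R) (YQ.coact
          (TensorProduct.lid k Q (LinearMap.rTensor Q 𝓠.counit u))) := by
      intro u
      induction u with
      | zero => simp
      | add x y hx hy => simp only [map_add, hx, hy]
      | tmul y z =>
        simp only [LinearMap.lTensor_tmul, LinearMap.comp_apply, LinearMap.rTensor_tmul,
          TensorProduct.lid_tmul, map_smul]
        induction LinearMap.rTensor Q (radfordCoproj 𝓗 R) (YQ.coact z) with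
        | zero => simp
        | add x y hx hy => simp only [map_add, hx, hy, TensorProduct.tmul_add, smul_add]
        | tmul a b => simp [radfordProj, hR.counit_one, TensorProduct.smul_tmul']
    have e2 := e1 (𝓠.comul x)
    rw [hQ.counit_left, hx] at e2
    rw [← e2]
    simp [radfordProj, hR.counit_one, hQ.counit_one, TensorProduct.smul_tmul']

theorem biprod_primitive (hR : IsNichols 𝓗 YV 𝓡 YR G jV) (hM : IsHighestWeight 𝓗 𝓡 YR G YM D)
    (hQ : IsNichols 𝓐 YM 𝓠 YQ F jM) {b : Q ⊗[k] R}
    (hb : (𝓑).comul b = (𝓑).one ⊗ₜ b + b ⊗ₜ (𝓑).one) :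
    b ∈ LinearMap.range (biprodMap 𝓡 YM 𝓠 jM jV) := by
  obtain ⟨x, v, rfl, hv⟩ := biprod_primitive_decomp hR.hopf hQ.hopf hb
  rw [← hR.primitive_iff, ← hR.range_eq] at hv
  obtain ⟨v, rfl⟩ := hv
  have h1 : biprodMap 𝓡 YM 𝓠 jM jV (0, v) = 𝓠.one ⊗ₜ jV v := by rw [biprodMap_apply]; simp
  have h2 : 𝓠.one ⊗ₜ jV v ∈ KB 1 := by
    rw [← biprod_range_eq hR hM hQ]
    exact ⟨_, h1⟩
  have h3 := biprod_comul_of_mem_one hR hM hQ h2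
  -- The summand `1 # v` is of degree one and so already primitive; subtracting it leaves `x # 1`
  -- primitive.
  have h4 : (𝓑).comul (x ⊗ₜ 𝓡.one) =
      (𝓑).one ⊗ₜ (x ⊗ₜ 𝓡.one) + (x ⊗ₜ 𝓡.one) ⊗ₜ (𝓑).one := by
    rw [map_add, h3, TensorProduct.tmul_add, TensorProduct.add_tmul] at hb
    refine add_right_cancel (hb.trans ?_)
    abel
  obtain ⟨h5, h6⟩ := biprod_primitive_left hR.hopf hQ.hopf h4
  rw [← hQ.primitive_iff, ← hQ.range_eq] at h5
  obtain ⟨m, rfl⟩ := h5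
  rw [hQ.graded.counit_eq_zero 1 one_ne_zero _ (hQ.j_mem m), zero_smul, add_zero,
    hQ.isPrimitiveMap.coact_j, ← LinearMap.comp_apply, LinearMap.rTensor_comp_lTensor,
    ← LinearMap.lTensor_comp_rTensor, LinearMap.comp_apply] at h6
  -- The triviality of the `R`-part of the coaction is known for `jM m` in `Q`; injectivity of `jM`
  -- brings it back to `m`.
  have hm : m ∈ hwSpace 𝓡 YM := mem_hwSpace_of_coproj (isHopf_of k H) hR.hopf hM.gradedYD.yd
    (Module.Flat.lTensor_preserves_injective_linearMap jM hQ.injective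
      (h6.trans (LinearMap.lTensor_tmul R jM 𝓡.one m).symm))
  exact ⟨(⟨m, hm⟩, v), rfl⟩

theorem isNichols_biproduct (hR : IsNichols 𝓗 YV 𝓡 YR G jV)
    (hM : IsHighestWeight 𝓗 𝓡 YR G YM D) (hQ : IsNichols 𝓐 YM 𝓠 YQ F jM) :
    IsNichols 𝓗 ((hwYD hR.graded.one_mem hM).prod YV) 𝓑 YB KB (biprodMap 𝓡 YM 𝓠 jM jV) := by
  have hB := isGradedBraidedHopf_biproduct hR hM hQ
  refine ⟨hB.hopf, hB.graded, hB.braiding_mem, biprod_injective hR hQ, biprod_range_eq hR hM hQ,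
    biprod_isYDHom hR hM hQ, biprod_generates hR hM hQ, fun x =>
      ⟨biprod_comul_of_mem_one hR hM hQ, fun hx => ?_⟩⟩
  rw [← biprod_range_eq hR hM hQ]
  exact biprod_primitive hR hM hQ hx

end Setting

end NicholsExt

end

theorem mainTheorem1 {k : Type*} [Field k]
    -- a Hopf algebra `H` with bijective antipode
    {H : Type*} [Ring H] [HopfAlgebra k H]
    (hS : Function.Bijective (HopfAlgebra.antipode k : H →ₗ[k] H))
    -- a Yetter-Drinfel'd module `V` over `H`
    {V : Type*} [AddCommGroup V] [Module k V] (YV : YDOps k H V) (hV : IsYD (HopfOps.of k H) YV)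
    -- the Nichols algebra `R = B(V)`
    {R : Type*} [AddCommGroup R] [Module k R] (𝓡 : HopfOps k R) (YR : YDOps k H R)
    (G : ℕ → Submodule k R) (jV : V →ₗ[k] R) (hR : IsNichols (HopfOps.of k H) YV 𝓡 YR G jV)
    -- a graded Yetter-Drinfel'd module `M` over `A = B(V) # H` of highest weight
    {M : Type*} [AddCommGroup M] [Module k M] (YM : YDOps k (R ⊗[k] H) M)
    (D : ℕ → Submodule k M) (hM : IsHighestWeight (HopfOps.of k H) 𝓡 YR G YM D)
    -- the Nichols algebra `Q = B(M)`
    {Q : Type*} [AddCommGroup Q] [Module k Q] (𝓠 : HopfOps k Q) (YQ : YDOps k (R ⊗[k] H) Q)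
    (F : ℕ → Submodule k Q) (jM : M →ₗ[k] Q)
    (hQ : IsNichols (radford (HopfOps.of k H) 𝓡 YR) YM 𝓠 YQ F jM) :
    -- `B = B(M) # B(V)`, with the tensor product grading, is a graded braided Hopf algebra over `H`
    IsGradedBraidedHopf (HopfOps.of k H)
      (biOps (HopfOps.of k H) 𝓡 YR 𝓠 YQ) (biYD (HopfOps.of k H) 𝓡 YR 𝓠 YQ)
      (tensorGrading (weightGrading 𝓠 jM D) G) ∧
    -- it is a Nichols algebra of `M_H ⊕ V` by means of `(x, v) ↦ x # 1 + 1 # v`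
    IsNichols (HopfOps.of k H) ((hwYD hR.graded.one_mem hM).prod YV)
      (biOps (HopfOps.of k H) 𝓡 YR 𝓠 YQ) (biYD (HopfOps.of k H) 𝓡 YR 𝓠 YQ)
      (tensorGrading (weightGrading 𝓠 jM D) G)
      (LinearMap.coprod
        ((TensorProduct.mk k Q R).flip 𝓡.one ∘ₗ jM ∘ₗ (hwSpace 𝓡 YM).subtype)
        (TensorProduct.mk k Q R 𝓠.one ∘ₗ jV)) ∧
    -- and it is isomorphic to the Nichols algebra `N = B(M_H ⊕ V)`
    ∀ {N : Type*} [AddCommGroup N] [Module k N] (𝓝 : HopfOps k N) (YN : YDOps k H N)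
      (K : ℕ → Submodule k N) (jN : hwSpace 𝓡 YM × V →ₗ[k] N),
      IsNichols (HopfOps.of k H) ((hwYD hR.graded.one_mem hM).prod YV) 𝓝 YN K jN →
      ∃ e : Q ⊗[k] R ≃ₗ[k] N, IsGradedBraidedHopfIso
        (biOps (HopfOps.of k H) 𝓡 YR 𝓠 YQ) (biYD (HopfOps.of k H) 𝓡 YR 𝓠 YQ)
        (tensorGrading (weightGrading 𝓠 jM D) G) 𝓝 YN K e := by
  have h := isNichols_biproduct hR hM hQ
  exact ⟨isGradedBraidedHopf_biproduct hR hM hQ, h, fun _ _ _ _ hN => h.exists_iso hN⟩
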